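/- Let $n,r\ge 1$, $m>0$, $s\neq 0$, and let $\kappa_{12},\kappa_{34},\dots,\kappa_{2[n/2]-1,2[n/2]}\ge 0$. Let $\kappa$ be the skew-symmetric $n\times n$ matrix with entries $\kappa_{2i-1,2i}=-\kappa_{2i,2i-1}$ ($1\le i\le [n/2]$) and all other entries $0$. Consider the magnetic flow $$\dot\gamma=\tfrac1m p,\qquad \dot p=\tfrac sm\kappa p+\mu\gamma,\qquad \mu=\tfrac1m\big(s\langle p,\kappa\gamma\rangle-\langle p,p\rangle\big)$$ on $T^*S^{n-1}=\{(\gamma,p)\in\mathbb R^{2n}:\phi_1=\langle\gamma,\gamma\rangle=1,\ \phi_2=\langle\gamma,p\rangle=0\}$, which is the Hamiltonian flow of $H=\frac1{2m}\langle p,p\rangle$ with respect to the restriction of the twisted symplectic form $\sum_i dp_i\wedge d\gamma_i+s\sum_{i<j}\kappa_{ij}\,d\gamma_i\wedge d\gamma_j$. Its Poisson bracket is the restriction to $T^*S^{n-1}$ of the Dirac bracket $\{F,G\}_d=\{F,G\}^\kappa-\big(\{F,\phi_1\}^\kappa\{G,\phi_2\}^\kappa-\{F,\phi_2\}^\kappa\{G,\phi_1\}^\kappa\big)/\{\phi_1,\phi_2\}^\kappa$,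 where $\{F,G\}^\kappa=\sum_i\big(\frac{\partial F}{\partial\gamma_i}\frac{\partial G}{\partial p_i}-\frac{\partial F}{\partial p_i}\frac{\partial G}{\partial\gamma_i}\big)+s\sum_{i,j}\kappa_{ij}\frac{\partial F}{\partial p_i}\frac{\partial G}{\partial p_j}$. Put $$J=\frac{s^2}{m^2}\sum_{i=1}^{[n/2]}\kappa_{2i-1,2i}^2(p_{2i-1}^2+p_{2i}^2)-\mu^2,$$ $$\Phi_{2i-1,2i}=\gamma_{2i-1}p_{2i}-\gamma_{2i}p_{2i-1}+\tfrac s2\kappa_{2i-1,2i}(\gamma_{2i-1}^2+\gamma_{2i}^2),$$ $$\Psi^1_{2i-1,2i;2j-1,2j}=(\gamma_{2i}p_{2j-1}-\gamma_{2j-1}p_{2i})-(\gamma_{2i-1}p_{2j}-\gamma_{2j}p_{2i-1})-s\kappa_{2i-1,2i}(\gamma_{2i-1}\gamma_{2j-1}+\gamma_{2i}\gamma_{2j}),$$ $$\Psi^2_{2i-1,2i;2j-1,2j}=(\gamma_{2i-1}p_{2j-1}-\gamma_{2j-1}p_{2i-1})+(\gamma_{2i}p_{2j}-\gamma_{2j}p_{2i})-s\kappa_{2i-1,2i}(\gamma_{2i-1}\gamma_{2j}-\gamma_{2i}\gamma_{2j-1}).$$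 Assume that $r\le[n/2]$ and $\kappa_{12}=\kappa_{34}=\dots=\kappa_{2r-1,2r}\neq0$. Let $r\ge 2$. In each of the cases (i) $n=2r$, with $k=2$; (ii) $n=2r+1$, with $k=3$; (iii) $n=2r+2$ and $\kappa_{12}\neq\kappa_{n-1,n}$, with $k=4$, the flow is integrable in the noncommutative sense by means of the first integrals $H$, $J$, $\Phi_{2i-1,2i}$ ($1\le i\le[n/2]$), $\Psi^1_{2i-1,2i;2j-1,2j}$, $\Psi^2_{2i-1,2i;2j-1,2j}$ ($1\le i<j\le r$), and generic motions are quasi-periodic over $k$-dimensional invariant isotropic tori. That is: these functions are first integrals; the algebra of functions on $T^*S^{n-1}$ that they generate is closed under the Poisson bracket; on an open dense subset of $T^*S^{n-1}$ the differentials of the functions of this algebra span a space of dimension $2(n-1)-k$, on which the kernel of the Poisson bracket has dimension $k$; and for all points of an open dense subset of $T^*S^{n-1}$, the connected component through the point of the common level set of the integrals is an embedded $k$-dimensional torus, isotropic for the twisted symplectic form, on which the flow is linear in suitable angle coordinates. In the cases $n=2r$, $n=2r+1$, and $n=2r+2$ with $\kappa_{12}\neq\kappa_{n-1,n}$, now for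 every $r\ge1$, the flow is also Liouville integrable: the functions $H$, $J$, $\Phi_{2i-1,2i}$ ($1\le i\le[n/2]$) and $$I_k=\sum_{1\le i<j\le k}\Big((\Psi^1_{2i-1,2i;2j-1,2j})^2+(\Psi^2_{2i-1,2i;2j-1,2j})^2\Big),\qquad k=2,\dots,r,$$ are first integrals that Poisson commute on $T^*S^{n-1}$, and on an open dense subset of $T^*S^{n-1}$ their differentials span a space of dimension $n-1$. -/

import Mathlib

open scoped Matrix ContDiff

noncomputable section

namespace MagneticSphere

variable {n : ℕ}

/-- The ambient space `ℝ²ⁿ` with coordinates `x = (γ, p)`, `γ = x.1`, `p = x.2`. Only its topology,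
its smooth structure and the Euclidean scalar products `γ ⬝ᵥ γ'` are used. -/
abbrev Phase (n : ℕ) : Type := (Fin n → ℝ) × (Fin n → ℝ)

/-- The zero-based pair number `i` consists of the zero-based coordinates `2 i` and `2 i + 1`
(in one-based numbering: of the coordinates `2 i' - 1` and `2 i'` with `i' = i + 1`).
This is its first coordinate. -/
def fstIdx (i : Fin (n / 2)) : Fin n := ⟨2 * (i : ℕ), by have := i.isLt; omega⟩

/-- The second coordinate of the pair number `i`. -/
def sndIdx (i : Fin (n / 2)) : Fin n := ⟨2 * (i : ℕ) + 1, by have := i.isLt; omega⟩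

/-- The skew-symmetric matrix in canonical block form whose `i`-th `2 × 2` block has upper right
entry `κ i` and lower left entry `-κ i` (and a last zero row and column if `n` is odd). -/
def kappaMatrix (κ : Fin (n / 2) → ℝ) : Matrix (Fin n) (Fin n) ℝ := fun a b =>
  ∑ i : Fin (n / 2),
    ((if a = fstIdx i ∧ b = sndIdx i then κ i else 0)
      - (if a = sndIdx i ∧ b = fstIdx i then κ i else 0))

/-- The constraint `φ₁ = ⟨γ, γ⟩`. -/
def phi1 (x : Phase n) : ℝ := x.1 ⬝ᵥ x.1

/-- The constraint `φ₂ = ⟨p, γ⟩`. -/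
def phi2 (x : Phase n) : ℝ := x.2 ⬝ᵥ x.1

/-- The cotangent bundle `T*Sⁿ⁻¹` as the submanifold `φ₁ = 1`, `φ₂ = 0` of `ℝ²ⁿ`. -/
def cotangentSphere (n : ℕ) : Set (Phase n) := {x | phi1 x = 1 ∧ phi2 x = 0}

/-- The differential of a function at a point, as a covector on `ℝ²ⁿ`. -/
def differential (f : Phase n → ℝ) (x : Phase n) : Module.Dual ℝ (Phase n) :=
  (fderiv ℝ f x : Phase n →ₗ[ℝ] ℝ)

/-- The tangent space of `T*Sⁿ⁻¹` at a point `x` of `T*Sⁿ⁻¹`: the common kernel of `dφ₁`, `dφ₂`. -/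
def tangentSpace (x : Phase n) : Submodule ℝ (Phase n) :=
  LinearMap.ker (differential phi1 x) ⊓ LinearMap.ker (differential phi2 x)

/-- The twisted symplectic form `Ω + F`,
`Ω = ∑ dpᵢ ∧ dγᵢ`, `F = s ∑_{i<j} κᵢⱼ dγᵢ ∧ dγⱼ`, evaluated on two vectors of `ℝ²ⁿ`. -/
def twistedForm (s : ℝ) (κ : Fin (n / 2) → ℝ) (u v : Phase n) : ℝ :=
  (u.2 ⬝ᵥ v.1 - v.2 ⬝ᵥ u.1) + s * (u.1 ⬝ᵥ (kappaMatrix κ *ᵥ v.1))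

/-- The component `∂/∂γᵢ` of a covector. -/
def dγ (α : Module.Dual ℝ (Phase n)) (i : Fin n) : ℝ := α (Pi.single i 1, 0)

/-- The component `∂/∂pᵢ` of a covector. -/
def dp (α : Module.Dual ℝ (Phase n)) (i : Fin n) : ℝ := α (0, Pi.single i 1)

/-- The bivector of the magnetic Poisson bracket `{·,·}^κ` on `ℝ²ⁿ`. -/
def magneticBivector (s : ℝ) (κ : Fin (n / 2) → ℝ) :
    LinearMap.BilinForm ℝ (Module.Dual ℝ (Phase n)) :=
  LinearMap.mk₂ ℝ
    (fun α β => (∑ i, (dγ α i * dp β i - dp α i * dγ β i))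
      + s * ∑ i, ∑ j, kappaMatrix κ i j * dp α i * dp β j)
    (by
      intro a b c
      simp only [dγ, dp, LinearMap.add_apply, add_mul, mul_add, Finset.sum_add_distrib,
        Finset.sum_sub_distrib]
      ring)
    (by
      intro t a b
      simp only [dγ, dp, LinearMap.smul_apply, smul_eq_mul, mul_add, Finset.mul_sum]
      congr 1
      · exact Finset.sum_congr rfl fun i _ => by ring
      · exact Finset.sum_congr rfl fun i _ => Finset.sum_congr rfl fun j _ => by ring)
    (by
      intro a b c
      simp only [dγ, dp, LinearMap.add_apply, mul_add, Finset.sum_add_distrib,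
        Finset.sum_sub_distrib]
      ring)
    (by
      intro t a b
      simp only [dγ, dp, LinearMap.smul_apply, smul_eq_mul, mul_add, Finset.mul_sum]
      congr 1
      · exact Finset.sum_congr rfl fun i _ => by ring
      · exact Finset.sum_congr rfl fun i _ => Finset.sum_congr rfl fun j _ => by ring)

/-- The bivector of the Dirac magnetic Poisson bracket at the point `x` (where `φ₁ ≠ 0`). -/
def diracBivector (s : ℝ) (κ : Fin (n / 2) → ℝ) (x : Phase n) :
    LinearMap.BilinForm ℝ (Module.Dual ℝ (Phase n)) :=
  LinearMap.mk₂ ℝ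
    (fun α β => magneticBivector s κ α β
      - (magneticBivector s κ α (differential phi1 x) * magneticBivector s κ β (differential phi2 x)
          - magneticBivector s κ α (differential phi2 x)
            * magneticBivector s κ β (differential phi1 x))
        / magneticBivector s κ (differential phi1 x) (differential phi2 x))
    (by intro a b c; simp only [map_add, LinearMap.add_apply]; ring)
    (by intro t a b; simp only [map_smul, LinearMap.smul_apply, smul_eq_mul]; ring)
    (by intro a b c; simp only [map_add, LinearMap.add_apply]; ring)
    (by intro t a b; simp only [map_smul, LinearMap.smul_apply, smul_eq_mul]; ring)

/-- The Dirac magnetic Poisson bracket `{f, g}_d`. On `T*Sⁿ⁻¹` it is the Poisson bracket of the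
restrictions of `f` and `g` with respect to the restriction of the twisted symplectic form. -/
def diracBracket (s : ℝ) (κ : Fin (n / 2) → ℝ) (f g : Phase n → ℝ) (x : Phase n) : ℝ :=
  diracBivector s κ x (differential f x) (differential g x)

/-- The Hamiltonian `H = ⟨p, p⟩ / (2 m)`. -/
def hamiltonian (m : ℝ) (x : Phase n) : ℝ := (x.2 ⬝ᵥ x.2) / (2 * m)

/-- The Lagrange multiplier `μ = (s ⟨p, κ γ⟩ - ⟨p, p⟩) / m`. -/
def multiplier (m s : ℝ) (κ : Fin (n / 2) → ℝ) (x : Phase n) : ℝ :=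
  (s * (x.2 ⬝ᵥ (kappaMatrix κ *ᵥ x.1)) - x.2 ⬝ᵥ x.2) / m

/-- The right-hand side of the equations of motion on `T*Sⁿ⁻¹`:
`γ' = p / m`, `p' = (s / m) κ p + μ γ`. -/
def magneticField (m s : ℝ) (κ : Fin (n / 2) → ℝ) (x : Phase n) : Phase n :=
  (m⁻¹ • x.2, (s / m) • (kappaMatrix κ *ᵥ x.2) + multiplier m s κ x • x.1)

/-- The function `f` is constant along every solution, on any interval, of the equations of motion
on `T*Sⁿ⁻¹`. -/
def IsFirstIntegral (m s : ℝ) (κ : Fin (n / 2) → ℝ) (f : Phase n → ℝ) : Prop :=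
  ∀ (I : Set ℝ) (c : ℝ → Phase n), I.OrdConnected →
    (∀ t ∈ I, c t ∈ cotangentSphere n ∧ HasDerivWithinAt c (magneticField m s κ (c t)) I t) →
    ∀ t ∈ I, ∀ t' ∈ I, f (c t) = f (c t')

/-- The gauge Noether integral `Φ` of the pair number `i`. -/
def Phi (s : ℝ) (κ : Fin (n / 2) → ℝ) (i : Fin (n / 2)) (x : Phase n) : ℝ :=
  x.1 (fstIdx i) * x.2 (sndIdx i) - x.1 (sndIdx i) * x.2 (fstIdx i)
    + s * (κ i / 2) * (x.1 (fstIdx i) ^ 2 + x.1 (sndIdx i) ^ 2)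

/-- The integral `J`. -/
def J (m s : ℝ) (κ : Fin (n / 2) → ℝ) (x : Phase n) : ℝ :=
  s ^ 2 / m ^ 2 * (∑ i, κ i ^ 2 * (x.2 (fstIdx i) ^ 2 + x.2 (sndIdx i) ^ 2))
    - multiplier m s κ x ^ 2

/-- The integral `Ψ¹` of the pairs number `i` and `j`. -/
def Psi1 (s : ℝ) (κ : Fin (n / 2) → ℝ) (i j : Fin (n / 2)) (x : Phase n) : ℝ :=
  (x.1 (sndIdx i) * x.2 (fstIdx j) - x.1 (fstIdx j) * x.2 (sndIdx i))
    - (x.1 (fstIdx i) * x.2 (sndIdx j) - x.1 (sndIdx j) * x.2 (fstIdx i))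
    - s * κ i * (x.1 (fstIdx i) * x.1 (fstIdx j) + x.1 (sndIdx i) * x.1 (sndIdx j))

/-- The integral `Ψ²` of the pairs number `i` and `j`. -/
def Psi2 (s : ℝ) (κ : Fin (n / 2) → ℝ) (i j : Fin (n / 2)) (x : Phase n) : ℝ :=
  (x.1 (fstIdx i) * x.2 (fstIdx j) - x.1 (fstIdx j) * x.2 (fstIdx i))
    + (x.1 (sndIdx i) * x.2 (sndIdx j) - x.1 (sndIdx j) * x.2 (sndIdx i))
    - s * κ i * (x.1 (fstIdx i) * x.1 (sndIdx j) - x.1 (sndIdx i) * x.1 (fstIdx j))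

/-- The filtration integral `I_k`: the sum of `(Ψ¹)² + (Ψ²)²` over all pairs `i < j` among the
first `k` coordinate pairs. -/
def filtrationIntegral (s : ℝ) (κ : Fin (n / 2) → ℝ) (k : ℕ) (x : Phase n) : ℝ :=
  ∑ i : Fin (n / 2), ∑ j : Fin (n / 2),
    if i < j ∧ (j : ℕ) < k then Psi1 s κ i j x ^ 2 + Psi2 s κ i j x ^ 2 else 0

/-- The integrals `H`, `J`, all the `Φ`, and the `Ψ¹`, `Ψ²` of all pairs `i < j` among the first `r`
coordinate pairs. -/
def integrals (m s : ℝ) (κ : Fin (n / 2) → ℝ) (r : ℕ) : Set (Phase n → ℝ) :=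
  {hamiltonian m, J m s κ} ∪ Set.range (Phi s κ)
    ∪ {f | ∃ i j : Fin (n / 2), i < j ∧ (j : ℕ) < r ∧ (f = Psi1 s κ i j ∨ f = Psi2 s κ i j)}

/-- The integrals `H`, `J`, all the `Φ`, and `I_2, …, I_r`. -/
def commutingIntegrals (m s : ℝ) (κ : Fin (n / 2) → ℝ) (r : ℕ) : Set (Phase n → ℝ) :=
  {hamiltonian m, J m s κ} ∪ Set.range (Phi s κ)
    ∪ {f | ∃ k : ℕ, 2 ≤ k ∧ k ≤ r ∧ f = filtrationIntegral s κ k}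

/-- The span at `x` of the differentials (on `ℝ²ⁿ`) of the functions of the set `A`. -/
def codiff (A : Set (Phase n → ℝ)) (x : Phase n) : Submodule ℝ (Module.Dual ℝ (Phase n)) :=
  Submodule.span ℝ ((fun f => differential f x) '' A)

/-- The number of functions of `A` that are independent on `T*Sⁿ⁻¹` at its point `x`: the dimension
of the span of the differentials of their restrictions to `T*Sⁿ⁻¹`. -/
def ddimAt (A : Set (Phase n → ℝ)) (x : Phase n) : ℕ :=
  Module.finrank ℝ ((codiff A x).map (tangentSpace x).dualRestrict)

/-- The dimension of the kernel of the Poisson bracket of `T*Sⁿ⁻¹` on the span at `x` of the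
differentials of the restrictions to `T*Sⁿ⁻¹` of the functions of `A`. -/
def dindAt (s : ℝ) (κ : Fin (n / 2) → ℝ) (A : Set (Phase n → ℝ)) (x : Phase n) : ℕ :=
  Module.finrank ℝ
    ((codiff A x ⊓ (diracBivector s κ x).orthogonal (codiff A x)).map
      (tangentSpace x).dualRestrict)

/-- The map `Θ`, with period lattice exactly `ℤᵏ`, is a parametrization by `ℝᵏ / ℤᵏ` of a smoothly
embedded `k`-dimensional torus in `T*Sⁿ⁻¹` which is isotropic for the twisted symplectic form and
on which the solutions of the equations of motion are `t ↦ Θ (a + t freq)`. -/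
structure IsQuasiPeriodicIsotropicTorus (m s : ℝ) (κ : Fin (n / 2) → ℝ) {k : ℕ}
    (Θ : (Fin k → ℝ) → Phase n) (freq : Fin k → ℝ) : Prop where
  smooth : ContDiff ℝ ∞ Θ
  mem : ∀ a, Θ a ∈ cotangentSphere n
  eq_iff : ∀ a b, Θ a = Θ b ↔ ∃ l : Fin k → ℤ, ∀ i, b i = a i + l i
  immersion : ∀ a, Function.Injective (fderiv ℝ Θ a)
  isotropic : ∀ a u v, twistedForm s κ (fderiv ℝ Θ a u) (fderiv ℝ Θ a v) = 0
  motion : ∀ (a : Fin k → ℝ) (t : ℝ),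
    HasDerivAt (fun τ : ℝ => Θ (a + τ • freq)) (magneticField m s κ (Θ (a + t • freq))) t

/-- `P` holds on an open dense subset of `T*Sⁿ⁻¹` (cut out by an open subset `U` of `ℝ²ⁿ`). -/
def HoldsGenerically (P : Phase n → Prop) : Prop :=
  ∃ U : Set (Phase n), IsOpen U ∧ cotangentSphere n ⊆ closure (cotangentSphere n ∩ U) ∧
    ∀ x ∈ cotangentSphere n ∩ U, P x

/-- Noncommutative integrability of the magnetic flow on `T*Sⁿ⁻¹` (of dimension `2 (n - 1)`) by
means of the functions of the set `S`, with invariant tori of dimension `k`. -/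
structure IsNoncommutativelyIntegrable (m s : ℝ) (κ : Fin (n / 2) → ℝ)
    (S : Set (Phase n → ℝ)) (k : ℕ) : Prop where
  smooth : ∀ f ∈ S, ContDiff ℝ ∞ f
  firstIntegral : ∀ f ∈ S, IsFirstIntegral m s κ f
  /-- On `T*Sⁿ⁻¹`, the algebra generated by `S` is closed under the Poisson bracket. -/
  bracket_mem : ∀ f ∈ Algebra.adjoin ℝ S, ∀ g ∈ Algebra.adjoin ℝ S,
    ∃ h ∈ Algebra.adjoin ℝ S, ∀ x ∈ cotangentSphere n, diracBracket s κ f g x = h x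
  /-- The algebra generated by `S` is complete: `ddim + dind = dim T*Sⁿ⁻¹`, with `dind = k`. -/
  complete : HoldsGenerically fun x =>
    ddimAt (Algebra.adjoin ℝ S : Set (Phase n → ℝ)) x
        + dindAt s κ (Algebra.adjoin ℝ S : Set (Phase n → ℝ)) x = 2 * (n - 1)
      ∧ dindAt s κ (Algebra.adjoin ℝ S : Set (Phase n → ℝ)) x = k
  /-- The connected component through a generic point of the common level set of `S` is an isotropic
  torus of dimension `k`, and the motions on it are quasi-periodic. -/
  tori : HoldsGenerically fun x =>
    ∃ (Θ : (Fin k → ℝ) → Phase n) (freq : Fin k → ℝ),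
      IsQuasiPeriodicIsotropicTorus m s κ Θ freq ∧
      Set.range Θ =
        connectedComponentIn {y | y ∈ cotangentSphere n ∧ ∀ f ∈ S, f y = f x} x

/-- Liouville integrability of the magnetic flow on `T*Sⁿ⁻¹` by means of the functions of the set
`S`: they are first integrals, they Poisson commute on `T*Sⁿ⁻¹`, and half the dimension of `T*Sⁿ⁻¹`
of them are independent at generic points. -/
structure IsLiouvilleIntegrable (m s : ℝ) (κ : Fin (n / 2) → ℝ)
    (S : Set (Phase n → ℝ)) : Prop where
  smooth : ∀ f ∈ S, ContDiff ℝ ∞ f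
  firstIntegral : ∀ f ∈ S, IsFirstIntegral m s κ f
  commute : ∀ f ∈ S, ∀ g ∈ S, ∀ x ∈ cotangentSphere n, diracBracket s κ f g x = 0
  independent : HoldsGenerically fun x => ddimAt S x = n - 1

end MagneticSphere

end

/-! Write the coordinate pairs of γ and p as complex numbers, z for γ, and replace the kinetic
momentum by the gauge momentum q = p + (i s κ / 2) z. In the coordinates (z, q) the twisted form
becomes canonical (`twistedForm_eq`). On pairs with equal κ, the functions Φ, Ψ¹, Ψ² are the real
components of the skew-Hermitian matrix M_ab = conj z_a q_b - conj q_a z_b, the momentum map of the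
unitary group that acts simultaneously on z and q. Their brackets are therefore linear in M
(`mom_bracket`).

A variation z' = α z + β q, q' = γ z - conj α q with β, γ real leaves M unchanged
(`momPolar_gauge`). The Hamiltonian vectors of φ₁, φ₂ and J and the magnetic field itself have this
form on indices with equal κ. Hence M is conserved, it commutes with H and J, its Dirac brackets
equal the magnetic ones, and the algebra of integrals closes.

Completeness rests on the converse: where the block parts of z and q (the first r pairs) are
independent over ℂ, all variations fixing M have the above form (`momentum_variation`). The
Hamiltonian vectors of the trace of M and of its quadratic Casimir function absorb β and the
imaginary part of α (`levelTangent_reduce`). The constraints, and H if there are coordinates outside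
the block, remove the rest, once the flow and the rotation of an extra pair have been split off. So
the tangent spaces of the level sets have explicit isotropic frames of 2, 3 or 4 vectors, and
`ddimAt_add_finrank` and `dindAt_eq` translate this into the required dimensions.

For the tori, z and q of the block are split into two orthogonal circular components A, B with
opposite angular momenta ±c, in which M = 2ic (conj A ⊗ A - conj B ⊗ B) (`exists_split`,
`split_momentum`). By uniqueness of this spectral decomposition, M determines A and B up to two
phases (`exists_phases`). What remains free is one radial degree of freedom, coupled to the unpaired
coordinate or to the extra pair. Conservation of energy turns it into a curve η² = f(y) with a
polynomial f, and between two simple roots of f this is a closed orbit (`exists_oval`). The phases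
are primitives of periodic functions; once their mean rates are split off they become angles on a
torus (`isTorus_torusMap`). That this torus is the whole component of the level set follows because
the component cannot leave the interval between the two roots (`mem_Icc_of_mem_component`).

For Liouville integrability, I_k differs from the Casimir function of the first k pairs only by
functions of the Φ (`casimirCovector_eq`). Casimir functions of a chain of unitary groups commute.
Independence follows from a triangular system of test vectors (`commuting_card_le`).

All genericity statements reduce to exhibiting one point where an even analytic function does not
vanish (`holdsGenerically_ne_zero`). -/

open scoped Matrix ContDiff
noncomputable section
namespace MagneticSphere
variable {n : ℕ}
open Complex
open scoped ComplexConjugate Topology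

/-! ### Complex coordinates -/

/-- The coordinate pairs of a vector as complex numbers. -/
def cpx : (Fin n → ℝ) →ₗ[ℝ] (Fin (n / 2) → ℂ) where
  toFun g i := ⟨g (fstIdx i), g (sndIdx i)⟩
  map_add' _ _ := by ext i; apply Complex.ext <;> simp
  map_smul' _ _ := by ext i; apply Complex.ext <;> simp

/-- The unpaired coordinate of a vector (zero in even dimension). -/
def lastCoord : (Fin n → ℝ) →ₗ[ℝ] ℝ where
  toFun g := if h : n % 2 = 1 then g ⟨n - 1, by omega⟩ else 0
  map_add' _ _ := by split_ifs <;> simp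
  map_smul' _ _ := by split_ifs <;> simp

/-- The vector with given coordinate pairs and given unpaired coordinate. -/
def mkVec (z : Fin (n / 2) → ℂ) (w : ℝ) : Fin n → ℝ := fun a =>
  if h : (a : ℕ) / 2 < n / 2 then
    if (a : ℕ) % 2 = 0 then (z ⟨a / 2, h⟩).re else (z ⟨a / 2, h⟩).im
  else w

lemma cpx_re (g : Fin n → ℝ) (i : Fin (n / 2)) : (cpx g i).re = g (fstIdx i) := rfl
lemma cpx_im (g : Fin n → ℝ) (i : Fin (n / 2)) : (cpx g i).im = g (sndIdx i) := rfl

lemma mkVec_fst (z : Fin (n / 2) → ℂ) (w : ℝ) (i : Fin (n / 2)) :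
    mkVec z w (fstIdx i) = (z i).re := by
  have hi := i.isLt
  have h1 : (fstIdx i : ℕ) / 2 = i := by simp [fstIdx]
  have h2 : (fstIdx i : ℕ) % 2 = 0 := by simp [fstIdx]
  have h3 : (fstIdx i : ℕ) / 2 < n / 2 := by omega
  simp only [mkVec, h3, h2, dif_pos, if_true]
  congr 2; ext; exact h1

lemma mkVec_snd (z : Fin (n / 2) → ℂ) (w : ℝ) (i : Fin (n / 2)) :
    mkVec z w (sndIdx i) = (z i).im := by
  have hi := i.isLt
  have h1 : (sndIdx i : ℕ) / 2 = i := by simp only [sndIdx]; omega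
  have h2 : (sndIdx i : ℕ) % 2 = 1 := by simp only [sndIdx]; omega
  have h3 : (sndIdx i : ℕ) / 2 < n / 2 := by omega
  simp only [mkVec, h3, h2, dif_pos, one_ne_zero, if_false]
  congr 2; ext; exact h1

@[simp] lemma cpx_mkVec (z : Fin (n / 2) → ℂ) (w : ℝ) : cpx (mkVec z w) = z := by
  funext i
  apply Complex.ext
  · rw [cpx_re, mkVec_fst]
  · rw [cpx_im, mkVec_snd]

lemma lastCoord_odd (hn : n % 2 = 1) (g : Fin n → ℝ) :
    lastCoord g = g ⟨n - 1, by omega⟩ := by simp [lastCoord, hn]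

lemma lastCoord_even (hn : n % 2 = 0) (g : Fin n → ℝ) : lastCoord g = 0 := by
  simp [lastCoord, hn]

lemma lastCoord_mkVec (hn : n % 2 = 1) (z : Fin (n / 2) → ℂ) (w : ℝ) :
    lastCoord (mkVec z w) = w := by
  have : ¬ (n - 1) / 2 < n / 2 := by omega
  simp [lastCoord_odd hn, mkVec, this]

@[simp] lemma lastCoord_mkVec_zero (z : Fin (n / 2) → ℂ) : lastCoord (mkVec z 0) = 0 := by
  rcases Nat.mod_two_eq_zero_or_one n with h | h
  · exact lastCoord_even h _
  · exact lastCoord_mkVec h _ _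

@[simp] lemma mkVec_cpx (g : Fin n → ℝ) : mkVec (cpx g) (lastCoord g) = g := by
  funext a
  by_cases h : (a : ℕ) / 2 < n / 2
  · by_cases h2 : (a : ℕ) % 2 = 0
    · have : a = fstIdx ⟨a / 2, h⟩ := by ext; simp only [fstIdx]; omega
      rw [this, mkVec_fst]; rfl
    · have : a = sndIdx ⟨a / 2, h⟩ := by ext; simp only [sndIdx]; omega
      rw [this, mkVec_snd]; rfl
  · have ha := a.isLt
    have hn : n % 2 = 1 := by omega
    simp only [mkVec, h, dif_neg, not_false_eq_true]
    rw [lastCoord_odd hn]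
    congr 1; ext; simp only; omega

lemma vec_ext {g g' : Fin n → ℝ} (h : ∀ i, cpx g i = cpx g' i)
    (h' : lastCoord g = lastCoord g') : g = g' := by
  rw [← mkVec_cpx g, ← mkVec_cpx g', h', funext h]

lemma sum_pairs_aux (k : ℕ) (f : ℕ → ℝ) :
    ∑ a ∈ Finset.range (2 * k), f a = ∑ i ∈ Finset.range k, (f (2 * i) + f (2 * i + 1)) := by
  induction k with
  | zero => simp
  | succ k ih =>
    rw [Finset.sum_range_succ _ k, ← ih, show 2 * (k + 1) = 2 * k + 1 + 1 by ring,
      Finset.sum_range_succ, Finset.sum_range_succ]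
    ring

lemma sum_pairs (f : Fin n → ℝ) :
    ∑ a, f a = ∑ i : Fin (n / 2), (f (fstIdx i) + f (sndIdx i)) + lastCoord f := by
  set F : ℕ → ℝ := fun a => if h : a < n then f ⟨a, h⟩ else 0 with hF
  have h1 : ∑ a, f a = ∑ a ∈ Finset.range n, F a := by
    rw [← Fin.sum_univ_eq_sum_range]
    exact Finset.sum_congr rfl fun a _ => by simp [hF]
  have h2 : ∑ i : Fin (n / 2), (f (fstIdx i) + f (sndIdx i))
      = ∑ a ∈ Finset.range (2 * (n / 2)), F a := by
    rw [sum_pairs_aux, ← Fin.sum_univ_eq_sum_range (fun i => F (2 * i) + F (2 * i + 1))]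
    refine Finset.sum_congr rfl fun i _ => ?_
    have := i.isLt
    have h3 : 2 * (i : ℕ) < n := by omega
    have h4 : 2 * (i : ℕ) + 1 < n := by omega
    simp [hF, h3, h4, fstIdx, sndIdx]
  rw [h1, h2]
  rcases Nat.mod_two_eq_zero_or_one n with h | h
  · rw [lastCoord_even h, show 2 * (n / 2) = n by omega, add_zero]
  · rw [lastCoord_odd h]
    have h5 : n = 2 * (n / 2) + 1 := by omega
    conv_lhs => rw [h5]
    rw [Finset.sum_range_succ]
    congr 1
    have h6 : 2 * (n / 2) < n := by omega
    simp only [hF, h6, dif_pos]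
    congr 1; ext; simp only; omega

lemma dot_eq (u v : Fin n → ℝ) :
    u ⬝ᵥ v = ∑ i, (conj (cpx u i) * cpx v i).re + lastCoord u * lastCoord v := by
  rw [dotProduct, sum_pairs]
  congr 1
  · exact Finset.sum_congr rfl fun i _ => by simp [cpx_re, cpx_im]
  · rcases Nat.mod_two_eq_zero_or_one n with h | h
    · simp [lastCoord_even h]
    · simp [lastCoord_odd h]

lemma fstIdx_inj {i j : Fin (n / 2)} : fstIdx i = fstIdx j ↔ i = j := by
  simp [fstIdx, Fin.ext_iff]

lemma sndIdx_inj {i j : Fin (n / 2)} : sndIdx i = sndIdx j ↔ i = j := by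
  simp [sndIdx, Fin.ext_iff]

lemma fstIdx_ne_sndIdx (i j : Fin (n / 2)) : fstIdx i ≠ sndIdx j := by
  simp only [fstIdx, sndIdx, ne_eq, Fin.ext_iff]; omega

lemma kappa_fst (κ : Fin (n / 2) → ℝ) (g : Fin n → ℝ) (i : Fin (n / 2)) :
    (kappaMatrix κ *ᵥ g) (fstIdx i) = κ i * g (sndIdx i) := by
  simp only [Matrix.mulVec, dotProduct, kappaMatrix, fstIdx_inj, fstIdx_ne_sndIdx, false_and,
    if_false, sub_zero]
  rw [Finset.sum_eq_single (sndIdx i)]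
  · rw [Finset.sum_eq_single i] <;> simp +contextual [eq_comm, sndIdx_inj]
  · intro b _ hb
    rw [Finset.sum_eq_zero, zero_mul]
    intro j _
    rw [if_neg]; rintro ⟨rfl, rfl⟩; exact hb rfl
  · simp

lemma kappa_snd (κ : Fin (n / 2) → ℝ) (g : Fin n → ℝ) (i : Fin (n / 2)) :
    (kappaMatrix κ *ᵥ g) (sndIdx i) = -(κ i * g (fstIdx i)) := by
  simp only [Matrix.mulVec, dotProduct, kappaMatrix, sndIdx_inj, (fstIdx_ne_sndIdx _ _).symm,
    false_and, if_false, zero_sub]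
  rw [Finset.sum_eq_single (fstIdx i)]
  · rw [Finset.sum_eq_single i] <;> simp +contextual [eq_comm, fstIdx_inj]
  · intro b _ hb
    rw [Finset.sum_eq_zero, zero_mul]
    intro j _
    rw [if_neg, neg_zero]; rintro ⟨rfl, rfl⟩; exact hb rfl
  · simp

@[simp] lemma cpx_kappa (κ : Fin (n / 2) → ℝ) (g : Fin n → ℝ) (i : Fin (n / 2)) :
    cpx (kappaMatrix κ *ᵥ g) i = -I * κ i * cpx g i := by
  apply Complex.ext
  · rw [cpx_re, kappa_fst]; simp [cpx_re, cpx_im]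
  · rw [cpx_im, kappa_snd]; simp [cpx_re, cpx_im]

@[simp] lemma lastCoord_kappa (κ : Fin (n / 2) → ℝ) (g : Fin n → ℝ) :
    lastCoord (kappaMatrix κ *ᵥ g) = 0 := by
  rcases Nat.mod_two_eq_zero_or_one n with h | h
  · exact lastCoord_even h _
  · rw [lastCoord_odd h]
    simp only [Matrix.mulVec, dotProduct, kappaMatrix]
    refine Finset.sum_eq_zero fun b _ => ?_
    rw [Finset.sum_eq_zero, zero_mul]
    intro i _
    have := i.isLt
    rw [if_neg, if_neg, sub_zero] <;>
    · rintro ⟨h1, -⟩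
      simp only [Fin.ext_iff, fstIdx, sndIdx] at h1
      omega

lemma dot_kappa_right (κ : Fin (n / 2) → ℝ) (u v : Fin n → ℝ) :
    u ⬝ᵥ (kappaMatrix κ *ᵥ v) = -((kappaMatrix κ *ᵥ u) ⬝ᵥ v) := by
  rw [dot_eq, dot_eq]
  simp only [cpx_kappa, lastCoord_kappa, mul_zero, zero_mul, add_zero, ← Finset.sum_neg_distrib]
  refine Finset.sum_congr rfl fun i _ => ?_
  simp; ring

lemma dot_kappa_self (κ : Fin (n / 2) → ℝ) (u : Fin n → ℝ) :
    u ⬝ᵥ (kappaMatrix κ *ᵥ u) = 0 := by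
  have := dot_kappa_right κ u u
  rw [dotProduct_comm (kappaMatrix κ *ᵥ u)] at this
  linarith

/-- The position coordinates of a phase point. -/
def zc : Phase n →ₗ[ℝ] (Fin (n / 2) → ℂ) := cpx ∘ₗ LinearMap.fst ℝ _ _

/-- The kinetic momentum coordinates of a phase point. -/
def pc : Phase n →ₗ[ℝ] (Fin (n / 2) → ℂ) := cpx ∘ₗ LinearMap.snd ℝ _ _

/-- The canonical momentum coordinates of a phase point. -/
def qc (s : ℝ) (κ : Fin (n / 2) → ℝ) : Phase n →ₗ[ℝ] (Fin (n / 2) → ℂ) where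
  toFun x i := pc x i + I * (s * κ i / 2 : ℝ) * zc x i
  map_add' _ _ := by funext i; simp only [map_add, Pi.add_apply]; ring
  map_smul' _ _ := by
    funext i
    simp only [map_smul, Pi.smul_apply, Complex.real_smul, RingHom.id_apply]; ring

/-- The unpaired position coordinate. -/
def wc : Phase n →ₗ[ℝ] ℝ := lastCoord ∘ₗ LinearMap.fst ℝ _ _

/-- The unpaired momentum coordinate. -/
def wp : Phase n →ₗ[ℝ] ℝ := lastCoord ∘ₗ LinearMap.snd ℝ _ _

lemma qc_eq (s : ℝ) (κ : Fin (n / 2) → ℝ) (x : Phase n) (i : Fin (n / 2)) :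
    qc s κ x i = pc x i + I * (s * κ i / 2 : ℝ) * zc x i := rfl

lemma pc_eq (s : ℝ) (κ : Fin (n / 2) → ℝ) (x : Phase n) (i : Fin (n / 2)) :
    pc x i = qc s κ x i - I * (s * κ i / 2 : ℝ) * zc x i := by rw [qc_eq]; ring

lemma zc_re (x : Phase n) (i) : (zc x i).re = x.1 (fstIdx i) := rfl
lemma zc_im (x : Phase n) (i) : (zc x i).im = x.1 (sndIdx i) := rfl
lemma pc_re (x : Phase n) (i) : (pc x i).re = x.2 (fstIdx i) := rfl
lemma pc_im (x : Phase n) (i) : (pc x i).im = x.2 (sndIdx i) := rfl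

@[simp] lemma zc_mk (g p : Fin n → ℝ) : zc (g, p) = cpx g := rfl
@[simp] lemma pc_mk (g p : Fin n → ℝ) : pc (g, p) = cpx p := rfl
@[simp] lemma wc_mk (g p : Fin n → ℝ) : wc (g, p) = lastCoord g := rfl
@[simp] lemma wp_mk (g p : Fin n → ℝ) : wp (g, p) = lastCoord p := rfl
lemma cpx_fst (x : Phase n) : cpx x.1 = zc x := rfl
lemma cpx_snd (x : Phase n) : cpx x.2 = pc x := rfl
lemma lastCoord_fst (x : Phase n) : lastCoord x.1 = wc x := rfl
lemma lastCoord_snd (x : Phase n) : lastCoord x.2 = wp x := rfl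

/-- The phase point with given canonical complex coordinates. -/
def ofCoord (s : ℝ) (κ : Fin (n / 2) → ℝ) (z q : Fin (n / 2) → ℂ) (w π : ℝ) : Phase n :=
  (mkVec z w, mkVec (fun i => q i - I * (s * κ i / 2 : ℝ) * z i) π)

section
variable {s : ℝ} {κ : Fin (n / 2) → ℝ} {z q : Fin (n / 2) → ℂ} {w π : ℝ}

@[simp] lemma zc_ofCoord : zc (ofCoord s κ z q w π) = z := by simp [ofCoord]
@[simp] lemma pc_ofCoord (i) :
    pc (ofCoord s κ z q w π) i = q i - I * (s * κ i / 2 : ℝ) * z i := by simp [ofCoord]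
@[simp] lemma qc_ofCoord : qc s κ (ofCoord s κ z q w π) = q := by
  funext i; simp [qc_eq]
lemma wc_ofCoord (hn : n % 2 = 1) : wc (ofCoord s κ z q w π) = w := by
  simp [ofCoord, lastCoord_mkVec hn]
lemma wp_ofCoord (hn : n % 2 = 1) : wp (ofCoord s κ z q w π) = π := by
  simp [ofCoord, lastCoord_mkVec hn]
@[simp] lemma wc_ofCoord_zero : wc (ofCoord s κ z q 0 π) = 0 := by simp [ofCoord]
@[simp] lemma wp_ofCoord_zero : wp (ofCoord s κ z q w 0) = 0 := by simp [ofCoord]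
end

lemma wc_even (hn : n % 2 = 0) (x : Phase n) : wc x = 0 := lastCoord_even hn _
lemma wp_even (hn : n % 2 = 0) (x : Phase n) : wp x = 0 := lastCoord_even hn _

lemma phase_ext (s : ℝ) (κ : Fin (n / 2) → ℝ) {x y : Phase n} (hz : zc x = zc y)
    (hq : qc s κ x = qc s κ y) (hw : wc x = wc y) (hp : wp x = wp y) : x = y := by
  refine Prod.ext (vec_ext (fun i => congrFun hz i) hw) (vec_ext (fun i => ?_) hp)
  change pc x i = pc y i
  rw [pc_eq s κ, pc_eq s κ, hz, hq]

lemma phi1_eq (x : Phase n) : phi1 x = ∑ i, (conj (zc x i) * zc x i).re + wc x * wc x :=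
  dot_eq _ _

lemma phi2_eq (s : ℝ) (κ : Fin (n / 2) → ℝ) (x : Phase n) :
    phi2 x = ∑ i, (conj (zc x i) * qc s κ x i).re + wc x * wp x := by
  rw [phi2, dotProduct_comm, dot_eq]
  congr 1
  refine Finset.sum_congr rfl fun i _ => ?_
  rw [cpx_fst, cpx_snd, qc_eq]
  simp; ring

/-- The shift of the momentum by half the magnetic potential in `qc` absorbs the magnetic two-form,
so the form is canonical in the coordinates `zc`, `qc`, `wc`, `wp`. -/
lemma twistedForm_eq (s : ℝ) (κ : Fin (n / 2) → ℝ) (u v : Phase n) :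
    twistedForm s κ u v
      = ∑ i, (conj (qc s κ u i) * zc v i - conj (qc s κ v i) * zc u i).re
        + (wp u * wc v - wp v * wc u) := by
  rw [twistedForm, dot_eq, dot_eq, dot_eq]
  simp only [lastCoord_kappa, cpx_fst, cpx_snd, lastCoord_fst, lastCoord_snd, cpx_kappa]
  have : ∑ i, (conj (qc s κ u i) * zc v i - conj (qc s κ v i) * zc u i).re
      = ∑ i, (conj (pc u i) * zc v i).re - ∑ i, (conj (pc v i) * zc u i).re
        + s * ∑ i, (conj (zc u i) * (-I * κ i * zc v i)).re := by
    rw [Finset.mul_sum, ← Finset.sum_sub_distrib, ← Finset.sum_add_distrib]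
    refine Finset.sum_congr rfl fun i _ => ?_
    rw [qc_eq, qc_eq]
    simp only [map_add, map_mul, conj_ofReal, conj_I, add_re, sub_re, mul_re, mul_im, add_im,
      neg_re, neg_im, I_re, I_im, ofReal_re, ofReal_im, conj_re, conj_im]
    ring
  rw [this]; ring

attribute [irreducible] zc pc qc wc wp

/-! ### The momentum functions of the unitary symmetries -/

section Momentum
variable (s : ℝ) (κ : Fin (n / 2) → ℝ)

/-- The polarization of the momentum matrix. -/
def momPolar (a b : Fin (n / 2)) (x y : Phase n) : ℂ :=
  conj (zc x a) * qc s κ y b - conj (qc s κ x a) * zc y b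

/-- The (skew-Hermitian) momentum matrix. -/
def momMat (x : Phase n) : Matrix (Fin (n / 2)) (Fin (n / 2)) ℂ := fun a b => momPolar s κ a b x x

/-- The real components of the momentum matrix. -/
def mom (t : ℂ) (a b : Fin (n / 2)) (x : Phase n) : ℝ := (conj t * momMat s κ x a b).re

variable {s κ}

lemma momMat_apply (x : Phase n) (a b) :
    momMat s κ x a b = conj (zc x a) * qc s κ x b - conj (qc s κ x a) * zc x b := rfl

lemma momMat_conj (x : Phase n) (a b) : conj (momMat s κ x a b) = -momMat s κ x b a := by
  simp only [momMat_apply, map_sub, map_mul, conj_conj]; ring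

lemma Phi_eq_mom (i : Fin (n / 2)) : Phi s κ i = mom s κ (I / 2) i i := by
  funext x
  have h2 : (conj (I / 2) : ℂ) = ((-1 / 2 : ℝ) : ℂ) * I := by
    rw [map_div₀, conj_I, map_ofNat]; push_cast; ring
  simp only [mom, Phi, momMat_apply, qc_eq, h2, map_add, map_mul, conj_ofReal, conj_I, add_re,
    sub_re, mul_re, mul_im, add_im, sub_im, neg_re, neg_im, I_re, I_im, ofReal_re, ofReal_im,
    conj_re, conj_im, zc_re, zc_im, pc_re, pc_im]
  ring

/-- The gauge terms contribute i s (κ i + κ j) / 2 · conj z_i z_j to the momentum matrix. For equal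
κ this is the magnetic term of Ψ², which contains only κ i. -/
lemma Psi2_eq_mom {i j : Fin (n / 2)} (h : κ i = κ j) : Psi2 s κ i j = mom s κ 1 i j := by
  funext x
  simp only [mom, Psi2, momMat_apply, qc_eq, map_one, one_re, one_im, map_add, map_mul,
    conj_ofReal, conj_I, add_re, ← h,
    sub_re, mul_re, mul_im, add_im, sub_im, neg_re, neg_im, I_re, I_im, ofReal_re, ofReal_im,
    conj_re, conj_im, zc_re, zc_im, pc_re, pc_im]
  ring

lemma Psi1_eq_mom {i j : Fin (n / 2)} (h : κ i = κ j) : Psi1 s κ i j = mom s κ (-I) i j := by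
  funext x
  simp only [mom, Psi1, momMat_apply, qc_eq, map_neg, map_add, map_mul,
    conj_ofReal, conj_I, add_re, ← h,
    sub_re, mul_re, mul_im, add_im, sub_im, neg_re, neg_im, I_re, I_im, ofReal_re, ofReal_im,
    conj_re, conj_im, zc_re, zc_im, pc_re, pc_im]
  ring

lemma momPolar_add_smul (a b) (x v : Phase n) (t : ℝ) :
    momMat s κ (x + t • v) a b = momMat s κ x a b
      + t * (momPolar s κ a b x v + momPolar s κ a b v x) + t ^ 2 * momMat s κ v a b := by
  simp only [momMat_apply, momPolar, map_add, map_smul, Pi.add_apply, Pi.smul_apply, real_smul,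
    map_mul, conj_ofReal]
  ring

end Momentum

/-! ### Differentials -/

@[fun_prop]
lemma contDiff_zc {k} (i : Fin (n / 2)) : ContDiff ℝ k (fun x : Phase n => zc x i) :=
  contDiff_pi.1 (LinearMap.toContinuousLinearMap (zc (n := n))).contDiff i

@[fun_prop]
lemma contDiff_qc {k} (s : ℝ) (κ) (i : Fin (n / 2)) :
    ContDiff ℝ k (fun x : Phase n => qc s κ x i) :=
  contDiff_pi.1 (LinearMap.toContinuousLinearMap (qc (n := n) s κ)).contDiff i

@[fun_prop]
lemma contDiff_wc {k} : ContDiff ℝ k (fun x : Phase n => wc x) :=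
  (LinearMap.toContinuousLinearMap (wc (n := n))).contDiff

@[fun_prop]
lemma contDiff_wp {k} : ContDiff ℝ k (fun x : Phase n => wp x) :=
  (LinearMap.toContinuousLinearMap (wp (n := n))).contDiff

@[fun_prop]
lemma contDiff_re {E : Type*} [NormedAddCommGroup E] [NormedSpace ℝ E] {k} {f : E → ℂ}
    (hf : ContDiff ℝ k f) : ContDiff ℝ k (fun x => (f x).re) := reCLM.contDiff.comp hf

@[fun_prop]
lemma contDiff_im {E : Type*} [NormedAddCommGroup E] [NormedSpace ℝ E] {k} {f : E → ℂ}
    (hf : ContDiff ℝ k f) : ContDiff ℝ k (fun x => (f x).im) := imCLM.contDiff.comp hf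

@[fun_prop]
lemma contDiff_conj {E : Type*} [NormedAddCommGroup E] [NormedSpace ℝ E] {k} {f : E → ℂ}
    (hf : ContDiff ℝ k f) : ContDiff ℝ k (fun x => conj (f x)) := conjCLE.contDiff.comp hf

@[fun_prop]
lemma contDiff_dot {k} {E : Type*} [NormedAddCommGroup E] [NormedSpace ℝ E]
    {f g : E → (Fin n → ℝ)} (hf : ContDiff ℝ k f) (hg : ContDiff ℝ k g) :
    ContDiff ℝ k (fun x => f x ⬝ᵥ g x) := by
  unfold dotProduct
  have h1 := contDiff_pi.1 hf
  have h2 := contDiff_pi.1 hg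
  fun_prop

@[fun_prop]
lemma contDiff_mulVec {k} {E : Type*} [NormedAddCommGroup E] [NormedSpace ℝ E]
    {f : E → (Fin n → ℝ)} (M : Matrix (Fin n) (Fin n) ℝ) (hf : ContDiff ℝ k f) :
    ContDiff ℝ k (fun x => M *ᵥ f x) :=
  (LinearMap.toContinuousLinearMap M.mulVecLin).contDiff.comp hf

lemma contDiff_mom {k} (s : ℝ) (κ) (t : ℂ) (a b : Fin (n / 2)) :
    ContDiff ℝ k (mom s κ t a b) := by
  unfold mom; simp only [momMat_apply]; fun_prop

lemma contDiff_phi1 {k} : ContDiff ℝ k (phi1 (n := n)) := by unfold phi1; fun_prop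
lemma contDiff_phi2 {k} : ContDiff ℝ k (phi2 (n := n)) := by unfold phi2; fun_prop
lemma contDiff_hamiltonian {k} (m : ℝ) : ContDiff ℝ k (hamiltonian (n := n) m) := by
  unfold hamiltonian; fun_prop
lemma contDiff_multiplier {k} (m s : ℝ) (κ : Fin (n / 2) → ℝ) :
    ContDiff ℝ k (multiplier m s κ) := by
  unfold multiplier; fun_prop

lemma kappa_normSq (κ : Fin (n / 2) → ℝ) (g : Fin n → ℝ) :
    ∑ i, κ i ^ 2 * (g (fstIdx i) ^ 2 + g (sndIdx i) ^ 2)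
      = (kappaMatrix κ *ᵥ g) ⬝ᵥ (kappaMatrix κ *ᵥ g) := by
  rw [dot_eq, lastCoord_kappa, mul_zero, add_zero]
  refine Finset.sum_congr rfl fun i _ => ?_
  rw [cpx_kappa]
  simp [cpx_re, cpx_im]; ring

lemma J_eq_dot (m s : ℝ) (κ : Fin (n / 2) → ℝ) (x : Phase n) :
    J m s κ x = s ^ 2 / m ^ 2 * ((kappaMatrix κ *ᵥ x.2) ⬝ᵥ (kappaMatrix κ *ᵥ x.2))
      - multiplier m s κ x ^ 2 := by
  rw [J, kappa_normSq]

lemma contDiff_J {k} (m s : ℝ) (κ : Fin (n / 2) → ℝ) : ContDiff ℝ k (J m s κ) := by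
  have h := contDiff_multiplier (n := n) (k := k) m s κ
  rw [funext (J_eq_dot m s κ)]; fun_prop

lemma differential_of_line {f : Phase n → ℝ} (hf : ContDiff ℝ 1 f) {x v : Phase n} {a : ℝ}
    (h : HasDerivAt (fun t : ℝ => f (x + t • v)) a 0) : differential f x v = a := by
  have h1 : HasFDerivAt f (fderiv ℝ f x) (x + (0 : ℝ) • v) := by
    rw [zero_smul, add_zero]
    exact (hf.differentiable (by simp) x).hasFDerivAt
  have h2 : HasDerivAt (fun t : ℝ => x + t • v) v 0 := by
    simpa using ((hasDerivAt_id (0 : ℝ)).smul_const v).const_add x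
  exact (h1.comp_hasDerivAt (0 : ℝ) h2).unique h

/-- Constraints, energy, multiplier and momentum functions are quadratic polynomials, so their
differentials can be read off as linear coefficients along lines. Only `J` needs
`differential_of_line`. -/
lemma differential_of_quadratic {f : Phase n → ℝ} (hf : ContDiff ℝ 1 f) {x v : Phase n} {a b : ℝ}
    (h : ∀ t : ℝ, f (x + t • v) = f x + t * a + t ^ 2 * b) : differential f x v = a := by
  refine differential_of_line hf ?_
  rw [funext h]
  have := (((hasDerivAt_id (0 : ℝ)).mul_const a).const_add (f x)).add
    (((hasDerivAt_id (0 : ℝ)).pow 2).mul_const b)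
  exact this.congr_deriv (by simp)

lemma differential_phi1 (x v : Phase n) : differential phi1 x v = 2 * (x.1 ⬝ᵥ v.1) := by
  refine differential_of_quadratic (b := v.1 ⬝ᵥ v.1) contDiff_phi1 fun t => ?_
  simp only [phi1, Prod.fst_add, Prod.smul_fst, dotProduct_add, add_dotProduct, smul_dotProduct,
    dotProduct_smul, smul_eq_mul, dotProduct_comm v.1 x.1]
  ring

lemma differential_phi2 (x v : Phase n) :
    differential phi2 x v = v.2 ⬝ᵥ x.1 + x.2 ⬝ᵥ v.1 := by
  refine differential_of_quadratic (b := v.2 ⬝ᵥ v.1) contDiff_phi2 fun t => ?_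
  simp only [phi2, Prod.fst_add, Prod.smul_fst, Prod.snd_add, Prod.smul_snd, dotProduct_add,
    add_dotProduct, smul_dotProduct, dotProduct_smul, smul_eq_mul]
  ring

lemma differential_hamiltonian (m : ℝ) (x v : Phase n) :
    differential (hamiltonian m) x v = (x.2 ⬝ᵥ v.2) / m := by
  refine differential_of_quadratic (b := (v.2 ⬝ᵥ v.2) / (2 * m)) (contDiff_hamiltonian m)
    fun t => ?_
  simp only [hamiltonian, Prod.snd_add, Prod.smul_snd, dotProduct_add, add_dotProduct,
    smul_dotProduct, dotProduct_smul, smul_eq_mul, dotProduct_comm v.2 x.2]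
  field_simp
  ring

lemma differential_mom (s : ℝ) (κ) (t : ℂ) (a b : Fin (n / 2)) (x v : Phase n) :
    differential (mom s κ t a b) x v
      = (conj t * (momPolar s κ a b x v + momPolar s κ a b v x)).re := by
  refine differential_of_quadratic (b := mom s κ t a b v) (contDiff_mom s κ t a b) fun r => ?_
  have h : ((r : ℂ) ^ 2) = ((r ^ 2 : ℝ) : ℂ) := by push_cast; rfl
  rw [mom, mom, mom, momPolar_add_smul, h, ← re_ofReal_mul, ← re_ofReal_mul, ← add_re, ← add_re]
  congr 1; ring

lemma differential_multiplier (m s : ℝ) (κ : Fin (n / 2) → ℝ) (x v : Phase n) :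
    differential (multiplier m s κ) x v
      = (s * (v.2 ⬝ᵥ (kappaMatrix κ *ᵥ x.1) + x.2 ⬝ᵥ (kappaMatrix κ *ᵥ v.1))
          - 2 * (x.2 ⬝ᵥ v.2)) / m := by
  refine differential_of_quadratic (b := multiplier m s κ v) (contDiff_multiplier m s κ)
    fun t => ?_
  simp only [multiplier, Prod.fst_add, Prod.smul_fst, Prod.snd_add, Prod.smul_snd, dotProduct_add,
    Matrix.mulVec_add, Matrix.mulVec_smul,
    add_dotProduct, smul_dotProduct, dotProduct_smul, smul_eq_mul, dotProduct_comm v.2 x.2]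
  ring

lemma differential_J (m s : ℝ) (κ : Fin (n / 2) → ℝ) (x v : Phase n) :
    differential (J m s κ) x v
      = s ^ 2 / m ^ 2 * (2 * ((kappaMatrix κ *ᵥ x.2) ⬝ᵥ (kappaMatrix κ *ᵥ v.2)))
        - 2 * multiplier m s κ x * differential (multiplier m s κ) x v := by
  refine differential_of_line (contDiff_J m s κ) ?_
  have h0 : HasFDerivAt (multiplier m s κ) (fderiv ℝ (multiplier m s κ) x)
      (x + (0 : ℝ) • v) := by
    rw [zero_smul, add_zero]
    exact ((contDiff_multiplier (k := 1) m s κ).differentiable (by simp) x).hasFDerivAt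
  have h2 : HasDerivAt (fun t : ℝ => x + t • v) v 0 := by
    simpa using ((hasDerivAt_id (0 : ℝ)).smul_const v).const_add x
  have h3 := (h0.comp_hasDerivAt (0 : ℝ) h2).pow 2
  set A := kappaMatrix κ *ᵥ x.2 with hA
  set B := kappaMatrix κ *ᵥ v.2 with hB
  have h4 : HasDerivAt (fun t : ℝ => A ⬝ᵥ A + t * (2 * (A ⬝ᵥ B)) + t ^ 2 * (B ⬝ᵥ B))
      (2 * (A ⬝ᵥ B)) 0 := by
    have := (((hasDerivAt_id (0 : ℝ)).mul_const (2 * (A ⬝ᵥ B))).const_add (A ⬝ᵥ A)).add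
      (((hasDerivAt_id (0 : ℝ)).pow 2).mul_const (B ⬝ᵥ B))
    exact this.congr_deriv (by simp)
  have h5 := (h4.const_mul (s ^ 2 / m ^ 2)).sub h3
  simp only [Function.comp_apply, zero_smul, add_zero, Nat.cast_ofNat, Nat.add_one_sub_one,
    pow_one] at h5
  refine h5.congr_of_eventuallyEq (Filter.Eventually.of_forall fun t => ?_)
  simp only [J_eq_dot, Prod.snd_add, Prod.smul_snd, Matrix.mulVec_add, Matrix.mulVec_smul,
    dotProduct_add, add_dotProduct, smul_dotProduct, dotProduct_smul, smul_eq_mul, ← hA, ← hB,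
    dotProduct_comm B A, Pi.sub_apply, Pi.pow_apply, Function.comp_apply]
  ring

lemma differential_mul {f g : Phase n → ℝ} (hf : ContDiff ℝ 1 f) (hg : ContDiff ℝ 1 g)
    (x : Phase n) : differential (f * g) x = f x • differential g x + g x • differential f x := by
  rw [differential, fderiv_mul (hf.differentiable (by simp) x) (hg.differentiable (by simp) x)]
  rfl

lemma differential_add {f g : Phase n → ℝ} (hf : ContDiff ℝ 1 f) (hg : ContDiff ℝ 1 g)
    (x : Phase n) : differential (f + g) x = differential f x + differential g x := by
  rw [differential, fderiv_add (hf.differentiable (by simp) x) (hg.differentiable (by simp) x)]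
  rfl

/-! ### Hamiltonian vector fields -/

/-- The Hamiltonian vector of a covector with respect to the twisted symplectic form. -/
def sharp (s : ℝ) (κ : Fin (n / 2) → ℝ) : Module.Dual ℝ (Phase n) →ₗ[ℝ] Phase n where
  toFun β := (dp β, -dγ β + s • (kappaMatrix κ *ᵥ dp β))
  map_add' a b := by
    have h1 : dp (a + b) = dp a + dp b := rfl
    have h2 : dγ (a + b) = dγ a + dγ b := rfl
    rw [h1, h2, Matrix.mulVec_add]
    ext i <;> simp; ring
  map_smul' t a := by
    have h1 : dp (t • a) = t • dp a := rfl
    have h2 : dγ (t • a) = t • dγ a := rfl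
    rw [h1, h2, Matrix.mulVec_smul]
    ext i <;> simp; ring

lemma dual_apply (β : Module.Dual ℝ (Phase n)) (v : Phase n) :
    β v = dγ β ⬝ᵥ v.1 + dp β ⬝ᵥ v.2 := by
  have h1 : v = ∑ i, v.1 i • ((Pi.single i 1, 0) : Phase n)
      + ∑ i, v.2 i • ((0, Pi.single i 1) : Phase n) := by
    refine Prod.ext ?_ ?_
    · simp only [Prod.fst_add, Prod.fst_sum, Prod.smul_mk, smul_zero, Finset.sum_const_zero,
        add_zero]
      exact pi_eq_sum_univ' v.1
    · simp only [Prod.snd_add, Prod.snd_sum, Prod.smul_mk, smul_zero, Finset.sum_const_zero,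
        zero_add]
      exact pi_eq_sum_univ' v.2
  conv_lhs => rw [h1]
  simp only [map_add, map_sum, map_smul, smul_eq_mul, dotProduct, dγ, dp, mul_comm]

lemma magneticBivector_eq (s : ℝ) (κ : Fin (n / 2) → ℝ) (α β : Module.Dual ℝ (Phase n)) :
    magneticBivector s κ α β = α (sharp s κ β) := by
  rw [dual_apply]
  simp only [magneticBivector, LinearMap.mk₂_apply, sharp, LinearMap.coe_mk, AddHom.coe_mk,
    dotProduct_add, dotProduct_neg, dotProduct_smul, smul_eq_mul]
  simp only [dotProduct, Matrix.mulVec, Finset.sum_sub_distrib, Finset.mul_sum]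
  rw [show ∀ a b c d : ℝ, c = d → a - b + c = a + (-b + d) by intros; linarith]
  exact Finset.sum_congr rfl fun i _ => Finset.sum_congr rfl fun j _ => by ring

lemma twistedForm_sharp (s : ℝ) (κ : Fin (n / 2) → ℝ) (β : Module.Dual ℝ (Phase n))
    (v : Phase n) : twistedForm s κ v (sharp s κ β) = β v := by
  rw [dual_apply, twistedForm]
  simp only [sharp, LinearMap.coe_mk, AddHom.coe_mk, add_dotProduct, neg_dotProduct,
    smul_dotProduct, smul_eq_mul]
  rw [dotProduct_comm v.2, dotProduct_comm (kappaMatrix κ *ᵥ dp β)]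
  ring

lemma twistedForm_add_right (s : ℝ) (κ : Fin (n / 2) → ℝ) (u v w : Phase n) :
    twistedForm s κ u (v + w) = twistedForm s κ u v + twistedForm s κ u w := by
  simp only [twistedForm, Prod.fst_add, Prod.snd_add, dotProduct_add, add_dotProduct,
    Matrix.mulVec_add]
  ring

lemma twistedForm_smul_right (s : ℝ) (κ : Fin (n / 2) → ℝ) (t : ℝ) (u v : Phase n) :
    twistedForm s κ u (t • v) = t * twistedForm s κ u v := by
  simp only [twistedForm, Prod.smul_fst, Prod.smul_snd, dotProduct_smul, smul_dotProduct,
    Matrix.mulVec_smul, smul_eq_mul]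
  ring

lemma twistedForm_antisymm (s : ℝ) (κ : Fin (n / 2) → ℝ) (u v : Phase n) :
    twistedForm s κ u v = -twistedForm s κ v u := by
  rw [twistedForm, twistedForm, dot_kappa_right, dotProduct_comm (kappaMatrix κ *ᵥ u.1)]
  ring

lemma twistedForm_nondegenerate {s : ℝ} {κ : Fin (n / 2) → ℝ} {u : Phase n}
    (h : ∀ v, twistedForm s κ v u = 0) : u = 0 := by
  have h1 : u.1 = 0 := by
    have := h (0, u.1)
    simp only [twistedForm, zero_dotProduct, dotProduct_zero, sub_zero, mul_zero,
      add_zero] at this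
    exact dotProduct_self_eq_zero.1 this
  have h2 := h (-u.2, 0)
  simp only [twistedForm, h1, dotProduct_zero, zero_sub, Matrix.mulVec_zero, mul_zero, add_zero,
    dotProduct_neg, neg_neg] at h2
  exact Prod.ext h1 (dotProduct_self_eq_zero.1 h2)

/-- By nondegeneracy a Hamiltonian vector is determined by its pairings with the form. All the
explicit Hamiltonian vectors below are obtained by guessing and pairing. -/
lemma sharp_eq_of {s : ℝ} {κ : Fin (n / 2) → ℝ} {β : Module.Dual ℝ (Phase n)} {u : Phase n}
    (h : ∀ v, twistedForm s κ v u = β v) : sharp s κ β = u := by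
  rw [← sub_eq_zero]
  refine twistedForm_nondegenerate (s := s) (κ := κ) fun v => ?_
  rw [sub_eq_add_neg, ← neg_one_smul ℝ u, twistedForm_add_right, twistedForm_smul_right, h,
    twistedForm_sharp]
  ring

lemma apply_sharp_antisymm (s : ℝ) (κ : Fin (n / 2) → ℝ) (α β : Module.Dual ℝ (Phase n)) :
    α (sharp s κ β) = -β (sharp s κ α) := by
  rw [← twistedForm_sharp s κ α, ← twistedForm_sharp s κ β, twistedForm_antisymm]

lemma sharp_phi1 (s : ℝ) (κ : Fin (n / 2) → ℝ) (x : Phase n) :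
    sharp s κ (differential phi1 x) = (0, (-2 : ℝ) • x.1) := by
  refine sharp_eq_of fun v => ?_
  rw [differential_phi1, twistedForm]
  simp

lemma sharp_phi2 (s : ℝ) (κ : Fin (n / 2) → ℝ) (x : Phase n) :
    sharp s κ (differential phi2 x) = (x.1, -x.2 + s • (kappaMatrix κ *ᵥ x.1)) := by
  refine sharp_eq_of fun v => ?_
  rw [differential_phi2, twistedForm]
  simp only [add_dotProduct, neg_dotProduct, smul_dotProduct, smul_eq_mul,
    dotProduct_comm v.1]
  ring

lemma sharp_hamiltonian (m s : ℝ) (κ : Fin (n / 2) → ℝ) (x : Phase n) :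
    sharp s κ (differential (hamiltonian m) x)
      = (m⁻¹ • x.2, (s / m) • (kappaMatrix κ *ᵥ x.2)) := by
  refine sharp_eq_of fun v => ?_
  rw [differential_hamiltonian, twistedForm]
  simp only [smul_dotProduct, smul_eq_mul, Matrix.mulVec_smul,
    dotProduct_comm v.1, dotProduct_comm v.2]
  ring

lemma sharp_J (m s : ℝ) (κ : Fin (n / 2) → ℝ) (x : Phase n) :
    sharp s κ (differential (J m s κ) x)
      = (-(2 * s ^ 2 / m ^ 2) • (kappaMatrix κ *ᵥ (kappaMatrix κ *ᵥ x.2))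
            - (2 * multiplier m s κ x / m) • (s • (kappaMatrix κ *ᵥ x.1) - (2 : ℝ) • x.2),
          -(2 * multiplier m s κ x / m * s) • (kappaMatrix κ *ᵥ x.2)
            + s • (kappaMatrix κ *ᵥ
              (-(2 * s ^ 2 / m ^ 2) • (kappaMatrix κ *ᵥ (kappaMatrix κ *ᵥ x.2))
            - (2 * multiplier m s κ x / m) • (s • (kappaMatrix κ *ᵥ x.1) - (2 : ℝ) • x.2)))) := by
  refine sharp_eq_of fun v => ?_
  rw [differential_J, differential_multiplier, twistedForm]
  set A := -(2 * s ^ 2 / m ^ 2) • (kappaMatrix κ *ᵥ (kappaMatrix κ *ᵥ x.2))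
    - (2 * multiplier m s κ x / m) • (s • (kappaMatrix κ *ᵥ x.1) - (2 : ℝ) • x.2) with hA
  simp only [add_dotProduct, smul_dotProduct, smul_eq_mul]
  rw [dotProduct_comm (kappaMatrix κ *ᵥ A), dot_kappa_right κ x.2 v.1, dot_kappa_right κ _ v.2,
    hA, dotProduct_sub, dotProduct_smul, dotProduct_smul, dotProduct_sub, dotProduct_smul,
    dotProduct_smul]
  simp only [smul_eq_mul]
  rw [dotProduct_comm v.2 (kappaMatrix κ *ᵥ (kappaMatrix κ *ᵥ x.2)), dotProduct_comm v.2 x.2]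
  ring

/-- The infinitesimal unitary transformation generated by `mom t a b`. -/
def rotCoord (t : ℂ) (a b : Fin (n / 2)) (z : Fin (n / 2) → ℂ) (i : Fin (n / 2)) : ℂ :=
  (if i = b then t * z a else 0) - (if i = a then conj t * z b else 0)

/-- Momentum functions generate linear unitary transformations that act in the same way on z and on
q. This makes their brackets linear in the momentum matrix. -/
lemma sharp_mom (s : ℝ) (κ : Fin (n / 2) → ℝ) (t : ℂ) (a b : Fin (n / 2)) (x : Phase n) :
    sharp s κ (differential (mom s κ t a b) x)
      = ofCoord s κ (rotCoord t a b (zc x)) (rotCoord t a b (qc s κ x)) 0 0 := by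
  refine sharp_eq_of fun v => ?_
  rw [differential_mom, twistedForm_eq]
  simp only [zc_ofCoord, qc_ofCoord, wc_ofCoord_zero, wp_ofCoord_zero, mul_zero, zero_mul,
    sub_zero, add_zero, rotCoord, map_sub, apply_ite conj, map_zero, map_mul, conj_conj, mul_sub,
    sub_mul, mul_ite, ite_mul, sub_re, apply_ite re, zero_re, Finset.sum_sub_distrib,
    Finset.sum_ite_eq', Finset.mem_univ, if_true, momPolar, mul_add, add_re]
  simp only [mul_re, mul_im, conj_re, conj_im]
  ring

/-- The entry M_ab is the skew-Hermitian form conj z q' - conj q z' evaluated on the vectors (z_a,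
q_a) and (z_b, q_b) of ℂ². The matrices with rows (α, β) and (γ, -conj α), β and γ real, are the
infinitesimal isometries of this form, a copy of u(1,1). Conservation of M along the flow and its
commutation with the constraints and with J all come from this. -/
lemma momPolar_gauge {s : ℝ} {κ : Fin (n / 2) → ℝ} {x v : Phase n} {a b : Fin (n / 2)}
    (α : ℂ) (β γ : ℝ)
    (hza : zc v a = α * zc x a + β * qc s κ x a) (hzb : zc v b = α * zc x b + β * qc s κ x b)
    (hqa : qc s κ v a = γ * zc x a - conj α * qc s κ x a)
    (hqb : qc s κ v b = γ * zc x b - conj α * qc s κ x b) :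
    momPolar s κ a b x v + momPolar s κ a b v x = 0 := by
  simp only [momPolar, hza, hzb, hqa, hqb, map_add, map_sub, map_mul, conj_ofReal, conj_conj]
  ring

section Gauge
variable {m s : ℝ} {κ : Fin (n / 2) → ℝ} {a b : Fin (n / 2)}

lemma differential_mom_sharp_phi1 (t : ℂ) (x : Phase n) :
    differential (mom s κ t a b) x (sharp s κ (differential phi1 x)) = 0 := by
  rw [differential_mom, momPolar_gauge 0 0 (-2), mul_zero, zero_re] <;>
  simp [sharp_phi1, qc_eq, cpx_fst]

lemma differential_mom_sharp_phi2 (t : ℂ) (x : Phase n) :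
    differential (mom s κ t a b) x (sharp s κ (differential phi2 x)) = 0 := by
  rw [differential_mom, momPolar_gauge 1 0 0, mul_zero, zero_re] <;>
  simp [sharp_phi2, qc_eq, cpx_fst, cpx_snd] <;> ring

lemma zc_field (x : Phase n) (i) : zc (magneticField m s κ x) i = (m⁻¹ : ℝ) * pc x i := by
  simp [magneticField, cpx_snd]

lemma pc_field (x : Phase n) (i) : pc (magneticField m s κ x) i
    = (multiplier m s κ x : ℝ) * zc x i - I * (s * κ i / m : ℝ) * pc x i := by
  simp [magneticField, cpx_snd, cpx_fst]; ring

lemma wc_field (x : Phase n) : wc (magneticField m s κ x) = m⁻¹ * wp x := by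
  simp [magneticField, lastCoord_snd]

lemma wp_field (x : Phase n) : wp (magneticField m s κ x) = multiplier m s κ x * wc x := by
  simp [magneticField, lastCoord_fst]

lemma differential_mom_field (h : κ a = κ b) (t : ℂ) (x : Phase n) :
    differential (mom s κ t a b) x (magneticField m s κ x) = 0 := by
  -- Coefficients of the flow in canonical coordinates: substitute p = q - (i s κ / 2) z into z' = p
  -- / m and into q' = μ z - (i s κ / (2 m)) p.
  rw [differential_mom, momPolar_gauge (-I * (s * κ a / (2 * m) : ℝ)) m⁻¹
    (multiplier m s κ x - s ^ 2 * κ a ^ 2 / (4 * m)), mul_zero, zero_re] <;>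
  simp only [zc_field, pc_field, qc_eq, ← h, map_mul, map_neg, conj_I, conj_ofReal]
  <;> push_cast <;> ring_nf <;> simp only [I_sq] <;> ring

/-- On indices with the same κ the magnetic matrix acts as the scalar -iκ, so the powers of it in
the Hamiltonian vector of J only produce common coefficients. That vector is again an infinitesimal
isometry of the form defining M. -/
lemma differential_mom_sharp_J (h : κ a = κ b) (t : ℂ) (x : Phase n) :
    differential (mom s κ t a b) x (sharp s κ (differential (J m s κ) x)) = 0 := by
  set μ := multiplier m s κ x with hμ
  -- The coefficient of p in the position component of the Hamiltonian vector of J: minus the square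
  -- of the matrix κ contributes κ², the multiplier contributes 4 μ / m.
  set B : ℝ := 2 * s ^ 2 * κ a ^ 2 / m ^ 2 + 4 * μ / m with hB
  have hz : ∀ i, κ i = κ a → zc (sharp s κ (differential (J m s κ) x)) i
      = B * pc x i + I * (2 * μ / m * s * κ a : ℝ) * zc x i := by
    intro i hi
    rw [sharp_J, hB, ← hμ]
    simp only [zc_mk, map_sub, map_smul, Pi.sub_apply, Pi.smul_apply, real_smul, cpx_kappa,
      cpx_fst, cpx_snd, hi]
    push_cast
    ring_nf
    simp only [I_sq]; ring
  have hp : ∀ i, κ i = κ a → pc (sharp s κ (differential (J m s κ) x)) i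
      = I * (2 * μ / m * s * κ a : ℝ) * pc x i
        - I * (s * κ a : ℝ) * zc (sharp s κ (differential (J m s κ) x)) i := by
    intro i hi
    rw [sharp_J, ← hμ]
    simp only [zc_mk, pc_mk, map_add, map_smul, Pi.add_apply, Pi.smul_apply, real_smul, cpx_kappa,
      cpx_snd, hi]
    push_cast
    ring
  rw [differential_mom, momPolar_gauge (I * (s * κ a * (2 * μ / m - B / 2) : ℝ)) B
    (s ^ 2 * κ a ^ 2 * (2 * μ / m - B / 4)), mul_zero, zero_re] <;>
  simp only [qc_eq, hp, hz, ← h, map_mul, conj_I, conj_ofReal]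
  <;> push_cast <;> ring_nf <;> simp only [I_sq] <;> ring

end Gauge

lemma differential_multiplier_field (m s : ℝ) (κ : Fin (n / 2) → ℝ) {x : Phase n}
    (hx : x ∈ cotangentSphere n) :
    differential (multiplier m s κ) x (magneticField m s κ x)
      = s ^ 2 / m ^ 2 * ((kappaMatrix κ *ᵥ x.2) ⬝ᵥ (kappaMatrix κ *ᵥ x.1)) := by
  have h2 : x.2 ⬝ᵥ x.1 = 0 := hx.2
  rw [differential_multiplier]
  simp only [magneticField, add_dotProduct, smul_dotProduct, dotProduct_add, dotProduct_smul,
    Matrix.mulVec_smul, smul_eq_mul, h2, dot_kappa_self]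
  ring

/-- Along p' = (s / m) κ p + μ γ the squared length of (s / m) κ p and μ² both change at the rate 2
μ (s² / m²) ⟨κ p, κ γ⟩, because κ is skew. -/
lemma differential_J_field (m s : ℝ) (κ : Fin (n / 2) → ℝ) {x : Phase n}
    (hx : x ∈ cotangentSphere n) : differential (J m s κ) x (magneticField m s κ x) = 0 := by
  rw [differential_J, differential_multiplier_field m s κ hx]
  simp only [magneticField, Matrix.mulVec_add, Matrix.mulVec_smul, dotProduct_add, dotProduct_smul,
    smul_eq_mul, dot_kappa_self]
  ring

lemma differential_hamiltonian_field (m s : ℝ) (κ : Fin (n / 2) → ℝ) {x : Phase n}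
    (hx : x ∈ cotangentSphere n) :
    differential (hamiltonian m) x (magneticField m s κ x) = 0 := by
  have h2 : x.2 ⬝ᵥ x.1 = 0 := hx.2
  rw [differential_hamiltonian]
  simp only [magneticField, dotProduct_add, dotProduct_smul, smul_eq_mul, dot_kappa_self, h2]
  ring

lemma isFirstIntegral_of_differential {m s : ℝ} {κ : Fin (n / 2) → ℝ} {f : Phase n → ℝ}
    (hf : ContDiff ℝ 1 f)
    (h : ∀ x ∈ cotangentSphere n, differential f x (magneticField m s κ x) = 0) :
    IsFirstIntegral m s κ f := by
  intro A c hA hc t ht t' ht'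
  have hd : ∀ τ ∈ A, HasDerivWithinAt (fun τ => f (c τ)) 0 A τ := by
    intro τ hτ
    have h1 := ((hf.differentiable (by simp) (c τ)).hasFDerivAt).comp_hasDerivWithinAt τ (hc τ hτ).2
    have h2 := h _ (hc τ hτ).1
    rw [differential] at h2
    exact h1.congr_deriv h2
  have := hA.convex.norm_image_sub_le_of_norm_hasDerivWithin_le (C := 0) hd (by simp) ht' ht
  rw [zero_mul] at this
  exact sub_eq_zero.1 (norm_le_zero_iff.1 this)

/-! ### The Dirac bracket on the cotangent bundle of the sphere -/

section Dirac
variable {m s : ℝ} {κ : Fin (n / 2) → ℝ} {x : Phase n}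

/-- The denominator of the Dirac correction is {φ₁, φ₂} = 2 ⟨γ, γ⟩, which equals 2 on the sphere. -/
lemma dirac_eq (hx : x ∈ cotangentSphere n) (α β : Module.Dual ℝ (Phase n)) :
    diracBivector s κ x α β = α (sharp s κ β)
      - (α (sharp s κ (differential phi1 x)) * β (sharp s κ (differential phi2 x))
        - α (sharp s κ (differential phi2 x)) * β (sharp s κ (differential phi1 x))) / 2 := by
  have h : differential phi1 x (sharp s κ (differential phi2 x)) = 2 := by
    have h1 : x.1 ⬝ᵥ x.1 = 1 := hx.1
    rw [sharp_phi2, differential_phi1, h1, mul_one]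
  simp only [diracBivector, LinearMap.mk₂_apply, magneticBivector_eq, h]

lemma dirac_antisymm (hx : x ∈ cotangentSphere n) (α β : Module.Dual ℝ (Phase n)) :
    diracBivector s κ x α β = -diracBivector s κ x β α := by
  rw [dirac_eq hx, dirac_eq hx, apply_sharp_antisymm s κ α β]; ring

/-- The Dirac correction for H is -μ / 2 times the Hamiltonian vector (0, -2 γ) of φ₁, which is
exactly the reaction force μ γ. -/
lemma dirac_hamiltonian (hx : x ∈ cotangentSphere n) (α : Module.Dual ℝ (Phase n)) :
    diracBivector s κ x α (differential (hamiltonian m) x) = α (magneticField m s κ x) := by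
  have h2 : x.2 ⬝ᵥ x.1 = 0 := hx.2
  have h3 : differential (hamiltonian m) x (sharp s κ (differential phi1 x)) = 0 := by
    rw [sharp_phi1, differential_hamiltonian]; simp [h2]
  have h4 : differential (hamiltonian m) x (sharp s κ (differential phi2 x))
      = multiplier m s κ x := by
    rw [sharp_phi2, differential_hamiltonian, multiplier]
    simp only [dotProduct_add, dotProduct_neg, dotProduct_smul, smul_eq_mul]; ring
  have h5 : magneticField m s κ x = sharp s κ (differential (hamiltonian m) x)
      - (multiplier m s κ x / 2) • sharp s κ (differential phi1 x) := by
    rw [sharp_hamiltonian, sharp_phi1, magneticField]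
    ext i <;> simp
    ring
  rw [dirac_eq hx, h3, h4, h5, map_sub, map_smul, smul_eq_mul]; ring

/-- Momentum functions commute with both constraints, so the Dirac correction vanishes. -/
lemma dirac_mom_left (hx : x ∈ cotangentSphere n) (t : ℂ) (a b : Fin (n / 2))
    (β : Module.Dual ℝ (Phase n)) :
    diracBivector s κ x (differential (mom s κ t a b) x) β
      = differential (mom s κ t a b) x (sharp s κ β) := by
  rw [dirac_eq hx, differential_mom_sharp_phi1, differential_mom_sharp_phi2]; ring

end Dirac

/-! ### The algebra generated by a set of functions -/

lemma contDiff_of_mem_adjoin {S : Set (Phase n → ℝ)} (hS : ∀ f ∈ S, ContDiff ℝ ∞ f)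
    {f : Phase n → ℝ} (hf : f ∈ Algebra.adjoin ℝ S) : ContDiff ℝ ∞ f := by
  induction hf using Algebra.adjoin_induction with
  | mem f hf => exact hS f hf
  | algebraMap r => exact contDiff_const (c := r)
  | add f g _ _ hf hg => exact hf.add hg
  | mul f g _ _ hf hg => exact hf.mul hg

lemma differential_algebraMap (r : ℝ) (x : Phase n) :
    differential (algebraMap ℝ (Phase n → ℝ) r) x = 0 := by
  have : algebraMap ℝ (Phase n → ℝ) r = fun _ => r := rfl
  rw [differential, this, fderiv_const_apply]; rfl

/-- By the Leibniz rule the differential of a polynomial in the generators is a combination of the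
differentials of the generators. -/
lemma codiff_adjoin {S : Set (Phase n → ℝ)} (hS : ∀ f ∈ S, ContDiff ℝ ∞ f) (x : Phase n) :
    codiff (Algebra.adjoin ℝ S : Set (Phase n → ℝ)) x = codiff S x := by
  refine le_antisymm (Submodule.span_le.2 ?_)
    (Submodule.span_mono (Set.image_mono Algebra.subset_adjoin))
  rintro _ ⟨f, hf, rfl⟩
  change differential f x ∈ codiff S x
  have hd : ∀ f ∈ Algebra.adjoin ℝ S, ContDiff ℝ 1 f := fun f hf =>
    (contDiff_of_mem_adjoin hS hf).of_le (by exact_mod_cast le_top)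
  induction hf using Algebra.adjoin_induction with
  | mem f hf => exact Submodule.subset_span ⟨f, hf, rfl⟩
  | algebraMap r => rw [differential_algebraMap]; exact Submodule.zero_mem _
  | add f g hf' hg' hf hg =>
    rw [differential_add (hd f hf') (hd g hg')]
    exact Submodule.add_mem _ hf hg
  | mul f g hf' hg' hf hg =>
    rw [differential_mul (hd f hf') (hd g hg')]
    exact Submodule.add_mem _ (Submodule.smul_mem _ _ hg) (Submodule.smul_mem _ _ hf)

lemma diracBracket_antisymm {s : ℝ} {κ : Fin (n / 2) → ℝ} {x : Phase n}
    (hx : x ∈ cotangentSphere n) (f g : Phase n → ℝ) :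
    diracBracket s κ f g x = -diracBracket s κ g f x := dirac_antisymm hx _ _

lemma bracket_mem_adjoin_left {s : ℝ} {κ : Fin (n / 2) → ℝ} {S : Set (Phase n → ℝ)}
    (hS : ∀ f ∈ S, ContDiff ℝ ∞ f) {g : Phase n → ℝ}
    (h : ∀ f ∈ S, ∃ h ∈ Algebra.adjoin ℝ S,
      ∀ x ∈ cotangentSphere n, diracBracket s κ f g x = h x)
    {f : Phase n → ℝ} (hf : f ∈ Algebra.adjoin ℝ S) :
    ∃ h ∈ Algebra.adjoin ℝ S, ∀ x ∈ cotangentSphere n, diracBracket s κ f g x = h x := by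
  have hd : ∀ f ∈ Algebra.adjoin ℝ S, ContDiff ℝ 1 f := fun f hf =>
    (contDiff_of_mem_adjoin hS hf).of_le (by exact_mod_cast le_top)
  induction hf using Algebra.adjoin_induction with
  | mem f hf => exact h f hf
  | algebraMap r =>
    refine ⟨0, Subalgebra.zero_mem _, fun x _ => ?_⟩
    simp [diracBracket, differential_algebraMap]
  | add f₁ f₂ hf₁ hf₂ ih₁ ih₂ =>
    obtain ⟨h₁, hh₁, e₁⟩ := ih₁
    obtain ⟨h₂, hh₂, e₂⟩ := ih₂
    refine ⟨h₁ + h₂, Subalgebra.add_mem _ hh₁ hh₂, fun x hx => ?_⟩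
    rw [Pi.add_apply, ← e₁ x hx, ← e₂ x hx, diracBracket,
      differential_add (hd _ hf₁) (hd _ hf₂), map_add]
    rfl
  | mul f₁ f₂ hf₁ hf₂ ih₁ ih₂ =>
    obtain ⟨h₁, hh₁, e₁⟩ := ih₁
    obtain ⟨h₂, hh₂, e₂⟩ := ih₂
    refine ⟨f₁ * h₂ + f₂ * h₁, Subalgebra.add_mem _ (Subalgebra.mul_mem _ hf₁ hh₂)
      (Subalgebra.mul_mem _ hf₂ hh₁), fun x hx => ?_⟩
    rw [Pi.add_apply, Pi.mul_apply, Pi.mul_apply, ← e₁ x hx, ← e₂ x hx, diracBracket,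
      differential_mul (hd _ hf₁) (hd _ hf₂), map_add, map_smul, map_smul]
    rfl

lemma bracket_mem_adjoin {s : ℝ} {κ : Fin (n / 2) → ℝ} {S : Set (Phase n → ℝ)}
    (hS : ∀ f ∈ S, ContDiff ℝ ∞ f)
    (h : ∀ f ∈ S, ∀ g ∈ S, ∃ h ∈ Algebra.adjoin ℝ S,
      ∀ x ∈ cotangentSphere n, diracBracket s κ f g x = h x) :
    ∀ f ∈ Algebra.adjoin ℝ S, ∀ g ∈ Algebra.adjoin ℝ S, ∃ h ∈ Algebra.adjoin ℝ S,
      ∀ x ∈ cotangentSphere n, diracBracket s κ f g x = h x := by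
  intro f hf g hg
  refine bracket_mem_adjoin_left hS (fun f hf => ?_) hf
  -- Closure in the second argument is closure in the first one with the roles exchanged, by
  -- antisymmetry of the bracket on the cotangent bundle.
  obtain ⟨k, hk, e⟩ := bracket_mem_adjoin_left (s := s) (κ := κ) (g := f) hS
    (fun g hg => h g hg f hf) hg
  refine ⟨-k, Subalgebra.neg_mem _ hk, fun x hx => ?_⟩
  rw [diracBracket_antisymm hx, e x hx]; rfl

/-! ### Brackets of the integrals -/

/-- The commutation relations of the unitary Lie algebra: the transformation generated by the second
function exchanges the indices c and d in M_ab. -/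
lemma mom_bracket (s : ℝ) (κ : Fin (n / 2) → ℝ) (t u : ℂ) (a b c d : Fin (n / 2)) (x : Phase n) :
    differential (mom s κ t a b) x (sharp s κ (differential (mom s κ u c d) x))
      = (if a = d then mom s κ (t * u) c b x else 0)
        - (if a = c then mom s κ (t * conj u) d b x else 0)
        + (if b = d then mom s κ (t * conj u) a c x else 0)
        - (if b = c then mom s κ (t * u) a d x else 0) := by
  have h : momPolar s κ a b x (ofCoord s κ (rotCoord u c d (zc x)) (rotCoord u c d (qc s κ x)) 0 0)
      + momPolar s κ a b (ofCoord s κ (rotCoord u c d (zc x)) (rotCoord u c d (qc s κ x)) 0 0) x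
      = (if a = d then conj u * momMat s κ x c b else 0)
        - (if a = c then u * momMat s κ x d b else 0)
        + (if b = d then u * momMat s κ x a c else 0)
        - (if b = c then conj u * momMat s κ x a d else 0) := by
    simp only [momPolar, zc_ofCoord, qc_ofCoord, rotCoord, momMat_apply]
    split_ifs <;> simp only [map_sub, map_mul, map_zero, conj_conj] <;> ring
  rw [differential_mom, sharp_mom, h]
  simp only [mom, map_mul, conj_conj, mul_add, mul_sub, mul_ite, mul_zero, sub_re, add_re,
    apply_ite re, zero_re, ← mul_assoc]

lemma mom_self (s : ℝ) (κ : Fin (n / 2) → ℝ) (t : ℂ) (a : Fin (n / 2)) (x : Phase n) :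
    mom s κ t a a x = 2 * t.im * Phi s κ a x := by
  rw [Phi_eq_mom, mom, mom]
  have h := momMat_conj (s := s) (κ := κ) x a a
  have h1 : (momMat s κ x a a).re = 0 := by
    have := congrArg re h
    simp only [conj_re, neg_re] at this; linarith
  have h2 : (conj (I / 2) : ℂ) = ((-1 / 2 : ℝ) : ℂ) * I := by
    rw [map_div₀, conj_I, map_ofNat]; push_cast; ring
  rw [h2]
  simp [h1]; ring

lemma mom_swap (s : ℝ) (κ : Fin (n / 2) → ℝ) (t : ℂ) (a b : Fin (n / 2)) (x : Phase n) :
    mom s κ t a b x = -mom s κ (conj t) b a x := by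
  rw [mom, mom, ← neg_neg (momMat s κ x a b), ← momMat_conj]
  simp

lemma mom_linear (s : ℝ) (κ : Fin (n / 2) → ℝ) (t : ℂ) (a b : Fin (n / 2)) (x : Phase n) :
    mom s κ t a b x = t.re * mom s κ 1 a b x - t.im * mom s κ (-I) a b x := by
  simp [mom]

section
variable {m s : ℝ} {κ : Fin (n / 2) → ℝ} {r : ℕ} {κ₀ : ℝ}

lemma Phi_mem_integrals (i : Fin (n / 2)) : Phi s κ i ∈ integrals m s κ r :=
  Or.inl (Or.inr ⟨i, rfl⟩)

lemma Psi1_mem_integrals {i j : Fin (n / 2)} (hij : i < j) (hj : (j : ℕ) < r) :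
    Psi1 s κ i j ∈ integrals m s κ r := Or.inr ⟨i, j, hij, hj, Or.inl rfl⟩

lemma Psi2_mem_integrals {i j : Fin (n / 2)} (hij : i < j) (hj : (j : ℕ) < r) :
    Psi2 s κ i j ∈ integrals m s κ r := Or.inr ⟨i, j, hij, hj, Or.inr rfl⟩

lemma hamiltonian_mem_integrals : hamiltonian m ∈ integrals m s κ r := Or.inl (Or.inl (Or.inl rfl))

lemma mom_mem_adjoin (heq : ∀ i : Fin (n / 2), (i : ℕ) < r → κ i = κ₀) (t : ℂ)
    {a b : Fin (n / 2)} (hab : ((a : ℕ) < r ∧ (b : ℕ) < r) ∨ a = b) :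
    mom s κ t a b ∈ Algebra.adjoin ℝ (integrals m s κ r) := by
  have key : ∀ (t : ℂ) (a b : Fin (n / 2)), (a : ℕ) < r → (b : ℕ) < r → a < b →
      mom s κ t a b ∈ Algebra.adjoin ℝ (integrals m s κ r) := by
    intro t a b ha hb hlt
    have h : κ a = κ b := by rw [heq a ha, heq b hb]
    have h1 : mom s κ t a b = t.re • Psi2 s κ a b - t.im • Psi1 s κ a b := by
      funext x
      rw [mom_linear, Psi2_eq_mom h, Psi1_eq_mom h]; rfl
    rw [h1]
    exact Subalgebra.sub_mem _
      (Subalgebra.smul_mem _ (Algebra.subset_adjoin (Psi2_mem_integrals hlt hb)) _)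
      (Subalgebra.smul_mem _ (Algebra.subset_adjoin (Psi1_mem_integrals hlt hb)) _)
  rcases lt_trichotomy a b with hlt | rfl | hlt
  · rcases hab with ⟨ha, hb⟩ | rfl
    · exact key t a b ha hb hlt
    · exact absurd hlt (lt_irrefl _)
  · have h1 : mom s κ t a a = (2 * t.im) • Phi s κ a := by
      funext x; rw [mom_self]; rfl
    rw [h1]
    exact Subalgebra.smul_mem _ (Algebra.subset_adjoin (Phi_mem_integrals a)) _
  · rcases hab with ⟨ha, hb⟩ | rfl
    · have h1 : mom s κ t a b = -mom s κ (conj t) b a := by funext x; exact mom_swap ..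
      rw [h1]
      exact Subalgebra.neg_mem _ (key _ b a hb ha hlt)
    · exact absurd hlt (lt_irrefl _)

lemma mem_integrals_cases (heq : ∀ i : Fin (n / 2), (i : ℕ) < r → κ i = κ₀) {f : Phase n → ℝ}
    (hf : f ∈ integrals m s κ r) :
    f = hamiltonian m ∨ f = J m s κ ∨ ∃ (t : ℂ) (a b : Fin (n / 2)),
      (((a : ℕ) < r ∧ (b : ℕ) < r) ∨ a = b) ∧ κ a = κ b ∧ f = mom s κ t a b := by
  rcases hf with (hf | ⟨i, rfl⟩) | ⟨i, j, hij, hj, hf⟩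
  · rcases hf with rfl | hf
    · exact Or.inl rfl
    · exact Or.inr (Or.inl hf)
  · exact Or.inr (Or.inr ⟨I / 2, i, i, Or.inr rfl, rfl, Phi_eq_mom i⟩)
  · have hi : (i : ℕ) < r := lt_trans hij hj
    have h : κ i = κ j := by rw [heq i hi, heq j hj]
    refine Or.inr (Or.inr ?_)
    rcases hf with rfl | rfl
    · exact ⟨-I, i, j, Or.inl ⟨hi, hj⟩, h, Psi1_eq_mom h⟩
    · exact ⟨1, i, j, Or.inl ⟨hi, hj⟩, h, Psi2_eq_mom h⟩

lemma contDiff_integrals {f : Phase n → ℝ}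
    (heq : ∀ i : Fin (n / 2), (i : ℕ) < r → κ i = κ₀) (hf : f ∈ integrals m s κ r) {k} :
    ContDiff ℝ k f := by
  rcases mem_integrals_cases heq hf with rfl | rfl | ⟨t, a, b, -, -, rfl⟩
  · exact contDiff_hamiltonian m
  · exact contDiff_J m s κ
  · exact contDiff_mom s κ t a b

lemma isFirstIntegral_integrals {f : Phase n → ℝ}
    (heq : ∀ i : Fin (n / 2), (i : ℕ) < r → κ i = κ₀) (hf : f ∈ integrals m s κ r) :
    IsFirstIntegral m s κ f := by
  refine isFirstIntegral_of_differential (contDiff_integrals heq hf) fun x hx => ?_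
  rcases mem_integrals_cases heq hf with rfl | rfl | ⟨t, a, b, -, h, rfl⟩
  · exact differential_hamiltonian_field m s κ hx
  · exact differential_J_field m s κ hx
  · exact differential_mom_field h t x

lemma bracket_hamiltonian_eq_zero {f : Phase n → ℝ}
    (heq : ∀ i : Fin (n / 2), (i : ℕ) < r → κ i = κ₀) (hf : f ∈ integrals m s κ r)
    {x : Phase n} (hx : x ∈ cotangentSphere n) :
    diracBracket s κ f (hamiltonian m) x = 0 := by
  rw [diracBracket, dirac_hamiltonian hx]
  rcases mem_integrals_cases heq hf with rfl | rfl | ⟨t, a, b, -, h, rfl⟩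
  · exact differential_hamiltonian_field m s κ hx
  · exact differential_J_field m s κ hx
  · exact differential_mom_field h t x

lemma bracket_J_eq_zero {f : Phase n → ℝ}
    (heq : ∀ i : Fin (n / 2), (i : ℕ) < r → κ i = κ₀) (hf : f ∈ integrals m s κ r)
    {x : Phase n} (hx : x ∈ cotangentSphere n) :
    diracBracket s κ f (J m s κ) x = 0 := by
  rcases mem_integrals_cases heq hf with rfl | rfl | ⟨t, a, b, -, h, rfl⟩
  · rw [diracBracket_antisymm hx, diracBracket, dirac_hamiltonian hx, differential_J_field m s κ hx,
      neg_zero]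
  · have := diracBracket_antisymm (s := s) (κ := κ) hx (J m s κ) (J m s κ)
    linarith
  · rw [diracBracket, dirac_mom_left hx, differential_mom_sharp_J h]

lemma bracket_mem_integrals (heq : ∀ i : Fin (n / 2), (i : ℕ) < r → κ i = κ₀) :
    ∀ f ∈ Algebra.adjoin ℝ (integrals m s κ r), ∀ g ∈ Algebra.adjoin ℝ (integrals m s κ r),
      ∃ h ∈ Algebra.adjoin ℝ (integrals m s κ r),
        ∀ x ∈ cotangentSphere n, diracBracket s κ f g x = h x := by
  refine bracket_mem_adjoin (fun f hf => contDiff_integrals heq hf) fun f hf g hg => ?_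
  rcases mem_integrals_cases heq hg with rfl | rfl | ⟨u, c, d, hcd, hκ', rfl⟩
  · exact ⟨0, Subalgebra.zero_mem _, fun x hx => bracket_hamiltonian_eq_zero heq hf hx⟩
  · exact ⟨0, Subalgebra.zero_mem _, fun x hx => bracket_J_eq_zero heq hf hx⟩
  rcases mem_integrals_cases heq hf with rfl | rfl | ⟨t, a, b, hab, hκ, rfl⟩
  · refine ⟨0, Subalgebra.zero_mem _, fun x hx => ?_⟩
    rw [diracBracket_antisymm hx, bracket_hamiltonian_eq_zero heq hg hx, neg_zero]; rfl
  · refine ⟨0, Subalgebra.zero_mem _, fun x hx => ?_⟩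
    rw [diracBracket_antisymm hx, bracket_J_eq_zero heq hg hx, neg_zero]; rfl
  refine ⟨(if a = d then mom s κ (t * u) c b else 0)
        - (if a = c then mom s κ (t * conj u) d b else 0)
        + (if b = d then mom s κ (t * conj u) a c else 0)
        - (if b = c then mom s κ (t * u) a d else 0), ?_, fun x hx => ?_⟩
  -- Contracting a common index of two pairs, each contained in the block or diagonal, gives again
  -- such a pair.
  · refine Subalgebra.sub_mem _ (Subalgebra.add_mem _ (Subalgebra.sub_mem _ ?_ ?_) ?_) ?_ <;>
    · split_ifs with h
      · apply mom_mem_adjoin heq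
        subst h
        rcases hab with ⟨ha, hb⟩ | rfl <;> rcases hcd with ⟨hc, hd⟩ | rfl <;> tauto
      · exact Subalgebra.zero_mem _
  · rw [diracBracket, dirac_mom_left hx, mom_bracket]
    simp only [Pi.add_apply, Pi.sub_apply]
    split_ifs <;> rfl

end

/-! ### Linear algebra of the restricted Poisson structure -/

section LinearAlgebra
variable {s : ℝ} {κ : Fin (n / 2) → ℝ} {x : Phase n}

/-- The tangent vectors annihilated by the differentials of all functions of `S`. -/
def levelTangent (S : Set (Phase n → ℝ)) (x : Phase n) : Submodule ℝ (Phase n) :=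
  tangentSpace x ⊓ (codiff S x).dualCoannihilator

lemma mem_tangentSpace {v : Phase n} :
    v ∈ tangentSpace x ↔ differential phi1 x v = 0 ∧ differential phi2 x v = 0 := by
  simp [tangentSpace, LinearMap.mem_ker]

lemma levelTangent_le (S : Set (Phase n → ℝ)) : levelTangent S x ≤ tangentSpace x := inf_le_left

lemma mem_levelTangent {S : Set (Phase n → ℝ)} {v : Phase n} :
    v ∈ levelTangent S x ↔ v ∈ tangentSpace x ∧ ∀ f ∈ S, differential f x v = 0 := by
  rw [levelTangent, Submodule.mem_inf, Submodule.mem_dualCoannihilator]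
  refine and_congr_right fun _ => ⟨fun h f hf => h _ (Submodule.subset_span ⟨f, hf, rfl⟩),
    fun h φ hφ => ?_⟩
  refine Submodule.span_induction ?_ ?_ ?_ ?_ hφ
  · rintro _ ⟨f, hf, rfl⟩; exact h f hf
  · simp
  · intro a b _ _ ha hb; simp [ha, hb]
  · intro t a _ ha; simp [ha]

lemma constraints_independent (hx : x ∈ cotangentSphere n) :
    LinearIndependent ℝ ![differential phi1 x, differential phi2 x] := by
  have h1 : x.1 ⬝ᵥ x.1 = 1 := hx.1
  have h2 : x.2 ⬝ᵥ x.1 = 0 := hx.2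
  rw [LinearIndependent.pair_iff]
  intro a b h
  have e1 := LinearMap.congr_fun h (x.1, 0)
  have e2 := LinearMap.congr_fun h (0, x.1)
  simp only [LinearMap.add_apply, LinearMap.smul_apply, differential_phi1, differential_phi2,
    smul_eq_mul, h1, h2, zero_dotProduct, dotProduct_zero, LinearMap.zero_apply] at e1 e2
  exact ⟨by linarith, by linarith⟩

lemma tangentSpace_eq :
    tangentSpace x = (Submodule.span ℝ
      (Set.range ![differential phi1 x, differential phi2 x])).dualCoannihilator := by
  ext v
  rw [mem_tangentSpace, Submodule.mem_dualCoannihilator]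
  constructor
  · rintro ⟨h1, h2⟩ φ hφ
    refine Submodule.span_induction ?_ ?_ ?_ ?_ hφ
    · rintro _ ⟨i, rfl⟩; fin_cases i <;> assumption
    · simp
    · intro a b _ _ ha hb; simp [ha, hb]
    · intro t a _ ha; simp [ha]
  · intro h
    exact ⟨h _ (Submodule.subset_span ⟨0, rfl⟩), h _ (Submodule.subset_span ⟨1, rfl⟩)⟩

lemma finrank_phase : Module.finrank ℝ (Phase n) = 2 * n := by
  rw [Module.finrank_prod, Module.finrank_fin_fun]; ring

lemma finrank_tangentSpace (hx : x ∈ cotangentSphere n) :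
    Module.finrank ℝ (tangentSpace x) = 2 * (n - 1) := by
  have h := Subspace.finrank_add_finrank_dualCoannihilator_eq (Submodule.span ℝ
      (Set.range ![differential phi1 x, differential phi2 x]))
  rw [← tangentSpace_eq, finrank_phase, finrank_span_eq_card (constraints_independent hx),
    Fintype.card_fin] at h
  omega

lemma coannihilator_map_subtype (N : Submodule ℝ (Module.Dual ℝ (Phase n))) :
    ((N.map (tangentSpace x).dualRestrict).dualCoannihilator).map (tangentSpace x).subtype
      = tangentSpace x ⊓ N.dualCoannihilator := by
  ext v
  simp only [Submodule.mem_map, Submodule.mem_dualCoannihilator, Submodule.mem_inf]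
  constructor
  · rintro ⟨⟨v, hv⟩, h, rfl⟩
    exact ⟨hv, fun φ hφ => h _ ⟨φ, hφ, rfl⟩⟩
  · rintro ⟨hv, h⟩
    refine ⟨⟨v, hv⟩, ?_, rfl⟩
    rintro _ ⟨φ, hφ, rfl⟩
    exact h φ hφ

/-- The span of the restricted differentials and the tangent vectors of the level set are
annihilators of each other in the tangent space. Counting integrals thus reduces to computing
`levelTangent`. -/
lemma ddimAt_add_finrank (S : Set (Phase n → ℝ)) (hx : x ∈ cotangentSphere n) :
    ddimAt S x + Module.finrank ℝ (levelTangent S x) = 2 * (n - 1) := by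
  rw [levelTangent, ← coannihilator_map_subtype, Submodule.finrank_map_subtype_eq, ddimAt,
    Subspace.finrank_add_finrank_dualCoannihilator_eq, finrank_tangentSpace hx]

/-- The Hamiltonian vector of a covector with respect to the Dirac bracket. -/
def diracSharp (s : ℝ) (κ : Fin (n / 2) → ℝ) (x : Phase n) (β : Module.Dual ℝ (Phase n)) :
    Phase n :=
  sharp s κ β - (β (sharp s κ (differential phi2 x)) / 2) • sharp s κ (differential phi1 x)
    + (β (sharp s κ (differential phi1 x)) / 2) • sharp s κ (differential phi2 x)

lemma dirac_eq_diracSharp (hx : x ∈ cotangentSphere n) (α β : Module.Dual ℝ (Phase n)) :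
    diracBivector s κ x α β = α (diracSharp s κ x β) := by
  rw [dirac_eq hx, diracSharp, map_add, map_sub, map_smul, map_smul, smul_eq_mul, smul_eq_mul]
  ring

lemma phi1_sharp_phi2 (hx : x ∈ cotangentSphere n) :
    differential phi1 x (sharp s κ (differential phi2 x)) = 2 := by
  have h1 : x.1 ⬝ᵥ x.1 = 1 := hx.1
  rw [sharp_phi2, differential_phi1, h1, mul_one]

lemma phi2_sharp_phi1 (hx : x ∈ cotangentSphere n) :
    differential phi2 x (sharp s κ (differential phi1 x)) = -2 := by
  rw [apply_sharp_antisymm, phi1_sharp_phi2 hx]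

lemma apply_sharp_self (α : Module.Dual ℝ (Phase n)) : α (sharp s κ α) = 0 := by
  have := apply_sharp_antisymm s κ α α; linarith

lemma diracSharp_mem (hx : x ∈ cotangentSphere n) (β : Module.Dual ℝ (Phase n)) :
    diracSharp s κ x β ∈ tangentSpace x := by
  rw [mem_tangentSpace, diracSharp]
  simp only [map_add, map_sub, map_smul, smul_eq_mul, phi1_sharp_phi2 hx, phi2_sharp_phi1 hx,
    apply_sharp_self]
  rw [apply_sharp_antisymm s κ _ β, apply_sharp_antisymm s κ _ β]
  constructor <;> ring

/-- The Dirac bivector inverts the restriction of the twisted form to the tangent space. -/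
lemma twistedForm_diracSharp {v : Phase n} (hv : v ∈ tangentSpace x)
    (β : Module.Dual ℝ (Phase n)) : twistedForm s κ v (diracSharp s κ x β) = β v := by
  rw [mem_tangentSpace] at hv
  rw [diracSharp, sub_eq_add_neg, ← neg_smul, twistedForm_add_right, twistedForm_add_right,
    twistedForm_smul_right, twistedForm_smul_right, twistedForm_sharp, twistedForm_sharp,
    twistedForm_sharp, hv.1, hv.2]
  ring

lemma tangent_nondegenerate (hx : x ∈ cotangentSphere n) {u : Phase n} (hu : u ∈ tangentSpace x)
    (h : ∀ v ∈ tangentSpace x, twistedForm s κ v u = 0) : u = 0 := by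
  refine twistedForm_nondegenerate (s := s) (κ := κ) fun v => ?_
  rw [mem_tangentSpace] at hu
  -- Projection of v to the tangent space along the Hamiltonian vectors of φ₁ and φ₂. These pair to
  -- zero with every tangent vector, so the pairing with u is not changed.
  have hv : v + ((differential phi2 x v / 2) • sharp s κ (differential phi1 x)
      + (-(differential phi1 x v / 2)) • sharp s κ (differential phi2 x)) ∈ tangentSpace x := by
    rw [mem_tangentSpace]
    simp only [map_add, map_smul, smul_eq_mul, phi1_sharp_phi2 hx, phi2_sharp_phi1 hx,
      apply_sharp_self]
    constructor <;> ring
  have h1 := h _ hv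
  rw [twistedForm_antisymm, twistedForm_add_right, twistedForm_add_right, twistedForm_smul_right,
    twistedForm_smul_right, twistedForm_sharp, twistedForm_sharp, hu.1, hu.2] at h1
  rw [twistedForm_antisymm]; linarith

/-- Contraction with the twisted symplectic form, as a covector on the tangent space. -/
def tangentFlat (s : ℝ) (κ : Fin (n / 2) → ℝ) (x : Phase n) :
    Phase n →ₗ[ℝ] Module.Dual ℝ (tangentSpace x) where
  toFun u :=
    { toFun := fun v => twistedForm s κ v u
      map_add' := fun a b => by
        rw [twistedForm_antisymm, Submodule.coe_add, twistedForm_add_right, neg_add,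
          ← twistedForm_antisymm, ← twistedForm_antisymm]
      map_smul' := fun t a => by
        rw [twistedForm_antisymm, Submodule.coe_smul, twistedForm_smul_right, ← mul_neg,
          ← twistedForm_antisymm]; rfl }
  map_add' u v := by ext w; exact twistedForm_add_right s κ w u v
  map_smul' t u := by ext w; exact twistedForm_smul_right s κ t w u

lemma tangentFlat_diracSharp (β : Module.Dual ℝ (Phase n)) :
    tangentFlat s κ x (diracSharp s κ x β) = (tangentSpace x).dualRestrict β := by
  ext v; exact twistedForm_diracSharp v.2 β

lemma finrank_map_tangentFlat (hx : x ∈ cotangentSphere n) {W : Submodule ℝ (Phase n)}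
    (hW : W ≤ tangentSpace x) :
    Module.finrank ℝ (W.map (tangentFlat s κ x)) = Module.finrank ℝ W := by
  rw [← LinearMap.range_domRestrict]
  refine LinearMap.finrank_range_of_inj ?_
  rw [← LinearMap.ker_eq_bot, LinearMap.ker_eq_bot']
  rintro ⟨u, hu⟩ h
  ext1
  exact tangent_nondegenerate (s := s) (κ := κ) hx (hW hu) fun v hv => LinearMap.congr_fun h ⟨v, hv⟩

/-- A covector is in the kernel of the bracket on the span exactly if its Hamiltonian vector is
tangent to the level set. Isotropy supplies the other condition: contraction of the form with a
level tangent vector annihilates all level tangent vectors, hence is a combination of the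
differentials of S. -/
lemma dindAt_eq (S : Set (Phase n → ℝ)) (hx : x ∈ cotangentSphere n)
    (hiso : ∀ u ∈ levelTangent S x, ∀ v ∈ levelTangent S x, twistedForm s κ u v = 0) :
    dindAt s κ S x = Module.finrank ℝ (levelTangent S x) := by
  rw [dindAt, ← finrank_map_tangentFlat (s := s) (κ := κ) hx
    (levelTangent_le S)]
  suffices h : (codiff S x ⊓ (diracBivector s κ x).orthogonal (codiff S x)).map
      (tangentSpace x).dualRestrict = (levelTangent S x).map (tangentFlat s κ x) by rw [h]
  ext φ
  simp only [Submodule.mem_map, Submodule.mem_inf, LinearMap.BilinForm.mem_orthogonal_iff,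
    dirac_eq_diracSharp hx]
  constructor
  · rintro ⟨β, ⟨-, hβ⟩, rfl⟩
    refine ⟨diracSharp s κ x β, ?_, tangentFlat_diracSharp β⟩
    rw [mem_levelTangent]
    exact ⟨diracSharp_mem hx β, fun f hf => hβ _ (Submodule.subset_span ⟨f, hf, rfl⟩)⟩
  · rintro ⟨u, hu, rfl⟩
    have h1 : tangentFlat s κ x u ∈ (codiff S x).map (tangentSpace x).dualRestrict := by
      rw [← Subspace.dualCoannihilator_dualAnnihilator_eq
        (W := (codiff S x).map (tangentSpace x).dualRestrict), Submodule.mem_dualAnnihilator]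
      intro v hv
      have : (v : Phase n) ∈ levelTangent S x := by
        rw [levelTangent, ← coannihilator_map_subtype]
        exact ⟨v, hv, rfl⟩
      exact hiso v this u hu
    obtain ⟨β, hβ, e⟩ := h1
    have h2 : diracSharp s κ x β = u := by
      rw [← sub_eq_zero]
      refine tangent_nondegenerate (s := s) (κ := κ) hx
        (Submodule.sub_mem _ (diracSharp_mem hx β) hu.1) fun v hv => ?_
      have e1 : β v = twistedForm s κ v u := LinearMap.congr_fun e ⟨v, hv⟩
      rw [sub_eq_add_neg, ← neg_one_smul ℝ u, twistedForm_add_right, twistedForm_smul_right,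
        twistedForm_diracSharp hv, e1]
      ring
    refine ⟨β, ⟨hβ, fun α hα => ?_⟩, e⟩
    rw [h2]
    exact (Submodule.mem_dualCoannihilator _).1 hu.2 α hα

/-- The Hamiltonian vectors of commuting functions are tangent to the level set, so the number of
independent functions is at most its dimension, which is the complement of that number in 2 (n - 1).
-/
lemma ddimAt_le_of_commute {S : Set (Phase n → ℝ)} (hx : x ∈ cotangentSphere n)
    (h : ∀ f ∈ S, ∀ g ∈ S, diracBracket s κ f g x = 0) : ddimAt S x ≤ n - 1 := by
  have hN : (codiff S x).map (tangentSpace x).dualRestrict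
      ≤ (levelTangent S x).map (tangentFlat s κ x) := by
    rintro _ ⟨β, hβ, rfl⟩
    refine ⟨diracSharp s κ x β, ?_, tangentFlat_diracSharp β⟩
    refine mem_levelTangent.2 ⟨diracSharp_mem hx β, fun f hf => ?_⟩
    rw [← dirac_eq_diracSharp hx]
    refine Submodule.span_induction ?_ ?_ ?_ ?_ hβ
    · rintro _ ⟨g, hg, rfl⟩; exact h f hf g hg
    · simp
    · intro a b _ _ ha hb; rw [map_add, ha, hb, add_zero]
    · intro t a _ ha; rw [map_smul, ha, smul_zero]
  have h1 := Submodule.finrank_mono hN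
  rw [finrank_map_tangentFlat hx (levelTangent_le S)] at h1
  have h2 := ddimAt_add_finrank S hx
  rw [ddimAt] at *
  omega

/-- Independence of the restrictions to the tangent space is independence modulo the two constraint
differentials, which can be tested with arbitrary ambient vectors. -/
lemma card_le_ddimAt {S : Set (Phase n → ℝ)} {ι : Type*} [Fintype ι]
    (β : ι → Module.Dual ℝ (Phase n)) (hβ : ∀ j, β j ∈ codiff S x)
    (h : ∀ (c : ι → ℝ) (a b : ℝ),
      ∑ j, c j • β j + a • differential phi1 x + b • differential phi2 x = 0 → c = 0) :
    Fintype.card ι ≤ ddimAt S x := by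
  have hli : LinearIndependent ℝ fun j => (tangentSpace x).dualRestrict (β j) := by
    rw [Fintype.linearIndependent_iff]
    intro c hc
    have h1 : ∀ v ∈ tangentSpace x, (∑ j, c j • β j) v = 0 := by
      intro v hv
      have := LinearMap.congr_fun hc ⟨v, hv⟩
      simpa using this
    have h2 : ∑ j, c j • β j ∈ Submodule.span ℝ
        (Set.range ![differential phi1 x, differential phi2 x]) := by
      rw [← Subspace.dualCoannihilator_dualAnnihilator_eq (W := Submodule.span ℝ
        (Set.range ![differential phi1 x, differential phi2 x])), ← tangentSpace_eq,
        Submodule.mem_dualAnnihilator]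
      exact h1
    rw [Matrix.range_cons, Matrix.range_cons, Matrix.range_empty, Set.union_empty,
      Set.singleton_union, Submodule.mem_span_pair] at h2
    obtain ⟨a, b, e⟩ := h2
    have := h c (-a) (-b) (by rw [← e]; module)
    exact fun i => congrFun this i
  have h3 : Submodule.span ℝ (Set.range fun j => (tangentSpace x).dualRestrict (β j))
      ≤ (codiff S x).map (tangentSpace x).dualRestrict := by
    rw [Submodule.span_le]
    rintro _ ⟨j, rfl⟩
    exact ⟨β j, hβ j, rfl⟩
  have h4 := Submodule.finrank_mono h3
  rwa [finrank_span_eq_card hli] at h4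

end LinearAlgebra

/-! ### Generic points -/

lemma HoldsGenerically.mono {P Q : Phase n → Prop} (h : HoldsGenerically P)
    (hPQ : ∀ x ∈ cotangentSphere n, P x → Q x) : HoldsGenerically Q := by
  obtain ⟨U, hU, hd, hP⟩ := h
  exact ⟨U, hU, hd, fun x hx => hPQ x hx.1 (hP x hx)⟩

lemma HoldsGenerically.and {P Q : Phase n → Prop} (hP : HoldsGenerically P)
    (hQ : HoldsGenerically Q) : HoldsGenerically fun x => P x ∧ Q x := by
  obtain ⟨U, hU, hUd, hP⟩ := hP
  obtain ⟨V, hV, hVd, hQ⟩ := hQ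
  refine ⟨U ∩ V, hU.inter hV, fun x hx => ?_,
    fun x hx => ⟨hP x ⟨hx.1, hx.2.1⟩, hQ x ⟨hx.1, hx.2.2⟩⟩⟩
  rw [mem_closure_iff]
  intro W hW hxW
  obtain ⟨y, hyW, hyc, hyU⟩ := mem_closure_iff.1 (hUd hx) W hW hxW
  obtain ⟨y', hyW', hyc', hyV'⟩ := mem_closure_iff.1 (hVd hyc) (W ∩ U) (hW.inter hU) ⟨hyW, hyU⟩
  exact ⟨y', hyW'.1, hyc', hyW'.2, hyV'⟩

lemma HoldsGenerically.forall {ι : Type*} [Finite ι] {P : ι → Phase n → Prop}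
    (hP : ∀ i, HoldsGenerically (P i)) : HoldsGenerically fun x => ∀ i, P i x := by
  have h : ∀ s : Set ι, s.Finite → HoldsGenerically fun x => ∀ i ∈ s, P i x := by
    intro s hs
    induction s, hs using Set.Finite.induction_on with
    | empty => exact ⟨Set.univ, isOpen_univ, by simpa using subset_closure, by simp⟩
    | @insert a s _ _ ih =>
      refine ((hP a).and ih).mono fun x _ h => ?_
      rintro i (rfl | hi)
      · exact h.1
      · exact h.2 i hi
  exact (h Set.univ Set.finite_univ).mono fun x _ h i => h i trivial

lemma phase_neg_mem {x : Phase n} (hx : x ∈ cotangentSphere n) : -x ∈ cotangentSphere n := by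
  obtain ⟨h1, h2⟩ := hx
  constructor
  · simpa [phi1] using h1
  · simpa [phi2] using h2

/-- The point of the cotangent bundle of the sphere obtained by normalization and projection. -/
def normalizePhase (a b : Fin n → ℝ) : Phase n :=
  ((Real.sqrt (a ⬝ᵥ a))⁻¹ • a, b - ((b ⬝ᵥ a) / (a ⬝ᵥ a)) • a)

lemma normalizePhase_mem {a b : Fin n → ℝ} (ha : 0 < a ⬝ᵥ a) :
    normalizePhase a b ∈ cotangentSphere n := by
  have h := Real.mul_self_sqrt ha.le
  have h0 : Real.sqrt (a ⬝ᵥ a) ≠ 0 := (Real.sqrt_pos.2 ha).ne'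
  constructor
  · simp only [phi1, normalizePhase, smul_dotProduct, dotProduct_smul, smul_eq_mul]
    rw [← mul_assoc, ← mul_inv, h, inv_mul_cancel₀ ha.ne']
  · simp only [phi2, normalizePhase, sub_dotProduct, smul_dotProduct, dotProduct_smul, smul_eq_mul,
      div_mul_cancel₀ _ ha.ne', sub_self, mul_zero]

lemma normalizePhase_of_mem {x : Phase n} (hx : x ∈ cotangentSphere n) :
    normalizePhase x.1 x.2 = x := by
  have h1 : x.1 ⬝ᵥ x.1 = 1 := hx.1
  have h2 : x.2 ⬝ᵥ x.1 = 0 := hx.2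
  simp [normalizePhase, h1, h2]

lemma segment_dot_pos {u v : Fin n → ℝ} (hu : u ⬝ᵥ u = 1) (hv : v ⬝ᵥ v = 1) (huv : v ≠ -u)
    (t : ℝ) : 0 < (u + t • (v - u)) ⬝ᵥ (u + t • (v - u)) := by
  have h1 : 0 < (u + v) ⬝ᵥ (u + v) := by
    have h0 : 0 ≤ (u + v) ⬝ᵥ (u + v) := Finset.sum_nonneg fun i _ => mul_self_nonneg _
    refine h0.lt_of_ne fun h => huv ?_
    have := dotProduct_self_eq_zero.1 h.symm
    rw [eq_neg_iff_add_eq_zero, add_comm, this]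
  have h2 : 0 ≤ (u - v) ⬝ᵥ (u - v) := Finset.sum_nonneg fun i _ => mul_self_nonneg _
  simp only [add_dotProduct, sub_dotProduct, smul_dotProduct, dotProduct_add, dotProduct_sub,
    dotProduct_smul, smul_eq_mul, hu, hv, dotProduct_comm v u] at h1 h2 ⊢
  -- For unit vectors, u + v and u - v are orthogonal, so the squared norm is |u + v|² / 4 + (2 t -
  -- 1)² |u - v|² / 4.
  nlinarith [mul_nonneg (sq_nonneg (2 * t - 1)) h2]

lemma contDiff_normalize_segment {x y : Phase n} (hx : x ∈ cotangentSphere n)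
    (hy : y ∈ cotangentSphere n) (hxy : y.1 ≠ -x.1) :
    ContDiff ℝ ω fun t : ℝ =>
      normalizePhase (x.1 + t • (y.1 - x.1)) (x.2 + t • (y.2 - x.2)) := by
  have hpos := segment_dot_pos hx.1 hy.1 hxy
  have ha : ContDiff ℝ ω fun t : ℝ => x.1 + t • (y.1 - x.1) := by fun_prop
  have hb : ContDiff ℝ ω fun t : ℝ => x.2 + t • (y.2 - x.2) := by fun_prop
  have haa := contDiff_dot ha ha
  have hba := contDiff_dot hb ha
  have hs := haa.sqrt fun t => (hpos t).ne'
  exact ((hs.inv fun t => (Real.sqrt_pos.2 (hpos t)).ne').smul ha).prodMk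
    (hb.sub ((hba.div haa fun t => (hpos t).ne').smul ha))

/-- Join x to y by a normalized and projected segment, an analytic curve in the cotangent bundle.
Since g is nonzero at one end, its zeros along the curve are isolated, and points with g ≠ 0
accumulate at x. The segment must not pass through the origin; evenness of g permits replacing y by
-y if y lies over the antipode of x. -/
lemma holdsGenerically_ne_zero {g : Phase n → ℝ} (hg : ContDiff ℝ ω g)
    (heven : ∀ x, g (-x) = g x) {y : Phase n} (hy : y ∈ cotangentSphere n) (hgy : g y ≠ 0) :
    HoldsGenerically fun x => g x ≠ 0 := by
  refine ⟨{x | g x ≠ 0}, isOpen_ne_fun hg.continuous continuous_const, fun x hx => ?_,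
    fun x hx => hx.2⟩
  obtain ⟨y, hy, hgy, hxy⟩ : ∃ y ∈ cotangentSphere n, g y ≠ 0 ∧ y.1 ≠ -x.1 := by
    by_cases h : y.1 = -x.1
    · refine ⟨-y, phase_neg_mem hy, by rwa [heven], fun h' => ?_⟩
      have h3 : x.1 = 0 := by
        rw [Prod.fst_neg, h, neg_neg] at h'
        funext i
        have := congrFun h' i
        simp only [Pi.neg_apply] at this
        simp only [Pi.zero_apply]; linarith
      have h4 : x.1 ⬝ᵥ x.1 = 1 := hx.1
      simp [h3] at h4
    · exact ⟨y, hy, hgy, h⟩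
  set c : ℝ → Phase n := fun t =>
    normalizePhase (x.1 + t • (y.1 - x.1)) (x.2 + t • (y.2 - x.2)) with hc
  have hcd : ContDiff ℝ ω c := contDiff_normalize_segment hx hy hxy
  have hc0 : c 0 = x := by simp [hc, normalizePhase_of_mem hx]
  have hc1 : c 1 = y := by simp [hc, normalizePhase_of_mem hy]
  have hcm : ∀ t, c t ∈ cotangentSphere n := fun t =>
    normalizePhase_mem (segment_dot_pos hx.1 hy.1 hxy t)
  have han : AnalyticOnNhd ℝ (g ∘ c) Set.univ :=
    contDiff_omega_iff_analyticOnNhd.1 (hg.comp hcd)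
  have hne : ∀ᶠ t in 𝓝[≠] (0 : ℝ), (g ∘ c) t ≠ 0 := by
    rcases (han 0 trivial).eventually_eq_zero_or_eventually_ne_zero with h | h
    · have := han.eqOn_zero_of_preconnected_of_eventuallyEq_zero isPreconnected_univ
        (Set.mem_univ 0) h (Set.mem_univ 1)
      simp only [Function.comp_apply, hc1, Pi.zero_apply] at this
      exact absurd this hgy
    · exact h
  have htend : Filter.Tendsto c (𝓝[≠] (0 : ℝ)) (𝓝 x) := by
    have := hcd.continuous.tendsto 0
    rw [hc0] at this
    exact this.mono_left nhdsWithin_le_nhds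
  exact mem_closure_of_tendsto htend (hne.mono fun t ht => ⟨hcm t, ht⟩)

/-! ### Hermitian products -/

section Hermitian
variable {ι : Type*} [Fintype ι]

/-- The Hermitian product. -/
def hdot (u v : ι → ℂ) : ℂ := ∑ i, conj (u i) * v i

lemma hdot_add_left (u v w : ι → ℂ) : hdot (u + v) w = hdot u w + hdot v w := by
  simp [hdot, add_mul, Finset.sum_add_distrib]
lemma hdot_add_right (u v w : ι → ℂ) : hdot u (v + w) = hdot u v + hdot u w := by
  simp [hdot, mul_add, Finset.sum_add_distrib]
lemma hdot_smul_left (t : ℂ) (u v : ι → ℂ) : hdot (t • u) v = conj t * hdot u v := by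
  simp [hdot, Finset.mul_sum, mul_assoc]
lemma hdot_smul_right (t : ℂ) (u v : ι → ℂ) : hdot u (t • v) = t * hdot u v := by
  simp only [hdot, Finset.mul_sum, Pi.smul_apply, smul_eq_mul]
  exact Finset.sum_congr rfl fun i _ => by ring
lemma hdot_neg_right (u v : ι → ℂ) : hdot u (-v) = -hdot u v := by simp [hdot]
lemma hdot_neg_left (u v : ι → ℂ) : hdot (-u) v = -hdot u v := by simp [hdot]
lemma hdot_sub_left (u v w : ι → ℂ) : hdot (u - v) w = hdot u w - hdot v w := by
  simp [sub_eq_add_neg, hdot_add_left, hdot_neg_left]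
lemma hdot_sub_right (u v w : ι → ℂ) : hdot u (v - w) = hdot u v - hdot u w := by
  simp [sub_eq_add_neg, hdot_add_right, hdot_neg_right]
lemma hdot_conj (u v : ι → ℂ) : conj (hdot u v) = hdot v u := by
  simp [hdot, mul_comm]

/-- The squared Hermitian norm. -/
def hsq (u : ι → ℂ) : ℝ := ∑ i, normSq (u i)

lemma hdot_self (u : ι → ℂ) : hdot u u = hsq u := by
  simp only [hdot, hsq, ofReal_sum]
  exact Finset.sum_congr rfl fun _ _ => normSq_eq_conj_mul_self.symm

lemma hsq_nonneg (u : ι → ℂ) : 0 ≤ hsq u := Finset.sum_nonneg fun _ _ => normSq_nonneg _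

lemma hsq_eq_zero {u : ι → ℂ} (h : hsq u = 0) : u = 0 := by
  funext i
  exact normSq_eq_zero.1
    ((Finset.sum_eq_zero_iff_of_nonneg fun i _ => normSq_nonneg _).1 h i (Finset.mem_univ i))

lemma hsq_pos {u : ι → ℂ} (h : u ≠ 0) : 0 < hsq u :=
  (hsq_nonneg u).lt_of_ne fun h' => h (hsq_eq_zero h'.symm)

/-- The Gram determinant of two complex vectors. -/
def hgram (z q : ι → ℂ) : ℝ := hsq z * hsq q - normSq (hdot z q)

lemma ofReal_hgram (z q : ι → ℂ) :
    (hgram z q : ℂ) = hsq z * hsq q - hdot z q * hdot q z := by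
  rw [hgram, ofReal_sub, ofReal_mul, normSq_eq_conj_mul_self, hdot_conj, mul_comm (hdot q z)]

lemma hgram_nonneg (z q : ι → ℂ) : 0 ≤ hgram z q := by
  -- The Gram–Schmidt vector |z|² q - ⟨z, q⟩ z has squared norm |z|² times the Gram determinant.
  have h : hsq (((hsq z : ℝ) : ℂ) • q - hdot z q • z) = hsq z * hgram z q := by
    have : ((hsq (((hsq z : ℝ) : ℂ) • q - hdot z q • z) : ℝ) : ℂ) = (hsq z * hgram z q : ℝ) := by
      rw [← hdot_self, ofReal_mul, ofReal_hgram]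
      simp only [hdot_sub_left, hdot_sub_right, hdot_smul_left, hdot_smul_right, conj_ofReal,
        hdot_conj]
      simp only [hdot_self]
      ring
    exact_mod_cast this
  rcases (hsq_nonneg z).eq_or_lt with h0 | h0
  · have hz := hsq_eq_zero h0.symm
    have : hdot z q = 0 := by simp [hz, hdot]
    simp [hgram, ← h0, this]
  · have h1 := hsq_nonneg (((hsq z : ℝ) : ℂ) • q - hdot z q • z)
    rw [h] at h1
    exact nonneg_of_mul_nonneg_right h1 h0

lemma hsq_pos_of_hgram {z q : ι → ℂ} (h : hgram z q ≠ 0) : 0 < hsq z := by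
  refine hsq_pos ?_
  rintro rfl
  simp [hgram, hsq, hdot] at h

lemma hgram_independent {z q : ι → ℂ} (h : hgram z q ≠ 0) {a b : ℂ}
    (hab : a • z + b • q = 0) : a = 0 ∧ b = 0 := by
  have h1 : a * hsq z + b * hdot z q = 0 := by
    have := congrArg (hdot z) hab
    rw [hdot_add_right, hdot_smul_right, hdot_smul_right, hdot_self] at this
    rw [this]; simp [hdot]
  have h2 : a * hdot q z + b * hsq q = 0 := by
    have := congrArg (hdot q) hab
    rw [hdot_add_right, hdot_smul_right, hdot_smul_right, hdot_self] at this
    rw [this]; simp [hdot]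
  have hG := ofReal_hgram z q
  have hG0 : (hgram z q : ℂ) ≠ 0 := by exact_mod_cast h
  constructor
  · refine (mul_eq_zero.1 (?_ : a * (hgram z q : ℂ) = 0)).resolve_right hG0
    rw [hG]; linear_combination (hsq q : ℂ) * h1 - hdot z q * h2
  · refine (mul_eq_zero.1 (?_ : b * (hgram z q : ℂ) = 0)).resolve_right hG0
    rw [hG]; linear_combination (hsq z : ℂ) * h2 - hdot q z * h1

/-- The variations of two independent vectors which fix their momentum matrix. -/
lemma momentum_variation {z q z' q' : ι → ℂ} (hG : hgram z q ≠ 0)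
    (hE : ∀ i j, conj (z' i) * q j + conj (z i) * q' j - conj (q' i) * z j - conj (q i) * z' j = 0) :
    ∃ (α : ℂ) (β γ : ℝ), (∀ i, z' i = α * z i + β * q i) ∧
      ∀ i, q' i = γ * z i - conj α * q i := by
  have hG0 : (hgram z q : ℂ) ≠ 0 := by exact_mod_cast hG
  have hGe := ofReal_hgram z q
  have hsum : ∀ (y : ι → ℂ) j, hdot z' y * q j + hdot z y * q' j - hdot q' y * z j
      - hdot q y * z' j = 0 := by
    intro y j
    simp only [hdot, Finset.sum_mul, ← Finset.sum_add_distrib, ← Finset.sum_sub_distrib]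
    refine Finset.sum_eq_zero fun i _ => ?_
    linear_combination y i * hE i j
  -- Contracting the first index with z and with q gives, for each j, two linear equations for z'_j
  -- and q'_j whose determinant is the Gram determinant. Cramer's rule then expresses both through
  -- z_j and q_j with coefficients independent of j.
  have E1 := hsum z
  have E2 := hsum q
  simp only [hdot_self] at E1 E2
  obtain ⟨α, hα⟩ : ∃ α : ℂ, α * hgram z q = hdot z q * hdot q' z - hsq z * hdot q' q :=
    ⟨_ / _, div_mul_cancel₀ _ hG0⟩
  obtain ⟨β, hβ⟩ : ∃ β : ℂ, β * hgram z q = hsq z * hdot z' q - hdot z q * hdot z' z :=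
    ⟨_ / _, div_mul_cancel₀ _ hG0⟩
  obtain ⟨γ, hγ⟩ : ∃ γ : ℂ, γ * hgram z q = hsq q * hdot q' z - hdot q z * hdot q' q :=
    ⟨_ / _, div_mul_cancel₀ _ hG0⟩
  obtain ⟨δ, hδ⟩ : ∃ δ : ℂ, δ * hgram z q = hdot q z * hdot z' q - hsq q * hdot z' z :=
    ⟨_ / _, div_mul_cancel₀ _ hG0⟩
  have hz' : ∀ j, z' j = α * z j + β * q j := by
    intro j
    refine mul_right_cancel₀ hG0 ?_
    linear_combination hdot z q * E1 j - hsq z * E2 j - z j * hα - q j * hβ + z' j * hGe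
  have hq' : ∀ j, q' j = γ * z j + δ * q j := by
    intro j
    refine mul_right_cancel₀ hG0 ?_
    linear_combination hsq q * E1 j - hdot q z * E2 j - z j * hγ - q j * hδ + q' j * hGe
  -- Substituting back leaves a relation between z and q in the index j, then one in the index i.
  -- Independence makes all its coefficients vanish, which forces β and γ to be real and δ to be
  -- -conj α.
  have hrow : ∀ i, (conj γ - γ) * conj (z i) + (conj δ + α) * conj (q i) = 0
      ∧ (conj α + δ) * conj (z i) + (conj β - β) * conj (q i) = 0 := by
    intro i
    have h1 : (-((conj γ - γ) * conj (z i) + (conj δ + α) * conj (q i))) • z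
        + ((conj α + δ) * conj (z i) + (conj β - β) * conj (q i)) • q = 0 := by
      funext j
      have := hE i j
      rw [hz' i, hz' j, hq' i, hq' j] at this
      simp only [map_add, map_mul] at this
      simp only [Pi.add_apply, Pi.smul_apply, smul_eq_mul, Pi.zero_apply]
      linear_combination this
    have h2 := hgram_independent hG h1
    exact ⟨neg_eq_zero.1 h2.1, h2.2⟩
  have h1 : conj (conj γ - γ) • z + conj (conj δ + α) • q = 0 := by
    funext i
    have := congrArg conj (hrow i).1
    simpa only [map_add, map_mul, conj_conj, map_zero, Pi.add_apply, Pi.smul_apply, smul_eq_mul,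
      Pi.zero_apply] using this
  have h2 : conj (conj α + δ) • z + conj (conj β - β) • q = 0 := by
    funext i
    have := congrArg conj (hrow i).2
    simpa only [map_add, map_mul, conj_conj, map_zero, Pi.add_apply, Pi.smul_apply, smul_eq_mul,
      Pi.zero_apply] using this
  obtain ⟨h3, -⟩ := hgram_independent hG h1
  obtain ⟨h4, h5⟩ := hgram_independent hG h2
  have h3' : conj γ = γ := by
    have := (map_eq_zero (starRingEnd ℂ)).1 h3; exact sub_eq_zero.1 this
  have h4' : δ = -conj α := by
    have := (map_eq_zero (starRingEnd ℂ)).1 h4; linear_combination this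
  have h5' : conj β = β := by
    have := (map_eq_zero (starRingEnd ℂ)).1 h5; exact sub_eq_zero.1 this
  refine ⟨α, β.re, γ.re, fun i => ?_, fun i => ?_⟩
  · rw [conj_eq_iff_re.1 h5', hz']
  · rw [conj_eq_iff_re.1 h3', hq', h4']; ring

end Hermitian

/-! ### Tangent spaces of the level sets -/

/-- The vector with all coordinates but the first `r` ones replaced by zero. -/
def mask (r : ℕ) (z : Fin (n / 2) → ℂ) : Fin (n / 2) → ℂ := fun i => if (i : ℕ) < r then z i else 0

lemma mask_of_lt {r : ℕ} {i : Fin (n / 2)} (h : (i : ℕ) < r) (z : Fin (n / 2) → ℂ) :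
    mask r z i = z i := if_pos h

lemma mask_of_not_lt {r : ℕ} {i : Fin (n / 2)} (h : ¬ (i : ℕ) < r) (z : Fin (n / 2) → ℂ) :
    mask r z i = 0 := if_neg h

section Level
variable {m s : ℝ} {κ : Fin (n / 2) → ℝ} {r : ℕ} {κ₀ : ℝ} {x : Phase n}

lemma zc_sharp_mom (t : ℂ) (a b i : Fin (n / 2)) :
    zc (sharp s κ (differential (mom s κ t a b) x)) i = rotCoord t a b (zc x) i := by
  rw [sharp_mom, zc_ofCoord]

lemma qc_sharp_mom (t : ℂ) (a b i : Fin (n / 2)) :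
    qc s κ (sharp s κ (differential (mom s κ t a b) x)) i = rotCoord t a b (qc s κ x) i := by
  rw [sharp_mom, qc_ofCoord]

lemma wc_sharp_mom (t : ℂ) (a b : Fin (n / 2)) :
    wc (sharp s κ (differential (mom s κ t a b) x)) = 0 := by
  rw [sharp_mom, wc_ofCoord_zero]

variable (s κ r x) in
/-- The differential of the sum of the first `r` functions `Φ`. -/
def phaseCovector : Module.Dual ℝ (Phase n) :=
  ∑ a : Fin (n / 2), if (a : ℕ) < r then differential (mom s κ (I / 2) a a) x else 0

variable (s κ r x) in
/-- A multiple of the differential of the quadratic Casimir function of the momentum matrix. -/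
def casimirCovector : Module.Dual ℝ (Phase n) :=
  ∑ a : Fin (n / 2), ∑ b : Fin (n / 2), if (a : ℕ) < r ∧ (b : ℕ) < r then
    (1 / 2 : ℝ) • differential (mom s κ (momMat s κ x a b) a b) x else 0

lemma rotCoord_phase (z : Fin (n / 2) → ℂ) (i : Fin (n / 2)) :
    ∑ a : Fin (n / 2), (if (a : ℕ) < r then rotCoord (I / 2) a a z i else 0)
      = I * mask r z i := by
  rw [Finset.sum_eq_single i]
  · have h : (conj (I / 2) : ℂ) = -I / 2 := by rw [map_div₀, conj_I, map_ofNat]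
    simp only [rotCoord, if_true, h, mask]
    split_ifs <;> ring
  · intro b _ hb
    simp [rotCoord, Ne.symm hb]
  · simp

lemma zc_phase (i : Fin (n / 2)) :
    zc (sharp s κ (phaseCovector s κ r x)) i = I * mask r (zc x) i := by
  rw [← rotCoord_phase, phaseCovector]
  simp only [map_sum, Finset.sum_apply, apply_ite (sharp s κ), apply_ite zc, map_zero, ite_apply,
    zc_sharp_mom, Pi.zero_apply]

lemma qc_phase (i : Fin (n / 2)) :
    qc s κ (sharp s κ (phaseCovector s κ r x)) i = I * mask r (qc s κ x) i := by
  rw [← rotCoord_phase, phaseCovector]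
  simp only [map_sum, Finset.sum_apply, apply_ite (sharp s κ), apply_ite (qc s κ), map_zero,
    ite_apply, qc_sharp_mom, Pi.zero_apply]

/-- The vector y is contracted with the momentum matrix of the block. The terms in which i is the
first index and those in which it is the second coincide because the matrix is skew-Hermitian, and
this cancels the factor 1/2. -/
lemma rotCoord_casimir (y : Fin (n / 2) → ℂ) (i : Fin (n / 2)) :
    ∑ a : Fin (n / 2), ∑ b : Fin (n / 2), (if (a : ℕ) < r ∧ (b : ℕ) < r then
        (1 / 2 : ℂ) * rotCoord (momMat s κ x a b) a b y i else 0)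
      = hdot (mask r (zc x)) (mask r y) * mask r (qc s κ x) i
        - hdot (mask r (qc s κ x)) (mask r y) * mask r (zc x) i := by
  have h1 : ∀ a b : Fin (n / 2), (if (a : ℕ) < r ∧ (b : ℕ) < r then
        (1 / 2 : ℂ) * rotCoord (momMat s κ x a b) a b y i else 0)
      = (if i = b then (if (a : ℕ) < r ∧ (i : ℕ) < r then
          1 / 2 * momMat s κ x a i * y a else 0) else 0)
        + (if i = a then (if (b : ℕ) < r ∧ (i : ℕ) < r then
          1 / 2 * momMat s κ x b i * y b else 0) else 0) := by
    intro a b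
    simp only [rotCoord, momMat_conj]
    by_cases hb : i = b <;> by_cases ha : i = a
    · subst hb; subst ha; split_ifs <;> ring
    · subst hb; simp only [if_true, ha, if_false]; split_ifs <;> ring
    · subst ha; simp only [if_true, hb, if_false, and_comm]; split_ifs <;> ring
    · simp [ha, hb]
  simp only [h1, Finset.sum_add_distrib, Finset.sum_ite_eq, Finset.mem_univ, if_true]
  rw [Finset.sum_comm (f := fun a b => if i = a then _ else _)]
  simp only [Finset.sum_ite_eq, Finset.mem_univ, if_true, hdot, Finset.sum_mul,
    ← Finset.sum_add_distrib, ← Finset.sum_sub_distrib]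
  refine Finset.sum_congr rfl fun a _ => ?_
  by_cases ha : (a : ℕ) < r <;> by_cases hi : (i : ℕ) < r <;>
    simp [mask, ha, hi, momMat_apply]
  ring

lemma zc_casimir (i : Fin (n / 2)) :
    zc (sharp s κ (casimirCovector s κ r x)) i
      = hsq (mask r (zc x)) * mask r (qc s κ x) i
        - hdot (mask r (qc s κ x)) (mask r (zc x)) * mask r (zc x) i := by
  rw [← hdot_self, ← rotCoord_casimir, casimirCovector]
  simp only [map_sum, Finset.sum_apply, apply_ite (sharp s κ), apply_ite zc, map_zero, ite_apply,
    map_smul, Pi.smul_apply, zc_sharp_mom, Pi.zero_apply, real_smul]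
  push_cast; rfl

lemma qc_casimir (i : Fin (n / 2)) :
    qc s κ (sharp s κ (casimirCovector s κ r x)) i
      = hdot (mask r (zc x)) (mask r (qc s κ x)) * mask r (qc s κ x) i
        - hsq (mask r (qc s κ x)) * mask r (zc x) i := by
  rw [← hdot_self, ← rotCoord_casimir, casimirCovector]
  simp only [map_sum, Finset.sum_apply, apply_ite (sharp s κ), apply_ite (qc s κ), map_zero,
    ite_apply, map_smul, Pi.smul_apply, qc_sharp_mom, Pi.zero_apply, real_smul]
  push_cast; rfl

lemma wc_phase : wc (sharp s κ (phaseCovector s κ r x)) = 0 := by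
  simp only [phaseCovector, map_sum, apply_ite (sharp s κ), apply_ite wc, map_zero, wc_sharp_mom,
    ite_self, Finset.sum_const_zero]

lemma wc_casimir : wc (sharp s κ (casimirCovector s κ r x)) = 0 := by
  simp only [casimirCovector, map_sum, apply_ite (sharp s κ), apply_ite wc, map_zero, map_smul,
    wc_sharp_mom, smul_zero, ite_self, Finset.sum_const_zero]

variable (s κ r x) in
/-- The span of the differentials of the components of the momentum matrix. -/
def momSpan : Submodule ℝ (Module.Dual ℝ (Phase n)) :=
  Submodule.span ℝ {β | ∃ (t : ℂ) (a b : Fin (n / 2)),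
    (((a : ℕ) < r ∧ (b : ℕ) < r) ∨ a = b) ∧ β = differential (mom s κ t a b) x}

lemma mom_mem_momSpan (t : ℂ) {a b : Fin (n / 2)} (h : ((a : ℕ) < r ∧ (b : ℕ) < r) ∨ a = b) :
    differential (mom s κ t a b) x ∈ momSpan s κ r x := Submodule.subset_span ⟨t, a, b, h, rfl⟩

lemma phaseCovector_mem : phaseCovector s κ r x ∈ momSpan s κ r x := by
  refine Submodule.sum_mem _ fun a _ => ?_
  split_ifs with h
  · exact mom_mem_momSpan _ (Or.inr rfl)
  · exact Submodule.zero_mem _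

lemma casimirCovector_mem : casimirCovector s κ r x ∈ momSpan s κ r x := by
  refine Submodule.sum_mem _ fun a _ => Submodule.sum_mem _ fun b _ => ?_
  split_ifs with h
  · exact Submodule.smul_mem _ _ (mom_mem_momSpan _ (Or.inl h))
  · exact Submodule.zero_mem _

lemma good_kappa (heq : ∀ i : Fin (n / 2), (i : ℕ) < r → κ i = κ₀) {a b : Fin (n / 2)}
    (h : ((a : ℕ) < r ∧ (b : ℕ) < r) ∨ a = b) : κ a = κ b := by
  rcases h with ⟨ha, hb⟩ | rfl
  · rw [heq a ha, heq b hb]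
  · rfl

lemma momSpan_apply {β : Module.Dual ℝ (Phase n)} (hβ : β ∈ momSpan s κ r x) {v : Phase n}
    (h : ∀ (t : ℂ) (a b : Fin (n / 2)), (((a : ℕ) < r ∧ (b : ℕ) < r) ∨ a = b) →
      differential (mom s κ t a b) x v = 0) : β v = 0 := by
  refine Submodule.span_induction ?_ ?_ ?_ ?_ hβ
  · rintro _ ⟨t, a, b, hab, rfl⟩; exact h t a b hab
  · simp
  · intro a b _ _ ha hb; simp [ha, hb]
  · intro t a _ ha; simp [ha]

lemma levelTangent_adjoin (heq : ∀ i : Fin (n / 2), (i : ℕ) < r → κ i = κ₀) {v : Phase n}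
    (hv : v ∈ levelTangent (integrals m s κ r) x) {f : Phase n → ℝ}
    (hf : f ∈ Algebra.adjoin ℝ (integrals m s κ r)) : differential f x v = 0 := by
  have h1 := hv.2
  rw [← codiff_adjoin fun f hf => contDiff_integrals heq hf] at h1
  exact (Submodule.mem_dualCoannihilator _).1 h1 _ (Submodule.subset_span ⟨f, hf, rfl⟩)

lemma levelTangent_mom (heq : ∀ i : Fin (n / 2), (i : ℕ) < r → κ i = κ₀) {v : Phase n}
    (hv : v ∈ levelTangent (integrals m s κ r) x) (t : ℂ) {a b : Fin (n / 2)}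
    (h : ((a : ℕ) < r ∧ (b : ℕ) < r) ∨ a = b) : differential (mom s κ t a b) x v = 0 :=
  levelTangent_adjoin heq hv (mom_mem_adjoin heq t h)

lemma twistedForm_sharp_momSpan (heq : ∀ i : Fin (n / 2), (i : ℕ) < r → κ i = κ₀) {v : Phase n}
    (hv : v ∈ levelTangent (integrals m s κ r) x) {β : Module.Dual ℝ (Phase n)}
    (hβ : β ∈ momSpan s κ r x) : twistedForm s κ v (sharp s κ β) = 0 := by
  rw [twistedForm_sharp]
  exact momSpan_apply hβ fun t a b h => levelTangent_mom heq hv t h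

lemma twistedForm_field {v : Phase n} (hv : v ∈ levelTangent (integrals m s κ r) x) :
    twistedForm s κ v (magneticField m s κ x) = 0 := by
  rw [mem_levelTangent, mem_tangentSpace] at hv
  have h1 := hv.1.1
  have h2 := hv.2 _ hamiltonian_mem_integrals
  rw [differential_phi1] at h1
  rw [differential_hamiltonian] at h2
  simp only [twistedForm, magneticField, add_dotProduct, smul_dotProduct,
    smul_eq_mul, Matrix.mulVec_smul, dotProduct_comm v.1, dotProduct_comm v.2]
  linear_combination h2 - multiplier m s κ x / 2 * h1

/-- Momentum functions commute with the constraints, with H and with J. So for a combination of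
their differentials, only the invariance of the momentum matrix itself has to be verified. -/
lemma sharp_mem_levelTangent (heq : ∀ i : Fin (n / 2), (i : ℕ) < r → κ i = κ₀)
    (hx : x ∈ cotangentSphere n) {β : Module.Dual ℝ (Phase n)} (hβ : β ∈ momSpan s κ r x)
    (h : ∀ (t : ℂ) (a b : Fin (n / 2)), (((a : ℕ) < r ∧ (b : ℕ) < r) ∨ a = b) →
      differential (mom s κ t a b) x (sharp s κ β) = 0) :
    sharp s κ β ∈ levelTangent (integrals m s κ r) x := by
  have hp1 : β (sharp s κ (differential phi1 x)) = 0 :=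
    momSpan_apply hβ fun t a b _ => differential_mom_sharp_phi1 t x
  have hp2 : β (sharp s κ (differential phi2 x)) = 0 :=
    momSpan_apply hβ fun t a b _ => differential_mom_sharp_phi2 t x
  rw [mem_levelTangent, mem_tangentSpace]
  refine ⟨⟨by rw [apply_sharp_antisymm, hp1, neg_zero], by rw [apply_sharp_antisymm, hp2, neg_zero]⟩,
    fun f hf => ?_⟩
  rcases mem_integrals_cases heq hf with rfl | rfl | ⟨t, a, b, hab, -, rfl⟩
  · have h1 := dirac_eq (s := s) (κ := κ) hx β (differential (hamiltonian m) x)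
    rw [dirac_hamiltonian hx, hp1, hp2] at h1
    rw [apply_sharp_antisymm]
    have h2 : β (magneticField m s κ x) = 0 :=
      momSpan_apply hβ fun t a b h => differential_mom_field (good_kappa heq h) t x
    linarith
  · rw [apply_sharp_antisymm, neg_eq_zero]
    exact momSpan_apply hβ fun t a b h => differential_mom_sharp_J (good_kappa heq h) t x
  · exact h t a b hab

lemma field_mem_levelTangent (heq : ∀ i : Fin (n / 2), (i : ℕ) < r → κ i = κ₀)
    (hx : x ∈ cotangentSphere n) :
    magneticField m s κ x ∈ levelTangent (integrals m s κ r) x := by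
  have h1 : x.1 ⬝ᵥ x.1 = 1 := hx.1
  have h2 : x.2 ⬝ᵥ x.1 = 0 := hx.2
  rw [mem_levelTangent, mem_tangentSpace]
  refine ⟨⟨?_, ?_⟩, fun f hf => ?_⟩
  · rw [differential_phi1]
    simp [magneticField, dotProduct_comm x.1 x.2, h2]
  · rw [differential_phi2]
    simp only [magneticField, add_dotProduct, smul_dotProduct, dotProduct_smul, smul_eq_mul, h1,
      multiplier]
    rw [dot_kappa_right κ x.2]
    ring
  · rcases mem_integrals_cases heq hf with rfl | rfl | ⟨t, a, b, -, h, rfl⟩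
    · exact differential_hamiltonian_field m s κ hx
    · exact differential_J_field m s κ hx
    · exact differential_mom_field h t x

lemma phase_mem_levelTangent (heq : ∀ i : Fin (n / 2), (i : ℕ) < r → κ i = κ₀)
    (hx : x ∈ cotangentSphere n) :
    sharp s κ (phaseCovector s κ r x) ∈ levelTangent (integrals m s κ r) x := by
  refine sharp_mem_levelTangent heq hx phaseCovector_mem fun t a b hab => ?_
  rw [differential_mom]
  by_cases ha : (a : ℕ) < r ∧ (b : ℕ) < r
  · rw [momPolar_gauge I 0 0, mul_zero, zero_re] <;>
    simp [zc_phase, qc_phase, mask_of_lt ha.1, mask_of_lt ha.2]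
  · obtain rfl := hab.resolve_left ha
    have ha' : ¬ (a : ℕ) < r := by tauto
    rw [momPolar_gauge 0 0 0, mul_zero, zero_re] <;>
    simp [zc_phase, qc_phase, mask_of_not_lt ha']

lemma casimir_mem_levelTangent (heq : ∀ i : Fin (n / 2), (i : ℕ) < r → κ i = κ₀)
    (hx : x ∈ cotangentSphere n) :
    sharp s κ (casimirCovector s κ r x) ∈ levelTangent (integrals m s κ r) x := by
  refine sharp_mem_levelTangent heq hx casimirCovector_mem fun t a b hab => ?_
  rw [differential_mom]
  by_cases ha : (a : ℕ) < r ∧ (b : ℕ) < r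
  · rw [momPolar_gauge (-hdot (mask r (qc s κ x)) (mask r (zc x))) (hsq (mask r (zc x)))
      (-hsq (mask r (qc s κ x))), mul_zero, zero_re] <;>
    simp only [zc_casimir, qc_casimir, mask_of_lt ha.1, mask_of_lt ha.2, map_neg, hdot_conj,
      ofReal_neg] <;> ring
  · obtain rfl := hab.resolve_left ha
    have ha' : ¬ (a : ℕ) < r := by tauto
    rw [momPolar_gauge 0 0 0, mul_zero, zero_re] <;>
    simp [zc_casimir, qc_casimir, mask_of_not_lt ha']

/-- It is enough to pair the frame vectors with the level tangent: as they are Hamiltonian vectors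
of integrals, up to a reaction force, these pairings vanish, and isotropy follows by linearity. -/
lemma levelTangent_of_frame {S : Set (Phase n → ℝ)} {k : ℕ} (u : Fin k → Phase n)
    (hu : ∀ j, u j ∈ levelTangent S x) (hli : LinearIndependent ℝ u)
    (hspan : ∀ v ∈ levelTangent S x, v ∈ Submodule.span ℝ (Set.range u))
    (hω : ∀ j, ∀ v ∈ levelTangent S x, twistedForm s κ v (u j) = 0) :
    Module.finrank ℝ (levelTangent S x) = k ∧
      ∀ v ∈ levelTangent S x, ∀ w ∈ levelTangent S x, twistedForm s κ v w = 0 := by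
  have h : levelTangent S x = Submodule.span ℝ (Set.range u) :=
    le_antisymm hspan (Submodule.span_le.2 (by rintro _ ⟨j, rfl⟩; exact hu j))
  refine ⟨by rw [h, finrank_span_eq_card hli, Fintype.card_fin], fun v hv w hw => ?_⟩
  refine Submodule.span_induction ?_ ?_ ?_ ?_ (hspan w hw)
  · rintro _ ⟨j, rfl⟩; exact hω j v hv
  · simp [twistedForm]
  · intro a b _ _ ha hb; rw [twistedForm_add_right, ha, hb, add_zero]
  · intro t a _ ha; rw [twistedForm_smul_right, ha, mul_zero]

/-- On the block, v acts as (α, β, γ) by `momentum_variation`. The Casimir vector has the real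
coefficient |z|² at q and removes β; the phase vector, multiplication by i, removes the imaginary
part of what α has become. -/
lemma levelTangent_reduce (heq : ∀ i : Fin (n / 2), (i : ℕ) < r → κ i = κ₀)
    (hG : hgram (mask r (zc x)) (mask r (qc s κ x)) ≠ 0) {v : Phase n}
    (hv : v ∈ levelTangent (integrals m s κ r) x) :
    ∃ b t α γ : ℝ, ∀ i : Fin (n / 2), (i : ℕ) < r →
      zc (v - b • sharp s κ (casimirCovector s κ r x) - t • sharp s κ (phaseCovector s κ r x)) i
        = α * zc x i ∧
      qc s κ (v - b • sharp s κ (casimirCovector s κ r x)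
        - t • sharp s κ (phaseCovector s κ r x)) i = γ * zc x i - α * qc s κ x i := by
  obtain ⟨α, β, γ, hz, hq⟩ := momentum_variation (z' := mask r (zc v)) (q' := mask r (qc s κ v)) hG
    (by
      intro i j
      by_cases hi : (i : ℕ) < r
      · by_cases hj : (j : ℕ) < r
        · have h1 := levelTangent_mom heq hv 1 (Or.inl ⟨hi, hj⟩)
          have h2 := levelTangent_mom heq hv I (Or.inl ⟨hi, hj⟩)
          rw [differential_mom] at h1 h2
          have h3 : momPolar s κ i j x v + momPolar s κ i j v x = 0 := by
            apply Complex.ext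
            · simpa using h1
            · simpa using h2
          simp only [momPolar] at h3
          simp only [mask_of_lt hi, mask_of_lt hj]
          linear_combination h3
        · simp [mask_of_not_lt hj]
      · simp [mask_of_not_lt hi])
  have hρ := hsq_pos_of_hgram hG
  set ρ := hsq (mask r (zc x)) with hρe
  set h := hdot (mask r (zc x)) (mask r (qc s κ x)) with hh
  have hρ0 : (ρ : ℂ) ≠ 0 := by exact_mod_cast hρ.ne'
  -- The coefficient of z after subtracting β / ρ times the Casimir vector, whose own coefficient at
  -- z is -⟨q, z⟩.
  set α' : ℂ := α + (β / ρ : ℝ) * conj h with hα'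
  have hre : (α'.re : ℂ) = α' - α'.im * I := by
    apply Complex.ext <;> simp
  have hre' : (α'.re : ℂ) = conj α' + α'.im * I := by
    apply Complex.ext <;> simp
  refine ⟨β / ρ, α'.im, α'.re, γ + β / ρ * hsq (mask r (qc s κ x)), fun i hi => ?_⟩
  have hzi := hz i
  have hqi := hq i
  simp only [mask_of_lt hi] at hzi hqi
  have hc : hdot (mask r (qc s κ x)) (mask r (zc x)) = conj h := (hdot_conj _ _).symm
  constructor
  · simp only [map_sub, map_smul, Pi.sub_apply, Pi.smul_apply, real_smul, zc_casimir, zc_phase,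
      mask_of_lt hi, hzi, hc, ← hρe]
    rw [hre, hα']
    push_cast
    field_simp
    ring
  · simp only [map_sub, map_smul, Pi.sub_apply, Pi.smul_apply, real_smul, qc_casimir, qc_phase,
      mask_of_lt hi, hqi, ← hh]
    rw [hre', hα']
    simp only [map_add, map_mul, conj_ofReal, conj_conj]
    push_cast
    ring

lemma differential_phi1_coord (v : Phase n) : differential phi1 x v
    = 2 * (∑ i, (conj (zc x i) * zc v i).re + wc x * wc v) := by
  rw [differential_phi1, dot_eq]; simp only [cpx_fst, lastCoord_fst]

lemma differential_hamiltonian_coord (v : Phase n) : differential (hamiltonian m) x v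
    = (∑ i, (conj (pc x i) * pc v i).re + wp x * wp v) / m := by
  rw [differential_hamiltonian, dot_eq]; simp only [cpx_snd, lastCoord_snd]

variable (s κ) in
lemma differential_phi2_coord (v : Phase n) : differential phi2 x v
    = ∑ i, (conj (zc x i) * qc s κ v i + conj (zc v i) * qc s κ x i).re
      + (wc x * wp v + wc v * wp x) := by
  rw [differential_phi2, dotProduct_comm, dotProduct_comm x.2, dot_eq, dot_eq]
  simp only [cpx_fst, cpx_snd, lastCoord_fst, lastCoord_snd]
  have : ∑ i, (conj (zc x i) * qc s κ v i + conj (zc v i) * qc s κ x i).re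
      = ∑ i, (conj (zc x i) * pc v i).re + ∑ i, (conj (zc v i) * pc x i).re := by
    rw [← Finset.sum_add_distrib]
    refine Finset.sum_congr rfl fun i _ => ?_
    rw [qc_eq, qc_eq]
    simp only [add_re, mul_re, mul_im, add_im, I_re, I_im, ofReal_re, ofReal_im, conj_re, conj_im]
    ring
  rw [this]; ring

end Level

/-! ### Isotropic frames of the level sets in the three cases -/

section Frames
variable {m s : ℝ} {κ : Fin (n / 2) → ℝ} {r : ℕ} {κ₀ : ℝ} {x : Phase n}

lemma sum_of_full {A : Type*} [AddCommMonoid A] (hfull : ∀ i : Fin (n / 2), (i : ℕ) < r)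
    (f : Fin (n / 2) → A) : ∑ i, f i = ∑ i : Fin (n / 2), if (i : ℕ) < r then f i else 0 :=
  Finset.sum_congr rfl fun i _ => by rw [if_pos (hfull i)]

lemma sum_of_last {A : Type*} [AddCommMonoid A] {L : Fin (n / 2)} (hL : (L : ℕ) = r)
    (hlast : ∀ i : Fin (n / 2), (i : ℕ) < r ∨ i = L) (f : Fin (n / 2) → A) :
    ∑ i, f i = (∑ i : Fin (n / 2), if (i : ℕ) < r then f i else 0) + f L := by
  have h : ∀ i, f i = (if (i : ℕ) < r then f i else 0) + (if i = L then f i else 0) := by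
    intro i
    rcases hlast i with h | rfl
    · have : i ≠ L := by rintro rfl; omega
      simp [h, this]
    · simp [hL]
  rw [Finset.sum_congr rfl fun i _ => h i, Finset.sum_add_distrib]
  simp

lemma masked_phi1 {v : Phase n} {α : ℝ}
    (h : ∀ i : Fin (n / 2), (i : ℕ) < r → zc v i = α * zc x i) :
    (∑ i : Fin (n / 2), if (i : ℕ) < r then (conj (zc x i) * zc v i).re else 0)
      = α * hsq (mask r (zc x)) := by
  rw [hsq, Finset.mul_sum]
  refine Finset.sum_congr rfl fun i _ => ?_
  split_ifs with hi
  · rw [h i hi, mask_of_lt hi, normSq_apply]; simp; ring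
  · rw [mask_of_not_lt hi]; simp

lemma masked_phi2 {v : Phase n} {α γ : ℝ}
    (h : ∀ i : Fin (n / 2), (i : ℕ) < r → zc v i = α * zc x i)
    (h' : ∀ i : Fin (n / 2), (i : ℕ) < r → qc s κ v i = γ * zc x i - α * qc s κ x i) :
    (∑ i : Fin (n / 2), if (i : ℕ) < r then
        (conj (zc x i) * qc s κ v i + conj (zc v i) * qc s κ x i).re else 0)
      = γ * hsq (mask r (zc x)) := by
  rw [hsq, Finset.mul_sum]
  refine Finset.sum_congr rfl fun i _ => ?_
  split_ifs with hi
  · rw [h i hi, h' i hi, mask_of_lt hi, normSq_apply]; simp; ring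
  · rw [mask_of_not_lt hi]; simp

lemma masked_hamiltonian {v : Phase n} {γ : ℝ}
    (h : ∀ i : Fin (n / 2), (i : ℕ) < r → zc v i = 0)
    (h' : ∀ i : Fin (n / 2), (i : ℕ) < r → qc s κ v i = γ * zc x i) :
    (∑ i : Fin (n / 2), if (i : ℕ) < r then (conj (pc x i) * pc v i).re else 0)
      = γ * ∑ i : Fin (n / 2), if (i : ℕ) < r then (conj (zc x i) * qc s κ x i).re else 0 := by
  rw [Finset.mul_sum]
  refine Finset.sum_congr rfl fun i _ => ?_
  split_ifs with hi
  · rw [pc_eq s κ v, pc_eq s κ x, h i hi, h' i hi]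
    simp only [map_sub, sub_re, mul_re, mul_im, sub_im, I_re, I_im, ofReal_re, ofReal_im, conj_re,
      conj_im, zero_re, zero_im]
    ring
  · ring

lemma masked_hsq : (∑ i : Fin (n / 2), if (i : ℕ) < r then (conj (zc x i) * zc x i).re else 0)
    = hsq (mask r (zc x)) := by
  have := masked_phi1 (x := x) (v := x) (r := r) (α := 1) (by simp)
  rwa [one_mul] at this

lemma phase_casimir_independent (hG : hgram (mask r (zc x)) (mask r (qc s κ x)) ≠ 0) {a b : ℝ}
    (h : a • sharp s κ (phaseCovector s κ r x) + b • sharp s κ (casimirCovector s κ r x) = 0) :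
    a = 0 ∧ b = 0 := by
  have h1 : (a * I - b * hdot (mask r (qc s κ x)) (mask r (zc x))) • mask r (zc x)
      + (b * hsq (mask r (zc x)) : ℂ) • mask r (qc s κ x) = 0 := by
    funext i
    have := congrFun (congrArg zc h) i
    simp only [map_add, map_smul, Pi.add_apply, Pi.smul_apply, real_smul, zc_casimir, zc_phase,
      map_zero, Pi.zero_apply] at this
    simp only [Pi.add_apply, Pi.smul_apply, smul_eq_mul, Pi.zero_apply]
    linear_combination this
  have h2 := hgram_independent hG h1
  have hρ : (hsq (mask r (zc x)) : ℂ) ≠ 0 := by exact_mod_cast (hsq_pos_of_hgram hG).ne'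
  have hb : b = 0 := by exact_mod_cast (mul_eq_zero.1 h2.2).resolve_right hρ
  refine ⟨?_, hb⟩
  have := h2.1
  rw [hb] at this
  simpa using this

/-- After `levelTangent_reduce` only (α z, γ z - α q) with real α, γ is left. The constraint
differentials take the values 2 α |z|² and γ |z|² on it, so it vanishes. -/
lemma frame_even (heq : ∀ i : Fin (n / 2), (i : ℕ) < r → κ i = κ₀)
    (hfull : ∀ i : Fin (n / 2), (i : ℕ) < r) (hn : n % 2 = 0) (hx : x ∈ cotangentSphere n)
    (hG : hgram (mask r (zc x)) (mask r (qc s κ x)) ≠ 0) :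
    Module.finrank ℝ (levelTangent (integrals m s κ r) x) = 2 ∧
      ∀ v ∈ levelTangent (integrals m s κ r) x, ∀ w ∈ levelTangent (integrals m s κ r) x,
        twistedForm s κ v w = 0 := by
  refine levelTangent_of_frame
    ![sharp s κ (phaseCovector s κ r x), sharp s κ (casimirCovector s κ r x)] ?_ ?_ ?_ ?_
  · intro j; fin_cases j
    · exact phase_mem_levelTangent heq hx
    · exact casimir_mem_levelTangent heq hx
  · rw [LinearIndependent.pair_iff]
    exact fun a b h => phase_casimir_independent hG h
  · intro v hv
    obtain ⟨b, t, α, γ, h⟩ := levelTangent_reduce heq hG hv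
    set v' := v - b • sharp s κ (casimirCovector s κ r x) - t • sharp s κ (phaseCovector s κ r x)
      with hv'
    have hm : v' ∈ levelTangent (integrals m s κ r) x :=
      Submodule.sub_mem _ (Submodule.sub_mem _ hv
        (Submodule.smul_mem _ _ (casimir_mem_levelTangent heq hx)))
        (Submodule.smul_mem _ _ (phase_mem_levelTangent heq hx))
    have hρ := hsq_pos_of_hgram hG
    obtain ⟨hT1, hT2⟩ := mem_tangentSpace.1 hm.1
    rw [differential_phi1_coord, sum_of_full hfull, masked_phi1 fun i hi => (h i hi).1,
      wc_even hn, zero_mul, add_zero] at hT1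
    have hα : α = 0 := by
      rcases mul_eq_zero.1 hT1 with h0 | h0
      · norm_num at h0
      · exact (mul_eq_zero.1 h0).resolve_right hρ.ne'
    rw [differential_phi2_coord s κ, sum_of_full hfull,
      masked_phi2 (fun i hi => (h i hi).1) (fun i hi => (h i hi).2), wc_even hn, wc_even hn,
      zero_mul, zero_mul, add_zero, add_zero] at hT2
    have hγ : γ = 0 := (mul_eq_zero.1 hT2).resolve_right hρ.ne'
    have hz : v' = 0 := by
      refine phase_ext s κ ?_ ?_ ?_ ?_
      · funext i; rw [(h i (hfull i)).1, hα]; simp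
      · funext i; rw [(h i (hfull i)).2, hα, hγ]; simp
      · rw [wc_even hn, wc_even hn]
      · rw [wp_even hn, wp_even hn]
    rw [Matrix.range_cons, Matrix.range_cons, Matrix.range_empty, Set.union_empty,
      Set.singleton_union, Submodule.mem_span_pair]
    exact ⟨t, b, by rw [← sub_eq_zero, ← neg_eq_zero, ← hz, hv']; abel⟩
  · intro j v hv; fin_cases j
    · exact twistedForm_sharp_momSpan heq hv phaseCovector_mem
    · exact twistedForm_sharp_momSpan heq hv casimirCovector_mem

/-- The flow changes the height because its momentum is nonzero, so the height component of a vector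
can be subtracted. Then φ₁ gives α = 0, and H gives the axial momentum component γ times the height.
With this, φ₂ evaluates to γ ⟨γ, γ⟩, where the second factor is the squared length 1 of the
position. -/
lemma frame_odd (hm0 : m ≠ 0) (heq : ∀ i : Fin (n / 2), (i : ℕ) < r → κ i = κ₀)
    (hfull : ∀ i : Fin (n / 2), (i : ℕ) < r) (hx : x ∈ cotangentSphere n)
    (hG : hgram (mask r (zc x)) (mask r (qc s κ x)) ≠ 0) (hp : wp x ≠ 0) :
    Module.finrank ℝ (levelTangent (integrals m s κ r) x) = 3 ∧
      ∀ v ∈ levelTangent (integrals m s κ r) x, ∀ w ∈ levelTangent (integrals m s κ r) x,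
        twistedForm s κ v w = 0 := by
  have hwX : wc (magneticField m s κ x) ≠ 0 := by
    rw [wc_field]; exact mul_ne_zero (inv_ne_zero hm0) hp
  refine levelTangent_of_frame ![magneticField m s κ x, sharp s κ (phaseCovector s κ r x),
    sharp s κ (casimirCovector s κ r x)] ?_ ?_ ?_ ?_
  · intro j; fin_cases j
    · exact field_mem_levelTangent heq hx
    · exact phase_mem_levelTangent heq hx
    · exact casimir_mem_levelTangent heq hx
  · rw [Fintype.linearIndependent_iff]
    intro c hc
    simp only [Fin.sum_univ_three, Matrix.cons_val_zero, Matrix.cons_val_one, Matrix.cons_val] at hc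
    have h0 : c 0 = 0 := by
      have := congrArg wc hc
      simp only [map_add, map_smul, wc_phase, wc_casimir, mul_zero, add_zero, map_zero,
        smul_eq_mul] at this
      exact (mul_eq_zero.1 this).resolve_right hwX
    rw [h0, zero_smul, zero_add] at hc
    have h1 := phase_casimir_independent hG hc
    intro i; fin_cases i
    · exact h0
    · exact h1.1
    · exact h1.2
  · intro v₀ hv₀
    set c := wc v₀ / wc (magneticField m s κ x) with hc
    set v := v₀ - c • magneticField m s κ x with hve
    have hv : v ∈ levelTangent (integrals m s κ r) x :=
      Submodule.sub_mem _ hv₀ (Submodule.smul_mem _ _ (field_mem_levelTangent heq hx))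
    have hwv : wc v = 0 := by
      rw [hve, map_sub, map_smul, smul_eq_mul, hc, div_mul_cancel₀ _ hwX, sub_self]
    obtain ⟨b, t, α, γ, h⟩ := levelTangent_reduce heq hG hv
    set v' := v - b • sharp s κ (casimirCovector s κ r x) - t • sharp s κ (phaseCovector s κ r x)
      with hv'
    have hm : v' ∈ levelTangent (integrals m s κ r) x :=
      Submodule.sub_mem _ (Submodule.sub_mem _ hv
        (Submodule.smul_mem _ _ (casimir_mem_levelTangent heq hx)))
        (Submodule.smul_mem _ _ (phase_mem_levelTangent heq hx))
    have hw' : wc v' = 0 := by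
      simp [hv', wc_casimir, wc_phase, hwv]
    have hρ := hsq_pos_of_hgram hG
    obtain ⟨hT1, hT2⟩ := mem_tangentSpace.1 hm.1
    rw [differential_phi1_coord, sum_of_full hfull, masked_phi1 fun i hi => (h i hi).1,
      hw', mul_zero, add_zero] at hT1
    have hα : α = 0 := by
      rcases mul_eq_zero.1 hT1 with h0 | h0
      · norm_num at h0
      · exact (mul_eq_zero.1 h0).resolve_right hρ.ne'
    rw [differential_phi2_coord s κ, sum_of_full hfull,
      masked_phi2 (fun i hi => (h i hi).1) (fun i hi => (h i hi).2), hw', zero_mul, add_zero] at hT2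
    have hH := (mem_levelTangent.1 hm).2 _ hamiltonian_mem_integrals
    rw [differential_hamiltonian_coord, sum_of_full hfull, masked_hamiltonian (γ := γ)
      (fun i hi => by rw [(h i hi).1, hα]; simp)
      (fun i hi => by rw [(h i hi).2, hα]; simp), ← sum_of_full hfull, div_eq_zero_iff,
      or_iff_left hm0] at hH
    have hc1 : phi1 x = 1 := hx.1
    have hc2 : phi2 x = 0 := hx.2
    rw [phi2_eq s κ] at hc2
    rw [phi1_eq, sum_of_full hfull, masked_hsq] at hc1
    have e1 : wp v' = γ * wc x := by
      refine mul_left_cancel₀ hp ?_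
      linear_combination hH - γ * hc2
    have hγ : γ = 0 := by
      rw [e1] at hT2
      linear_combination hT2 - γ * hc1
    have hz : v' = 0 := by
      refine phase_ext s κ ?_ ?_ ?_ ?_
      · funext i; rw [(h i (hfull i)).1, hα]; simp
      · funext i; rw [(h i (hfull i)).2, hα, hγ]; simp
      · rw [hw', map_zero]
      · rw [e1, hγ, zero_mul, map_zero]
    have hfin : v₀ = c • magneticField m s κ x + t • sharp s κ (phaseCovector s κ r x)
        + b • sharp s κ (casimirCovector s κ r x) := by
      rw [← sub_eq_zero, ← hz, hv', hve]; abel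
    rw [hfin]
    exact Submodule.add_mem _ (Submodule.add_mem _
      (Submodule.smul_mem _ _ (Submodule.subset_span ⟨0, rfl⟩))
      (Submodule.smul_mem _ _ (Submodule.subset_span ⟨1, rfl⟩)))
      (Submodule.smul_mem _ _ (Submodule.subset_span ⟨2, rfl⟩))
  · intro j v hv; fin_cases j
    · exact twistedForm_field hv
    · exact twistedForm_sharp_momSpan heq hv phaseCovector_mem
    · exact twistedForm_sharp_momSpan heq hv casimirCovector_mem

-- The flow moves z_L radially, since the virial of the pair is nonzero, and R rotates it, so the
-- variation of z_L can be subtracted. Then conservation of Φ makes conj z_L q'_L real, H gives q'_L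
-- = γ z_L, and φ₂ evaluates to γ times the squared length of the position.
set_option maxHeartbeats 800000 in
lemma frame_last (hm0 : m ≠ 0) (heq : ∀ i : Fin (n / 2), (i : ℕ) < r → κ i = κ₀)
    {L : Fin (n / 2)} (hL : (L : ℕ) = r) (hlast : ∀ i : Fin (n / 2), (i : ℕ) < r ∨ i = L)
    (hn : n % 2 = 0) (hx : x ∈ cotangentSphere n)
    (hG : hgram (mask r (zc x)) (mask r (qc s κ x)) ≠ 0)
    (hp : (conj (zc x L) * qc s κ x L).re ≠ 0) :
    Module.finrank ℝ (levelTangent (integrals m s κ r) x) = 4 ∧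
      ∀ v ∈ levelTangent (integrals m s κ r) x, ∀ w ∈ levelTangent (integrals m s κ r) x,
        twistedForm s κ v w = 0 := by
  have hLr : ¬ (L : ℕ) < r := by omega
  have hd : zc x L ≠ 0 := by intro h; simp [h] at hp
  have hu : normSq (zc x L) ≠ 0 := by rwa [Ne, normSq_eq_zero]
  set η := (conj (zc x L) * qc s κ x L).re with hη
  have hηp : (conj (zc x L) * pc x L).re = η := by
    rw [hη, qc_eq]
    simp only [add_re, mul_re, mul_im, add_im, I_re, I_im, ofReal_re, ofReal_im, conj_re, conj_im]
    ring
  -- The rotation of the extra pair alone, generated by its function Φ.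
  set R : Phase n := sharp s κ (differential (mom s κ (I / 2) L L) x) with hR
  have hconj : (conj (I / 2) : ℂ) = -I / 2 := by rw [map_div₀, conj_I, map_ofNat]
  have hRz : zc R L = I * zc x L := by
    rw [hR, zc_sharp_mom, rotCoord, if_pos rfl, if_pos rfl, hconj]; ring
  have hRz' : ∀ i, i ≠ L → zc R i = 0 := fun i hi => by
    rw [hR, zc_sharp_mom, rotCoord, if_neg hi, if_neg hi, sub_zero]
  have hRq : qc s κ R L = I * qc s κ x L := by
    rw [hR, qc_sharp_mom, rotCoord, if_pos rfl, if_pos rfl, hconj]; ring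
  have hRq' : ∀ i, i ≠ L → qc s κ R i = 0 := fun i hi => by
    rw [hR, qc_sharp_mom, rotCoord, if_neg hi, if_neg hi, sub_zero]
  have hRm : R ∈ levelTangent (integrals m s κ r) x := by
    refine sharp_mem_levelTangent heq hx (mom_mem_momSpan _ (Or.inr rfl)) fun t a b hab => ?_
    rw [← hR, differential_mom]
    by_cases ha : (a : ℕ) < r ∧ (b : ℕ) < r
    · have h1 : a ≠ L := by rintro rfl; exact hLr ha.1
      have h2 : b ≠ L := by rintro rfl; exact hLr ha.2
      rw [momPolar_gauge 0 0 0, mul_zero, zero_re] <;>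
        simp [hRz' _ h1, hRz' _ h2, hRq' _ h1, hRq' _ h2]
    · obtain rfl := hab.resolve_left ha
      rcases hlast a with h1 | rfl
      · exact absurd ⟨h1, h1⟩ ha
      rw [momPolar_gauge I 0 0, mul_zero, zero_re] <;>
        simp [hRz, hRq]
  set X := magneticField m s κ x with hX
  have hXL : (conj (zc x L) * zc X L).re = m⁻¹ * η := by
    rw [hX, zc_field, ← hηp, mul_left_comm, re_ofReal_mul]
  have hX0 : (conj (zc x L) * zc X L).re ≠ 0 := by
    rw [hXL]; exact mul_ne_zero (inv_ne_zero hm0) hp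
  have hphL : zc (sharp s κ (phaseCovector s κ r x)) L = 0 := by
    rw [zc_phase, mask_of_not_lt hLr, mul_zero]
  have hcaL : zc (sharp s κ (casimirCovector s κ r x)) L = 0 := by
    rw [zc_casimir, mask_of_not_lt hLr, mask_of_not_lt hLr]; ring
  have hRre : (conj (zc x L) * zc R L).re = 0 := by
    rw [hRz]; simp; ring
  refine levelTangent_of_frame ![X, R, sharp s κ (phaseCovector s κ r x),
    sharp s κ (casimirCovector s κ r x)] ?_ ?_ ?_ ?_
  · intro j; fin_cases j
    · exact field_mem_levelTangent heq hx
    · exact hRm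
    · exact phase_mem_levelTangent heq hx
    · exact casimir_mem_levelTangent heq hx
  · rw [Fintype.linearIndependent_iff]
    intro c hc
    simp only [Fin.sum_univ_four, Matrix.cons_val_zero, Matrix.cons_val_one, Matrix.cons_val] at hc
    have hcL := congrFun (congrArg zc hc) L
    simp only [map_add, map_smul, Pi.add_apply, Pi.smul_apply, real_smul, hphL, hcaL, mul_zero,
      add_zero, map_zero, Pi.zero_apply] at hcL
    have h0 : c 0 = 0 := by
      have h1 := congrArg (fun y => (conj (zc x L) * y).re) hcL
      simp only [mul_add, add_re, mul_zero, zero_re] at h1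
      rw [mul_left_comm, re_ofReal_mul, mul_left_comm, re_ofReal_mul, hRre, mul_zero,
        add_zero] at h1
      exact (mul_eq_zero.1 h1).resolve_right hX0
    have h1 : c 1 = 0 := by
      rw [h0, ofReal_zero, zero_mul, zero_add, hRz] at hcL
      simpa [hd] using hcL
    rw [h0, h1, zero_smul, zero_smul, zero_add, zero_add] at hc
    have h2 := phase_casimir_independent hG hc
    intro i; fin_cases i
    · exact h0
    · exact h1
    · exact h2.1
    · exact h2.2
  · intro v₀ hv₀
    set c := (conj (zc x L) * zc v₀ L).re / (conj (zc x L) * zc X L).re with hc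
    set v₁ := v₀ - c • X with hv1
    have hv1L : (conj (zc x L) * zc v₁ L).re = 0 := by
      rw [hv1, map_sub, map_smul, Pi.sub_apply, Pi.smul_apply, real_smul, mul_sub, sub_re,
        mul_left_comm, re_ofReal_mul, hc, div_mul_cancel₀ _ hX0, sub_self]
    set d := (conj (zc x L) * zc v₁ L).im / normSq (zc x L) with hde
    set v := v₁ - d • R with hve
    have hv : v ∈ levelTangent (integrals m s κ r) x :=
      Submodule.sub_mem _ (Submodule.sub_mem _ hv₀
        (Submodule.smul_mem _ _ (field_mem_levelTangent heq hx))) (Submodule.smul_mem _ _ hRm)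
    have hvL : zc v L = 0 := by
      have h1 : conj (zc x L) * zc v L = 0 := by
        rw [hve, map_sub, map_smul, Pi.sub_apply, Pi.smul_apply, real_smul, hRz, mul_sub]
        have h2 : conj (zc x L) * (d * (I * zc x L)) = (d * normSq (zc x L) : ℝ) * I := by
          push_cast; rw [normSq_eq_conj_mul_self]; ring
        rw [h2, hde, div_mul_cancel₀ _ hu]
        apply Complex.ext
        · rw [sub_re, hv1L]; simp
        · simp
      exact (mul_eq_zero.1 h1).resolve_left (by simpa using hd)
    obtain ⟨b, t, α, γ, h⟩ := levelTangent_reduce heq hG hv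
    set v' := v - b • sharp s κ (casimirCovector s κ r x) - t • sharp s κ (phaseCovector s κ r x)
      with hv'
    have hm : v' ∈ levelTangent (integrals m s κ r) x :=
      Submodule.sub_mem _ (Submodule.sub_mem _ hv
        (Submodule.smul_mem _ _ (casimir_mem_levelTangent heq hx)))
        (Submodule.smul_mem _ _ (phase_mem_levelTangent heq hx))
    have hw' : zc v' L = 0 := by
      simp [hv', hphL, hcaL, hvL]
    have hp' : pc v' L = qc s κ v' L := by rw [pc_eq s κ, hw', mul_zero, sub_zero]
    have hρ := hsq_pos_of_hgram hG
    obtain ⟨hT1, hT2⟩ := mem_tangentSpace.1 hm.1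
    rw [differential_phi1_coord, sum_of_last hL hlast, masked_phi1 fun i hi => (h i hi).1,
      hw', wc_even hn, zero_mul, mul_zero, zero_re, add_zero, add_zero] at hT1
    have hα : α = 0 := by
      rcases mul_eq_zero.1 hT1 with h0 | h0
      · norm_num at h0
      · exact (mul_eq_zero.1 h0).resolve_right hρ.ne'
    rw [differential_phi2_coord s κ, sum_of_last hL hlast,
      masked_phi2 (fun i hi => (h i hi).1) (fun i hi => (h i hi).2), hw', map_zero, zero_mul,
      add_zero, wc_even hn, wc_even hn, zero_mul, zero_mul, add_zero, add_zero] at hT2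
    have hH := (mem_levelTangent.1 hm).2 _ hamiltonian_mem_integrals
    rw [differential_hamiltonian_coord, sum_of_last hL hlast, masked_hamiltonian (γ := γ)
      (fun i hi => by rw [(h i hi).1, hα]; simp)
      (fun i hi => by rw [(h i hi).2, hα]; simp), wp_even hn, zero_mul, add_zero, hp',
      div_eq_zero_iff, or_iff_left hm0] at hH
    have hΦ := levelTangent_mom heq hm (I / 2) (a := L) (b := L) (Or.inr rfl)
    rw [differential_mom, momPolar, momPolar, hw', map_zero, mul_zero, zero_mul, hconj] at hΦ
    have hc1 : phi1 x = 1 := hx.1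
    have hc2 : phi2 x = 0 := hx.2
    rw [phi2_eq s κ, sum_of_last hL hlast, wc_even hn, zero_mul, add_zero, ← hη] at hc2
    rw [phi1_eq, sum_of_last hL hlast, masked_hsq, wc_even hn, zero_mul, add_zero,
      ← normSq_eq_conj_mul_self, ofReal_re] at hc1
    have him : (conj (zc x L) * qc s κ v' L).im = 0 := by
      have e : (-I / 2 * (conj (zc x L) * qc s κ v' L - 0 + (0 - conj (qc s κ v' L) * zc x L)))
          = ((conj (zc x L) * qc s κ v' L).im : ℝ) := by
        have h1 : conj (qc s κ v' L) * zc x L = conj (conj (zc x L) * qc s κ v' L) := by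
          rw [map_mul, conj_conj, mul_comm]
        rw [h1]
        apply Complex.ext <;> simp
        ring
      rw [e, ofReal_re] at hΦ
      exact hΦ
    set y := (conj (zc x L) * qc s κ v' L).re with hy
    have hyq : conj (zc x L) * qc s κ v' L = (y : ℂ) := by
      apply Complex.ext
      · simp [hy]
      · rw [him]; simp
    have hqL : qc s κ v' L = (y / normSq (zc x L) : ℝ) * zc x L := by
      refine mul_left_cancel₀ (show conj (zc x L) ≠ 0 by simpa using hd) ?_
      rw [hyq, mul_left_comm, ← normSq_eq_conj_mul_self, ← ofReal_mul, div_mul_cancel₀ _ hu]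
    have hpq : (conj (pc x L) * qc s κ v' L).re = y / normSq (zc x L) * η := by
      rw [hqL, mul_left_comm, re_ofReal_mul, ← hηp, ← conj_re (conj (zc x L) * pc x L), map_mul,
        conj_conj, mul_comm (zc x L)]
    rw [hpq] at hH
    have e1 : y / normSq (zc x L) = γ := by
      refine mul_right_cancel₀ hp ?_
      linear_combination hH - γ * hc2
    have e2 : y = γ * normSq (zc x L) := by rw [← e1, div_mul_cancel₀ _ hu]
    have hγ : γ = 0 := by
      rw [e2] at hT2
      linear_combination hT2 - γ * hc1
    have hz : v' = 0 := by
      refine phase_ext s κ ?_ ?_ ?_ ?_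
      · funext i
        rcases hlast i with hi | rfl
        · rw [(h i hi).1, hα]; simp
        · rw [hw']; simp
      · funext i
        rcases hlast i with hi | rfl
        · rw [(h i hi).2, hα, hγ]; simp
        · rw [hqL, e1, hγ]; simp
      · rw [wc_even hn, wc_even hn]
      · rw [wp_even hn, wp_even hn]
    have hfin : v₀ = c • X + d • R + t • sharp s κ (phaseCovector s κ r x)
        + b • sharp s κ (casimirCovector s κ r x) := by
      rw [← sub_eq_zero, ← hz, hv', hve, hv1]; abel
    rw [hfin]
    exact Submodule.add_mem _ (Submodule.add_mem _ (Submodule.add_mem _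
      (Submodule.smul_mem _ _ (Submodule.subset_span ⟨0, rfl⟩))
      (Submodule.smul_mem _ _ (Submodule.subset_span ⟨1, rfl⟩)))
      (Submodule.smul_mem _ _ (Submodule.subset_span ⟨2, rfl⟩)))
      (Submodule.smul_mem _ _ (Submodule.subset_span ⟨3, rfl⟩))
  · intro j v hv; fin_cases j
    · exact twistedForm_field hv
    · exact twistedForm_sharp_momSpan heq hv (mom_mem_momSpan _ (Or.inr rfl))
    · exact twistedForm_sharp_momSpan heq hv phaseCovector_mem
    · exact twistedForm_sharp_momSpan heq hv casimirCovector_mem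

end Frames

/-! ### The commuting integrals -/

section Filtration
variable {m s : ℝ} {κ : Fin (n / 2) → ℝ} {r : ℕ} {κ₀ : ℝ} {x : Phase n}

lemma differential_sum {ι : Type*} (A : Finset ι) {f : ι → Phase n → ℝ}
    (hf : ∀ i ∈ A, ContDiff ℝ 1 (f i)) (x : Phase n) :
    differential (∑ i ∈ A, f i) x = ∑ i ∈ A, differential (f i) x := by
  rw [differential, fderiv_sum fun i hi => (hf i hi).differentiable (by simp) x]
  refine LinearMap.ext fun v => ?_
  simp [differential]

lemma differential_mom_add (a b : Fin (n / 2)) (t u : ℂ) :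
    differential (mom s κ (t + u) a b) x
      = differential (mom s κ t a b) x + differential (mom s κ u a b) x := by
  refine LinearMap.ext fun v => ?_
  simp only [LinearMap.add_apply, differential_mom, map_add, add_mul, add_re]

lemma differential_mom_smul (a b : Fin (n / 2)) (c : ℝ) (t : ℂ) :
    differential (mom s κ (c * t) a b) x = c • differential (mom s κ t a b) x := by
  refine LinearMap.ext fun v => ?_
  simp only [LinearMap.smul_apply, differential_mom, map_mul, conj_ofReal, mul_assoc, re_ofReal_mul,
    smul_eq_mul]

lemma differential_mom_swap (t : ℂ) (a b : Fin (n / 2)) :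
    differential (mom s κ t a b) x = -differential (mom s κ (conj t) b a) x := by
  have h : mom s κ t a b = -mom s κ (conj t) b a := by funext y; exact mom_swap ..
  rw [h, differential, fderiv_neg]; rfl

/-- The sum of the squares is |M_ij|², and the differential of this is twice that of Re (conj T ·
M_ij), with T frozen at the value of M_ij at x. -/
lemma differential_Psi_sq {i j : Fin (n / 2)} (h : κ i = κ j) :
    differential (Psi1 s κ i j * Psi1 s κ i j + Psi2 s κ i j * Psi2 s κ i j) x
      = (2 : ℝ) • differential (mom s κ (momMat s κ x i j) i j) x := by
  rw [Psi1_eq_mom h, Psi2_eq_mom h]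
  have h1 := contDiff_mom (k := 1) s κ (-I) i j
  have h2 := contDiff_mom (k := 1) s κ 1 i j
  have h11 : ContDiff ℝ 1 (mom s κ (-I) i j * mom s κ (-I) i j) := h1.mul h1
  have h22 : ContDiff ℝ 1 (mom s κ 1 i j * mom s κ 1 i j) := h2.mul h2
  rw [differential_add h11 h22, differential_mul h1 h1, differential_mul h2 h2]
  have h3 : momMat s κ x i j
      = ((mom s κ (-I) i j x : ℝ) : ℂ) * (-I) + ((mom s κ 1 i j x : ℝ) : ℂ) * 1 := by
    apply Complex.ext <;> simp [mom]
  conv_rhs => rw [h3]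
  rw [differential_mom_add, differential_mom_smul, differential_mom_smul]
  module

lemma filtrationIntegral_eq (k : ℕ) : filtrationIntegral s κ k
    = ∑ i : Fin (n / 2), ∑ j : Fin (n / 2), if i < j ∧ (j : ℕ) < k then
        Psi1 s κ i j * Psi1 s κ i j + Psi2 s κ i j * Psi2 s κ i j else 0 := by
  funext x
  simp only [filtrationIntegral, Finset.sum_apply]
  refine Finset.sum_congr rfl fun i _ => Finset.sum_congr rfl fun j _ => ?_
  split_ifs
  · simp [sq]
  · rfl

lemma contDiff_filtration_term {k : ℕ} {d : WithTop ℕ∞}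
    (hκ : ∀ i j : Fin (n / 2), i < j → (j : ℕ) < k → κ i = κ j) (i j : Fin (n / 2)) :
    ContDiff ℝ d (if i < j ∧ (j : ℕ) < k then
        Psi1 s κ i j * Psi1 s κ i j + Psi2 s κ i j * Psi2 s κ i j else 0) := by
  split_ifs with h
  · rw [Psi1_eq_mom (hκ i j h.1 h.2), Psi2_eq_mom (hκ i j h.1 h.2)]
    have h1 := contDiff_mom (k := d) s κ (-I) i j
    have h2 := contDiff_mom (k := d) s κ 1 i j
    exact (h1.mul h1).add (h2.mul h2)
  · exact contDiff_const (c := (0 : ℝ))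

lemma contDiff_filtration {k : ℕ} {d : WithTop ℕ∞}
    (hκ : ∀ i j : Fin (n / 2), i < j → (j : ℕ) < k → κ i = κ j) :
    ContDiff ℝ d (filtrationIntegral s κ k) := by
  rw [filtrationIntegral_eq]
  have h := fun i j => contDiff_filtration_term (s := s) (d := d) hκ i j
  have h1 : ∀ i : Fin (n / 2), ContDiff ℝ d (∑ j : Fin (n / 2), if i < j ∧ (j : ℕ) < k then
        Psi1 s κ i j * Psi1 s κ i j + Psi2 s κ i j * Psi2 s κ i j else 0) := fun i => by
    have := ContDiff.sum (s := Finset.univ) fun j _ => h i j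
    convert this using 1
    funext x; simp
  have := ContDiff.sum (s := Finset.univ) fun i _ => h1 i
  convert this using 1
  funext x; simp

lemma differential_filtration {k : ℕ}
    (hκ : ∀ i j : Fin (n / 2), i < j → (j : ℕ) < k → κ i = κ j) (x : Phase n) :
    differential (filtrationIntegral s κ k) x
      = ∑ i : Fin (n / 2), ∑ j : Fin (n / 2), if i < j ∧ (j : ℕ) < k then
        (2 : ℝ) • differential (mom s κ (momMat s κ x i j) i j) x else 0 := by
  have h := fun i j => contDiff_filtration_term (s := s) (d := 1) hκ i j
  rw [filtrationIntegral_eq, differential_sum]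
  · refine Finset.sum_congr rfl fun i _ => ?_
    rw [differential_sum _ fun j _ => h i j]
    refine Finset.sum_congr rfl fun j _ => ?_
    split_ifs with hij
    · exact differential_Psi_sq (hκ i j hij.1 hij.2)
    · exact differential_algebraMap 0 x
  · intro i _
    have := ContDiff.sum (s := Finset.univ) fun j _ => h i j
    convert this using 1
    funext x; simp

lemma differential_filtration_mem {k : ℕ}
    (hκ : ∀ i j : Fin (n / 2), i < j → (j : ℕ) < k → κ i = κ j) (hk : k ≤ r) (x : Phase n) :
    differential (filtrationIntegral s κ k) x ∈ momSpan s κ r x := by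
  rw [differential_filtration hκ]
  refine Submodule.sum_mem _ fun i _ => Submodule.sum_mem _ fun j _ => ?_
  split_ifs with h
  · refine Submodule.smul_mem _ _ (mom_mem_momSpan _ (Or.inl ⟨?_, by omega⟩))
    have := Fin.lt_def.1 h.1; omega
  · exact Submodule.zero_mem _

lemma dirac_momSpan_left (hx : x ∈ cotangentSphere n) {β : Module.Dual ℝ (Phase n)}
    (hβ : β ∈ momSpan s κ r x) (α : Module.Dual ℝ (Phase n)) :
    diracBivector s κ x β α = β (sharp s κ α) := by
  rw [dirac_eq hx, momSpan_apply hβ fun t a b _ => differential_mom_sharp_phi1 t x,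
    momSpan_apply hβ fun t a b _ => differential_mom_sharp_phi2 t x]
  ring

/-- A phase rotation of a single pair multiplies the off-diagonal entries of the momentum matrix by
phases, and the filtration integrals involve only their moduli. -/
lemma filtration_sharp_Phi {k : ℕ}
    (hκ : ∀ i j : Fin (n / 2), i < j → (j : ℕ) < k → κ i = κ j) (c : Fin (n / 2)) (t : ℂ) :
    differential (filtrationIntegral s κ k) x (sharp s κ (differential (mom s κ t c c) x)) = 0 := by
  rw [differential_filtration hκ]
  simp only [LinearMap.sum_apply]
  refine Finset.sum_eq_zero fun i _ => Finset.sum_eq_zero fun j _ => ?_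
  split_ifs with h
  · have hij : i ≠ j := h.1.ne
    have key : ∀ u : ℂ, mom s κ (momMat s κ x i j * u) i j x
        = mom s κ (momMat s κ x i j * conj u) i j x := by
      intro u
      simp only [mom, map_mul, conj_conj]
      rw [mul_right_comm, mul_right_comm _ u, ← normSq_eq_conj_mul_self, re_ofReal_mul,
        re_ofReal_mul, conj_re]
    rw [LinearMap.smul_apply, mom_bracket]
    by_cases hi : i = c
    · subst hi
      rw [if_pos rfl, if_pos rfl, if_neg hij.symm, if_neg hij.symm, key t]; simp
    · rw [if_neg hi, if_neg hi]
      by_cases hj : j = c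
      · subst hj
        rw [if_pos rfl, if_pos rfl, key t]; simp
      · simp [hj]
  · rfl

/-- In the Casimir function every off-diagonal pair occurs twice with equal contributions, by
skew-Hermitian symmetry. The diagonal entries contribute functions of the Φ only. -/
lemma casimirCovector_eq {k : ℕ}
    (hκ : ∀ i j : Fin (n / 2), i < j → (j : ℕ) < k → κ i = κ j) :
    (2 : ℝ) • casimirCovector s κ k x = differential (filtrationIntegral s κ k) x
      + ∑ c : Fin (n / 2), if (c : ℕ) < k then
          differential (mom s κ (momMat s κ x c c) c c) x else 0 := by
  have hsplit : ∀ i j : Fin (n / 2), (if (i : ℕ) < k ∧ (j : ℕ) < k then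
      (1 / 2 : ℝ) • differential (mom s κ (momMat s κ x i j) i j) x else 0)
      = (if i < j ∧ (j : ℕ) < k then
          (1 / 2 : ℝ) • differential (mom s κ (momMat s κ x i j) i j) x else 0)
        + (if j < i ∧ (i : ℕ) < k then
          (1 / 2 : ℝ) • differential (mom s κ (momMat s κ x j i) j i) x else 0)
        + (if i = j then (if (i : ℕ) < k then
          (1 / 2 : ℝ) • differential (mom s κ (momMat s κ x i i) i i) x else 0) else 0) := by
    intro i j
    rcases lt_trichotomy i j with h | rfl | h
    · have h1 : (i : ℕ) < j := h
      have h2 : ¬ j < i := h.not_gt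
      by_cases hj : (j : ℕ) < k
      · rw [if_pos ⟨by omega, hj⟩, if_pos ⟨h, hj⟩, if_neg (by tauto), if_neg h.ne]; simp
      · rw [if_neg (by tauto), if_neg (by tauto), if_neg (by tauto), if_neg h.ne]; simp
    · simp
    · have h1 : (j : ℕ) < i := h
      have h2 : ¬ i < j := h.not_gt
      by_cases hj : (i : ℕ) < k
      · rw [if_pos ⟨hj, by omega⟩, if_neg (by tauto), if_pos ⟨h, hj⟩, if_neg h.ne']
        rw [differential_mom_swap, momMat_conj]
        have : -momMat s κ x j i = ((-1 : ℝ) : ℂ) * momMat s κ x j i := by push_cast; ring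
        rw [this, differential_mom_smul]; simp only [zero_add, add_zero]; module
      · rw [if_neg (by tauto), if_neg (by tauto), if_neg (by tauto), if_neg h.ne']; simp
  rw [differential_filtration hκ, casimirCovector]
  simp only [hsplit, Finset.sum_add_distrib, Finset.sum_ite_eq, Finset.mem_univ, if_true]
  rw [Finset.sum_comm (f := fun i j : Fin (n / 2) => if j < i ∧ (i : ℕ) < k then
    (1 / 2 : ℝ) • differential (mom s κ (momMat s κ x j i) j i) x else 0), smul_add, smul_add]
  simp only [Finset.smul_sum, smul_ite, smul_zero, smul_smul]
  congr 1
  · rw [← Finset.sum_add_distrib]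
    refine Finset.sum_congr rfl fun i _ => ?_
    rw [← Finset.sum_add_distrib]
    refine Finset.sum_congr rfl fun j _ => ?_
    split_ifs
    · module
    · simp
  · norm_num

end Filtration

/-! ### Involution and independence of the commuting integrals -/

section Commuting
variable {m s : ℝ} {κ : Fin (n / 2) → ℝ} {r : ℕ} {κ₀ : ℝ} {x : Phase n}

/-- The Casimir vector of the first l pairs fixes their momentum matrix, hence every function of its
leading k × k part. The diagonal terms by which I_l differs from the Casimir function generate phase
rotations, which fix I_k as well. -/
lemma filtration_sharp_filtration {k l : ℕ} (hkl : k ≤ l)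
    (heq : ∀ i : Fin (n / 2), (i : ℕ) < l → κ i = κ₀) (hx : x ∈ cotangentSphere n) :
    differential (filtrationIntegral s κ k) x
      (sharp s κ (differential (filtrationIntegral s κ l) x)) = 0 := by
  have hκ : ∀ k, k ≤ l → ∀ i j : Fin (n / 2), i < j → (j : ℕ) < k → κ i = κ j := by
    intro k hk i j hij hj
    have := Fin.lt_def.1 hij
    rw [heq i (by omega), heq j (by omega)]
  have h1 : differential (filtrationIntegral s κ l) x = (2 : ℝ) • casimirCovector s κ l x
      - ∑ c : Fin (n / 2), if (c : ℕ) < l then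
          differential (mom s κ (momMat s κ x c c) c c) x else 0 := by
    rw [casimirCovector_eq (hκ l le_rfl), add_sub_cancel_right]
  have h2 : differential (filtrationIntegral s κ k) x (sharp s κ (casimirCovector s κ l x)) = 0 :=
    momSpan_apply (differential_filtration_mem (hκ k hkl) hkl x) fun t a b h =>
      levelTangent_mom (m := 1) heq (casimir_mem_levelTangent heq hx) t h
  rw [h1, map_sub, map_smul, map_sub, map_smul, h2, smul_zero, zero_sub, neg_eq_zero, map_sum,
    map_sum]
  refine Finset.sum_eq_zero fun c _ => ?_
  split_ifs
  · exact filtration_sharp_Phi (hκ k hkl) c _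
  · simp

lemma commuting_cases {f : Phase n → ℝ} (hf : f ∈ commutingIntegrals m s κ r) :
    f ∈ ({hamiltonian m, J m s κ} ∪ Set.range (Phi s κ) : Set (Phase n → ℝ)) ∨
      ∃ k, k ≤ r ∧ f = filtrationIntegral s κ k := by
  rcases hf with h | ⟨k, -, hk, rfl⟩
  · exact Or.inl h
  · exact Or.inr ⟨k, hk, rfl⟩

lemma filtration_kappa (heq : ∀ i : Fin (n / 2), (i : ℕ) < r → κ i = κ₀) {k : ℕ} (hk : k ≤ r)
    (i j : Fin (n / 2)) (hij : i < j) (hj : (j : ℕ) < k) : κ i = κ j := by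
  have := Fin.lt_def.1 hij
  rw [heq i (by omega), heq j (by omega)]

lemma contDiff_commuting (heq : ∀ i : Fin (n / 2), (i : ℕ) < r → κ i = κ₀) {f : Phase n → ℝ}
    (hf : f ∈ commutingIntegrals m s κ r) {d} : ContDiff ℝ d f := by
  rcases commuting_cases hf with h | ⟨k, hk, rfl⟩
  · exact contDiff_integrals heq (Or.inl h)
  · exact contDiff_filtration (filtration_kappa heq hk)

lemma isFirstIntegral_commuting (heq : ∀ i : Fin (n / 2), (i : ℕ) < r → κ i = κ₀)
    {f : Phase n → ℝ} (hf : f ∈ commutingIntegrals m s κ r) : IsFirstIntegral m s κ f := by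
  rcases commuting_cases hf with h | ⟨k, hk, rfl⟩
  · exact isFirstIntegral_integrals heq (Or.inl h)
  · refine isFirstIntegral_of_differential (contDiff_filtration (filtration_kappa heq hk))
      fun x _ => momSpan_apply (differential_filtration_mem (filtration_kappa heq hk) hk x)
        fun t a b h => differential_mom_field (good_kappa heq h) t x

lemma filtration_bracket (heq : ∀ i : Fin (n / 2), (i : ℕ) < r → κ i = κ₀) {k : ℕ} (hk : k ≤ r)
    {f : Phase n → ℝ} (hf : f ∈ ({hamiltonian m, J m s κ} ∪ Set.range (Phi s κ) : Set _))
    (hx : x ∈ cotangentSphere n) : diracBracket s κ (filtrationIntegral s κ k) f x = 0 := by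
  have hκ := filtration_kappa heq hk
  have hmem := differential_filtration_mem (s := s) hκ hk x
  rcases hf with (rfl | hf) | ⟨c, rfl⟩
  · rw [diracBracket, dirac_hamiltonian hx]
    exact momSpan_apply hmem fun t a b h => differential_mom_field (good_kappa heq h) t x
  · obtain rfl : f = J m s κ := hf
    rw [diracBracket, dirac_momSpan_left hx hmem]
    exact momSpan_apply hmem fun t a b h => differential_mom_sharp_J (good_kappa heq h) t x
  · rw [diracBracket, dirac_momSpan_left hx hmem, Phi_eq_mom]
    exact filtration_sharp_Phi hκ c _

lemma commuting_bracket (heq : ∀ i : Fin (n / 2), (i : ℕ) < r → κ i = κ₀) {f g : Phase n → ℝ}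
    (hf : f ∈ commutingIntegrals m s κ r) (hg : g ∈ commutingIntegrals m s κ r)
    (hx : x ∈ cotangentSphere n) : diracBracket s κ f g x = 0 := by
  rcases commuting_cases hf with hf | ⟨k, hk, rfl⟩ <;> rcases commuting_cases hg with hg | ⟨l, hl, rfl⟩
  · rcases hg with (rfl | hg) | ⟨c, rfl⟩
    · exact bracket_hamiltonian_eq_zero heq (Or.inl hf) hx
    · obtain rfl : g = J m s κ := hg
      exact bracket_J_eq_zero heq (Or.inl hf) hx
    · rcases hf with (rfl | hf) | ⟨d, rfl⟩
      · rw [diracBracket_antisymm hx,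
          bracket_hamiltonian_eq_zero heq (Phi_mem_integrals c) hx, neg_zero]
      · obtain rfl : f = J m s κ := hf
        rw [diracBracket_antisymm hx, bracket_J_eq_zero heq (Phi_mem_integrals c) hx, neg_zero]
      · rw [diracBracket, Phi_eq_mom, Phi_eq_mom, dirac_mom_left hx, mom_bracket]
        by_cases hdc : d = c
        · subst hdc
          simp only [if_true, mom, map_mul, map_div₀, conj_I, map_ofNat]
          simp
        · simp [hdc]
  · rw [diracBracket_antisymm hx, filtration_bracket heq hl hf hx, neg_zero]
  · exact filtration_bracket heq hk hg hx
  · have hk' := differential_filtration_mem (s := s) (filtration_kappa heq hk) hk x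
    have hl' := differential_filtration_mem (s := s) (filtration_kappa heq hl) hl x
    rcases le_total k l with h | h
    · rw [diracBracket, dirac_momSpan_left hx hk',
        filtration_sharp_filtration h (fun i hi => heq i (by omega)) hx]
    · rw [diracBracket_antisymm hx, diracBracket, dirac_momSpan_left hx hl',
        filtration_sharp_filtration h (fun i hi => heq i (by omega)) hx, neg_zero]

/-- The virial of the first `r` pairs of coordinates. -/
def virial (r : ℕ) (x : Phase n) : ℝ :=
  ∑ i : Fin (n / 2), if (i : ℕ) < r then (conj (zc x i) * pc x i).re else 0

/-- A minor measuring the dependence of the Casimir functions of consecutive filtration steps. -/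
def stepMinor (b : Fin (n / 2)) (x : Phase n) : ℝ :=
  hsq (mask (b + 1) (zc x)) * (conj (zc x b) * pc x b).re - virial (b + 1) x * normSq (zc x b)

variable (s κ) in
lemma re_conj_zc_qc (x : Phase n) (i : Fin (n / 2)) :
    (conj (zc x i) * qc s κ x i).re = (conj (zc x i) * pc x i).re := by
  rw [qc_eq]; simp; ring

variable (s κ) in
lemma re_hdot_mask (r : ℕ) (x : Phase n) :
    (hdot (mask r (qc s κ x)) (mask r (zc x))).re = virial r x := by
  rw [hdot, re_sum, virial]
  refine Finset.sum_congr rfl fun i _ => ?_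
  by_cases h : (i : ℕ) < r
  · rw [mask_of_lt h, mask_of_lt h, if_pos h, ← re_conj_zc_qc s κ]
    simp; ring
  · rw [mask_of_not_lt h, mask_of_not_lt h, if_neg h]; simp

lemma momSpan_fiber {β : Module.Dual ℝ (Phase n)} (b : Fin (n / 2)) (y : ℂ) :
    β (ofCoord s κ 0 (Pi.single b y) 0 0) = (conj y * zc (sharp s κ β) b).re := by
  rw [← twistedForm_sharp s κ, twistedForm_eq, Finset.sum_eq_single b]
  · simp
  · intro l _ hl; simp [hl]
  · simp

lemma casimir_fiber (b : Fin (n / 2)) (k : ℕ) (h : k ≤ b) (y : ℂ) :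
    casimirCovector s κ k x (ofCoord s κ 0 (Pi.single b y) 0 0) = 0 := by
  rw [momSpan_fiber, zc_casimir, mask_of_not_lt (by omega), mask_of_not_lt (by omega)]; simp

lemma casimir_fiber_self (b : Fin (n / 2)) :
    casimirCovector s κ (b + 1) x (ofCoord s κ 0 (Pi.single b (zc x b)) 0 0) = stepMinor b x := by
  rw [momSpan_fiber, zc_casimir, mask_of_lt (by omega), mask_of_lt (by omega), stepMinor,
    ← re_hdot_mask s κ, ← re_conj_zc_qc s κ]
  simp [normSq_apply]; ring

lemma Phi_fiber (c b : Fin (n / 2)) (y : ℂ) :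
    differential (Phi s κ c) x (ofCoord s κ 0 (Pi.single b y) 0 0)
      = if b = c then (conj y * (I * zc x b)).re else 0 := by
  rw [momSpan_fiber, Phi_eq_mom, zc_sharp_mom, rotCoord]
  split_ifs with h
  · subst h
    congr 2
    rw [map_div₀, conj_I, map_ofNat]; ring
  · simp

/-- The relation is tested first on vectors that isolate the constraints and H. On the remaining
combination of the dΦ and the Casimir covectors, variations of a single momentum coordinate give a
triangular system. The number e records whether H is counted. -/
lemma commuting_card_le (heq : ∀ i : Fin (n / 2), (i : ℕ) < r → κ i = κ₀) (hr : r ≤ n / 2)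
    (hx : x ∈ cotangentSphere n) (hm : m ≠ 0) (e : ℕ) (he : e ≤ 1)
    (hθ : e = 0 ∨ virial r x ≠ 0)
    (hz : ∀ i, zc x i ≠ 0) (hg : ∀ b : Fin (n / 2), 0 < (b : ℕ) → stepMinor b x ≠ 0) :
    n / 2 + (r - 1) + e ≤ ddimAt (commutingIntegrals m s κ r) x := by
  have hPhi : ∀ i, differential (Phi s κ i) x ∈ codiff (commutingIntegrals m s κ r) x := fun i =>
    Submodule.subset_span ⟨_, Or.inl (Or.inr ⟨i, rfl⟩), rfl⟩
  have hcas : ∀ j : Fin (r - 1),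
      casimirCovector s κ (j + 2) x ∈ codiff (commutingIntegrals m s κ r) x := by
    intro j
    have hj : (j : ℕ) + 2 ≤ r := by omega
    have h := casimirCovector_eq (s := s) (x := x) (filtration_kappa heq hj)
    have h1 : casimirCovector s κ (j + 2) x
        = (1 / 2 : ℝ) • ((2 : ℝ) • casimirCovector s κ (j + 2) x) := by module
    rw [h1, h]
    refine Submodule.smul_mem _ _ (Submodule.add_mem _
      (Submodule.subset_span ⟨_, Or.inr ⟨_, by omega, hj, rfl⟩, rfl⟩)
      (Submodule.sum_mem _ fun c _ => ?_))
    split_ifs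
    · have h2 : mom s κ (momMat s κ x c c) c c = (2 * (momMat s κ x c c).im) • Phi s κ c := by
        funext y; rw [mom_self]; rfl
      rw [h2, differential, fderiv_const_smul (by
        rw [Phi_eq_mom]; exact (contDiff_mom (k := 1) s κ _ c c).differentiable (by simp) x)]
      exact Submodule.smul_mem _ _ (hPhi c)
    · exact Submodule.zero_mem _
  set β : Fin (n / 2) ⊕ Fin (r - 1) ⊕ Fin e → Module.Dual ℝ (Phase n) :=
    Sum.elim (fun i => differential (Phi s κ i) x)
      (Sum.elim (fun j => casimirCovector s κ (j + 2) x)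
        (fun _ => differential (hamiltonian m) x)) with hβ
  have hcard : Fintype.card (Fin (n / 2) ⊕ Fin (r - 1) ⊕ Fin e) = n / 2 + (r - 1) + e := by
    simp; ring
  rw [← hcard]
  refine card_le_ddimAt β ?_ ?_
  · rintro (i | j | k)
    · exact hPhi i
    · exact hcas j
    · exact Submodule.subset_span ⟨_, Or.inl (Or.inl (Or.inl rfl)), rfl⟩
  intro c a b hc
  simp only [Fintype.sum_sum_type, hβ, Sum.elim_inl, Sum.elim_inr] at hc
  set M : Module.Dual ℝ (Phase n) := ∑ i, c (Sum.inl i) • differential (Phi s κ i) x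
    + ∑ j, c (Sum.inr (Sum.inl j)) • casimirCovector s κ (j + 2) x with hM
  rw [← add_assoc, ← hM, ← Finset.sum_smul] at hc
  set d : ℝ := ∑ k : Fin e, c (Sum.inr (Sum.inr k)) with hd
  have hMmem : M ∈ momSpan s κ r x := by
    refine Submodule.add_mem _ (Submodule.sum_mem _ fun i _ => Submodule.smul_mem _ _ ?_)
      (Submodule.sum_mem _ fun j _ => Submodule.smul_mem _ _ ?_)
    · rw [Phi_eq_mom]; exact mom_mem_momSpan _ (Or.inr rfl)
    · refine Submodule.span_mono ?_ (casimirCovector_mem (r := j + 2))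
      rintro _ ⟨t, a, b, hab, rfl⟩
      exact ⟨t, a, b, hab.imp (fun h => by omega) id, rfl⟩
  -- The Hamiltonian vector of φ₁ annihilates the momentum functions, H and φ₁, but not φ₂.
  have hb : b = 0 := by
    have h := LinearMap.congr_fun hc (sharp s κ (differential phi1 x))
    have h2 : x.2 ⬝ᵥ x.1 = 0 := hx.2
    have h3 : differential (hamiltonian m) x (sharp s κ (differential phi1 x)) = 0 := by
      rw [sharp_phi1, differential_hamiltonian]; simp [h2]
    simp only [LinearMap.add_apply, LinearMap.smul_apply, smul_eq_mul, h3, apply_sharp_self,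
      phi2_sharp_phi1 hx, momSpan_apply hMmem fun t a b _ => differential_mom_sharp_phi1 t x,
      LinearMap.zero_apply] at h
    linarith
  have hd0 : d = 0 := by
    rcases hθ with rfl | hθ
    · simp [hd]
    -- Adding multiples of z to q inside the block fixes the momentum matrix and the positions,
    -- while H changes at a rate proportional to the virial of the block.
    have h := LinearMap.congr_fun hc (ofCoord s κ 0 (mask r (zc x)) 0 0)
    have h1 : M (ofCoord s κ 0 (mask r (zc x)) 0 0) = 0 := by
      refine momSpan_apply hMmem fun t a b hab => ?_
      rw [differential_mom]
      by_cases ha : (a : ℕ) < r ∧ (b : ℕ) < r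
      · rw [momPolar_gauge 0 0 1, mul_zero, zero_re] <;> simp [mask_of_lt ha.1, mask_of_lt ha.2]
      · obtain rfl := hab.resolve_left ha
        have ha' : ¬ (a : ℕ) < r := by tauto
        rw [momPolar_gauge 0 0 0, mul_zero, zero_re] <;> simp [mask_of_not_lt ha']
    have h2 : differential (hamiltonian m) x (ofCoord s κ 0 (mask r (zc x)) 0 0)
        = virial r x / m := by
      rw [differential_hamiltonian_coord, wp_ofCoord_zero, mul_zero, add_zero, virial]
      congr 1
      refine Finset.sum_congr rfl fun i _ => ?_
      rw [pc_ofCoord, mask]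
      split_ifs
      · simp; ring
      · simp
    have h3 : differential phi1 x (ofCoord s κ 0 (mask r (zc x)) 0 0) = 0 := by
      rw [differential_phi1_coord]; simp
    simp only [LinearMap.add_apply, LinearMap.smul_apply, smul_eq_mul, h1, h2, h3, hb,
      LinearMap.zero_apply] at h
    have h4 : d * (virial r x / m) = 0 := by linarith
    exact (mul_eq_zero.1 h4).resolve_right (div_ne_zero hθ hm)
  have ha : a = 0 := by
    have h := LinearMap.congr_fun hc (sharp s κ (differential phi2 x))
    simp only [LinearMap.add_apply, LinearMap.smul_apply, smul_eq_mul, hb, hd0, 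
      phi1_sharp_phi2 hx, momSpan_apply hMmem fun t a b _ => differential_mom_sharp_phi2 t x,
      LinearMap.zero_apply] at h
    linarith
  have hM0 : M = 0 := by simpa [ha, hb, hd0] using hc
  have hval : ∀ (b : Fin (n / 2)) (y : ℂ), c (Sum.inl b) * (conj y * (I * zc x b)).re
      + ∑ j, c (Sum.inr (Sum.inl j))
        * casimirCovector s κ (j + 2) x (ofCoord s κ 0 (Pi.single b y) 0 0) = 0 := by
    intro b y
    have h := LinearMap.congr_fun hM0 (ofCoord s κ 0 (Pi.single b y) 0 0)
    simpa [hM, LinearMap.add_apply, LinearMap.sum_apply, Phi_fiber] using h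
  -- Descending induction on j. The covector number j belongs to the first j + 2 pairs, the last of
  -- which has index j + 1. In the direction z of that momentum coordinate the dΦ vanish, as do the
  -- Casimir covectors of fewer pairs, and the coefficients of those of more pairs are already known
  -- to be zero. The remaining factor is `stepMinor`.
  have hstep : ∀ N : ℕ, ∀ j : Fin (r - 1), r - 1 - (j : ℕ) ≤ N → c (Sum.inr (Sum.inl j)) = 0 := by
    intro N
    induction N with
    | zero => intro j hj; omega
    | succ N ih =>
      intro j hj
      have hjb : (j : ℕ) + 1 < n / 2 := by omega
      have h := hval ⟨j + 1, hjb⟩ (zc x ⟨j + 1, hjb⟩)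
      rw [Finset.sum_eq_single j] at h
      · have h1 := casimir_fiber_self (s := s) (κ := κ) (x := x) ⟨j + 1, hjb⟩
        have h2 : (conj (zc x ⟨j + 1, hjb⟩) * (I * zc x ⟨j + 1, hjb⟩)).re = 0 := by
          simp; ring
        simp only at h1
        rw [h2, mul_zero, zero_add, h1] at h
        exact (mul_eq_zero.1 h).resolve_right (hg _ (Nat.succ_pos _))
      · intro l _ hl
        rcases lt_or_gt_of_ne (fun h => hl (Fin.ext h) : (l : ℕ) ≠ j) with h | h
        · rw [casimir_fiber _ _ (by simp only; omega), mul_zero]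
        · rw [ih l (by omega), zero_mul]
      · simp
  have hcas0 : ∀ j, c (Sum.inr (Sum.inl j)) = 0 := fun j => hstep _ j le_rfl
  funext j
  rcases j with i | j | k
  · have h := hval i (I * zc x i)
    simp only [hcas0, zero_mul, Finset.sum_const_zero, add_zero] at h
    have h2 : (conj (I * zc x i) * (I * zc x i)).re = normSq (zc x i) := by
      simp [normSq_apply]
    rw [h2] at h
    exact (mul_eq_zero.1 h).resolve_right (normSq_pos.2 (hz i)).ne'
  · exact hcas0 j
  · obtain rfl : e = 1 := by have := k.isLt; omega
    rw [hd, Fin.sum_univ_one] at hd0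
    rw [Subsingleton.elim k 0]; exact hd0

end Commuting

/-! ### Generic points -/

/-- The phase point with two nonzero pairs of coordinates. -/
def twoPoint (i j : Fin (n / 2)) (a b c d : ℂ) (w π : ℝ) : Phase n :=
  ofCoord 0 0 (fun l => if l = i then a else if l = j then b else 0)
    (fun l => if l = i then c else if l = j then d else 0) w π

section TwoPoint
variable {i j : Fin (n / 2)} {a b c d : ℂ} {w π : ℝ}

@[simp] lemma zc_twoPoint (l) : zc (twoPoint i j a b c d w π) l
    = if l = i then a else if l = j then b else 0 := by rw [twoPoint, zc_ofCoord]
@[simp] lemma pc_twoPoint (l) : pc (twoPoint i j a b c d w π) l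
    = if l = i then c else if l = j then d else 0 := by rw [twoPoint, pc_ofCoord]; simp

lemma sum_twoPoint (hij : i ≠ j) {M : Type*} [AddCommMonoid M] (f : Fin (n / 2) → M)
    (h : ∀ l, l ≠ i → l ≠ j → f l = 0) : ∑ l, f l = f i + f j :=
  Finset.sum_eq_add i j hij (fun l _ hl => h l hl.1 hl.2) (by simp) (by simp)

lemma twoPoint_mem (hij : i ≠ j) (h1 : normSq a + normSq b = 1)
    (h2 : (conj a * c).re + (conj b * d).re = 0) :
    twoPoint i j a b c d 0 0 ∈ cotangentSphere n := by
  constructor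
  · rw [phi1_eq, sum_twoPoint hij]
    · rw [← h1]; simp [hij.symm, twoPoint, normSq_apply]
    · intro l h h'; simp [h, h']
  · rw [phi2_eq 0 0, sum_twoPoint hij]
    · rw [re_conj_zc_qc, re_conj_zc_qc]
      simp only [zc_twoPoint, pc_twoPoint, if_pos, hij.symm, if_false]
      rw [h2, twoPoint, wc_ofCoord_zero]; ring
    · intro l h h'; simp [h, h']

lemma onePoint_mem (hn : n % 2 = 1) (h1 : normSq a + w ^ 2 = 1)
    (h2 : (conj a * c).re + w * π = 0) :
    twoPoint i i a a c c w π ∈ cotangentSphere n := by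
  constructor
  · rw [phi1_eq, Finset.sum_eq_single i]
    · rw [← h1]; simp [twoPoint, normSq_apply, wc_ofCoord hn]; ring
    · intro l _ h; simp [h]
    · simp
  · rw [phi2_eq 0 0, Finset.sum_eq_single i]
    · rw [re_conj_zc_qc, ← h2]
      simp [twoPoint, wc_ofCoord hn, wp_ofCoord hn]
    · intro l _ h; simp [h]
    · simp

lemma basePoint_mem : twoPoint i i 1 1 0 0 0 0 ∈ cotangentSphere n := by
  constructor
  · rw [phi1_eq, Finset.sum_eq_single i]
    · simp [twoPoint]
    · intro l _ h; simp [h]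
    · simp
  · rw [phi2_eq 0 0, Finset.sum_eq_single i]
    · rw [re_conj_zc_qc]; simp [twoPoint]
    · intro l _ h; simp [h]
    · simp

end TwoPoint

lemma contDiff_normSq {d : WithTop ℕ∞} {f : Phase n → ℂ} (hf : ContDiff ℝ d f) :
    ContDiff ℝ d fun x => normSq (f x) := by
  simp only [normSq_apply]
  have h1 := contDiff_re hf
  have h2 := contDiff_im hf
  exact (h1.mul h1).add (h2.mul h2)

lemma holdsGenerically_zc (i : Fin (n / 2)) : HoldsGenerically fun x : Phase n => zc x i ≠ 0 := by
  refine (holdsGenerically_ne_zero (g := fun x => normSq (zc x i))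
    (contDiff_normSq (contDiff_zc i)) (fun x => by simp) (basePoint_mem (i := i)) (by simp)).mono
    fun x _ h h0 => h (by simp [h0])

lemma contDiff_pc {d : WithTop ℕ∞} (i : Fin (n / 2)) :
    ContDiff ℝ d (fun x : Phase n => pc x i) :=
  contDiff_pi.1 (LinearMap.toContinuousLinearMap (pc (n := n))).contDiff i

lemma contDiff_re_conj_mul {d : WithTop ℕ∞} {f g : Phase n → ℂ} (hf : ContDiff ℝ d f)
    (hg : ContDiff ℝ d g) : ContDiff ℝ d fun x => (conj (f x) * g x).re :=
  contDiff_re ((contDiff_conj hf).mul hg)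

lemma contDiff_mask {d : WithTop ℕ∞} {f : Phase n → Fin (n / 2) → ℂ}
    (hf : ∀ i, ContDiff ℝ d fun x => f x i) (r : ℕ) (i : Fin (n / 2)) :
    ContDiff ℝ d fun x => mask r (f x) i := by
  unfold mask
  split_ifs
  · exact hf i
  · exact contDiff_const

lemma contDiff_hsq {d : WithTop ℕ∞} {f : Phase n → Fin (n / 2) → ℂ}
    (hf : ∀ i, ContDiff ℝ d fun x => f x i) : ContDiff ℝ d fun x => hsq (f x) :=
  ContDiff.sum fun i _ => contDiff_normSq (hf i)

lemma contDiff_hdot {d : WithTop ℕ∞} {f g : Phase n → Fin (n / 2) → ℂ}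
    (hf : ∀ i, ContDiff ℝ d fun x => f x i) (hg : ∀ i, ContDiff ℝ d fun x => g x i) :
    ContDiff ℝ d fun x => hdot (f x) (g x) :=
  ContDiff.sum fun i _ => (contDiff_conj (hf i)).mul (hg i)

lemma contDiff_virial {d : WithTop ℕ∞} (r : ℕ) : ContDiff ℝ d (virial (n := n) r) := by
  refine ContDiff.sum fun i _ => ?_
  split_ifs
  · exact contDiff_re_conj_mul (contDiff_zc i) (contDiff_pc i)
  · exact contDiff_const

lemma virial_neg (r : ℕ) (x : Phase n) : virial r (-x) = virial r x := by
  simp [virial]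

lemma hsq_neg {ι : Type*} [Fintype ι] (u : ι → ℂ) : hsq (-u) = hsq u := by simp [hsq]

lemma mask_neg (r : ℕ) (z : Fin (n / 2) → ℂ) : mask r (-z) = -mask r z := by
  funext i; simp only [mask, Pi.neg_apply]; split_ifs <;> simp

lemma holdsGenerically_stepMinor (b : Fin (n / 2)) :
    HoldsGenerically fun x : Phase n => 0 < (b : ℕ) → stepMinor b x ≠ 0 := by
  by_cases hb : 0 < (b : ℕ)
  swap
  · exact ⟨Set.univ, isOpen_univ, by simpa using subset_closure, fun x _ h => absurd h hb⟩
  set i : Fin (n / 2) := ⟨0, by omega⟩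
  have hib : i ≠ b := fun h => by rw [← h] at hb; exact absurd hb (lt_irrefl 0)
  -- Pythagorean values satisfy both constraints with opposite virials -12/5 and 12/5 of the two
  -- pairs. The total virial is zero, so the minor equals the virial of the pair b.
  refine (holdsGenerically_ne_zero (g := stepMinor b) ?_ ?_
    (twoPoint_mem (i := i) (j := b) (a := 3 / 5) (b := 4 / 5) (c := -4) (d := 3) hib
      (by norm_num [normSq_apply]) (by simp only [mul_re, conj_re, conj_im]; norm_num)) ?_).mono
    fun x _ h _ => h
  · exact ((contDiff_hsq (contDiff_mask contDiff_zc _)).mul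
      (contDiff_re_conj_mul (contDiff_zc b) (contDiff_pc b))).sub
      ((contDiff_virial _).mul (contDiff_normSq (contDiff_zc b)))
  · intro x
    simp only [stepMinor, map_neg, mask_neg, hsq_neg, virial_neg, Pi.neg_apply]
    simp
  · have hi0 : (i : ℕ) < b + 1 := by simp [i]
    rw [stepMinor, hsq, sum_twoPoint hib, virial, sum_twoPoint hib]
    · rw [mask_of_lt hi0, mask_of_lt (Nat.lt_succ_self _), if_pos hi0,
        if_pos (Nat.lt_succ_self _)]
      simp only [zc_twoPoint, pc_twoPoint, if_pos, hib.symm, if_false, mul_re, conj_re, conj_im]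
      norm_num [normSq_apply]
    · intro l h h'; simp [h, h']
    · intro l h h'; rw [mask]; simp [h, h']

lemma holdsGenerically_virial_odd {r : ℕ} (hr : 1 ≤ r) (hn : n = 2 * r + 1) :
    HoldsGenerically fun x : Phase n => virial r x ≠ 0 := by
  set i : Fin (n / 2) := ⟨0, by omega⟩ with hi
  refine holdsGenerically_ne_zero (contDiff_virial r) (virial_neg r)
    (onePoint_mem (i := i) (a := 3 / 5) (c := -4) (w := 4 / 5) (π := 3) (by omega)
      (by norm_num [normSq_apply]) (by simp only [mul_re, conj_re, conj_im]; norm_num)) ?_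
  have hi0 : (i : ℕ) < r := by simp only [hi]; omega
  rw [virial, Finset.sum_eq_single i]
  · rw [if_pos hi0, mul_re, conj_re, conj_im]; norm_num
  · intro l _ h; simp [h]
  · simp

lemma holdsGenerically_virial_last {r : ℕ} (hr : 1 ≤ r) (hn : n = 2 * r + 2) :
    HoldsGenerically fun x : Phase n => virial r x ≠ 0 := by
  set i : Fin (n / 2) := ⟨0, by omega⟩ with hi
  set j : Fin (n / 2) := ⟨r, by omega⟩ with hj
  have hij : i ≠ j := fun h => by rw [hi, hj, Fin.mk.injEq] at h; omega
  refine holdsGenerically_ne_zero (contDiff_virial r) (virial_neg r)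
    (twoPoint_mem (i := i) (j := j) (a := 3 / 5) (b := 4 / 5) (c := -4) (d := 3) hij
      (by norm_num [normSq_apply]) (by simp only [mul_re, conj_re, conj_im]; norm_num)) ?_
  have hi0 : (i : ℕ) < r := by simp only [hi]; omega
  rw [virial, sum_twoPoint hij]
  · rw [if_pos hi0, if_neg (by simp [hj]), mul_re, conj_re, conj_im]; norm_num
  · intro l h h'; simp [h, h']

/-- Involution bounds the number of independent integrals by n - 1. The Φ and the Casimir functions
already give n / 2 + r - 1, which is n - 1 if n = 2 r; in the other two cases H supplies the missing
one. -/
theorem liouville_integrable {m s : ℝ} {κ : Fin (n / 2) → ℝ} {r : ℕ} {κ₀ : ℝ} (hm : m ≠ 0)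
    (hr : 1 ≤ r) (heq : ∀ i : Fin (n / 2), (i : ℕ) < r → κ i = κ₀)
    (hn : n = 2 * r ∨ n = 2 * r + 1 ∨ n = 2 * r + 2) :
    IsLiouvilleIntegrable m s κ (commutingIntegrals m s κ r) where
  smooth f hf := contDiff_commuting heq hf
  firstIntegral f hf := isFirstIntegral_commuting heq hf
  commute f hf g hg x hx := commuting_bracket heq hf hg hx
  independent := by
    have hgen := (HoldsGenerically.forall holdsGenerically_zc).and
      (HoldsGenerically.forall (holdsGenerically_stepMinor (n := n)))
    have hle : ∀ x ∈ cotangentSphere n, ddimAt (commutingIntegrals m s κ r) x ≤ n - 1 :=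
      fun x hx => ddimAt_le_of_commute (s := s) (κ := κ) hx
        fun f hf g hg => commuting_bracket heq hf hg hx
    have hv : HoldsGenerically fun x : Phase n => n = 2 * r ∨ virial r x ≠ 0 := by
      rcases hn with hn | hn | hn
      · exact ⟨Set.univ, isOpen_univ, by simpa using subset_closure, fun x _ => Or.inl hn⟩
      · exact (holdsGenerically_virial_odd hr hn).mono fun x _ h => Or.inr h
      · exact (holdsGenerically_virial_last hr hn).mono fun x _ h => Or.inr h
    refine (hgen.and hv).mono fun x hx ⟨⟨hz, hg⟩, hv⟩ => ?_
    refine le_antisymm (hle x hx) ?_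
    by_cases h0 : n = 2 * r
    · have := commuting_card_le (m := m) (s := s) heq (by omega) hx hm 0 (by omega) (Or.inl rfl)
        hz hg
      omega
    · have := commuting_card_le (m := m) (s := s) heq (by omega) hx hm 1 le_rfl
        (Or.inr (hv.resolve_left h0)) hz hg
      omega

/-! ### Completeness of the algebra of integrals -/

section Complete
variable {m s : ℝ} {κ : Fin (n / 2) → ℝ} {r : ℕ} {κ₀ : ℝ}

variable (s κ) in
lemma contDiff_hgram_mask {d : WithTop ℕ∞} (r : ℕ) :
    ContDiff ℝ d fun x : Phase n => hgram (mask r (zc x)) (mask r (qc s κ x)) :=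
  ((contDiff_hsq (contDiff_mask contDiff_zc r)).mul
    (contDiff_hsq (contDiff_mask (contDiff_qc s κ) r))).sub
    (contDiff_normSq (contDiff_hdot (contDiff_mask contDiff_zc r)
      (contDiff_mask (contDiff_qc s κ) r)))

lemma qc_twoPoint {i j : Fin (n / 2)} {a b c d : ℂ} {w π : ℝ} (l) :
    qc s κ (twoPoint i j a b c d w π) l = (if l = i then c else if l = j then d else 0)
      + I * (s * κ l / 2 : ℝ) * (if l = i then a else if l = j then b else 0) := by
  rw [qc_eq, zc_twoPoint, pc_twoPoint]

variable (s κ) in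
-- At least two pairs are needed, since vectors with a single complex coordinate are always
-- dependent. The test point has position in the first pair and kinetic momentum in the second, so
-- the gauge shift of q is parallel to z and does not affect the Gram determinant.
lemma holdsGenerically_hgram (hr : 2 ≤ r) (hn : r ≤ n / 2) :
    HoldsGenerically fun x : Phase n => hgram (mask r (zc x)) (mask r (qc s κ x)) ≠ 0 := by
  set i : Fin (n / 2) := ⟨0, by omega⟩ with hi
  set j : Fin (n / 2) := ⟨1, by omega⟩ with hj
  have hij : i ≠ j := fun h => by rw [hi, hj, Fin.mk.injEq] at h; omega
  refine holdsGenerically_ne_zero (contDiff_hgram_mask s κ r) (fun x => ?_)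
    (twoPoint_mem (i := i) (j := j) (a := 1) (b := 0) (c := 0) (d := 1) hij
      (by norm_num) (by norm_num)) ?_
  · simp only [map_neg, mask_neg, hgram, hsq_neg, hdot_neg_left, hdot_neg_right, neg_neg]
  · have hi0 : (i : ℕ) < r := by simp only [hi]; omega
    have hj0 : (j : ℕ) < r := by simp only [hj]; omega
    rw [hgram, hsq, hsq, hdot, sum_twoPoint hij, sum_twoPoint hij, sum_twoPoint hij]
    · simp only [mask_of_lt hi0, mask_of_lt hj0, qc_twoPoint, zc_twoPoint, if_true, hij.symm,
        if_false]
      simp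
    all_goals
      intro l h h'
      by_cases hl : (l : ℕ) < r
      · simp [mask_of_lt hl, qc_twoPoint, h, h']
      · simp [mask_of_not_lt hl]

lemma holdsGenerically_wp (hn : n % 2 = 1) (h1 : 0 < n / 2) :
    HoldsGenerically fun x : Phase n => wp x ≠ 0 := by
  refine (holdsGenerically_ne_zero (g := fun x => wp x ^ 2) (contDiff_wp.pow 2)
    (fun x => by simp)
    (onePoint_mem (i := ⟨0, h1⟩) (a := 1) (c := 0) (w := 0) (π := 1) hn (by norm_num)
      (by norm_num)) ?_).mono fun x _ h h0 => h (by simp [h0])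
  simp [twoPoint, wp_ofCoord hn]

variable (s κ) in
lemma holdsGenerically_radial {i j : Fin (n / 2)} (hij : i ≠ j) :
    HoldsGenerically fun x : Phase n => (conj (zc x j) * qc s κ x j).re ≠ 0 := by
  simp only [re_conj_zc_qc]
  refine holdsGenerically_ne_zero (contDiff_re_conj_mul (contDiff_zc j) (contDiff_pc j))
    (fun x => by simp) (twoPoint_mem (i := i) (j := j) (a := 3 / 5) (b := 4 / 5) (c := -4) (d := 3)
      hij (by norm_num [normSq_apply]) (by simp only [mul_re, conj_re, conj_im]; norm_num)) ?_
  simp only [zc_twoPoint, pc_twoPoint, if_true, hij.symm, if_false, mul_re, conj_re, conj_im]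
  norm_num

lemma complete_of_levelTangent (heq : ∀ i : Fin (n / 2), (i : ℕ) < r → κ i = κ₀) {x : Phase n}
    (hx : x ∈ cotangentSphere n) {k : ℕ}
    (h : Module.finrank ℝ (levelTangent (integrals m s κ r) x) = k ∧
      ∀ v ∈ levelTangent (integrals m s κ r) x, ∀ w ∈ levelTangent (integrals m s κ r) x,
        twistedForm s κ v w = 0) :
    ddimAt (Algebra.adjoin ℝ (integrals m s κ r) : Set (Phase n → ℝ)) x
        + dindAt s κ (Algebra.adjoin ℝ (integrals m s κ r) : Set (Phase n → ℝ)) x = 2 * (n - 1)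
      ∧ dindAt s κ (Algebra.adjoin ℝ (integrals m s κ r) : Set (Phase n → ℝ)) x = k := by
  have hc := codiff_adjoin (S := integrals m s κ r) (fun f hf => contDiff_integrals heq hf) x
  have h1 : dindAt s κ (Algebra.adjoin ℝ (integrals m s κ r) : Set (Phase n → ℝ)) x = k := by
    rw [← h.1, ← dindAt_eq (s := s) (κ := κ) _ hx h.2, dindAt, dindAt, hc]
  refine ⟨?_, h1⟩
  rw [h1, ← h.1, ← ddimAt_add_finrank (integrals m s κ r) hx]
  have h2 : ddimAt (Algebra.adjoin ℝ (integrals m s κ r) : Set (Phase n → ℝ)) x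
      = ddimAt (integrals m s κ r) x := by rw [ddimAt, hc, ddimAt]
  rw [h2]

lemma noncommutativelyIntegrable_of {k : ℕ}
    (heq : ∀ i : Fin (n / 2), (i : ℕ) < r → κ i = κ₀)
    (h : HoldsGenerically fun x => Module.finrank ℝ (levelTangent (integrals m s κ r) x) = k ∧
      ∀ v ∈ levelTangent (integrals m s κ r) x, ∀ w ∈ levelTangent (integrals m s κ r) x,
        twistedForm s κ v w = 0)
    (htori : HoldsGenerically fun x =>
      ∃ (Θ : (Fin k → ℝ) → Phase n) (freq : Fin k → ℝ),
        IsQuasiPeriodicIsotropicTorus m s κ Θ freq ∧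
        Set.range Θ = connectedComponentIn
          {y | y ∈ cotangentSphere n ∧ ∀ f ∈ integrals m s κ r, f y = f x} x) :
    IsNoncommutativelyIntegrable m s κ (integrals m s κ r) k where
  smooth _ hf := contDiff_integrals heq hf
  firstIntegral _ hf := isFirstIntegral_integrals heq hf
  bracket_mem := bracket_mem_integrals heq
  complete := h.mono fun _ hx h => complete_of_levelTangent heq hx h
  tori := htori

lemma frame_even_generic (heq : ∀ i : Fin (n / 2), (i : ℕ) < r → κ i = κ₀) (hr : 2 ≤ r)
    (hn : n = 2 * r) :
    HoldsGenerically fun x => Module.finrank ℝ (levelTangent (integrals m s κ r) x) = 2 ∧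
      ∀ v ∈ levelTangent (integrals m s κ r) x, ∀ w ∈ levelTangent (integrals m s κ r) x,
        twistedForm s κ v w = 0 :=
  (holdsGenerically_hgram s κ hr (by omega)).mono fun x hx h =>
    frame_even heq (fun i => by omega) (by omega) hx h

lemma frame_odd_generic (hm : m ≠ 0) (heq : ∀ i : Fin (n / 2), (i : ℕ) < r → κ i = κ₀)
    (hr : 2 ≤ r) (hn : n = 2 * r + 1) :
    HoldsGenerically fun x => Module.finrank ℝ (levelTangent (integrals m s κ r) x) = 3 ∧
      ∀ v ∈ levelTangent (integrals m s κ r) x, ∀ w ∈ levelTangent (integrals m s κ r) x,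
        twistedForm s κ v w = 0 :=
  ((holdsGenerically_hgram s κ hr (by omega)).and
    (holdsGenerically_wp (by omega) (by omega))).mono fun x hx h =>
    frame_odd hm heq (fun i => by omega) hx h.1 h.2

lemma frame_last_generic (hm : m ≠ 0) (heq : ∀ i : Fin (n / 2), (i : ℕ) < r → κ i = κ₀)
    (hr : 2 ≤ r) (hn : n = 2 * r + 2) :
    HoldsGenerically fun x => Module.finrank ℝ (levelTangent (integrals m s κ r) x) = 4 ∧
      ∀ v ∈ levelTangent (integrals m s κ r) x, ∀ w ∈ levelTangent (integrals m s κ r) x,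
        twistedForm s κ v w = 0 := by
  have hij : (⟨0, by omega⟩ : Fin (n / 2)) ≠ ⟨r, by omega⟩ := fun h => by
    rw [Fin.mk.injEq] at h; omega
  refine ((holdsGenerically_hgram s κ hr (by omega)).and
    (holdsGenerically_radial s κ hij)).mono fun x hx h =>
    frame_last hm heq (L := ⟨r, by omega⟩) rfl (fun i => ?_) (by omega) hx h.1 h.2
  by_cases hi : (i : ℕ) < r
  · exact Or.inl hi
  · exact Or.inr (Fin.ext (by simp only; omega))

end Complete

/-! ### Periodic solutions of one-dimensional systems -/

section Oval
open Polynomial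

lemma contDiff_primitive {G : ℝ → ℝ} (hG : ContDiff ℝ ∞ G) :
    ContDiff ℝ ∞ fun t => ∫ u in (0 : ℝ)..t, G u := by
  have h : ∀ t, HasDerivAt (fun t => ∫ u in (0 : ℝ)..t, G u) (G t) t := fun t =>
    hG.continuous.integral_hasStrictDerivAt 0 t |>.hasDerivAt
  rw [contDiff_infty_iff_deriv]
  refine ⟨fun t => (h t).differentiableAt, ?_⟩
  rwa [show deriv (fun t => ∫ u in (0 : ℝ)..t, G u) = G from funext fun t => (h t).deriv]

lemma primitive_add_period {G : ℝ → ℝ} (hG : Continuous G) {p : ℝ} (hp : ∀ t, G (t + p) = G t)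
    (t : ℝ) : ∫ u in (0 : ℝ)..(t + p), G u = (∫ u in (0 : ℝ)..t, G u) + ∫ u in (0 : ℝ)..p, G u := by
  have h := Function.Periodic.intervalIntegral_add_eq (f := G) (T := p) hp t 0
  rw [zero_add] at h
  rw [← h, intervalIntegral.integral_add_adjacent_intervals (hG.intervalIntegrable _ _)
    (hG.intervalIntegrable _ _)]

/-- Subtracting the mean M makes the primitive periodic. Applied to the rates of the phases, this
separates uniform rotation from a periodic correction. -/
lemma exists_periodic_primitive {G : ℝ → ℝ} (hG : ContDiff ℝ ∞ G) (hp : ∀ t, G (t + 1) = G t) :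
    ∃ (σ : ℝ → ℝ) (M : ℝ), ContDiff ℝ ∞ σ ∧ (∀ t, σ (t + 1) = σ t) ∧
      ∀ t, HasDerivAt σ (G t - M) t := by
  set M := ∫ u in (0 : ℝ)..1, G u with hM
  refine ⟨fun t => (∫ u in (0 : ℝ)..t, G u) - M * t, M,
    (contDiff_primitive hG).sub (contDiff_const.mul contDiff_id), fun t => ?_, fun t => ?_⟩
  · simp only [primitive_add_period hG.continuous hp t, ← hM]; ring
  · have h1 := (hG.continuous.integral_hasStrictDerivAt 0 t).hasDerivAt
    have h2 := (hasDerivAt_id t).const_mul M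
    rw [mul_one] at h2
    exact h1.sub h2

lemma exists_angle {x y : ℝ} (h : x ^ 2 + y ^ 2 = 1) : ∃ φ : ℝ, Real.cos φ = x ∧ Real.sin φ = y := by
  have h1 : ‖(⟨x, y⟩ : ℂ)‖ = 1 := by
    rw [Complex.norm_def, normSq_mk, ← sq, ← sq, h, Real.sqrt_one]
  have h2 := Complex.norm_mul_cos_arg ⟨x, y⟩
  have h3 := Complex.norm_mul_sin_arg ⟨x, y⟩
  rw [h1, one_mul] at h2 h3
  exact ⟨_, h2, h3⟩

/-- The inverse of the primitive of a positive periodic function. -/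
lemma exists_inverse_primitive {G : ℝ → ℝ} (hG : ContDiff ℝ ∞ G) {p : ℝ} (hp0 : 0 < p)
    (hp : ∀ t, G (t + p) = G t) (hpos : ∀ t, 0 < G t) :
    ∃ (P : ℝ) (ψ : ℝ → ℝ), 0 < P ∧ ContDiff ℝ ∞ ψ ∧ Function.Surjective ψ ∧
      (∀ t, HasDerivAt ψ (G (ψ t))⁻¹ t) ∧
      ∀ (t t' : ℝ) (l : ℤ), ψ t' = ψ t + l * p ↔ t' = t + l * P := by
  set S : ℝ → ℝ := fun t => ∫ u in (0 : ℝ)..t, G u with hS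
  have hSd : ∀ t, HasDerivAt S (G t) t := fun t =>
    (hG.continuous.integral_hasStrictDerivAt 0 t).hasDerivAt
  have hmono : StrictMono S := strictMono_of_hasDerivAt_pos hSd hpos
  have hcont : Continuous S := continuous_iff_continuousAt.2 fun t => (hSd t).continuousAt
  set P := S p with hP
  have hS0 : S 0 = 0 := by simp [hS]
  have hP0 : 0 < P := by rw [← hS0]; exact hmono hp0
  -- The primitive of a periodic function is linear up to a periodic term, so shifts by integer
  -- multiples of p become shifts by multiples of P.
  have hper : Function.Periodic (fun t => S t - P / p * t) p := by
    intro t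
    have h1 : S (t + p) = S t + P := primitive_add_period hG.continuous hp t
    simp only [h1]; field_simp; ring
  have hint : ∀ (t : ℝ) (l : ℤ), S (t + l * p) = S t + l * P := by
    intro t l
    have h1 := hper.int_mul l t
    have h2 : P / p * (t + l * p) = P / p * t + l * P := by field_simp
    simp only [h2] at h1
    linarith
  have hsurj : Function.Surjective S := by
    intro y
    set k := ⌊y / P⌋ with hk
    have h1 : (k : ℝ) * P ≤ y := by
      rw [← le_div_iff₀ hP0]; exact Int.floor_le _
    have h2 : y ≤ (k + 1 : ℝ) * P := by
      rw [← div_le_iff₀ hP0]; exact (Int.lt_floor_add_one _).le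
    have h3 : S (0 + k * p) = k * P := by rw [hint, hS0, zero_add]
    have h4 : S (0 + ((k + 1 : ℤ) : ℝ) * p) = (k + 1 : ℝ) * P := by
      rw [hint, hS0, zero_add]; push_cast; rfl
    obtain ⟨t, -, ht⟩ := intermediate_value_Icc (a := 0 + (k : ℝ) * p)
      (b := 0 + ((k + 1 : ℤ) : ℝ) * p) (by push_cast; nlinarith) hcont.continuousOn
      (show y ∈ Set.Icc _ _ by rw [h3, h4]; exact ⟨h1, h2⟩)
    exact ⟨t, ht⟩
  set e := (hmono.orderIsoOfSurjective S hsurj).toHomeomorph with he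
  have heS : ∀ t, e t = S t := fun t => rfl
  have hSe : ∀ t, S (e.symm t) = t := fun t => e.apply_symm_apply t
  have heS' : ∀ t, e.symm (S t) = t := fun t => e.symm_apply_apply t
  refine ⟨P, e.symm, hP0, e.contDiff_symm_deriv (fun t => (hpos t).ne') hSd
    (contDiff_primitive hG), e.symm.surjective, fun t => ?_, fun t t' l => ?_⟩
  · exact HasDerivAt.of_local_left_inverse e.symm.continuous.continuousAt (hSd _) (hpos _).ne'
      (Filter.Eventually.of_forall hSe)
  · constructor
    · intro h
      rw [← hSe t', h, hint, hSe]
    · rintro rfl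
      rw [← hSe t, ← hint, heS', heS']

/-- A component of the curve `η² = f y` between two simple zeros of the polynomial `f` is
parametrized by a periodic solution of a Hamiltonian system. -/
lemma exists_oval {g : ℝ[X]} {a b α : ℝ} (hab : a < b) (hα : 0 < α)
    (hg : ∀ y ∈ Set.Icc a b, 0 < g.eval y) {f : ℝ[X]} (hf : f = (X - C a) * (C b - X) * g) :
    ∃ (T : ℝ) (y η : ℝ → ℝ), 0 < T ∧ ContDiff ℝ ∞ y ∧ ContDiff ℝ ∞ η ∧
      (∀ t, HasDerivAt y (T * (α * η t)) t) ∧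
      (∀ t, HasDerivAt η (T * (α * (f.derivative.eval (y t) / 2))) t) ∧
      (∀ t, y (t + 1) = y t) ∧ (∀ t, η (t + 1) = η t) ∧ (∀ t, η t ^ 2 = f.eval (y t)) ∧
      (∀ t, y t ∈ Set.Icc a b) ∧
      (∀ t t', y t = y t' → η t = η t' → ∃ l : ℤ, t' = t + l) ∧
      ∀ Y ∈ Set.Icc a b, ∀ E, E ^ 2 = f.eval Y → ∃ t, y t = Y ∧ η t = E := by
  set e := (a + b) / 2 with he
  set d := (b - a) / 2 with hd
  have hd0 : 0 < d := by rw [hd]; linarith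
  -- With y = e - d cos φ the factor (y - a)(b - y) is the square of d sin φ, so η = d sin φ √g is a
  -- smooth branch of √f around the whole curve, including its turning points.
  set Y : ℝ → ℝ := fun φ => e - d * Real.cos φ with hY
  have hYmem : ∀ φ, Y φ ∈ Set.Icc a b := fun φ => by
    have h1 := Real.neg_one_le_cos φ
    have h2 := Real.cos_le_one φ
    constructor <;> simp only [hY, he] <;> nlinarith
  have hgpos : ∀ φ, 0 < g.eval (Y φ) := fun φ => hg _ (hYmem φ)
  have hYs : ContDiff ℝ ∞ Y := contDiff_const.sub (contDiff_const.mul Real.contDiff_cos)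
  have hgc : ContDiff ℝ ∞ fun y => g.eval y := by simpa using g.contDiff_aeval (𝕜 := ℝ) ∞
  have hgs : ContDiff ℝ ∞ fun φ => g.eval (Y φ) := hgc.comp hYs
  have hsq : ContDiff ℝ ∞ fun φ => √(g.eval (Y φ)) := hgs.sqrt fun φ => (hgpos φ).ne'
  have hsq0 : ∀ φ, 0 < √(g.eval (Y φ)) := fun φ => Real.sqrt_pos.2 (hgpos φ)
  have hYd : ∀ φ, HasDerivAt Y (d * Real.sin φ) φ := fun φ => by
    have := ((Real.hasDerivAt_cos φ).const_mul d).const_sub e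
    exact this.congr_deriv (by ring)
  set N : ℝ → ℝ := fun φ => d * Real.sin φ * √(g.eval (Y φ)) with hN
  have hNs : ContDiff ℝ ∞ N := (contDiff_const.mul Real.contDiff_sin).mul hsq
  have hfY : ∀ φ, f.eval (Y φ) = (d * Real.sin φ) ^ 2 * g.eval (Y φ) := fun φ => by
    have h1 := Real.sin_sq_add_cos_sq φ
    simp only [hf, eval_mul, eval_sub, eval_X, eval_C]
    have : (Y φ - a) * (b - Y φ) = (d * Real.sin φ) ^ 2 := by
      simp only [hY, he, hd]; linear_combination (-(b - a) ^ 2 / 4) * h1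
    rw [this]
  have hNd : ∀ φ, HasDerivAt N (f.derivative.eval (Y φ) / 2 / √(g.eval (Y φ))) φ := fun φ => by
    have h1 : HasDerivAt (fun φ => g.eval (Y φ)) (g.derivative.eval (Y φ) * (d * Real.sin φ)) φ :=
      (g.hasDerivAt (Y φ)).comp φ (hYd φ)
    have h2 := h1.sqrt (hgpos φ).ne'
    have h3 := ((Real.hasDerivAt_sin φ).const_mul d).mul h2
    refine h3.congr_deriv ?_
    have h4 : f.derivative.eval (Y φ) = 2 * d * Real.cos φ * g.eval (Y φ)
        + (d * Real.sin φ) ^ 2 * g.derivative.eval (Y φ) := by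
      have h1 := Real.sin_sq_add_cos_sq φ
      rw [hf]
      simp only [derivative_mul, derivative_sub, derivative_X, derivative_C, eval_add, eval_mul,
        eval_sub, eval_X, eval_C, eval_one, eval_zero]
      have : (Y φ - a) * (b - Y φ) = (d * Real.sin φ) ^ 2 := by
        simp only [hY, he, hd]; linear_combination (-(b - a) ^ 2 / 4) * h1
      rw [← this]
      simp only [hY, he, hd]; ring
    have h5 := Real.sq_sqrt (hgpos φ).le
    have h6 := (hsq0 φ).ne'
    rw [h4]
    field_simp
    rw [h5]; ring
  -- The equation y' = α η becomes φ' = α √g. The time is a primitive of the reciprocal, a positive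
  -- periodic function of φ, and its inverse gives φ as a function of time; afterwards time is
  -- rescaled to period 1.
  obtain ⟨P, ψ, hP, hψs, hψsurj, hψd, hψp⟩ := exists_inverse_primitive
    (G := fun φ => (α * √(g.eval (Y φ)))⁻¹)
    ((contDiff_const.mul hsq).inv fun φ => (mul_pos hα (hsq0 φ)).ne') Real.two_pi_pos
    (fun φ => by simp [hY]) (fun φ => inv_pos.2 (mul_pos hα (hsq0 φ)))
  simp only [inv_inv] at hψd
  have hlin : ContDiff ℝ ∞ fun t : ℝ => ψ (P * t) := hψs.comp (contDiff_const.mul contDiff_id)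
  have hlind : ∀ t : ℝ, HasDerivAt (fun t : ℝ => ψ (P * t))
      (P * (α * √(g.eval (Y (ψ (P * t)))))) t := fun t => by
    have h1 := (hasDerivAt_id t).const_mul P
    rw [mul_one] at h1
    have := (hψd (P * t)).comp t h1
    refine this.congr_deriv ?_
    ring
  have hshift : ∀ t : ℝ, ψ (P * (t + 1)) = ψ (P * t) + 2 * Real.pi := fun t => by
    have := (hψp (P * t) (P * (t + 1)) 1).2 (by push_cast; ring)
    rw [this]; push_cast; ring
  refine ⟨P, fun t => Y (ψ (P * t)), fun t => N (ψ (P * t)), hP, hYs.comp hlin, hNs.comp hlin,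
    fun t => ?_, fun t => ?_, fun t => ?_, fun t => ?_, fun t => ?_, fun t => hYmem _,
    fun t t' h1 h2 => ?_, fun y hy E hE => ?_⟩
  · refine ((hYd _).comp t (hlind t)).congr_deriv ?_
    simp only [hN]; ring
  · refine ((hNd _).comp t (hlind t)).congr_deriv ?_
    have h6 := (hsq0 (ψ (P * t))).ne'
    field_simp
  · simp only [hshift, hY, Real.cos_add_two_pi]
  · simp only [hshift, hN, hY, Real.cos_add_two_pi, Real.sin_add_two_pi]
  · rw [hfY]
    simp only [hN]
    rw [mul_pow, Real.sq_sqrt (hgpos _).le]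
  · have hc : Real.cos (ψ (P * t)) = Real.cos (ψ (P * t')) := by
      simp only [hY] at h1
      exact mul_left_cancel₀ hd0.ne' (by linarith)
    have hs : Real.sin (ψ (P * t)) = Real.sin (ψ (P * t')) := by
      simp only [hN] at h1 h2
      rw [h1] at h2
      exact mul_left_cancel₀ hd0.ne' (mul_right_cancel₀ (hsq0 _).ne' h2)
    obtain ⟨l, hl⟩ := Real.Angle.angle_eq_iff_two_pi_dvd_sub.1
      (Real.Angle.cos_sin_inj hc.symm hs.symm)
    have h3 := (hψp (P * t) (P * t') l).1 (by linarith)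
    exact ⟨l, mul_left_cancel₀ hP.ne' (by linarith)⟩
  · have hgy := hg y hy
    have hsy := Real.sqrt_pos.2 hgy
    -- The angle is recovered from y = e - d cos φ and η = d sin φ √g; the equation of the curve
    -- says that these cosine and sine values are compatible.
    obtain ⟨φ, hc, hs⟩ := exists_angle (x := (e - y) / d) (y := E / (d * √(g.eval y))) (by
      have h1 := Real.sq_sqrt hgy.le
      simp only [hf, eval_mul, eval_sub, eval_X, eval_C] at hE
      rw [div_pow _ d, div_pow E, mul_pow, hE, h1]
      have h2 := hgy.ne'
      field_simp
      rw [he, hd]; ring)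
    obtain ⟨t, ht⟩ := hψsurj φ
    have hYy : Y φ = y := by simp only [hY, hc]; field_simp; ring
    refine ⟨t / P, ?_, ?_⟩
    · simp only [mul_div_cancel₀ t hP.ne', ht, hYy]
    · simp only [mul_div_cancel₀ t hP.ne', ht, hN, hYy, hs]
      have := hsy.ne'
      field_simp

end Oval

/-! ### Motions in orthogonal frames -/

lemma mkVec_add (z z' : Fin (n / 2) → ℂ) (w w' : ℝ) :
    mkVec (z + z') (w + w') = (mkVec z w + mkVec z' w' : Fin n → ℝ) := by
  funext a
  simp only [mkVec, Pi.add_apply]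
  split_ifs <;> simp

lemma mkVec_smul (t : ℝ) (z : Fin (n / 2) → ℂ) (w : ℝ) :
    mkVec (t • z) (t * w) = (t • mkVec z w : Fin n → ℝ) := by
  funext a
  simp only [mkVec, Pi.smul_apply, smul_eq_mul]
  split_ifs <;> simp

section Frame
variable {m s : ℝ} {κ : Fin (n / 2) → ℝ} {l : ℕ} {E : Fin l → Fin (n / 2) → ℂ} {k c : Fin l → ℝ}

lemma ofCoord_add (z z' q q' : Fin (n / 2) → ℂ) (w w' π π' : ℝ) :
    ofCoord s κ (z + z') (q + q') (w + w') (π + π')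
      = ofCoord s κ z q w π + ofCoord s κ z' q' w' π' := by
  simp only [ofCoord, mkVec_add, Prod.mk_add_mk, Prod.mk.injEq, true_and]
  rw [← mkVec_add]
  congr 1
  funext i
  simp only [Pi.add_apply]; ring

lemma ofCoord_smul (t : ℝ) (z q : Fin (n / 2) → ℂ) (w π : ℝ) :
    ofCoord s κ (t • z) (t • q) (t * w) (t * π) = t • ofCoord s κ z q w π := by
  simp only [ofCoord, mkVec_smul, Prod.smul_mk, Prod.mk.injEq, true_and]
  rw [← mkVec_smul]
  congr 1
  funext i
  simp only [Pi.smul_apply, real_smul]; ring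

variable (s κ E) in
/-- The phase point with given coordinates in a frame of complex vectors. -/
def frameMap : (Fin l → ℂ) × (Fin l → ℂ) × ℝ × ℝ →ₗ[ℝ] Phase n where
  toFun X := ofCoord s κ (∑ j, X.1 j • E j) (∑ j, X.2.1 j • E j) X.2.2.1 X.2.2.2
  map_add' X Y := by
    rw [← ofCoord_add]
    simp [add_smul, Finset.sum_add_distrib]
  map_smul' t X := by
    rw [RingHom.id_apply, ← ofCoord_smul]
    simp [Finset.smul_sum, mul_smul]

lemma frameMap_apply (α β : Fin l → ℂ) (w π : ℝ) : frameMap s κ E (α, β, w, π)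
    = ofCoord s κ (∑ j, α j • E j) (∑ j, β j • E j) w π := rfl

variable (κ E k) in
/-- The vectors `E j` are nonzero and orthogonal, and are eigenvectors of the magnetic term. -/
structure IsMagneticFrame : Prop where
  orth : ∀ i j, i ≠ j → hdot (E i) (E j) = 0
  ne_zero : ∀ j, E j ≠ 0
  kappa : ∀ j i, (κ i : ℂ) * E j i = k j * E j i

lemma hdot_sum_left {ι : Type*} [Fintype ι] (a : Fin l → ℂ) (F : Fin l → ι → ℂ) (v : ι → ℂ) :
    hdot (∑ j, a j • F j) v = ∑ j, conj (a j) * hdot (F j) v := by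
  simp only [hdot, Finset.sum_apply, Pi.smul_apply, smul_eq_mul, map_sum, map_mul, Finset.sum_mul,
    Finset.mul_sum]
  rw [Finset.sum_comm]
  exact Finset.sum_congr rfl fun _ _ => Finset.sum_congr rfl fun _ _ => by ring

lemma hdot_sum_right {ι : Type*} [Fintype ι] (a : Fin l → ℂ) (F : Fin l → ι → ℂ) (v : ι → ℂ) :
    hdot v (∑ j, a j • F j) = ∑ j, a j * hdot v (F j) := by
  simp only [hdot, Finset.sum_apply, Pi.smul_apply, smul_eq_mul, Finset.mul_sum]
  rw [Finset.sum_comm]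
  exact Finset.sum_congr rfl fun _ _ => Finset.sum_congr rfl fun _ _ => by ring

lemma hdot_frame_left (hE : IsMagneticFrame κ E k) (a : Fin l → ℂ) (j : Fin l) :
    hdot (E j) (∑ i, a i • E i) = a j * hsq (E j) := by
  rw [hdot_sum_right, Finset.sum_eq_single j]
  · rw [hdot_self]
  · intro i _ h; rw [hE.orth j i h.symm, mul_zero]
  · simp

lemma hdot_frame (hE : IsMagneticFrame κ E k) (a b : Fin l → ℂ) :
    hdot (∑ j, a j • E j) (∑ j, b j • E j) = ∑ j, conj (a j) * b j * hsq (E j) := by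
  rw [hdot_sum_left]
  refine Finset.sum_congr rfl fun j _ => ?_
  rw [hdot_frame_left hE]; ring

lemma frame_injective (hE : IsMagneticFrame κ E k) {a b : Fin l → ℂ}
    (h : ∑ j, a j • E j = ∑ j, b j • E j) : a = b := by
  funext j
  have h1 := congrArg (hdot (E j)) h
  rw [hdot_frame_left hE, hdot_frame_left hE] at h1
  exact mul_right_cancel₀ (ofReal_ne_zero.2 (hsq_pos (hE.ne_zero j)).ne') h1

lemma wc_ofCoord' {z q : Fin (n / 2) → ℂ} {w π : ℝ} (h : n % 2 = 1 ∨ w = 0 ∧ π = 0) :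
    wc (ofCoord s κ z q w π) = w := by
  rcases h with h | ⟨rfl, rfl⟩
  · exact wc_ofCoord h
  · exact wc_ofCoord_zero

lemma wp_ofCoord' {z q : Fin (n / 2) → ℂ} {w π : ℝ} (h : n % 2 = 1 ∨ w = 0 ∧ π = 0) :
    wp (ofCoord s κ z q w π) = π := by
  rcases h with h | ⟨rfl, rfl⟩
  · exact wp_ofCoord h
  · exact wp_ofCoord_zero

lemma twistedForm_frame (hE : IsMagneticFrame κ E k) {α β α' β' : Fin l → ℂ} {w π w' π' : ℝ}
    (h : n % 2 = 1 ∨ w = 0 ∧ π = 0) (h' : n % 2 = 1 ∨ w' = 0 ∧ π' = 0) :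
    twistedForm s κ (frameMap s κ E (α, β, w, π)) (frameMap s κ E (α', β', w', π'))
      = ∑ j, (conj (β j) * α' j - conj (β' j) * α j).re * hsq (E j) + (π * w' - π' * w) := by
  rw [frameMap_apply, frameMap_apply, twistedForm_eq, wc_ofCoord' h, wc_ofCoord' h', wp_ofCoord' h,
    wp_ofCoord' h']
  simp only [zc_ofCoord, qc_ofCoord]
  rw [← re_sum, Finset.sum_sub_distrib]
  have h1 := hdot_frame hE β α'
  have h2 := hdot_frame hE β' α
  rw [hdot] at h1 h2
  rw [h1, h2, ← Finset.sum_sub_distrib, re_sum]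
  congr 1
  refine Finset.sum_congr rfl fun j _ => ?_
  rw [← sub_mul, re_mul_ofReal]

lemma pc_frame (hE : IsMagneticFrame κ E k) (α β : Fin l → ℂ) (w π : ℝ) :
    pc (frameMap s κ E (α, β, w, π))
      = ∑ j, (β j - I * (s * k j / 2 : ℝ) * α j) • E j := by
  funext i
  rw [frameMap_apply, pc_ofCoord]
  simp only [Finset.sum_apply, Pi.smul_apply, smul_eq_mul, Finset.mul_sum,
    ← Finset.sum_sub_distrib]
  refine Finset.sum_congr rfl fun j _ => ?_
  have := hE.kappa j i
  push_cast
  linear_combination (-(I * s * α j / 2)) * this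

lemma multiplier_coord (m s : ℝ) (κ : Fin (n / 2) → ℝ) (x : Phase n) : multiplier m s κ x
    = ((hdot (pc x) fun i => -I * (s * κ i : ℝ) * zc x i - pc x i).re - wp x ^ 2) / m := by
  rw [multiplier, dot_eq, dot_eq]
  simp only [cpx_kappa, cpx_fst, cpx_snd, lastCoord_kappa, lastCoord_snd, hdot, re_sum]
  congr 1
  rw [mul_add, Finset.mul_sum, mul_zero, mul_zero, add_zero, ← sub_sub, ← Finset.sum_sub_distrib,
    sq]
  congr 1
  refine Finset.sum_congr rfl fun i _ => ?_
  rw [← re_ofReal_mul, ← sub_re]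
  congr 1
  push_cast; ring

variable (s κ E c) in
/-- The phase point with radial coordinates `r`, radial velocities `v`, phases `ζ` and angular
momenta `c` in a frame. -/
def rotor (r v : Fin l → ℝ) (ζ : Fin l → ℂ) (w π : ℝ) : Phase n :=
  frameMap s κ E (fun j => r j * ζ j, fun j => (v j + I * (c j / r j : ℝ)) * ζ j, w, π)

variable (s k c) in
/-- The kinetic angular velocity times the radius. -/
def swirl (r : Fin l → ℝ) (j : Fin l) : ℝ := c j / r j - s * k j / 2 * r j

variable (m s E k c) in
/-- The Lagrange multiplier of a rotor. -/
def rotorMultiplier (r v : Fin l → ℝ) (π : ℝ) : ℝ :=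
  (∑ j, (-v j ^ 2 - swirl s k c r j * (swirl s k c r j + s * k j * r j)) * hsq (E j) - π ^ 2) / m

section Rotor
variable {r v : Fin l → ℝ} {ζ : Fin l → ℂ} {w π : ℝ}

lemma zc_rotor : zc (rotor s κ E c r v ζ w π) = ∑ j, ((r j : ℂ) * ζ j) • E j := by
  rw [rotor, frameMap_apply, zc_ofCoord]

lemma qc_rotor : qc s κ (rotor s κ E c r v ζ w π)
    = ∑ j, ((v j + I * (c j / r j : ℝ)) * ζ j) • E j := by
  rw [rotor, frameMap_apply, qc_ofCoord]

lemma pc_rotor (hE : IsMagneticFrame κ E k) : pc (rotor s κ E c r v ζ w π)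
    = ∑ j, ((v j + I * swirl s k c r j) * ζ j) • E j := by
  rw [rotor, pc_frame hE]
  refine Finset.sum_congr rfl fun j _ => ?_
  congr 1
  rw [swirl]; push_cast; ring

lemma wc_rotor (h : n % 2 = 1 ∨ w = 0 ∧ π = 0) : wc (rotor s κ E c r v ζ w π) = w := by
  rw [rotor, frameMap_apply, wc_ofCoord' h]

lemma wp_rotor (h : n % 2 = 1 ∨ w = 0 ∧ π = 0) : wp (rotor s κ E c r v ζ w π) = π := by
  rw [rotor, frameMap_apply, wp_ofCoord' h]

/-- Orthogonality of the frame and unit phases make the products depend on the radial data only.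
This is why the multiplier, the constraints, H and J of a rotor do not see the phases. -/
lemma rotor_hdot_re (hE : IsMagneticFrame κ E k) (hζ : ∀ j, normSq (ζ j) = 1) (a b : Fin l → ℂ) :
    (hdot (∑ j, (a j * ζ j) • E j) (∑ j, (b j * ζ j) • E j)).re
      = ∑ j, (conj (a j) * b j).re * hsq (E j) := by
  rw [hdot_frame hE, re_sum]
  refine Finset.sum_congr rfl fun j _ => ?_
  rw [re_mul_ofReal]
  congr 2
  rw [map_mul, mul_mul_mul_comm, ← normSq_eq_conj_mul_self, hζ j]; simp

lemma multiplier_rotor (hE : IsMagneticFrame κ E k) (hζ : ∀ j, normSq (ζ j) = 1)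
    (h : n % 2 = 1 ∨ w = 0 ∧ π = 0) :
    multiplier m s κ (rotor s κ E c r v ζ w π) = rotorMultiplier m s E k c r v π := by
  have h1 : (fun i => -I * (s * κ i : ℝ) * zc (rotor s κ E c r v ζ w π) i
      - pc (rotor s κ E c r v ζ w π) i)
      = ∑ j, ((-I * (s * k j : ℝ) * r j - (v j + I * swirl s k c r j)) * ζ j) • E j := by
    funext i
    rw [zc_rotor, pc_rotor hE]
    simp only [Finset.sum_apply, Pi.smul_apply, smul_eq_mul, Finset.mul_sum,
      ← Finset.sum_sub_distrib]
    refine Finset.sum_congr rfl fun j _ => ?_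
    have := hE.kappa j i
    push_cast
    linear_combination (-(I * s * r j * ζ j)) * this
  rw [multiplier_coord, h1, pc_rotor hE, rotor_hdot_re hE hζ, wp_rotor h, rotorMultiplier]
  congr 2
  refine Finset.sum_congr rfl fun j _ => ?_
  congr 1
  simp; ring

lemma phi1_rotor (hE : IsMagneticFrame κ E k) (hζ : ∀ j, normSq (ζ j) = 1)
    (h : n % 2 = 1 ∨ w = 0 ∧ π = 0) :
    phi1 (rotor s κ E c r v ζ w π) = ∑ j, r j ^ 2 * hsq (E j) + w ^ 2 := by
  rw [phi1_eq, wc_rotor h, ← re_sum]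
  have := rotor_hdot_re hE hζ (fun j => (r j : ℂ)) fun j => (r j : ℂ)
  rw [zc_rotor]
  rw [hdot] at this
  rw [this, sq]
  congr 1
  refine Finset.sum_congr rfl fun j _ => ?_
  congr 1
  simp [sq]

lemma phi2_rotor (hE : IsMagneticFrame κ E k) (hζ : ∀ j, normSq (ζ j) = 1)
    (h : n % 2 = 1 ∨ w = 0 ∧ π = 0) :
    phi2 (rotor s κ E c r v ζ w π) = ∑ j, r j * v j * hsq (E j) + w * π := by
  rw [phi2_eq s κ, wc_rotor h, wp_rotor h, ← re_sum]
  have := rotor_hdot_re hE hζ (fun j => (r j : ℂ)) fun j => (v j + I * (c j / r j : ℝ))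
  rw [zc_rotor, qc_rotor]
  rw [hdot] at this
  rw [this]
  congr 1
  refine Finset.sum_congr rfl fun j _ => ?_
  congr 1
  simp

lemma hamiltonian_rotor (hE : IsMagneticFrame κ E k) (hζ : ∀ j, normSq (ζ j) = 1)
    (h : n % 2 = 1 ∨ w = 0 ∧ π = 0) :
    hamiltonian m (rotor s κ E c r v ζ w π)
      = (∑ j, (v j ^ 2 + swirl s k c r j ^ 2) * hsq (E j) + π ^ 2) / (2 * m) := by
  rw [hamiltonian, dot_eq]
  simp only [cpx_snd, lastCoord_snd]
  rw [wp_rotor h, ← re_sum]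
  have := rotor_hdot_re hE hζ (fun j => (v j + I * swirl s k c r j : ℂ))
    fun j => (v j + I * swirl s k c r j)
  rw [pc_rotor hE]
  rw [hdot] at this
  rw [this, ← sq]
  congr 2
  refine Finset.sum_congr rfl fun j _ => ?_
  congr 1
  simp; ring

lemma J_rotor (hE : IsMagneticFrame κ E k) (hζ : ∀ j, normSq (ζ j) = 1)
    (h : n % 2 = 1 ∨ w = 0 ∧ π = 0) :
    J m s κ (rotor s κ E c r v ζ w π)
      = s ^ 2 / m ^ 2 * ∑ j, k j ^ 2 * (v j ^ 2 + swirl s k c r j ^ 2) * hsq (E j)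
        - rotorMultiplier m s E k c r v π ^ 2 := by
  rw [J, multiplier_rotor hE hζ h]
  congr 2
  have h1 : ∀ x : Phase n, ∑ i, κ i ^ 2 * (x.2 (fstIdx i) ^ 2 + x.2 (sndIdx i) ^ 2)
      = (hdot (fun i => κ i * pc x i) fun i => κ i * pc x i).re := by
    intro x
    rw [hdot, re_sum]
    refine Finset.sum_congr rfl fun i _ => ?_
    rw [← pc_re, ← pc_im]
    simp; ring
  have h2 : (fun i => (κ i : ℂ) * pc (rotor s κ E c r v ζ w π) i)
      = ∑ j, ((k j * (v j + I * swirl s k c r j)) * ζ j) • E j := by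
    funext i
    rw [pc_rotor hE]
    simp only [Finset.sum_apply, Pi.smul_apply, smul_eq_mul, Finset.mul_sum]
    refine Finset.sum_congr rfl fun j _ => ?_
    linear_combination ((v j + I * swirl s k c r j) * ζ j) * hE.kappa j i
  rw [h1, h2, rotor_hdot_re hE hζ]
  refine Finset.sum_congr rfl fun j _ => ?_
  congr 1
  simp; ring

lemma field_rotor (hE : IsMagneticFrame κ E k) (hζ : ∀ j, normSq (ζ j) = 1)
    (h : n % 2 = 1 ∨ w = 0 ∧ π = 0) :
    magneticField m s κ (rotor s κ E c r v ζ w π)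
      = frameMap s κ E (fun j => m⁻¹ * ((v j + I * swirl s k c r j) * ζ j),
          fun j => (rotorMultiplier m s E k c r v π * r j
            - I * (s * k j / (2 * m) : ℝ) * (v j + I * swirl s k c r j)) * ζ j,
          m⁻¹ * π, rotorMultiplier m s E k c r v π * w) := by
  have h' : n % 2 = 1 ∨ m⁻¹ * π = 0 ∧ rotorMultiplier m s E k c r v π * w = 0 :=
    h.imp id fun h => by simp [h.1, h.2]
  refine phase_ext s κ (funext fun i => ?_) (funext fun i => ?_) ?_ ?_
  · rw [zc_field, frameMap_apply, zc_ofCoord, pc_rotor hE]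
    simp only [Finset.sum_apply, Pi.smul_apply, smul_eq_mul, Finset.mul_sum]
    refine Finset.sum_congr rfl fun j _ => ?_
    push_cast; ring
  · rw [qc_eq, zc_field, pc_field, frameMap_apply, qc_ofCoord, pc_rotor hE, zc_rotor,
      multiplier_rotor hE hζ h]
    simp only [Finset.sum_apply, Pi.smul_apply, smul_eq_mul, Finset.mul_sum,
      ← Finset.sum_sub_distrib, ← Finset.sum_add_distrib]
    refine Finset.sum_congr rfl fun j _ => ?_
    have := hE.kappa j i
    push_cast
    by_cases hm : (m : ℂ) = 0
    · simp [hm]; ring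
    field_simp
    linear_combination (-(I * s * (v j + I * swirl s k c r j) * ζ j)) * this
  · rw [wc_field, wp_rotor h, frameMap_apply, wc_ofCoord' h']
  · rw [wp_field, wc_rotor h, frameMap_apply, wp_ofCoord' h', multiplier_rotor hE hζ h]

end Rotor
end Frame

section Torus
variable {m s : ℝ} {κ : Fin (n / 2) → ℝ} {l : ℕ} {E : Fin l → Fin (n / 2) → ℂ} {k c : Fin l → ℝ}

/-- Periodic radial data of a family of rotors, and phases whose mean motion has been split off. -/
structure RotorData (l : ℕ) where
  r : Fin l → ℝ → ℝ
  v : Fin l → ℝ → ℝ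
  σ : Fin l → ℝ → ℝ
  w : ℝ → ℝ
  π : ℝ → ℝ

variable {K : ℕ} (D : RotorData l) (p : (Fin K → ℝ) →L[ℝ] ℝ) (idx : Fin l → Fin K)

/-- The smoothness and periodicity of radial data. -/
structure RotorData.IsPeriodic (D : RotorData l) (n : ℕ) : Prop where
  r_smooth : ∀ j, ContDiff ℝ ∞ (D.r j)
  v_smooth : ∀ j, ContDiff ℝ ∞ (D.v j)
  σ_smooth : ∀ j, ContDiff ℝ ∞ (D.σ j)
  w_smooth : ContDiff ℝ ∞ D.w
  π_smooth : ContDiff ℝ ∞ D.π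
  r_pos : ∀ j t, 0 < D.r j t
  r_per : ∀ j, Function.Periodic (D.r j) 1
  v_per : ∀ j, Function.Periodic (D.v j) 1
  σ_per : ∀ j, Function.Periodic (D.σ j) 1
  w_per : Function.Periodic D.w 1
  π_per : Function.Periodic D.π 1
  parity : ∀ t, n % 2 = 1 ∨ D.w t = 0 ∧ D.π t = 0

variable (m s E k c) in
/-- The reduced equations of motion. -/
structure RotorData.IsSolution (D : RotorData l) (p : (Fin K → ℝ) →L[ℝ] ℝ) (idx : Fin l → Fin K)
    (freq : Fin K → ℝ) : Prop where
  phi1 : ∀ t, ∑ j, D.r j t ^ 2 * hsq (E j) + D.w t ^ 2 = 1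
  phi2 : ∀ t, ∑ j, D.r j t * D.v j t * hsq (E j) + D.w t * D.π t = 0
  r_deriv : ∀ j t, p freq * deriv (D.r j) t = m⁻¹ * D.v j t
  v_deriv : ∀ j t, p freq * deriv (D.v j) t
    = rotorMultiplier m s E k c (fun j => D.r j t) (fun j => D.v j t) (D.π t) * D.r j t
      + swirl s k c (fun j => D.r j t) j / m * (c j / D.r j t ^ 2 + s * k j / 2)
  σ_deriv : ∀ j t, 2 * Real.pi * freq (idx j) + p freq * deriv (D.σ j) t
    = swirl s k c (fun j => D.r j t) j / (m * D.r j t)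
  w_deriv : ∀ t, p freq * deriv D.w t = m⁻¹ * D.π t
  π_deriv : ∀ t, p freq * deriv D.π t
    = rotorMultiplier m s E k c (fun j => D.r j t) (fun j => D.v j t) (D.π t) * D.w t

/-- The phase factors of the torus parametrization. -/
def torusPhase (a : Fin K → ℝ) (j : Fin l) : ℂ :=
  exp (((2 * Real.pi * a (idx j) + D.σ j (p a) : ℝ) : ℂ) * I)

lemma normSq_torusPhase (a : Fin K → ℝ) (j : Fin l) : normSq (torusPhase D p idx a j) = 1 := by
  rw [normSq_eq_norm_sq, torusPhase, norm_exp_ofReal_mul_I, one_pow]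

variable (s κ E c) in
/-- The torus swept out by rotors. -/
def torusMap (a : Fin K → ℝ) : Phase n :=
  rotor s κ E c (fun j => D.r j (p a)) (fun j => D.v j (p a)) (torusPhase D p idx a) (D.w (p a))
    (D.π (p a))

variable {D}

lemma contDiff_torusMap (hD : D.IsPeriodic n) :
    ContDiff ℝ ∞ (torusMap (n := n) s κ E c D p idx) := by
  have hof : ∀ {f : (Fin K → ℝ) → ℝ}, ContDiff ℝ ∞ f → ContDiff ℝ ∞ fun a => (f a : ℂ) :=
    fun hf => ofRealCLM.contDiff.comp hf
  have hr : ∀ j, ContDiff ℝ ∞ fun a => D.r j (p a) := fun j => (hD.r_smooth j).comp p.contDiff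
  have hv : ∀ j, ContDiff ℝ ∞ fun a => D.v j (p a) := fun j => (hD.v_smooth j).comp p.contDiff
  have hσ : ∀ j, ContDiff ℝ ∞ fun a => D.σ j (p a) := fun j => (hD.σ_smooth j).comp p.contDiff
  have hζ : ∀ j, ContDiff ℝ ∞ fun a => torusPhase D p idx a j := fun j =>
    ((hof ((contDiff_const.mul (contDiff_apply ℝ ℝ (idx j))).add (hσ j))).mul
      contDiff_const).cexp
  have h1 : ContDiff ℝ ∞ fun a => (fun j => (D.r j (p a) : ℂ) * torusPhase D p idx a j) :=
    contDiff_pi.2 fun j => (hof (hr j)).mul (hζ j)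
  have h2 : ContDiff ℝ ∞ fun a => (fun j => ((D.v j (p a) : ℂ) + I * (c j / D.r j (p a) : ℝ))
      * torusPhase D p idx a j) :=
    contDiff_pi.2 fun j => ((hof (hv j)).add (contDiff_const.mul
      (hof (contDiff_const.div (hr j) fun a => (hD.r_pos j _).ne')))).mul (hζ j)
  exact (LinearMap.toContinuousLinearMap (frameMap s κ E)).contDiff.comp
    (h1.prodMk (h2.prodMk ((hD.w_smooth.comp p.contDiff).prodMk (hD.π_smooth.comp p.contDiff))))

variable (s κ E c D) in
/-- The derivative of the torus parametrization. -/
def torusTangent (a u : Fin K → ℝ) : Phase n :=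
  frameMap s κ E
    (fun j => ((p u * deriv (D.r j) (p a) : ℝ)
      + I * (D.r j (p a) * (2 * Real.pi * u (idx j) + p u * deriv (D.σ j) (p a)) : ℝ))
        * torusPhase D p idx a j,
    fun j => ((p u * deriv (D.v j) (p a) : ℝ)
      - I * (c j * (p u * deriv (D.r j) (p a)) / D.r j (p a) ^ 2 : ℝ)
      + I * (D.v j (p a) + I * (c j / D.r j (p a) : ℝ))
        * (2 * Real.pi * u (idx j) + p u * deriv (D.σ j) (p a) : ℝ)) * torusPhase D p idx a j,
    p u * deriv D.w (p a), p u * deriv D.π (p a))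

lemma hasDerivAt_torusMap (hD : D.IsPeriodic n) (a u : Fin K → ℝ) (t : ℝ) :
    HasDerivAt (fun τ : ℝ => torusMap s κ E c D p idx (a + τ • u))
      (torusTangent (n := n) s κ E c D p idx (a + t • u) u) t := by
  have hline : HasDerivAt (fun τ : ℝ => a + τ • u) u t := by
    simpa using ((hasDerivAt_id t).smul_const u).const_add a
  have hp : HasDerivAt (fun τ : ℝ => p (a + τ • u)) (p u) t := p.hasFDerivAt.comp_hasDerivAt t hline
  have hcomp : ∀ {f : ℝ → ℝ}, ContDiff ℝ ∞ f →
      HasDerivAt (fun τ : ℝ => f (p (a + τ • u))) (p u * deriv f (p (a + t • u))) t := by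
    intro f hf
    have h1 : HasDerivAt f (deriv f (p (a + t • u))) (p (a + t • u)) :=
      (hf.differentiable (by simp) _).hasDerivAt
    exact (h1.comp t hp).congr_deriv (mul_comm _ _)
  have hidx : ∀ j, HasDerivAt (fun τ : ℝ => (a + τ • u) (idx j)) (u (idx j)) t := fun j =>
    hasDerivAt_pi.1 hline (idx j)
  have hζ : ∀ j, HasDerivAt (fun τ : ℝ => torusPhase D p idx (a + τ • u) j)
      (I * (2 * Real.pi * u (idx j) + p u * deriv (D.σ j) (p (a + t • u)) : ℝ)
        * torusPhase D p idx (a + t • u) j) t := fun j => by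
    have h1 := (((hidx j).const_mul (2 * Real.pi)).add (hcomp (hD.σ_smooth j))).ofReal_comp
    exact ((h1.mul_const I).cexp).congr_deriv (by
      rw [torusPhase]; simp only [Pi.add_apply]; ring)
  have h1 := hasDerivAt_pi.2 fun j => ((hcomp (hD.r_smooth j)).ofReal_comp).mul (hζ j)
  have h2 := hasDerivAt_pi.2 fun j => ((((hcomp (hD.v_smooth j)).ofReal_comp).add
    ((((hcomp (hD.r_smooth j)).fun_inv (hD.r_pos j _).ne').const_mul (c j)).ofReal_comp.const_mul I)).mul
      (hζ j))
  have h3 := (LinearMap.toContinuousLinearMap (frameMap s κ E)).hasFDerivAt.comp_hasDerivAt t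
    (h1.prodMk (h2.prodMk ((hcomp hD.w_smooth).prodMk (hcomp hD.π_smooth))))
  refine h3.congr_deriv ?_
  rw [LinearMap.coe_toContinuousLinearMap', torusTangent]
  congr 1
  refine Prod.ext (funext fun j => ?_) (Prod.ext (funext fun j => ?_) rfl)
  · simp only
    push_cast
    ring
  · simp only [div_eq_mul_inv, Pi.add_apply]
    push_cast
    ring

lemma fderiv_torusMap (hD : D.IsPeriodic n) (a u : Fin K → ℝ) :
    fderiv ℝ (torusMap (n := n) s κ E c D p idx) a u = torusTangent s κ E c D p idx a u := by
  have h1 := hasDerivAt_torusMap (s := s) (κ := κ) (E := E) (c := c) p idx hD a u 0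
  have h2 : HasFDerivAt (torusMap (n := n) s κ E c D p idx)
      (fderiv ℝ (torusMap (n := n) s κ E c D p idx) a) (a + (0 : ℝ) • u) := by
    rw [zero_smul, add_zero]
    exact ((contDiff_torusMap p idx hD).differentiable (by simp) a).hasFDerivAt
  have hline : HasDerivAt (fun τ : ℝ => a + τ • u) u 0 := by
    simpa using ((hasDerivAt_id (0 : ℝ)).smul_const u).const_add a
  have h3 : HasDerivAt (fun τ : ℝ => torusMap (n := n) s κ E c D p idx (a + τ • u)) _ 0 :=
    HasFDerivAt.comp_hasDerivAt (f := fun τ : ℝ => a + τ • u) (0 : ℝ) h2 hline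
  have h3 := h3.unique h1
  rwa [zero_smul, add_zero] at h3

lemma torusTangent_freq (hm : m ≠ 0) (hE : IsMagneticFrame κ E k) (hD : D.IsPeriodic n)
    {freq : Fin K → ℝ} (hS : D.IsSolution m s E k c p idx freq) (a : Fin K → ℝ) :
    torusTangent s κ E c D p idx a freq
      = magneticField m s κ (torusMap (n := n) s κ E c D p idx a) := by
  rw [torusMap, field_rotor hE (normSq_torusPhase D p idx a) (hD.parity _), torusTangent]
  congr 1
  refine Prod.ext (funext fun j => ?_) (Prod.ext (funext fun j => ?_) (Prod.ext ?_ ?_))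
  · have h0 := (hD.r_pos j (p a)).ne'
    simp only [hS.r_deriv, hS.σ_deriv]
    rw [← mul_assoc]
    congr 1
    have : D.r j (p a) * (swirl s k c (fun j => D.r j (p a)) j / (m * D.r j (p a)))
        = m⁻¹ * swirl s k c (fun j => D.r j (p a)) j := by field_simp
    rw [this]; push_cast; ring
  · have h0 := (hD.r_pos j (p a)).ne'
    simp only [hS.r_deriv, hS.σ_deriv, hS.v_deriv]
    congr 1
    apply Complex.ext
    · simp [-ofReal_div, -ofReal_mul, -ofReal_pow, -ofReal_inv]
      field_simp
      ring
    · simp [-ofReal_div, -ofReal_mul, -ofReal_pow, -ofReal_inv, swirl]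
      field_simp
      ring
  · exact hS.w_deriv _
  · exact hS.π_deriv _

lemma frameMap_injective (hE : IsMagneticFrame κ E k) {α β α' β' : Fin l → ℂ} {w π w' π' : ℝ}
    (h : n % 2 = 1 ∨ w = 0 ∧ π = 0) (h' : n % 2 = 1 ∨ w' = 0 ∧ π' = 0)
    (he : frameMap s κ E (α, β, w, π) = frameMap s κ E (α', β', w', π')) :
    α = α' ∧ β = β' ∧ w = w' ∧ π = π' := by
  rw [frameMap_apply, frameMap_apply] at he
  refine ⟨frame_injective hE ?_, frame_injective hE ?_, ?_, ?_⟩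
  · simpa using congrArg zc he
  · simpa using congrArg (qc s κ) he
  · rw [← wc_ofCoord' h (s := s) (κ := κ), he, wc_ofCoord' h']
  · rw [← wp_ofCoord' h (s := s) (κ := κ), he, wp_ofCoord' h']

/-- The moduli of the position components give the radii, the quotients then give the phases, and
finally the momenta give the radial velocities. -/
lemma rotor_eq_iff (hE : IsMagneticFrame κ E k) {r v r' v' : Fin l → ℝ} {ζ ζ' : Fin l → ℂ}
    {w π w' π' : ℝ} (hr : ∀ j, 0 < r j) (hr' : ∀ j, 0 < r' j) (hζ : ∀ j, normSq (ζ j) = 1)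
    (hζ' : ∀ j, normSq (ζ' j) = 1) (h : n % 2 = 1 ∨ w = 0 ∧ π = 0)
    (h' : n % 2 = 1 ∨ w' = 0 ∧ π' = 0)
    (he : rotor s κ E c r v ζ w π = rotor s κ E c r' v' ζ' w' π') :
    r = r' ∧ v = v' ∧ ζ = ζ' ∧ w = w' ∧ π = π' := by
  obtain ⟨hz, hq, hw, hπ⟩ := frameMap_injective hE h h' he
  have hr : r = r' := by
    funext j
    have h1 := congrArg normSq (congrFun hz j)
    simp only [normSq_mul, normSq_ofReal, hζ, hζ', mul_one] at h1
    exact (mul_self_inj (hr j).le (hr' j).le).1 h1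
  subst hr
  have hζe : ζ = ζ' := by
    funext j
    exact mul_left_cancel₀ (ofReal_ne_zero.2 (hr' j).ne') (congrFun hz j)
  subst hζe
  refine ⟨rfl, ?_, rfl, hw, hπ⟩
  funext j
  have h0 : ζ j ≠ 0 := fun h => by simpa [h] using hζ j
  have h1 := mul_right_cancel₀ h0 (congrFun hq j)
  exact ofReal_inj.1 (add_right_cancel h1)

/-- Rotors whose radial data solve the reduced equations of motion sweep out isotropic tori. -/
theorem isTorus_torusMap (hm : m ≠ 0) (hE : IsMagneticFrame κ E k) (hD : D.IsPeriodic n)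
    {freq : Fin K → ℝ} (hS : D.IsSolution m s E k c p idx freq)
    -- Either all angles of the torus are phases and the radial data are constant, or the angle i₀
    -- is the radial time and all others are phases. In the second case the radial curve must be
    -- simple and immersed.
    (hp : (p = 0 ∧ ∀ i, ∃ j, idx j = i) ∨
      ∃ i₀, p = ContinuousLinearMap.proj i₀ ∧ (∀ i, i ≠ i₀ → ∃ j, idx j = i) ∧
        (∀ t t', (∀ j, D.r j t = D.r j t') → (∀ j, D.v j t = D.v j t') → D.w t = D.w t' →
          D.π t = D.π t' → ∃ z : ℤ, t' = t + z) ∧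
        ∀ t, (∀ j, deriv (D.r j) t = 0) → (∀ j, deriv (D.v j) t = 0) → deriv D.w t = 0 →
          deriv D.π t = 0 → False) :
    IsQuasiPeriodicIsotropicTorus m s κ (torusMap (n := n) s κ E c D p idx) freq := by
  have hu : ∀ a j, normSq (torusPhase D p idx a j) = 1 := normSq_torusPhase D p idx
  have hu0 : ∀ a j, torusPhase D p idx a j ≠ 0 := fun a j h => by simpa [h] using hu a j
  have hpar' : ∀ a u, n % 2 = 1 ∨ p u * deriv D.w (p a) = 0 ∧ p u * deriv D.π (p a) = 0 := by
    intro a u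
    by_cases h : n % 2 = 1
    · exact Or.inl h
    · have hw : D.w = fun _ => 0 := funext fun t => ((hD.parity t).resolve_left h).1
      have hπ : D.π = fun _ => 0 := funext fun t => ((hD.parity t).resolve_left h).2
      right; rw [hw, hπ]; simp
  refine ⟨contDiff_torusMap p idx hD, fun a => ⟨?_, ?_⟩, fun a b => ⟨fun h => ?_, ?_⟩, fun a => ?_,
    fun a u v => ?_, fun a t => ?_⟩
  · rw [torusMap, phi1_rotor hE (hu a) (hD.parity _)]; exact hS.phi1 _
  · rw [torusMap, phi2_rotor hE (hu a) (hD.parity _)]; exact hS.phi2 _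
  · obtain ⟨e1, e2, e3, e4, e5⟩ := rotor_eq_iff hE (fun j => hD.r_pos j _) (fun j => hD.r_pos j _)
      (hu a) (hu b) (hD.parity _) (hD.parity _) h
    obtain ⟨z₀, hz₀⟩ : ∃ z₀ : ℤ, p b = p a + z₀ := by
      rcases hp with ⟨rfl, -⟩ | ⟨i₀, rfl, -, hinj, -⟩
      · exact ⟨0, by simp⟩
      · exact hinj _ _ (congrFun e1) (congrFun e2) e4 e5
    -- Once the radial times differ by an integer, the periodic corrections of the phases agree, so
    -- equality of the phase factors is a congruence of the angles modulo 1.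
    have hphase : ∀ j, ∃ z : ℤ, b (idx j) = a (idx j) + z := by
      intro j
      have h1 := congrFun e3 j
      have h2 : D.σ j (p b) = D.σ j (p a) := by
        rw [hz₀]; simpa using (hD.σ_per j).int_mul z₀ (p a)
      rw [torusPhase, torusPhase, h2, exp_eq_exp_iff_exists_int] at h1
      obtain ⟨z, hz⟩ := h1
      refine ⟨-z, ?_⟩
      have h3 := congrArg im hz
      simp at h3
      have h4 := Real.pi_pos.ne'
      have h5 : 2 * Real.pi * (a (idx j) - (b (idx j) + z)) = 0 := by linarith
      rcases mul_eq_zero.1 h5 with h6 | h6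
      · exact absurd h6 (by positivity)
      · push_cast; linarith
    have hall : ∀ i, ∃ z : ℤ, b i = a i + z := by
      intro i
      rcases hp with ⟨-, hcov⟩ | ⟨i₀, rfl, hcov, -, -⟩
      · obtain ⟨j, rfl⟩ := hcov i; exact hphase j
      · by_cases hi : i = i₀
        · subst hi; exact ⟨z₀, hz₀⟩
        · obtain ⟨j, rfl⟩ := hcov i hi; exact hphase j
    exact ⟨fun i => (hall i).choose, fun i => (hall i).choose_spec⟩
  · rintro ⟨z, hz⟩
    obtain ⟨z₀, hz₀⟩ : ∃ z₀ : ℤ, p b = p a + z₀ := by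
      rcases hp with ⟨rfl, -⟩ | ⟨i₀, rfl, -⟩
      · exact ⟨0, by simp⟩
      · exact ⟨z i₀, hz i₀⟩
    have hper : ∀ {f : ℝ → ℝ}, Function.Periodic f 1 → f (p b) = f (p a) := fun hf => by
      rw [hz₀]; simpa using hf.int_mul z₀ (p a)
    have hζ : torusPhase D p idx b = torusPhase D p idx a := by
      funext j
      rw [torusPhase, torusPhase, hper (hD.σ_per j), hz, exp_eq_exp_iff_exists_int]
      exact ⟨z (idx j), by push_cast; ring⟩
    simp only [torusMap, hζ, hper (hD.r_per _), hper (hD.v_per _), hper hD.w_per, hper hD.π_per]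
  · rw [injective_iff_map_eq_zero]
    intro u hu'
    rw [fderiv_torusMap p idx hD] at hu'
    obtain ⟨hz, hq, hw, hπ⟩ := frameMap_injective hE (s := s) (α' := 0) (β' := 0) (hpar' a u)
      (Or.inr ⟨rfl, rfl⟩) (hu'.trans (map_zero (frameMap s κ E)).symm)
    have hz' : ∀ j, p u * deriv (D.r j) (p a) = 0 ∧
        2 * Real.pi * u (idx j) + p u * deriv (D.σ j) (p a) = 0 := by
      intro j
      have h1 := (mul_eq_zero.1 (congrFun hz j)).resolve_right (hu0 a j)
      have h2 := congrArg re h1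
      have h3 := congrArg im h1
      rw [add_re, ofReal_re, I_mul_re, ofReal_im, neg_zero, add_zero, zero_re] at h2
      rw [add_im, ofReal_im, I_mul_im, ofReal_re, zero_add, zero_im] at h3
      exact ⟨h2, (mul_eq_zero.1 h3).resolve_left (hD.r_pos j _).ne'⟩
    have hq' : ∀ j, p u * deriv (D.v j) (p a) = 0 := by
      intro j
      have h1 := (mul_eq_zero.1 (congrFun hq j)).resolve_right (hu0 a j)
      rw [(hz' j).1, (hz' j).2] at h1
      simpa using h1
    have hpu : p u = 0 := by
      rcases hp with ⟨rfl, -⟩ | ⟨i₀, rfl, -, -, hnd⟩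
      · simp
      · by_contra h0
        exact hnd _ (fun j => (mul_eq_zero.1 (hz' j).1).resolve_left h0)
          (fun j => (mul_eq_zero.1 (hq' j)).resolve_left h0)
          ((mul_eq_zero.1 hw).resolve_left h0) ((mul_eq_zero.1 hπ).resolve_left h0)
    have hidx : ∀ j, u (idx j) = 0 := by
      intro j
      have h1 := (hz' j).2
      rw [hpu, zero_mul, add_zero] at h1
      exact (mul_eq_zero.1 h1).resolve_left (by positivity)
    funext i
    rcases hp with ⟨-, hcov⟩ | ⟨i₀, rfl, hcov, -, -⟩
    · obtain ⟨j, rfl⟩ := hcov i; exact hidx j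
    · by_cases hi : i = i₀
      · subst hi; exact hpu
      · obtain ⟨j, rfl⟩ := hcov i hi; exact hidx j
  · rw [fderiv_torusMap p idx hD, fderiv_torusMap p idx hD, torusTangent, torusTangent,
      twistedForm_frame hE (hpar' a u) (hpar' a v)]
    have h1 : ∀ x y z t : ℂ, conj (x * z) * (y * z) - conj (t * z) * (y * z)
        = (conj x - conj t) * y * normSq z := by
      intro x y z t; rw [normSq_eq_conj_mul_self]; simp only [map_mul]; ring
    -- In radial coordinates the form is a sum of terms dv ∧ dr + dc ∧ dθ and of dπ ∧ dw. The radial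
    -- data depend on the single variable p a and the angular momenta c are constant, so every term
    -- vanishes.
    rw [Finset.sum_eq_zero, zero_add]
    · ring
    · intro j _
      have h2 : ∀ x y x' y' z : ℂ, normSq z = 1 → conj (y * z) * (x' * z) - conj (y' * z) * (x * z)
          = conj y * x' - conj y' * x := by
        intro x y x' y' z hz
        have : (normSq z : ℂ) = 1 := by rw [hz, ofReal_one]
        rw [normSq_eq_conj_mul_self] at this
        simp only [map_mul]
        linear_combination (conj y * x' - conj y' * x) * this
      have h0 := (hD.r_pos j (p a)).ne'
      rw [h2 _ _ _ _ _ (hu a j), mul_eq_zero]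
      left
      simp only [sub_re, mul_re, mul_im, conj_re, conj_im, add_re, add_im, sub_im, ofReal_re,
        ofReal_im, I_re, I_im]
      field_simp
      ring
  · exact (hasDerivAt_torusMap p idx hD a freq t).congr_deriv
      (torusTangent_freq p idx hm hE hD hS _)

end Torus

/-! ### Decomposition into two circular motions -/

section Split
variable {ι : Type*} [Fintype ι]

lemma sum_normSq_momentum (z q : ι → ℂ) :
    ((∑ a, ∑ b, normSq (conj (z a) * q b - conj (q a) * z b) : ℝ) : ℂ)
      = 2 * (hsq z * hsq q) - hdot z q ^ 2 - hdot q z ^ 2 := by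
  have h : ∀ f g : ι → ℂ, (∑ a, ∑ b, f a * g b) = (∑ a, f a) * ∑ b, g b := fun f g => by
    rw [Finset.sum_mul_sum]
  have key : ∀ a b, ((normSq (conj (z a) * q b - conj (q a) * z b) : ℝ) : ℂ)
      = (conj (z a) * z a) * (conj (q b) * q b) + (conj (q a) * q a) * (conj (z b) * z b)
        - (conj (q a) * z a) * (conj (q b) * z b) - (conj (z a) * q a) * (conj (z b) * q b) := by
    intro a b
    rw [normSq_eq_conj_mul_self]
    simp only [map_sub, map_mul, conj_conj]
    ring
  simp only [ofReal_sum, key, Finset.sum_sub_distrib, Finset.sum_add_distrib, h]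
  rw [← hdot_self, ← hdot_self]
  simp only [hdot]
  ring

/-- The square of the sectorial velocity. -/
def sectorial (z q : ι → ℂ) : ℝ := hsq z * hsq q - (hdot z q).re ^ 2

lemma hgram_eq_sectorial (z q : ι → ℂ) : hgram z q = sectorial z q - (hdot z q).im ^ 2 := by
  rw [hgram, sectorial, normSq_apply]; ring

lemma sectorial_pos {z q : ι → ℂ} (h : hgram z q ≠ 0) : 0 < sectorial z q := by
  have h1 := (hgram_nonneg z q).lt_of_ne h.symm
  rw [hgram_eq_sectorial] at h1
  nlinarith [sq_nonneg (hdot z q).im]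

/-- Together with `hdot_im_eq_momentum`, which reads off Im ⟨z, q⟩ from the trace, this shows that
the sectorial velocity is a function of the momentum matrix alone, hence constant on level sets. -/
lemma sectorial_eq_momentum (z q : ι → ℂ) : sectorial z q
    = (∑ a, ∑ b, normSq (conj (z a) * q b - conj (q a) * z b)) / 2 - (hdot z q).im ^ 2 := by
  have h := congrArg re (sum_normSq_momentum z q)
  rw [← hdot_conj z q, ofReal_re] at h
  rw [h, sectorial]
  simp [sq]
  ring

lemma hdot_im_eq_momentum (z q : ι → ℂ) :
    (hdot z q).im = (∑ a, (conj (z a) * q a - conj (q a) * z a)).im / 2 := by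
  rw [Finset.sum_sub_distrib]
  change (hdot z q).im = (hdot z q - hdot q z).im / 2
  rw [← hdot_conj z q]
  simp

/-- One of the two circular components of a motion with radius square `ρ`, radial velocity `v` and
sectorial velocity `c`. -/
def circular (ρ v c : ℝ) (z q : ι → ℂ) : ι → ℂ := fun i =>
  ((2 * √ρ : ℝ) : ℂ)⁻¹ * (z i - I * (c : ℂ)⁻¹ * (ρ * q i - v * z i))

/-- The vectors `A`, `B` are the circular components, with angular momentum `c`, of a motion. -/
structure IsSplit (A B : ι → ℂ) (c : ℝ) : Prop where
  pos : 0 < c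
  orth : hdot A B = 0
  left_ne : A ≠ 0
  right_ne : B ≠ 0
  hsq_add : hsq A + hsq B = 1

/-- With ρ = |z|² and v = Re ⟨z, q⟩, the vector u = (ρ q - v z) / c has the same norm as z, and Re
⟨z, u⟩ = 0. Therefore (z - i u) / (2 √ρ) and (z + i u) / (2 √ρ) are Hermitian orthogonal. They are
nonzero because positivity of the Gram determinant says that |Im ⟨z, q⟩| < c. -/
lemma exists_split {z q : ι → ℂ} (h : hgram z q ≠ 0) :
    ∃ A B : ι → ℂ, IsSplit A B √(sectorial z q) ∧
      (∀ i, z i = √(hsq z) * (A i + B i)) ∧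
      (∀ i, q i = (((hdot z q).re / √(hsq z) : ℝ) + I * (√(sectorial z q) / √(hsq z) : ℝ)) * A i
        + (((hdot z q).re / √(hsq z) : ℝ) + I * (-√(sectorial z q) / √(hsq z) : ℝ)) * B i) ∧
      (∀ i, z i = 0 → q i = 0 → A i = 0 ∧ B i = 0) := by
  have hC := sectorial_pos h
  have hρ := hsq_pos_of_hgram h
  set ρ := hsq z with hρe
  set v := (hdot z q).re with hv
  set L := (hdot z q).im with hL
  set c := √(sectorial z q) with hc
  have hc0 : 0 < c := Real.sqrt_pos.2 hC
  have hcc : c ^ 2 = ρ * hsq q - v ^ 2 := by rw [hc, Real.sq_sqrt hC.le, sectorial]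
  have hs0 : 0 < √ρ := Real.sqrt_pos.2 hρ
  have hss : √ρ ^ 2 = ρ := Real.sq_sqrt hρ.le
  have hh : hdot z q = v + L * I := (re_add_im _).symm
  have hh' : hdot q z = v - L * I := by
    rw [← hdot_conj, hh]; simp [sub_eq_add_neg]
  have hcC : (c : ℂ) ≠ 0 := ofReal_ne_zero.2 hc0.ne'
  have hsC : ((√ρ : ℝ) : ℂ) ≠ 0 := ofReal_ne_zero.2 hs0.ne'
  have hccC : (c : ℂ) ^ 2 = ρ * hsq q - v ^ 2 := by exact_mod_cast congrArg ofReal hcc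
  have hssC : ((√ρ : ℝ) : ℂ) ^ 2 = ρ := by exact_mod_cast congrArg ofReal hss
  have hcirc : ∀ e : ℝ, circular ρ v e z q = (((2 * √ρ : ℝ) : ℂ)⁻¹ * (1 + I * (e : ℂ)⁻¹ * v)) • z
      + (-((2 * √ρ : ℝ) : ℂ)⁻¹ * (I * (e : ℂ)⁻¹ * ρ)) • q := by
    intro e; funext i
    simp only [circular, Pi.add_apply, Pi.smul_apply, smul_eq_mul]; ring
  -- The two components are `circular` at c and at -c, so one computation with e, f = ±c yields both
  -- their norms and their orthogonality.
  have hprod : ∀ e f : ℝ, e ^ 2 = c ^ 2 → f ^ 2 = c ^ 2 → e ≠ 0 → f ≠ 0 →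
      hdot (circular ρ v e z q) (circular ρ v f z q)
        = (1 + (c : ℂ) ^ 2 / (e * f) + L / e + L / f) / 4 := by
    intro e f he hf he0 hf0
    have heC : (e : ℂ) ≠ 0 := ofReal_ne_zero.2 he0
    have hfC : (f : ℂ) ≠ 0 := ofReal_ne_zero.2 hf0
    rw [hcirc, hcirc]
    simp only [hdot_add_left, hdot_add_right, hdot_smul_left, hdot_smul_right, hdot_self, hh, hh',
      ← hρe]
    simp only [map_mul, map_add, map_neg, map_inv₀, conj_ofReal, conj_I, map_one]
    push_cast
    field_simp
    rw [hccC, show ((√ρ : ℝ) : ℂ) ^ 2 = ρ from hssC]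
    ring_nf
    simp only [I_sq]
    ring
  have hAA : ∀ e : ℝ, e ^ 2 = c ^ 2 → e ≠ 0 → hsq (circular ρ v e z q) = (1 + L / e) / 2 := by
    intro e he he0
    have h1 := hprod e e he he he0 he0
    rw [hdot_self] at h1
    have heC : (e : ℂ) ≠ 0 := ofReal_ne_zero.2 he0
    have h2 : (c : ℂ) ^ 2 / (e * e) = 1 := by
      rw [← sq]
      have : (e : ℂ) ^ 2 = (c : ℂ) ^ 2 := by exact_mod_cast congrArg ofReal he
      rw [← this]; exact div_self (pow_ne_zero 2 heC)
    rw [h2] at h1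
    apply ofReal_injective
    rw [h1]; push_cast; ring
  have hLc : L ^ 2 < c ^ 2 := by
    have h1 := (hgram_nonneg z q).lt_of_ne h.symm
    rw [hgram_eq_sectorial, sectorial] at h1
    rw [hcc]; linarith
  have habs := abs_lt_of_sq_lt_sq hLc hc0.le
  have hne : ∀ e : ℝ, e ^ 2 = c ^ 2 → e ≠ 0 → circular ρ v e z q ≠ 0 := by
    intro e he he0 h0
    have h1 := hAA e he he0
    rw [h0] at h1
    have h2 : hsq (0 : ι → ℂ) = 0 := by simp [hsq]
    rw [h2] at h1
    have h3 : L = -e := by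
      have : 1 + L / e = 0 := by linarith
      field_simp at this
      linarith
    rw [h3, neg_sq, he] at hLc
    exact lt_irrefl _ hLc
  refine ⟨circular ρ v c z q, circular ρ v (-c) z q, ⟨hc0, ?_, hne c rfl hc0.ne',
    hne (-c) (neg_sq c) (neg_ne_zero.2 hc0.ne'), ?_⟩, fun i => ?_, fun i => ?_, fun i hz hq => ?_⟩
  · rw [hprod c (-c) rfl (neg_sq c) hc0.ne' (neg_ne_zero.2 hc0.ne')]
    push_cast
    field_simp
    ring
  · rw [hAA c rfl hc0.ne', hAA (-c) (neg_sq c) (neg_ne_zero.2 hc0.ne')]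
    field_simp
    ring
  · simp only [circular]
    push_cast
    field_simp
    ring
  · simp only [circular]
    push_cast
    field_simp
    rw [hssC]
    ring_nf
    simp only [I_sq]
    ring
  · simp [circular, hz, hq]

/-- The cross terms cancel because the two components rotate with opposite angular momenta; the
radial velocity and the phases drop out of the diagonal terms. -/
lemma split_momentum {ι : Type*} {A B : ι → ℂ} {c ρ v : ℝ} (hρ : 0 < ρ) {z q : ι → ℂ} {ζ η : ℂ}
    (hζ : normSq ζ = 1) (hη : normSq η = 1)
    (hz : ∀ i, z i = ρ * (ζ * A i + η * B i))
    (hq : ∀ i, q i = (v + I * (c / ρ : ℝ)) * (ζ * A i) + (v + I * (-c / ρ : ℝ)) * (η * B i))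
    (a b : ι) : conj (z a) * q b - conj (q a) * z b
      = 2 * I * c * (conj (A a) * A b - conj (B a) * B b) := by
  have h1 : conj ζ * ζ = 1 := by rw [← normSq_eq_conj_mul_self, hζ, ofReal_one]
  have h2 : conj η * η = 1 := by rw [← normSq_eq_conj_mul_self, hη, ofReal_one]
  have hρC : (ρ : ℂ) ≠ 0 := ofReal_ne_zero.2 hρ.ne'
  rw [hz, hz, hq, hq]
  simp only [map_mul, map_add, conj_ofReal, conj_I]
  push_cast
  field_simp
  linear_combination (2 * I * c * conj (A a) * A b) * h1 - (2 * I * c * conj (B a) * B b) * h2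

/-- Uniqueness of the spectral decomposition. Applying both sides to A' and pairing with B gives
|A'|² ⟨B, A'⟩ = -|B|² ⟨B, A'⟩, so A' is orthogonal to B. Hence A' is a multiple of A, and equal
norms make the factor a phase. -/
lemma split_unique_left {A B A' B' : ι → ℂ} (hAB : hdot A B = 0) (hAB' : hdot A' B' = 0)
    (hA' : A' ≠ 0) (hsq_eq : hsq A = hsq A')
    (h : ∀ a b, conj (A a) * A b - conj (B a) * B b = conj (A' a) * A' b - conj (B' a) * B' b) :
    ∃ ζ : ℂ, normSq ζ = 1 ∧ A' = ζ • A := by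
  have hBA' : hdot B' A' = 0 := by rw [← hdot_conj, hAB', map_zero]
  have h1 : ∀ b, hsq A' * A' b = hdot A A' * A b - hdot B A' * B b := by
    intro b
    have h2 : ∑ a, A' a * (conj (A a) * A b - conj (B a) * B b)
        = ∑ a, A' a * (conj (A' a) * A' b - conj (B' a) * B' b) :=
      Finset.sum_congr rfl fun a _ => by rw [h]
    have h3 : ∀ (X Y : ι → ℂ), ∑ a, A' a * (conj (X a) * X b - conj (Y a) * Y b)
        = hdot X A' * X b - hdot Y A' * Y b := by
      intro X Y
      simp only [hdot, Finset.sum_mul, ← Finset.sum_sub_distrib]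
      exact Finset.sum_congr rfl fun a _ => by ring
    rw [h3, h3, hdot_self, hBA'] at h2
    rw [h2]; ring
  have hpos := hsq_pos hA'
  have h4 : hdot B A' = 0 := by
    have h2 : (hsq A' : ℂ) • A' = hdot A A' • A - hdot B A' • B := funext fun b => by
      simpa using h1 b
    have h3 := congrArg (hdot B) h2
    rw [hdot_smul_right, hdot_sub_right, hdot_smul_right, hdot_smul_right, hdot_self,
      show hdot B A = 0 by rw [← hdot_conj, hAB, map_zero]] at h3
    have h5 : hdot B A' * ((hsq A' + hsq B : ℝ) : ℂ) = 0 := by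
      push_cast; linear_combination h3
    refine (mul_eq_zero.1 h5).resolve_right (ofReal_ne_zero.2 ?_)
    have := hsq_nonneg B
    positivity
  have hposC : (hsq A' : ℂ) ≠ 0 := ofReal_ne_zero.2 hpos.ne'
  have h5 : A' = (hdot A A' / hsq A') • A := by
    funext b
    have := h1 b
    rw [h4] at this
    simp only [Pi.smul_apply, smul_eq_mul]
    field_simp
    linear_combination this
  refine ⟨_, ?_, h5⟩
  have h6 : hsq A' = normSq (hdot A A' / hsq A') * hsq A := by
    conv_lhs => rw [h5]
    simp only [hsq, Pi.smul_apply, smul_eq_mul, normSq_mul, Finset.mul_sum]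
  rw [hsq_eq] at h6
  have h7 : (normSq (hdot A A' / hsq A') - 1) * hsq A' = 0 := by linarith
  have := (mul_eq_zero.1 h7).resolve_right hpos.ne'
  linarith

/-- Two motions with the same momentum matrix have the same circular components up to phases. -/
lemma exists_phases {z q z' q' : ι → ℂ} {A B : ι → ℂ} (hG : hgram z q ≠ 0)
    (hAB : IsSplit A B √(sectorial z q))
    (hN : ∀ a b, conj (z a) * q b - conj (q a) * z b
      = 2 * I * √(sectorial z q) * (conj (A a) * A b - conj (B a) * B b))
    (hN' : ∀ a b, conj (z' a) * q' b - conj (q' a) * z' b = conj (z a) * q b - conj (q a) * z b) :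
    hgram z' q' = hgram z q ∧ sectorial z' q' = sectorial z q ∧ (hdot z' q').im = (hdot z q).im ∧
    ∃ ζ η : ℂ, normSq ζ = 1 ∧ normSq η = 1 ∧
      (∀ i, z' i = √(hsq z') * (ζ * A i + η * B i)) ∧
      ∀ i, q' i = (((hdot z' q').re / √(hsq z') : ℝ)
          + I * (√(sectorial z q) / √(hsq z') : ℝ)) * (ζ * A i)
        + (((hdot z' q').re / √(hsq z') : ℝ)
          + I * (-√(sectorial z q) / √(hsq z') : ℝ)) * (η * B i) := by
  have hL : (hdot z' q').im = (hdot z q).im := by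
    simp only [hdot_im_eq_momentum, hN']
  have hC : sectorial z' q' = sectorial z q := by
    simp only [sectorial_eq_momentum, hN', hL]
  have hg : hgram z' q' = hgram z q := by rw [hgram_eq_sectorial, hgram_eq_sectorial, hC, hL]
  refine ⟨hg, hC, hL, ?_⟩
  obtain ⟨A', B', hs', hz', hq', -⟩ := exists_split (z := z') (q := q') (by rwa [hg])
  rw [hC] at hs' hq'
  have hρ' : 0 < √(hsq z') := Real.sqrt_pos.2 (hsq_pos_of_hgram (q := q') (by rwa [hg]))
  have hc0 : (2 * I * (√(sectorial z q) : ℝ) : ℂ) ≠ 0 :=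
    mul_ne_zero (mul_ne_zero two_ne_zero I_ne_zero) (ofReal_ne_zero.2 hAB.pos.ne')
  have hM : ∀ a b, conj (A a) * A b - conj (B a) * B b
      = conj (A' a) * A' b - conj (B' a) * B' b := by
    intro a b
    refine mul_left_cancel₀ hc0 ?_
    rw [← hN, ← hN', split_momentum (A := A') (B := B') (c := √(sectorial z q))
      (v := (hdot z' q').re / √(hsq z')) hρ' (ζ := 1) (η := 1) (by simp) (by simp)
      (fun i => by rw [hz' i, one_mul, one_mul]) (fun i => by rw [hq' i, one_mul, one_mul])]
  -- The trace of the momentum matrix fixes the difference of the squared norms and normalization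
  -- fixes their sum.
  have htr : hsq A - hsq B = hsq A' - hsq B' := by
    apply ofReal_injective
    push_cast
    rw [← hdot_self, ← hdot_self, ← hdot_self, ← hdot_self]
    simp only [hdot, ← Finset.sum_sub_distrib, hM]
  have h1 := hAB.hsq_add
  have h2 := hs'.hsq_add
  obtain ⟨ζ, hζ, hA⟩ := split_unique_left hAB.orth hs'.orth hs'.left_ne (by linarith) hM
  obtain ⟨η, hη, hB⟩ := split_unique_left (A := B) (B := A) (A' := B') (B' := A')
    (by rw [← hdot_conj, hAB.orth, map_zero]) (by rw [← hdot_conj, hs'.orth, map_zero]) hs'.right_ne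
    (by linarith) fun a b => by linear_combination -hM a b
  refine ⟨ζ, η, hζ, hη, fun i => ?_, fun i => ?_⟩
  · rw [hz' i, hA, hB]; rfl
  · rw [hq' i, hA, hB]; rfl

end Split

/-! ### Level sets of the integrals -/

section LevelSet
variable {m s : ℝ} {κ : Fin (n / 2) → ℝ} {r : ℕ} {κ₀ : ℝ}

lemma momMat_eq_of_level (heq : ∀ i : Fin (n / 2), (i : ℕ) < r → κ i = κ₀) {x y : Phase n}
    (h : ∀ f ∈ integrals m s κ r, f y = f x) {a b : Fin (n / 2)}
    (hab : ((a : ℕ) < r ∧ (b : ℕ) < r) ∨ a = b) : momMat s κ y a b = momMat s κ x a b := by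
  have key : ∀ t : ℂ, mom s κ t a b y = mom s κ t a b x := fun t =>
    Algebra.adjoin_induction (p := fun f _ => f y = f x) h (fun _ => rfl)
      (fun f g _ _ hf hg => by rw [Pi.add_apply, Pi.add_apply, hf, hg])
      (fun f g _ _ hf hg => by rw [Pi.mul_apply, Pi.mul_apply, hf, hg])
      (mom_mem_adjoin (m := m) heq t hab)
  apply Complex.ext
  · simpa [mom] using key 1
  · simpa [mom] using key I

/-- A function of the radial time alone is constant on the torus as soon as it is a first integral,
because the flow carries the radial time to every value. No explicit evaluation of H or J along the
radial motion is needed. -/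
lemma IsQuasiPeriodicIsotropicTorus.const_of_firstIntegral {K : ℕ} {Θ : (Fin K → ℝ) → Phase n}
    {freq : Fin K → ℝ} (hT : IsQuasiPeriodicIsotropicTorus m s κ Θ freq) {f : Phase n → ℝ}
    (hf : IsFirstIntegral m s κ f) {p : (Fin K → ℝ) →L[ℝ] ℝ} (hp : p = 0 ∨ p freq ≠ 0)
    (hF : ∀ a b, p a = p b → f (Θ a) = f (Θ b)) (a b : Fin K → ℝ) : f (Θ a) = f (Θ b) := by
  rcases hp with rfl | hp
  · exact hF a b rfl
  · have h1 := hf Set.univ (fun t => Θ (a + t • freq)) Set.ordConnected_univ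
      (fun t _ => ⟨hT.mem _, (hT.motion a t).hasDerivWithinAt⟩) 0 trivial
      ((p b - p a) / p freq) trivial
    simp only [zero_smul, add_zero] at h1
    rw [h1]
    refine hF _ _ ?_
    rw [map_add, map_smul, smul_eq_mul, div_mul_cancel₀ _ hp]
    ring

/-- The torus is connected and lies in the level set: the momentum functions agree by assumption,
while H and J are first integrals depending on the radial time only. The reverse inclusion is left
to each case. -/
lemma range_torusMap_eq (heq : ∀ i : Fin (n / 2), (i : ℕ) < r → κ i = κ₀) {K l : ℕ}
    {E : Fin l → Fin (n / 2) → ℂ} {k c : Fin l → ℝ} {D : RotorData l} {p : (Fin K → ℝ) →L[ℝ] ℝ}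
    {idx : Fin l → Fin K} {freq : Fin K → ℝ} (hE : IsMagneticFrame κ E k) (hD : D.IsPeriodic n)
    (hT : IsQuasiPeriodicIsotropicTorus m s κ (torusMap s κ E c D p idx) freq)
    (hp : p = 0 ∨ p freq ≠ 0) {x : Phase n}
    (hmom : ∀ a (i j : Fin (n / 2)), (((i : ℕ) < r ∧ (j : ℕ) < r) ∨ i = j) →
      momMat s κ (torusMap s κ E c D p idx a) i j = momMat s κ x i j)
    (hx : x ∈ Set.range (torusMap (n := n) s κ E c D p idx))
    (hsurj : connectedComponentIn
        {y | y ∈ cotangentSphere n ∧ ∀ f ∈ integrals m s κ r, f y = f x} x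
      ⊆ Set.range (torusMap s κ E c D p idx)) :
    Set.range (torusMap s κ E c D p idx) = connectedComponentIn
      {y | y ∈ cotangentSphere n ∧ ∀ f ∈ integrals m s κ r, f y = f x} x := by
  refine subset_antisymm ?_ hsurj
  refine (isPreconnected_range hT.smooth.continuous).subset_connectedComponentIn hx ?_
  rintro _ ⟨a, rfl⟩
  refine ⟨hT.mem a, fun f hf => ?_⟩
  have hI := isFirstIntegral_integrals heq hf
  obtain ⟨a₀, rfl⟩ := hx
  have hu : ∀ a j, normSq (torusPhase D p idx a j) = 1 := normSq_torusPhase D p idx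
  rcases mem_integrals_cases heq hf with rfl | rfl | ⟨t, i, j, hij, -, rfl⟩
  · refine hT.const_of_firstIntegral hI hp (fun a b h => ?_) a a₀
    simp only [torusMap]
    rw [hamiltonian_rotor hE (hu a) (hD.parity _), hamiltonian_rotor hE (hu b) (hD.parity _), h]
  · refine hT.const_of_firstIntegral hI hp (fun a b h => ?_) a a₀
    simp only [torusMap]
    rw [J_rotor hE (hu a) (hD.parity _), J_rotor hE (hu b) (hD.parity _), h]
  · rw [mom, mom, hmom a i j hij]

end LevelSet

/-- The image of the component under Y is an interval on which f is nonnegative. It cannot cross the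
points just outside [a, b], where f is negative. -/
lemma mem_Icc_of_mem_component {X : Type*} [TopologicalSpace X] {S : Set X} {x y : X}
    {Y : X → ℝ} (hY : Continuous Y) {f : ℝ → ℝ} {a b : ℝ} (hS : ∀ y ∈ S, 0 ≤ f (Y y))
    (ha : ∀ᶠ t in 𝓝[<] a, f t < 0) (hb : ∀ᶠ t in 𝓝[>] b, f t < 0) (hx : Y x ∈ Set.Icc a b)
    (hy : y ∈ connectedComponentIn S x) : Y y ∈ Set.Icc a b := by
  have hxS : x ∈ S := by
    by_contra h; rw [connectedComponentIn_eq_empty h] at hy; exact hy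
  have hord := (isPreconnected_connectedComponentIn (F := S) (x := x)).image Y hY.continuousOn
    |>.ordConnected
  have hsub : ∀ t ∈ Y '' connectedComponentIn S x, 0 ≤ f t := by
    rintro _ ⟨u, hu, rfl⟩
    exact hS u (connectedComponentIn_subset S x hu)
  have hx' : Y x ∈ Y '' connectedComponentIn S x := ⟨x, mem_connectedComponentIn hxS, rfl⟩
  have hy' : Y y ∈ Y '' connectedComponentIn S x := ⟨y, hy, rfl⟩
  constructor
  · by_contra! h
    obtain ⟨t, ht, ht'⟩ := (ha.and (Ioo_mem_nhdsLT h)).exists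
    exact absurd (hsub t (hord.out hy' hx' ⟨ht'.1.le, ht'.2.le.trans hx.1⟩)) (not_le.2 ht)
  · by_contra! h
    obtain ⟨t, ht, ht'⟩ := (hb.and (Ioo_mem_nhdsGT h)).exists
    exact absurd (hsub t (hord.out hx' hy' ⟨hx.2.trans ht'.1.le, ht'.2.le⟩)) (not_le.2 ht)

/-! ### Simple roots enclosing an interval of positivity -/

section Roots
open Polynomial

/-- Here a is the largest root below y and b the smallest above. Dividing both out leaves a cofactor
that is positive between them, nonnegative at the ends by continuity, and nonzero there because the
roots are simple. -/
lemma exists_simple_roots {f : ℝ[X]} {lo y hi : ℝ} (hlo : lo < y) (hhi : y < hi)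
    (h1 : f.eval lo < 0) (h2 : 0 < f.eval y) (h3 : f.eval hi < 0)
    (hs : ∀ t ∈ Set.Ioo lo hi, f.eval t = 0 → f.derivative.eval t ≠ 0) :
    ∃ (a b : ℝ) (g : ℝ[X]), lo < a ∧ a < y ∧ y < b ∧ b < hi ∧ f = (X - C a) * (C b - X) * g ∧
      (∀ t ∈ Set.Icc a b, 0 < g.eval t) ∧ (∀ᶠ t in 𝓝[<] a, f.eval t < 0) ∧
      ∀ᶠ t in 𝓝[>] b, f.eval t < 0 := by
  have hc : Continuous fun t => f.eval t := f.continuous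
  obtain ⟨a, ⟨⟨hla, hay⟩, ha0⟩, hamax⟩ :=
    (isCompact_Icc (a := lo) (b := y)).inter_right (isClosed_singleton.preimage hc)
      |>.exists_isGreatest (s := Set.Icc lo y ∩ (fun t => f.eval t) ⁻¹' {0}) (by
        obtain ⟨t, ht, h⟩ := intermediate_value_Icc hlo.le hc.continuousOn ⟨h1.le, h2.le⟩
        exact ⟨t, ht, h⟩)
  obtain ⟨b, ⟨⟨hyb, hbh⟩, hb0⟩, hbmin⟩ :=
    (isCompact_Icc (a := y) (b := hi)).inter_right (isClosed_singleton.preimage hc)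
      |>.exists_isLeast (s := Set.Icc y hi ∩ (fun t => f.eval t) ⁻¹' {0}) (by
        obtain ⟨t, ht, h⟩ := intermediate_value_Icc' hhi.le hc.continuousOn ⟨h3.le, h2.le⟩
        exact ⟨t, ht, h⟩)
  simp only [Set.mem_preimage, Set.mem_singleton_iff] at ha0 hb0
  have hla : lo < a := hla.lt_of_ne (by rintro rfl; exact h1.ne ha0)
  have hay : a < y := hay.lt_of_ne (by rintro rfl; exact h2.ne' ha0)
  have hyb : y < b := hyb.lt_of_ne (by rintro rfl; exact h2.ne' hb0)
  have hbh : b < hi := hbh.lt_of_ne (by rintro rfl; exact h3.ne hb0)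
  have hpos : ∀ t ∈ Set.Ioo a b, 0 < f.eval t := by
    intro t ht
    by_contra! hneg
    rcases le_total t y with h | h
    · obtain ⟨u, hu, hu0⟩ := intermediate_value_Icc h hc.continuousOn ⟨hneg, h2.le⟩
      have := hamax ⟨⟨hla.le.trans (ht.1.le.trans hu.1), hu.2⟩, hu0⟩
      exact absurd (ht.1.trans_le hu.1) (not_lt.2 this)
    · obtain ⟨u, hu, hu0⟩ := intermediate_value_Icc' h hc.continuousOn ⟨hneg, h2.le⟩
      have := hbmin ⟨⟨hu.1, hu.2.trans (ht.2.le.trans hbh.le)⟩, hu0⟩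
      exact absurd (hu.2.trans_lt ht.2) (not_lt.2 this)
  obtain ⟨f₁, hf₁⟩ := dvd_iff_isRoot.2 ha0
  have hab : a < b := hay.trans hyb
  have hb1 : f₁.IsRoot b := by
    have := hb0
    rw [hf₁, eval_mul, eval_sub, eval_X, eval_C] at this
    exact (mul_eq_zero.1 this).resolve_left (sub_ne_zero.2 hab.ne')
  obtain ⟨f₂, hf₂⟩ := dvd_iff_isRoot.2 hb1
  have hf : f = (X - C a) * (C b - X) * (-f₂) := by rw [hf₁, hf₂]; ring
  have hfe : ∀ t, f.eval t = (t - a) * (b - t) * (-f₂).eval t := fun t => by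
    conv_lhs => rw [hf]
    simp only [eval_mul, eval_sub, eval_X, eval_C]
  have hgc : Continuous fun t => (-f₂).eval t := (-f₂).continuous
  have hg0 : ∀ t ∈ Set.Ioo a b, 0 < (-f₂).eval t := fun t ht => by
    have h := hpos t ht
    rw [hfe] at h
    exact pos_of_mul_pos_right h (mul_nonneg (sub_nonneg.2 ht.1.le) (sub_nonneg.2 ht.2.le))
  have hgn : ∀ t ∈ Set.Icc a b, 0 ≤ (-f₂).eval t := by
    rw [← closure_Ioo hab.ne]
    exact fun t ht => closure_minimal (s := Set.Ioo a b) (t := {t | 0 ≤ (-f₂).eval t})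
      (fun t ht => (hg0 t ht).le) (isClosed_le continuous_const hgc) ht
  have hder : ∀ t, f.derivative.eval t = (a + b - 2 * t) * (-f₂).eval t
      + (t - a) * (b - t) * (derivative (-f₂)).eval t := fun t => by
    conv_lhs => rw [hf]
    simp only [derivative_mul, derivative_sub, derivative_X, derivative_C, eval_mul, eval_sub,
      eval_X, eval_C, eval_add, eval_one, eval_zero]
    ring
  have hga : 0 < (-f₂).eval a := by
    refine (hgn a ⟨le_rfl, hab.le⟩).lt_of_ne fun h0 => hs a ⟨hla, hab.trans hbh⟩ ha0 ?_
    rw [hder, ← h0]; ring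
  have hgb : 0 < (-f₂).eval b := by
    refine (hgn b ⟨hab.le, le_rfl⟩).lt_of_ne fun h0 => hs b ⟨hla.trans hab, hbh⟩ hb0 ?_
    rw [hder, ← h0]; ring
  refine ⟨a, b, -f₂, hla, hay, hyb, hbh, hf, fun t ht => ?_, ?_, ?_⟩
  · rcases ht.1.eq_or_lt with rfl | h
    · exact hga
    rcases ht.2.eq_or_lt with rfl | h'
    · exact hgb
    exact hg0 t ⟨h, h'⟩
  · filter_upwards [nhdsWithin_le_nhds (hgc.continuousAt.eventually_const_lt hga),
      self_mem_nhdsWithin] with t ht ht'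
    rw [hfe]
    have : t < a := ht'
    exact mul_neg_of_neg_of_pos (mul_neg_of_neg_of_pos (by linarith) (by linarith)) ht
  · filter_upwards [nhdsWithin_le_nhds (hgc.continuousAt.eventually_const_lt hgb),
      self_mem_nhdsWithin] with t ht ht'
    rw [hfe]
    have : b < t := ht'
    exact mul_neg_of_neg_of_pos (mul_neg_of_pos_of_neg (by linarith) (by linarith)) ht

end Roots

/-! ### Circular components of the block of equal magnetic coefficients -/

section Block
variable {s : ℝ} {κ : Fin (n / 2) → ℝ} {r : ℕ}

variable (s κ) in
/-- The squared sectorial velocity of the motion of the first `r` coordinate pairs. -/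
def blockSectorial (r : ℕ) (x : Phase n) : ℝ := sectorial (mask r (zc x)) (mask r (qc s κ x))

variable (s κ) in
/-- The circular components of the motion of the first `r` coordinate pairs. -/
structure IsBlockSplit (r : ℕ) (x : Phase n) (A B : Fin (n / 2) → ℂ) : Prop where
  split : IsSplit A B √(blockSectorial s κ r x)
  support : ∀ i : Fin (n / 2), ¬ (i : ℕ) < r → A i = 0 ∧ B i = 0
  momentum : ∀ a b : Fin (n / 2), (a : ℕ) < r → (b : ℕ) < r → momMat s κ x a b
    = 2 * I * √(blockSectorial s κ r x) * (conj (A a) * A b - conj (B a) * B b)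
  phases : ∀ y : Phase n, (∀ a b : Fin (n / 2), (a : ℕ) < r → (b : ℕ) < r →
      momMat s κ y a b = momMat s κ x a b) →
    blockSectorial s κ r y = blockSectorial s κ r x ∧ 0 < hsq (mask r (zc y)) ∧
    (hdot (mask r (zc y)) (mask r (qc s κ y))).im
      = (hdot (mask r (zc x)) (mask r (qc s κ x))).im ∧
    ∃ ζ η : ℂ, normSq ζ = 1 ∧ normSq η = 1 ∧
      (∀ i, mask r (zc y) i = √(hsq (mask r (zc y))) * (ζ * A i + η * B i)) ∧
      ∀ i, mask r (qc s κ y) i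
        = (((hdot (mask r (zc y)) (mask r (qc s κ y))).re / √(hsq (mask r (zc y))) : ℝ)
            + I * (√(blockSectorial s κ r x) / √(hsq (mask r (zc y))) : ℝ)) * (ζ * A i)
          + (((hdot (mask r (zc y)) (mask r (qc s κ y))).re / √(hsq (mask r (zc y))) : ℝ)
            + I * (-√(blockSectorial s κ r x) / √(hsq (mask r (zc y))) : ℝ)) * (η * B i)

lemma exists_block_split {x : Phase n} (hG : hgram (mask r (zc x)) (mask r (qc s κ x)) ≠ 0) :
    ∃ A B, IsBlockSplit s κ r x A B := by
  obtain ⟨A, B, hAB, hz, hq, h0⟩ := exists_split hG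
  have hρ : 0 < √(hsq (mask r (zc x))) := Real.sqrt_pos.2 (hsq_pos_of_hgram hG)
  have hN := split_momentum (A := A) (B := B) (z := mask r (zc x)) (q := mask r (qc s κ x))
    (c := √(sectorial (mask r (zc x)) (mask r (qc s κ x))))
    (v := (hdot (mask r (zc x)) (mask r (qc s κ x))).re / √(hsq (mask r (zc x)))) hρ (ζ := 1) (η := 1) (by simp)
    (by simp) (fun i => by rw [hz i, one_mul, one_mul]) (fun i => by rw [hq i, one_mul, one_mul])
  refine ⟨A, B, hAB, fun i hi => h0 i (mask_of_not_lt hi _) (mask_of_not_lt hi _),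
    fun a b ha hb => ?_, fun y hy => ?_⟩
  · rw [blockSectorial, ← hN, momMat_apply, mask_of_lt ha, mask_of_lt hb, mask_of_lt ha,
      mask_of_lt hb]
  · obtain ⟨h1, h2, h3, h4⟩ := exists_phases (z' := mask r (zc y)) (q' := mask r (qc s κ y)) hG hAB
      hN fun a b => by
        by_cases ha : (a : ℕ) < r
        · by_cases hb : (b : ℕ) < r
          · have := hy a b ha hb
            simpa only [momMat_apply, mask_of_lt ha, mask_of_lt hb] using this
          · simp only [mask_of_not_lt hb, mul_zero]
        · simp only [mask_of_not_lt ha, map_zero, zero_mul]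
    exact ⟨h2, hsq_pos_of_hgram (by rwa [h1]), h3, h4⟩

end Block

lemma exists_phase_angle {ζ : ℂ} (h : normSq ζ = 1) : ∃ θ : ℝ, exp ((θ : ℂ) * I) = ζ := by
  obtain ⟨θ, h1, h2⟩ := exists_angle (x := ζ.re) (y := ζ.im) (by rw [← h, normSq_apply]; ring)
  refine ⟨θ, ?_⟩
  rw [exp_mul_I, ← ofReal_cos, ← ofReal_sin, h1, h2, re_add_im]

lemma exists_torusPhase {l K : ℕ} (D : RotorData l) (p : (Fin K → ℝ) →L[ℝ] ℝ)
    {idx : Fin l → Fin K} (hidx : Function.Injective idx)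
    (hp : p = 0 ∨ ∃ i₀, p = ContinuousLinearMap.proj i₀ ∧ ∀ j, idx j ≠ i₀) (t : ℝ)
    (ht : p = 0 → t = 0) {ζ : Fin l → ℂ} (hζ : ∀ j, normSq (ζ j) = 1) :
    ∃ a : Fin K → ℝ, p a = t ∧ torusPhase D p idx a = ζ := by
  choose θ hθ using fun j => exists_phase_angle (hζ j)
  -- Outside the range of `idx` there is at most the radial angle that matters, which takes the
  -- default value t. The other angles solve 2 π a + σ(t) = θ.
  set a : Fin K → ℝ := Function.extend idx (fun j => (θ j - D.σ j t) / (2 * Real.pi)) fun _ => t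
  have h1 : ∀ j, a (idx j) = (θ j - D.σ j t) / (2 * Real.pi) := fun j => hidx.extend_apply ..
  have h2 : p a = t := by
    rcases hp with hp | ⟨i₀, rfl, hi⟩
    · rw [ht hp, hp]; rfl
    · rw [ContinuousLinearMap.proj_apply]
      exact Function.extend_apply' (f := idx) _ (fun _ => t) i₀ fun ⟨j, hj⟩ => hi j hj
  refine ⟨a, h2, funext fun j => ?_⟩
  rw [torusPhase, h2, h1, ← hθ j]
  congr 3
  field_simp
  ring

/-! ### Coordinates on level sets -/

section BlockSums
variable {m s : ℝ} {κ : Fin (n / 2) → ℝ} {r : ℕ} {κ₀ : ℝ}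

variable (s κ) in
/-- The virial of the motion of the first `r` coordinate pairs. -/
def blockVirial (r : ℕ) (x : Phase n) : ℝ := (hdot (mask r (zc x)) (mask r (qc s κ x))).re

variable (s κ) in
/-- The gauge momentum of the motion of the first `r` coordinate pairs. -/
def blockMomentum (r : ℕ) (x : Phase n) : ℝ := (hdot (mask r (zc x)) (mask r (qc s κ x))).im

/-- The radius square of the first `r` coordinate pairs. -/
def blockRadius (r : ℕ) (x : Phase n) : ℝ := hsq (mask r (zc x))

variable (s κ) in
/-- The kinetic energy of the gauge velocities of the first `r` coordinate pairs. -/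
def blockEnergy (r : ℕ) (x : Phase n) : ℝ := hsq (mask r (qc s κ x))

lemma blockSectorial_eq (r : ℕ) (x : Phase n) : blockSectorial s κ r x
    = blockRadius r x * blockEnergy s κ r x - blockVirial s κ r x ^ 2 := rfl

lemma hsq_mask (z : Fin (n / 2) → ℂ) :
    hsq (mask r z) = ∑ i : Fin (n / 2), if (i : ℕ) < r then normSq (z i) else 0 :=
  Finset.sum_congr rfl fun i _ => by rw [mask]; split_ifs <;> simp

lemma hdot_mask (z q : Fin (n / 2) → ℂ) :
    hdot (mask r z) (mask r q) = ∑ i : Fin (n / 2), if (i : ℕ) < r then conj (z i) * q i else 0 :=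
  Finset.sum_congr rfl fun i _ => by rw [mask, mask]; split_ifs <;> simp

lemma blockVirial_eq (x : Phase n) : blockVirial s κ r x
    = ∑ i : Fin (n / 2), if (i : ℕ) < r then (conj (zc x i) * qc s κ x i).re else 0 := by
  rw [blockVirial, hdot_mask, re_sum]
  exact Finset.sum_congr rfl fun i _ => by split_ifs <;> simp

lemma normSq_pc (s : ℝ) (κ : Fin (n / 2) → ℝ) (x : Phase n) (i : Fin (n / 2)) :
    normSq (pc x i) = normSq (qc s κ x i) + s ^ 2 * κ i ^ 2 / 4 * normSq (zc x i)
      - s * κ i * (conj (zc x i) * qc s κ x i).im := by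
  rw [pc_eq s κ]
  simp only [normSq_apply, sub_re, sub_im, mul_re, mul_im, I_re, I_im, ofReal_re, ofReal_im,
    conj_re, conj_im]
  ring

lemma block_normSq_pc (heq : ∀ i : Fin (n / 2), (i : ℕ) < r → κ i = κ₀) (x : Phase n) :
    (∑ i : Fin (n / 2), if (i : ℕ) < r then normSq (pc x i) else 0)
      = blockEnergy s κ r x + s ^ 2 * κ₀ ^ 2 / 4 * blockRadius r x
        - s * κ₀ * blockMomentum s κ r x := by
  rw [blockEnergy, blockRadius, blockMomentum, hsq_mask, hsq_mask, hdot_mask, im_sum,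
    Finset.mul_sum, Finset.mul_sum, ← Finset.sum_add_distrib, ← Finset.sum_sub_distrib]
  refine Finset.sum_congr rfl fun i _ => ?_
  split_ifs with h
  · rw [normSq_pc s κ, heq i h]
  · simp

lemma two_mul_hamiltonian (hm : m ≠ 0) (x : Phase n) :
    2 * m * hamiltonian m x = ∑ i, normSq (pc x i) + wp x ^ 2 := by
  rw [hamiltonian, mul_div_cancel₀ _ (by simpa using hm), dot_eq]
  simp only [cpx_snd, lastCoord_snd, ← sq]
  congr 1
  refine Finset.sum_congr rfl fun i _ => ?_
  rw [← normSq_eq_conj_mul_self, ofReal_re]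

lemma phi1_eq_normSq (x : Phase n) : phi1 x = ∑ i, normSq (zc x i) + wc x ^ 2 := by
  rw [phi1_eq, sq]
  congr 1
  refine Finset.sum_congr rfl fun i _ => ?_
  rw [← normSq_eq_conj_mul_self, ofReal_re]

lemma blockRadius_full (hfull : ∀ i : Fin (n / 2), (i : ℕ) < r) {x : Phase n}
    (hx : x ∈ cotangentSphere n) : blockRadius r x + wc x ^ 2 = 1 := by
  rw [← hx.1, phi1_eq_normSq, sum_of_full hfull, blockRadius, hsq_mask]

lemma blockVirial_full (hfull : ∀ i : Fin (n / 2), (i : ℕ) < r) {x : Phase n}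
    (hx : x ∈ cotangentSphere n) : blockVirial s κ r x + wc x * wp x = 0 := by
  rw [← hx.2, phi2_eq s κ, sum_of_full hfull, blockVirial_eq]

lemma hamiltonian_full (hm : m ≠ 0) (heq : ∀ i : Fin (n / 2), (i : ℕ) < r → κ i = κ₀)
    (hfull : ∀ i : Fin (n / 2), (i : ℕ) < r) (x : Phase n) :
    2 * m * hamiltonian m x = blockEnergy s κ r x + s ^ 2 * κ₀ ^ 2 / 4 * blockRadius r x
      - s * κ₀ * blockMomentum s κ r x + wp x ^ 2 := by
  rw [two_mul_hamiltonian hm, sum_of_full hfull, block_normSq_pc (s := s) heq]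

section Last
variable {L : Fin (n / 2)}

lemma blockRadius_last (hL : (L : ℕ) = r) (hlast : ∀ i : Fin (n / 2), (i : ℕ) < r ∨ i = L)
    (hn : n % 2 = 0) {x : Phase n} (hx : x ∈ cotangentSphere n) :
    blockRadius r x + normSq (zc x L) = 1 := by
  rw [← hx.1, phi1_eq_normSq, sum_of_last hL hlast, blockRadius, hsq_mask, wc_even hn]
  ring

lemma blockVirial_last (hL : (L : ℕ) = r) (hlast : ∀ i : Fin (n / 2), (i : ℕ) < r ∨ i = L)
    (hn : n % 2 = 0) {x : Phase n} (hx : x ∈ cotangentSphere n) :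
    blockVirial s κ r x + (conj (zc x L) * qc s κ x L).re = 0 := by
  rw [← hx.2, phi2_eq s κ, sum_of_last hL hlast, blockVirial_eq, wc_even hn]
  ring

lemma hamiltonian_last (hm : m ≠ 0) (heq : ∀ i : Fin (n / 2), (i : ℕ) < r → κ i = κ₀)
    (hL : (L : ℕ) = r) (hlast : ∀ i : Fin (n / 2), (i : ℕ) < r ∨ i = L) (hn : n % 2 = 0)
    (x : Phase n) :
    2 * m * hamiltonian m x = blockEnergy s κ r x + s ^ 2 * κ₀ ^ 2 / 4 * blockRadius r x
      - s * κ₀ * blockMomentum s κ r x + normSq (qc s κ x L)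
      + s ^ 2 * κ L ^ 2 / 4 * normSq (zc x L) - s * κ L * (conj (zc x L) * qc s κ x L).im := by
  rw [two_mul_hamiltonian hm, sum_of_last hL hlast, block_normSq_pc (s := s) heq, wp_even hn,
    normSq_pc s κ]
  ring

end Last
end BlockSums

/-! ### Rotors built on the two circular components, and the two-dimensional tori -/

section TwoFrame
variable {m s : ℝ} {κ : Fin (n / 2) → ℝ} {r : ℕ} {κ₀ : ℝ} {x : Phase n}
  {A B : Fin (n / 2) → ℂ}

lemma IsBlockSplit.momMat_eq (h : IsBlockSplit s κ r x A B) {y : Phase n} {ρ v : ℝ} {ζ η : ℂ}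
    (hρ : 0 < ρ) (hζ : normSq ζ = 1) (hη : normSq η = 1)
    (hz : ∀ i : Fin (n / 2), (i : ℕ) < r → zc y i = ρ * (ζ * A i + η * B i))
    (hq : ∀ i : Fin (n / 2), (i : ℕ) < r → qc s κ y i
      = (v + I * (√(blockSectorial s κ r x) / ρ : ℝ)) * (ζ * A i)
        + (v + I * (-√(blockSectorial s κ r x) / ρ : ℝ)) * (η * B i))
    {a b : Fin (n / 2)} (ha : (a : ℕ) < r) (hb : (b : ℕ) < r) :
    momMat s κ y a b = momMat s κ x a b := by
  rw [h.momentum a b ha hb, momMat_apply, hz a ha, hz b hb, hq a ha, hq b hb]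
  exact split_momentum hρ hζ hη (z := fun i => ρ * (ζ * A i + η * B i))
    (q := fun i => (v + I * (√(blockSectorial s κ r x) / ρ : ℝ)) * (ζ * A i)
        + (v + I * (-√(blockSectorial s κ r x) / ρ : ℝ)) * (η * B i))
    (fun _ => rfl) (fun _ => rfl) a b

lemma IsBlockSplit.isMagneticFrame (h : IsBlockSplit s κ r x A B)
    (heq : ∀ i : Fin (n / 2), (i : ℕ) < r → κ i = κ₀) :
    IsMagneticFrame κ ![A, B] fun _ => κ₀ where
  orth i j hij := by
    fin_cases i <;> fin_cases j
    · exact absurd rfl hij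
    · exact h.split.orth
    · change hdot B A = 0
      rw [← hdot_conj, h.split.orth, map_zero]
    · exact absurd rfl hij
  ne_zero j := by
    fin_cases j
    · exact h.split.left_ne
    · exact h.split.right_ne
  kappa j i := by
    by_cases hi : (i : ℕ) < r
    · rw [heq i hi]
    · have h0 : ![A, B] j i = 0 := by
        fin_cases j
        · exact (h.support i hi).1
        · exact (h.support i hi).2
      rw [h0, mul_zero, mul_zero]

lemma IsBlockSplit.rotor_momMat (h : IsBlockSplit s κ r x A B) {R V w π : ℝ} {ζ : Fin 2 → ℂ}
    (hR : 0 < R) (hζ : ∀ j, normSq (ζ j) = 1) {a b : Fin (n / 2)} (ha : (a : ℕ) < r)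
    (hb : (b : ℕ) < r) :
    momMat s κ (rotor s κ ![A, B] ![√(blockSectorial s κ r x), -√(blockSectorial s κ r x)]
      (fun _ => R) (fun _ => V) ζ w π) a b = momMat s κ x a b := by
  refine h.momMat_eq hR (hζ 0) (hζ 1) (v := V) (fun i _ => ?_) (fun i _ => ?_) ha hb
  · rw [zc_rotor]; simp [Fin.sum_univ_two]; ring
  · rw [qc_rotor]; simp [Fin.sum_univ_two]; ring

/-- Equality of the momentum matrices fixes the circular components up to phases, so any such point
is described by its radial data and two phases. -/
lemma IsBlockSplit.eq_rotor (h : IsBlockSplit s κ r x A B)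
    (hfull : ∀ i : Fin (n / 2), (i : ℕ) < r) {y : Phase n}
    (hy : ∀ a b : Fin (n / 2), (a : ℕ) < r → (b : ℕ) < r → momMat s κ y a b = momMat s κ x a b)
    {w π : ℝ} (hw : wc y = w) (hπ : wp y = π) :
    ∃ ζ : Fin 2 → ℂ, (∀ j, normSq (ζ j) = 1) ∧
      rotor s κ ![A, B] ![√(blockSectorial s κ r x), -√(blockSectorial s κ r x)]
        (fun _ => √(blockRadius r y)) (fun _ => blockVirial s κ r y / √(blockRadius r y)) ζ w π
        = y := by
  obtain ⟨-, -, -, ζ, η, hζ, hη, hz, hq⟩ := h.phases y hy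
  have hpar : n % 2 = 1 ∨ w = 0 ∧ π = 0 := by
    rcases Nat.mod_two_eq_zero_or_one n with h | h
    · exact Or.inr ⟨hw ▸ wc_even h y, hπ ▸ wp_even h y⟩
    · exact Or.inl h
  refine ⟨![ζ, η], fun j => by fin_cases j <;> assumption,
    phase_ext s κ (funext fun i => ?_) (funext fun i => ?_) ?_ ?_⟩
  · rw [← mask_of_lt (hfull i) (zc y), hz i, zc_rotor]
    simp [Fin.sum_univ_two, blockRadius]; ring
  · rw [← mask_of_lt (hfull i) (qc s κ y), hq i, qc_rotor]
    simp [Fin.sum_univ_two, blockRadius, blockVirial]; ring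
  · rw [wc_rotor hpar, hw]
  · rw [wp_rotor hpar, hπ]

/-- The angular momentum enters only through its square. The two components, with angular momenta
±c, therefore feel the same radial force and can keep a common radius. -/
lemma IsBlockSplit.swirl_mul (h : IsBlockSplit s κ r x A B) {R : ℝ} (hR : R ≠ 0) (j : Fin 2) :
    swirl s (fun _ => κ₀) ![√(blockSectorial s κ r x), -√(blockSectorial s κ r x)] (fun _ => R) j
      * ((![√(blockSectorial s κ r x), -√(blockSectorial s κ r x)] : Fin 2 → ℝ) j / R
        + s * κ₀ / 2 * R)
      = blockSectorial s κ r x / R ^ 2 - s ^ 2 * κ₀ ^ 2 / 4 * R ^ 2 := by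
  have hc := Real.sq_sqrt (Real.sqrt_pos.1 h.split.pos).le
  rw [swirl]
  generalize blockSectorial s κ r x = C at *
  have h1 : (![√C, -√C] : Fin 2 → ℝ) j ^ 2 = C := by fin_cases j <;> simp [hc]
  generalize (![√C, -√C] : Fin 2 → ℝ) j = e at *
  rw [← h1]
  field_simp
  ring

lemma IsBlockSplit.swirl_force (h : IsBlockSplit s κ r x A B) {R : ℝ} (hR : R ≠ 0) (j : Fin 2) :
    swirl s (fun _ => κ₀) ![√(blockSectorial s κ r x), -√(blockSectorial s κ r x)] (fun _ => R) j
      / m * ((![√(blockSectorial s κ r x), -√(blockSectorial s κ r x)] : Fin 2 → ℝ) j / R ^ 2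
        + s * κ₀ / 2)
      = (blockSectorial s κ r x / R ^ 2 - s ^ 2 * κ₀ ^ 2 / 4 * R ^ 2) / (m * R) := by
  rw [← h.swirl_mul hR j]
  field_simp

lemma IsBlockSplit.rotorMultiplier_eq (h : IsBlockSplit s κ r x A B) {R V π : ℝ} (hR : R ≠ 0) :
    rotorMultiplier m s ![A, B] (fun _ => κ₀)
        ![√(blockSectorial s κ r x), -√(blockSectorial s κ r x)] (fun _ => R) (fun _ => V) π
      = (-V ^ 2 - (blockSectorial s κ r x / R ^ 2 - s ^ 2 * κ₀ ^ 2 / 4 * R ^ 2) - π ^ 2) / m := by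
  have h1 : ∀ j, swirl s (fun _ => κ₀) ![√(blockSectorial s κ r x), -√(blockSectorial s κ r x)]
      (fun _ => R) j * (swirl s (fun _ => κ₀)
        ![√(blockSectorial s κ r x), -√(blockSectorial s κ r x)] (fun _ => R) j + s * κ₀ * R)
      = blockSectorial s κ r x / R ^ 2 - s ^ 2 * κ₀ ^ 2 / 4 * R ^ 2 := by
    intro j
    rw [← h.swirl_mul hR j]
    congr 1
    rw [swirl]; ring
  have h2 : hsq A = 1 - hsq B := by linarith [h.split.hsq_add]
  rw [rotorMultiplier]
  simp only [h1, Fin.sum_univ_two, Matrix.cons_val_zero, Matrix.cons_val_one, h2]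
  congr 1
  ring

/-- If all coordinates belong to the first `r` pairs, then the motions that are not in a complex
line are quasi-periodic on two-dimensional tori. -/
theorem tori_even (hm : m ≠ 0) (heq : ∀ i : Fin (n / 2), (i : ℕ) < r → κ i = κ₀)
    (hfull : ∀ i : Fin (n / 2), (i : ℕ) < r) (hn : n % 2 = 0) (hx : x ∈ cotangentSphere n)
    (hG : hgram (mask r (zc x)) (mask r (qc s κ x)) ≠ 0) :
    ∃ (Θ : (Fin 2 → ℝ) → Phase n) (freq : Fin 2 → ℝ),
      IsQuasiPeriodicIsotropicTorus m s κ Θ freq ∧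
      Set.range Θ = connectedComponentIn
        {y | y ∈ cotangentSphere n ∧ ∀ f ∈ integrals m s κ r, f y = f x} x := by
  obtain ⟨A, B, h⟩ := exists_block_split hG
  have hE := h.isMagneticFrame heq
  set c : Fin 2 → ℝ := ![√(blockSectorial s κ r x), -√(blockSectorial s κ r x)] with hc
  -- All coordinates belong to the block, so the radius is 1 and there is no radial motion: the two
  -- phases rotate uniformly at the kinetic angular velocities, and p = 0.
  let D : RotorData 2 := ⟨fun _ _ => 1, fun _ _ => 0, fun _ _ => 0, fun _ => 0, fun _ => 0⟩
  set freq : Fin 2 → ℝ := fun j => swirl s (fun _ => κ₀) c (fun _ => 1) j / (2 * Real.pi * m)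
    with hfreq
  have hD : D.IsPeriodic n :=
    ⟨fun _ => contDiff_const, fun _ => contDiff_const, fun _ => contDiff_const, contDiff_const,
      contDiff_const, fun _ _ => one_pos, fun _ _ => rfl, fun _ _ => rfl, fun _ _ => rfl,
      fun _ => rfl, fun _ => rfl, fun _ => Or.inr ⟨rfl, rfl⟩⟩
  have hS : D.IsSolution m s ![A, B] (fun _ => κ₀) c (0 : (Fin 2 → ℝ) →L[ℝ] ℝ) id freq := by
    refine ⟨fun t => ?_, fun t => ?_, fun j t => ?_, fun j t => ?_, fun j t => ?_, fun t => ?_,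
      fun t => ?_⟩
    · simpa [D, Fin.sum_univ_two] using h.split.hsq_add
    · simp [D]
    · simp [D]
    · simp only [D]
      rw [hc, h.rotorMultiplier_eq one_ne_zero, h.swirl_force one_ne_zero]
      simp
      ring
    · simp only [D, hfreq, id]
      simp
      field_simp
    · simp [D]
    · simp [D]
  have hT := isTorus_torusMap (n := n) 0 id hm hE hD hS (Or.inl ⟨rfl, fun i => ⟨i, rfl⟩⟩)
  have hsurj : ∀ y ∈ {y | y ∈ cotangentSphere n ∧ ∀ f ∈ integrals m s κ r, f y = f x},
      y ∈ Set.range (torusMap s κ ![A, B] c D 0 id) := by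
    rintro y ⟨hy, hyf⟩
    have hR := blockRadius_full hfull hy
    have hV := blockVirial_full (s := s) (κ := κ) hfull hy
    rw [wc_even hn, sq, zero_mul, add_zero] at hR
    rw [wc_even hn, zero_mul, add_zero] at hV
    obtain ⟨ζ, hζ, he⟩ := h.eq_rotor hfull
      (fun a b ha hb => momMat_eq_of_level heq hyf (Or.inl ⟨ha, hb⟩)) (wc_even hn y) (wp_even hn y)
    obtain ⟨a, -, ha⟩ := exists_torusPhase D (0 : (Fin 2 → ℝ) →L[ℝ] ℝ) Function.injective_id
      (Or.inl rfl) 0 (fun _ => rfl) hζ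
    refine ⟨a, ?_⟩
    rw [hR, hV, Real.sqrt_one, zero_div] at he
    rw [torusMap, ha, ← he]
  refine ⟨_, freq, hT, range_torusMap_eq heq hE hD hT (Or.inl rfl) (fun a i j hij => ?_)
    (hsurj x ⟨hx, fun _ _ => rfl⟩)
    fun y hy => hsurj y (connectedComponentIn_subset _ _ hy)⟩
  rw [torusMap]
  exact h.rotor_momMat one_pos (normSq_torusPhase D 0 id a)
    (hij.elim And.left fun _ => hfull i) (hij.elim And.right fun _ => hfull j)

end TwoFrame

/-! ### One unpaired coordinate: oscillation of the height -/

section Odd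
variable {m s : ℝ} {κ : Fin (n / 2) → ℝ} {r : ℕ} {κ₀ : ℝ} {x : Phase n}
  {A B : Fin (n / 2) → ℂ}

/-- The square of the momentum along the axis as a polynomial in the height. -/
def heightPoly (K e C : ℝ) : Polynomial ℝ :=
  (1 - Polynomial.X ^ 2) * Polynomial.C e - Polynomial.C C
    - Polynomial.C K * (1 - Polynomial.X ^ 2) ^ 2

lemma heightPoly_eval (K e C t : ℝ) :
    (heightPoly K e C).eval t = (1 - t ^ 2) * e - C - K * (1 - t ^ 2) ^ 2 := by
  simp [heightPoly]

lemma heightPoly_derivative (K e C t : ℝ) :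
    (heightPoly K e C).derivative.eval t = -2 * t * (e - 2 * K * (1 - t ^ 2)) := by
  simp [heightPoly, Polynomial.derivative_pow]; ring

/-- A double root is either at height 0, where the value is e - C - K, or a double root of the
underlying quadratic in 1 - t², whose discriminant is e² - 4 K C. -/
lemma heightPoly_simple {K e C : ℝ} (h1 : e - C - K ≠ 0) (h2 : e ^ 2 - 4 * K * C ≠ 0) {t : ℝ}
    (ht : (heightPoly K e C).eval t = 0) : (heightPoly K e C).derivative.eval t ≠ 0 := by
  intro h
  rw [heightPoly_eval] at ht
  rw [heightPoly_derivative] at h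
  rcases mul_eq_zero.1 h with h | h
  · have h0 : t = 0 := by linarith
    rw [h0] at ht
    exact h1 (by linarith)
  · refine h2 ?_
    have he : e = 2 * K * (1 - t ^ 2) := by linarith
    have hC : C = (1 - t ^ 2) * e - K * (1 - t ^ 2) ^ 2 := by linarith
    rw [hC, he]; ring

variable (s κ) in
/-- The kinetic energy of the gauge velocities, corrected by the magnetic potential. -/
def gaugeEnergy (κ₀ : ℝ) (r : ℕ) (x : Phase n) : ℝ :=
  blockEnergy s κ r x + s ^ 2 * κ₀ ^ 2 / 4 * blockRadius r x + wp x ^ 2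

/-- The constraints give the block radius square 1 - w² and the block virial -w π. Inserting these
into C = ρ · energy - virial² collects the terms in π² to π² (ρ + w²) = π². -/
lemma wp_sq_eq (hfull : ∀ i : Fin (n / 2), (i : ℕ) < r) (hx : x ∈ cotangentSphere n) :
    wp x ^ 2 = (heightPoly (s ^ 2 * κ₀ ^ 2 / 4) (gaugeEnergy s κ κ₀ r x)
      (blockSectorial s κ r x)).eval (wc x) := by
  have h1 := blockRadius_full hfull hx
  have h2 := blockVirial_full (s := s) (κ := κ) hfull hx
  rw [heightPoly_eval, gaugeEnergy, blockSectorial_eq, show 1 - wc x ^ 2 = blockRadius r x by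
    linarith, show blockVirial s κ r x = -(wc x * wp x) by linarith]
  linear_combination (-wp x ^ 2) * h1

/-- The radial data of motions with given height and momentum along the axis. -/
def heightData (y η : ℝ → ℝ) (σ : Fin 2 → ℝ → ℝ) : RotorData 2 where
  r _ t := √(1 - y t ^ 2)
  v _ t := -(y t * η t) / √(1 - y t ^ 2)
  σ := σ
  w := y
  π := η

lemma heightData_isPeriodic (hn : n % 2 = 1) {y η : ℝ → ℝ} {σ : Fin 2 → ℝ → ℝ}
    (hy : ContDiff ℝ ∞ y) (hη : ContDiff ℝ ∞ η) (hσ : ∀ j, ContDiff ℝ ∞ (σ j))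
    (hyp : ∀ t, y (t + 1) = y t) (hηp : ∀ t, η (t + 1) = η t) (hσp : ∀ j t, σ j (t + 1) = σ j t)
    (hpos : ∀ t, 0 < 1 - y t ^ 2) : (heightData y η σ).IsPeriodic n := by
  have hR : ContDiff ℝ ∞ fun t => √(1 - y t ^ 2) :=
    (contDiff_const.sub (hy.pow 2)).sqrt fun t => (hpos t).ne'
  refine ⟨fun _ => hR, fun _ => (hy.mul hη).neg.div hR fun t => (Real.sqrt_pos.2 (hpos t)).ne', hσ,
    hy, hη, fun _ t => Real.sqrt_pos.2 (hpos t), fun _ t => ?_, fun _ t => ?_, hσp, hyp, hηp,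
    fun _ => Or.inl hn⟩ <;>
  simp only [heightData, hyp, hηp]

lemma IsBlockSplit.heightData_isSolution (h : IsBlockSplit s κ r x A B) {T e : ℝ} (hm : m ≠ 0)
    (hT : T ≠ 0) {y η : ℝ → ℝ} {σ : Fin 2 → ℝ → ℝ} {M : Fin 2 → ℝ} (hpos : ∀ t, 0 < 1 - y t ^ 2)
    (hy : ∀ t, HasDerivAt y (T * (m⁻¹ * η t)) t)
    (hη : ∀ t, HasDerivAt η (T * (m⁻¹ * ((heightPoly (s ^ 2 * κ₀ ^ 2 / 4) e
      (blockSectorial s κ r x)).derivative.eval (y t) / 2))) t)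
    (hsq_eq : ∀ t, η t ^ 2
      = (heightPoly (s ^ 2 * κ₀ ^ 2 / 4) e (blockSectorial s κ r x)).eval (y t))
    (hσ : ∀ j t, HasDerivAt (σ j) (T * (swirl s (fun _ => κ₀)
      ![√(blockSectorial s κ r x), -√(blockSectorial s κ r x)] (fun _ => √(1 - y t ^ 2)) j
        / (m * √(1 - y t ^ 2))) - M j) t) :
    (heightData y η σ).IsSolution m s ![A, B] (fun _ => κ₀)
      ![√(blockSectorial s κ r x), -√(blockSectorial s κ r x)]
      (ContinuousLinearMap.proj 0 : (Fin 3 → ℝ) →L[ℝ] ℝ) Fin.succ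
      (Fin.cons T⁻¹ fun j => M j / (2 * Real.pi * T)) := by
  have hR0 : ∀ t, 0 < √(1 - y t ^ 2) := fun t => Real.sqrt_pos.2 (hpos t)
  have hRR : ∀ t, √(1 - y t ^ 2) ^ 2 = 1 - y t ^ 2 := fun t => Real.sq_sqrt (hpos t).le
  have hR : ∀ t, HasDerivAt (fun t => √(1 - y t ^ 2))
      (T * (m⁻¹ * (-(y t * η t) / √(1 - y t ^ 2)))) t := fun t => by
    refine ((((hy t).fun_pow 2).const_sub 1).sqrt (hpos t).ne').congr_deriv ?_
    simp
    field_simp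
  have hV : ∀ t, HasDerivAt (fun t => -(y t * η t) / √(1 - y t ^ 2)) _ t := fun t =>
    (((hy t).fun_mul (hη t)).fun_neg).fun_div (hR t) (hR0 t).ne'
  have hfreq : (ContinuousLinearMap.proj 0 : (Fin 3 → ℝ) →L[ℝ] ℝ)
      (Fin.cons T⁻¹ fun j => M j / (2 * Real.pi * T)) = T⁻¹ := rfl
  refine ⟨fun t => ?_, fun t => ?_, fun j t => ?_, fun j t => ?_, fun j t => ?_, fun t => ?_,
    fun t => ?_⟩
  · simp only [heightData, Fin.sum_univ_two, hRR, Matrix.cons_val_zero, Matrix.cons_val_one]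
    linear_combination (1 - y t ^ 2) * h.split.hsq_add
  · have h1 : √(1 - y t ^ 2) * (-(y t * η t) / √(1 - y t ^ 2)) = -(y t * η t) :=
      mul_div_cancel₀ _ (hR0 t).ne'
    simp only [heightData, Fin.sum_univ_two, h1, Matrix.cons_val_zero, Matrix.cons_val_one]
    linear_combination (-(y t * η t)) * h.split.hsq_add
  · simp only [heightData, hfreq, (hR t).deriv]
    field_simp
  · simp only [heightData, hfreq, (hV t).deriv]
    rw [h.swirl_force (hR0 t).ne', h.rotorMultiplier_eq (hR0 t).ne', heightPoly_derivative]
    have h1 := hsq_eq t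
    rw [heightPoly_eval] at h1
    have h2 := hRR t
    have h3 := (hR0 t).ne'
    have h4 : y t ^ 2 = 1 - √(1 - y t ^ 2) ^ 2 := by rw [h2]; ring
    have h5 : η t ^ 2 = √(1 - y t ^ 2) ^ 2 * e - blockSectorial s κ r x
        - s ^ 2 * κ₀ ^ 2 / 4 * (√(1 - y t ^ 2) ^ 2) ^ 2 := by rw [h1, h2]
    -- With the radius R as an independent variable, the equation of motion becomes a polynomial
    -- identity modulo the relations for y² and η².
    generalize √(1 - y t ^ 2) = R at *
    generalize blockSectorial s κ r x = C at *
    generalize y t = Y at *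
    generalize η t = N at *
    clear hR hV hy hη hsq_eq hσ hpos hR0 hRR
    rw [← h2]
    field_simp
    linear_combination (R ^ 2 * (4 * e - 2 * s ^ 2 * κ₀ ^ 2 * R ^ 2) - 4 * N ^ 2
      + 4 * R ^ 2 * N ^ 2) * h4 + (4 * R ^ 2 - 4) * h5
  · simp only [heightData, hfreq, (hσ j t).deriv, Fin.cons_succ]
    field_simp
    ring
  · simp only [heightData, hfreq, (hy t).deriv]
    field_simp
  · simp only [heightData, hfreq, (hη t).deriv]
    rw [h.rotorMultiplier_eq (hR0 t).ne', heightPoly_derivative]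
    have h1 := hsq_eq t
    rw [heightPoly_eval] at h1
    have h2 := hRR t
    have h3 := (hR0 t).ne'
    have h4 : y t ^ 2 = 1 - √(1 - y t ^ 2) ^ 2 := by rw [h2]; ring
    have h5 : η t ^ 2 = √(1 - y t ^ 2) ^ 2 * e - blockSectorial s κ r x
        - s ^ 2 * κ₀ ^ 2 / 4 * (√(1 - y t ^ 2) ^ 2) ^ 2 := by rw [h1, h2]
    generalize √(1 - y t ^ 2) = R at *
    generalize blockSectorial s κ r x = C at *
    generalize y t = Y at *
    generalize η t = N at *
    clear hR hV hy hη hsq_eq hσ hpos hR0 hRR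
    rw [← h2]
    field_simp
    linear_combination (4 * Y * N ^ 2) * h4 + 4 * Y * h5

/-- If exactly one coordinate does not belong to the first `r` pairs, then generic motions are
quasi-periodic on three-dimensional tori. -/
theorem tori_odd (hm : 0 < m) (heq : ∀ i : Fin (n / 2), (i : ℕ) < r → κ i = κ₀)
    (hfull : ∀ i : Fin (n / 2), (i : ℕ) < r) (hn : n % 2 = 1) (hx : x ∈ cotangentSphere n)
    (hG : hgram (mask r (zc x)) (mask r (qc s κ x)) ≠ 0) (hw : wp x ≠ 0)
    (h1 : gaugeEnergy s κ κ₀ r x - blockSectorial s κ r x - s ^ 2 * κ₀ ^ 2 / 4 ≠ 0)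
    (h2 : gaugeEnergy s κ κ₀ r x ^ 2 - 4 * (s ^ 2 * κ₀ ^ 2 / 4) * blockSectorial s κ r x ≠ 0) :
    ∃ (Θ : (Fin 3 → ℝ) → Phase n) (freq : Fin 3 → ℝ),
      IsQuasiPeriodicIsotropicTorus m s κ Θ freq ∧
      Set.range Θ = connectedComponentIn
        {y | y ∈ cotangentSphere n ∧ ∀ f ∈ integrals m s κ r, f y = f x} x := by
  obtain ⟨A, B, h⟩ := exists_block_split hG
  have hE := h.isMagneticFrame heq
  set C := blockSectorial s κ r x with hC
  have hC0 : 0 < C := Real.sqrt_pos.1 h.split.pos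
  set e := gaugeEnergy s κ κ₀ r x with he
  set f := heightPoly (s ^ 2 * κ₀ ^ 2 / 4) e C with hf
  -- The momentum matrix fixes C and the gauge momentum of the block, and H then fixes the corrected
  -- energy e. All points of the level set therefore lie over the same curve.
  have hlevel : ∀ y ∈ {y | y ∈ cotangentSphere n ∧ ∀ f ∈ integrals m s κ r, f y = f x},
      (∀ a b : Fin (n / 2), (a : ℕ) < r → (b : ℕ) < r → momMat s κ y a b = momMat s κ x a b) ∧
      wp y ^ 2 = f.eval (wc y) := by
    rintro y ⟨hy, hyf⟩
    have hmom : ∀ a b : Fin (n / 2), (a : ℕ) < r → (b : ℕ) < r →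
        momMat s κ y a b = momMat s κ x a b :=
      fun a b ha hb => momMat_eq_of_level heq hyf (Or.inl ⟨ha, hb⟩)
    refine ⟨hmom, ?_⟩
    obtain ⟨hsec, -, him, -⟩ := h.phases y hmom
    have hH := hyf _ hamiltonian_mem_integrals
    have h3 := hamiltonian_full (s := s) hm.ne' heq hfull x
    have h4 := hamiltonian_full (s := s) hm.ne' heq hfull y
    have h5 : blockMomentum s κ r y = blockMomentum s κ r x := him
    rw [hH, h5, h3] at h4
    rw [wp_sq_eq (s := s) (κ := κ) (κ₀ := κ₀) hfull hy, hsec]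
    have h6 : gaugeEnergy s κ κ₀ r y = e := by rw [he, gaugeEnergy, gaugeEnergy]; linarith
    rw [h6]
  have hradius := blockRadius_full hfull hx
  have hρ : 0 < blockRadius r x := hsq_pos_of_hgram hG
  have hwx := abs_lt.1 ((sq_lt_one_iff_abs_lt_one (wc x)).1 (by linarith))
  -- At the poles the polynomial equals -C, which is negative.
  have hend : ∀ t : ℝ, t ^ 2 = 1 → f.eval t < 0 := fun t ht => by
    rw [hf, heightPoly_eval, ht]; linarith
  obtain ⟨a, b, g, hla, hax, hxb, hbh, hfg, hgpos, hfa, hfb⟩ := exists_simple_roots hwx.1 hwx.2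
    (hend _ (by norm_num)) (by rw [← (hlevel x ⟨hx, fun _ _ => rfl⟩).2]; positivity)
    (hend _ (by norm_num)) fun t _ => heightPoly_simple h1 h2
  obtain ⟨T, y, η, hT, hys, hηs, hyd, hηd, hyp, hηp, hyη, hyI, hinj, hcov⟩ :=
    exists_oval (hax.trans hxb) (inv_pos.2 hm) hgpos hfg
  have hpos : ∀ t ∈ Set.Icc a b, 0 < 1 - t ^ 2 := fun t ht => by
    have := ht.1; have := ht.2; nlinarith
  set c : Fin 2 → ℝ := ![√C, -√C] with hc
  have hRs : ContDiff ℝ ∞ fun t => √(1 - y t ^ 2) :=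
    (contDiff_const.sub (hys.pow 2)).sqrt fun t => (hpos _ (hyI t)).ne'
  have hR0 : ∀ t, √(1 - y t ^ 2) ≠ 0 := fun t => (Real.sqrt_pos.2 (hpos _ (hyI t))).ne'
  -- The rates of the phases over one radial period: M gives the frequencies and σ the periodic
  -- corrections.
  choose σ M hσs hσp hσd using fun j : Fin 2 => exists_periodic_primitive
    (G := fun t => T * (swirl s (fun _ => κ₀) c (fun _ => √(1 - y t ^ 2)) j
      / (m * √(1 - y t ^ 2))))
    (contDiff_const.mul (((contDiff_const.div hRs hR0).sub (contDiff_const.mul hRs)).div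
      (contDiff_const.mul hRs) fun t => mul_ne_zero hm.ne' (hR0 t)))
    (fun t => by simp only [hyp])
  have hD := heightData_isPeriodic hn hys hηs hσs hyp hηp hσp fun t => hpos _ (hyI t)
  have hS := h.heightData_isSolution hm.ne' hT.ne' (fun t => hpos _ (hyI t)) hyd hηd hyη hσd
  have hp0 : (ContinuousLinearMap.proj 0 : (Fin 3 → ℝ) →L[ℝ] ℝ)
      (Fin.cons T⁻¹ fun j => M j / (2 * Real.pi * T)) ≠ 0 := (inv_pos.2 hT).ne'
  have hpne : (ContinuousLinearMap.proj 0 : (Fin 3 → ℝ) →L[ℝ] ℝ) ≠ 0 := fun h0 => by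
    rw [h0] at hp0; exact hp0 rfl
  have hTor := isTorus_torusMap (n := n) _ Fin.succ hm.ne' hE hD hS
    -- If height and axial momentum were both stationary, then η = 0 and f' = 0 at a root of f,
    -- contradicting simplicity.
    (Or.inr ⟨0, rfl, fun i hi => ⟨i.pred hi, Fin.succ_pred i hi⟩,
      fun t t' _ _ => hinj t t', fun t _ _ hw' hπ' => by
        have h3 : η t = 0 := by
          have : T * (m⁻¹ * η t) = 0 := (hyd t).deriv.symm.trans hw'
          simpa [hT.ne', hm.ne'] using this
        have h4 : f.derivative.eval (y t) = 0 := by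
          have : T * (m⁻¹ * (f.derivative.eval (y t) / 2)) = 0 := (hηd t).deriv.symm.trans hπ'
          simpa [hT.ne', hm.ne'] using this
        exact heightPoly_simple h1 h2 (by rw [← hf, ← hyη t, h3]; norm_num) h4⟩)
  have hsurj : ∀ z ∈ {y | y ∈ cotangentSphere n ∧ ∀ f ∈ integrals m s κ r, f y = f x},
      wc z ∈ Set.Icc a b → z ∈ Set.range (torusMap s κ ![A, B] c (heightData y η σ)
        (ContinuousLinearMap.proj 0 : (Fin 3 → ℝ) →L[ℝ] ℝ) Fin.succ) := by
    intro z hz hzI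
    obtain ⟨hmom, hwp⟩ := hlevel z hz
    obtain ⟨t, ht, ht'⟩ := hcov _ hzI _ hwp
    have hR := blockRadius_full hfull hz.1
    have hV := blockVirial_full (s := s) (κ := κ) hfull hz.1
    obtain ⟨ζ, hζ, hez⟩ := h.eq_rotor hfull hmom rfl rfl
    obtain ⟨a, hat, ha⟩ := exists_torusPhase (heightData y η σ) _ (Fin.succ_injective 2)
      (Or.inr ⟨0, rfl, Fin.succ_ne_zero⟩) t (fun h0 => absurd h0 hpne) hζ
    refine ⟨a, ?_⟩
    rw [torusMap, ha, hat, ← hez]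
    simp only [heightData, ht, ht']
    rw [show blockRadius r z = 1 - wc z ^ 2 by linarith,
      show blockVirial s κ r z = -(wc z * wp z) by linarith]
  refine ⟨_, _, hTor, range_torusMap_eq heq hE hD hTor (Or.inr hp0) (fun a i j hij => ?_)
    (hsurj x ⟨hx, fun _ _ => rfl⟩ ⟨hax.le, hxb.le⟩) fun z hz => ?_⟩
  · rw [torusMap]
    exact h.rotor_momMat (hD.r_pos 0 _) (normSq_torusPhase _ _ _ a)
      (hij.elim And.left fun _ => hfull i) (hij.elim And.right fun _ => hfull j)
  · exact hsurj z (connectedComponentIn_subset _ _ hz) (mem_Icc_of_mem_component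
      (contDiff_wc (n := n) (k := 0)).continuous (f := fun t => f.eval t)
      (fun z hz => by rw [← (hlevel z hz).2]; positivity) hfa hfb ⟨hax.le, hxb.le⟩ hz)

end Odd

/-! ### One extra pair: the cubic of the radial oscillation -/

section RadialPoly

/-- The square of the virial of a coordinate pair as a polynomial in its radius square. -/
def radialPoly (K K' e C l : ℝ) : Polynomial ℝ :=
  (1 - Polynomial.X) * Polynomial.X * Polynomial.C e - Polynomial.X * Polynomial.C C
    - Polynomial.C K * (1 - Polynomial.X) ^ 2 * Polynomial.X
    - (1 - Polynomial.X) * Polynomial.C l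
    - Polynomial.C K' * (1 - Polynomial.X) * Polynomial.X ^ 2

variable {K K' e C l : ℝ}

lemma radialPoly_eval (t : ℝ) : (radialPoly K K' e C l).eval t
    = (1 - t) * t * e - t * C - K * (1 - t) ^ 2 * t - (1 - t) * l - K' * (1 - t) * t ^ 2 := by
  simp [radialPoly, mul_comm t]

lemma radialPoly_derivative (t : ℝ) : (radialPoly K K' e C l).derivative.eval t
    = (1 - 2 * t) * e - C - K * ((1 - t) ^ 2 - 2 * t * (1 - t)) + l
      - K' * (2 * t - 3 * t ^ 2) := by
  simp [radialPoly, Polynomial.derivative_pow]; ring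

/-- For a cubic, the second order remainder is the square (u - t)² times a function affine in u. -/
lemma radialPoly_taylor (t u : ℝ) : (radialPoly K K' e C l).eval u
    = (radialPoly K K' e C l).eval t + (radialPoly K K' e C l).derivative.eval t * (u - t)
      + (u - t) ^ 2 * ((K' - K) * (u + 2 * t) - e + 2 * K - K') := by
  rw [radialPoly_eval, radialPoly_eval, radialPoly_derivative]; ring

/-- At a double root t the polynomial is (u - t)² times an affine function. Being negative at 0 and
at 1, the affine factor is negative in between, contradicting the positive value at u. So simplicity
needs no genericity condition beyond these signs. -/
lemma radialPoly_simple (h0 : (radialPoly K K' e C l).eval 0 < 0)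
    (h1 : (radialPoly K K' e C l).eval 1 < 0) {u : ℝ} (hu : u ∈ Set.Ioo (0 : ℝ) 1)
    (hpos : 0 < (radialPoly K K' e C l).eval u) {t : ℝ}
    (ht : (radialPoly K K' e C l).eval t = 0) : (radialPoly K K' e C l).derivative.eval t ≠ 0 := by
  intro ht'
  rw [radialPoly_taylor t, ht, ht'] at h0 h1 hpos
  have e0 : (K' - K) * (0 + 2 * t) - e + 2 * K - K' < 0 := by
    by_contra! h; nlinarith [mul_nonneg (sq_nonneg (0 - t)) h]
  have e1 : (K' - K) * (1 + 2 * t) - e + 2 * K - K' < 0 := by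
    by_contra! h; nlinarith [mul_nonneg (sq_nonneg (1 - t)) h]
  have e2 : 0 < (K' - K) * (u + 2 * t) - e + 2 * K - K' := by
    by_contra! h; nlinarith [mul_nonneg (sq_nonneg (u - t)) (neg_nonneg.2 h)]
  nlinarith [mul_pos (sub_pos.2 hu.2) (neg_pos.2 e0), mul_pos hu.1 (neg_pos.2 e1)]

/-- The radial equation of the block in terms of the radius square u of the extra pair. The large
bracket is m times the multiplier, and C / (1 - u) - K (1 - u) is the centrifugal term with its
magnetic correction. -/
lemma radialPoly_force_block {u N : ℝ} (hu : u ≠ 0) (hu' : 1 - u ≠ 0)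
    (hN : N = (radialPoly K K' e C l).eval u) :
    -(radialPoly K K' e C l).derivative.eval u - N / (1 - u)
      = ((-(N / (1 - u)) - (C / (1 - u) - K * (1 - u))) + (-(N / u) - (l / u - K' * u))) * (1 - u)
        + (C / (1 - u) - K * (1 - u)) := by
  rw [radialPoly_eval] at hN
  rw [radialPoly_derivative, hN]
  field_simp
  ring

lemma radialPoly_force_last {u N : ℝ} (hu : u ≠ 0) (hu' : 1 - u ≠ 0)
    (hN : N = (radialPoly K K' e C l).eval u) :
    (radialPoly K K' e C l).derivative.eval u - N / u
      = ((-(N / (1 - u)) - (C / (1 - u) - K * (1 - u))) + (-(N / u) - (l / u - K' * u))) * u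
        + (l / u - K' * u) := by
  rw [radialPoly_eval] at hN
  rw [radialPoly_derivative, hN]
  field_simp
  ring

end RadialPoly

section Swirl
variable {m s : ℝ} {l : ℕ} {k c r : Fin l → ℝ} {j : Fin l}

lemma swirl_mul_swirl (hr : r j ≠ 0) : swirl s k c r j * (swirl s k c r j + s * k j * r j)
    = c j ^ 2 / r j ^ 2 - s ^ 2 * k j ^ 2 / 4 * r j ^ 2 := by
  rw [swirl]; field_simp; ring

lemma swirl_eq_force (hr : r j ≠ 0) : swirl s k c r j / m * (c j / r j ^ 2 + s * k j / 2)
    = (c j ^ 2 / r j ^ 2 - s ^ 2 * k j ^ 2 / 4 * r j ^ 2) / (m * r j) := by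
  have : c j ^ 2 / r j ^ 2 - s ^ 2 * k j ^ 2 / 4 * r j ^ 2
      = swirl s k c r j * (c j / r j + s * k j / 2 * r j) := by rw [swirl]; field_simp; ring
  rw [this]; field_simp

end Swirl

/-! ### Rotors with two components in the block and one in an extra pair -/

section Last
variable {m s : ℝ} {κ : Fin (n / 2) → ℝ} {r : ℕ} {κ₀ : ℝ} {x : Phase n} {L : Fin (n / 2)}
  {A B : Fin (n / 2) → ℂ}

lemma normSq_conj_mul (z q : ℂ) : normSq z * normSq q = (conj z * q).re ^ 2 + (conj z * q).im ^ 2 := by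
  rw [← normSq_conj z, ← normSq_mul, normSq_apply]; ring

variable (s κ) in
/-- The kinetic energy of the gauge velocities, corrected by the magnetic potential. -/
def gaugeEnergyLast (κ₀ : ℝ) (r : ℕ) (L : Fin (n / 2)) (x : Phase n) : ℝ :=
  blockEnergy s κ r x + s ^ 2 * κ₀ ^ 2 / 4 * blockRadius r x + normSq (qc s κ x L)
    + s ^ 2 * κ L ^ 2 / 4 * normSq (zc x L)

/-- With u = |z_L|², the constraints give the block radius square 1 - u and opposite virials. The
relation |z_L|² |q_L|² = virial² + angular momentum² then eliminates the momenta from the energy. -/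
lemma virial_sq_eq (hL : (L : ℕ) = r) (hlast : ∀ i : Fin (n / 2), (i : ℕ) < r ∨ i = L)
    (hn : n % 2 = 0) (hx : x ∈ cotangentSphere n) :
    (conj (zc x L) * qc s κ x L).re ^ 2
      = (radialPoly (s ^ 2 * κ₀ ^ 2 / 4) (s ^ 2 * κ L ^ 2 / 4) (gaugeEnergyLast s κ κ₀ r L x)
        (blockSectorial s κ r x) ((conj (zc x L) * qc s κ x L).im ^ 2)).eval
          (normSq (zc x L)) := by
  have h1 := blockRadius_last hL hlast hn hx
  have h2 := blockVirial_last (s := s) (κ := κ) hL hlast hn hx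
  have h3 := normSq_conj_mul (zc x L) (qc s κ x L)
  rw [radialPoly_eval, gaugeEnergyLast, blockSectorial_eq, show 1 - normSq (zc x L)
    = blockRadius r x by linarith, show blockVirial s κ r x = -(conj (zc x L) * qc s κ x L).re by
    linarith]
  linear_combination (-(conj (zc x L) * qc s κ x L).re ^ 2) * h1 - blockRadius r x * h3

/-- The frame of a motion with two circular components in a block and one in an extra pair. -/
lemma IsBlockSplit.isMagneticFrame_last (h : IsBlockSplit s κ r x A B)
    (heq : ∀ i : Fin (n / 2), (i : ℕ) < r → κ i = κ₀) (hL : (L : ℕ) = r) :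
    IsMagneticFrame κ ![A, B, Pi.single L 1] ![κ₀, κ₀, κ L] := by
  have hLr : ¬ (L : ℕ) < r := by omega
  have hA : ∀ v : Fin (n / 2) → ℂ, hdot (Pi.single L 1) v = v L := fun v => by
    simp [hdot, Pi.single_apply, apply_ite]
  have hA' : ∀ v : Fin (n / 2) → ℂ, hdot v (Pi.single L 1) = conj (v L) := fun v => by
    rw [← hdot_conj, hA]
  have h2 := h.isMagneticFrame heq
  refine ⟨fun i j hij => ?_, fun j => ?_, fun j i => ?_⟩
  · have hBA : hdot B A = 0 := h2.orth 1 0 (by decide)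
    fin_cases i <;> fin_cases j <;> first
      | exact absurd rfl hij
      | simp [hA, hA', h.split.orth, hBA, h.support L hLr]
  · fin_cases j
    · exact h.split.left_ne
    · exact h.split.right_ne
    · simp
  · fin_cases j
    · exact h2.kappa 0 i
    · exact h2.kappa 1 i
    · by_cases hi : i = L
      · subst hi; rfl
      · simp [hi]

lemma hsq_single (L : Fin (n / 2)) : hsq (Pi.single L 1 : Fin (n / 2) → ℂ) = 1 := by
  rw [hsq, Finset.sum_eq_single L]
  · simp
  · intro i _ hi; simp [hi]
  · simp

lemma IsBlockSplit.rotor_momMat_last (h : IsBlockSplit s κ r x A B) (hL : (L : ℕ) = r)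
    (hlast : ∀ i : Fin (n / 2), (i : ℕ) < r ∨ i = L) {R V U W w π : ℝ} {ζ : Fin 3 → ℂ}
    (hR : 0 < R) (hU : 0 < U) (hζ : ∀ j, normSq (ζ j) = 1) {a b : Fin (n / 2)}
    (hab : ((a : ℕ) < r ∧ (b : ℕ) < r) ∨ a = b) :
    momMat s κ (rotor s κ ![A, B, Pi.single L 1] ![√(blockSectorial s κ r x),
      -√(blockSectorial s κ r x), (conj (zc x L) * qc s κ x L).im] ![R, R, U] ![V, V, W] ζ w π) a b
      = momMat s κ x a b := by
  have hLr : ¬ (L : ℕ) < r := by omega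
  have hz : ∀ i, zc (rotor s κ ![A, B, Pi.single L 1] ![√(blockSectorial s κ r x),
      -√(blockSectorial s κ r x), (conj (zc x L) * qc s κ x L).im] ![R, R, U] ![V, V, W] ζ w π) i
      = R * (ζ 0 * A i + ζ 1 * B i) + U * ζ 2 * (Pi.single L 1 : Fin (n / 2) → ℂ) i := by
    intro i; rw [zc_rotor]; simp [Fin.sum_univ_three]; ring
  have hq : ∀ i, qc s κ (rotor s κ ![A, B, Pi.single L 1] ![√(blockSectorial s κ r x),
      -√(blockSectorial s κ r x), (conj (zc x L) * qc s κ x L).im] ![R, R, U] ![V, V, W] ζ w π) i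
      = (V + I * (√(blockSectorial s κ r x) / R : ℝ)) * (ζ 0 * A i)
        + (V + I * (-√(blockSectorial s κ r x) / R : ℝ)) * (ζ 1 * B i)
        + (W + I * ((conj (zc x L) * qc s κ x L).im / U : ℝ)) * ζ 2
          * (Pi.single L 1 : Fin (n / 2) → ℂ) i := by
    intro i; rw [qc_rotor]; simp only [Fin.sum_univ_three]; simp; ring
  have h0 : ∀ i : Fin (n / 2), (i : ℕ) < r → (Pi.single L 1 : Fin (n / 2) → ℂ) i = 0 := by
    intro i hi
    rw [Pi.single_apply, if_neg]
    rintro rfl; exact hLr hi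
  have key : ∀ {a b : Fin (n / 2)}, (a : ℕ) < r → (b : ℕ) < r → momMat s κ _ a b
      = momMat s κ x a b := fun ha hb => h.momMat_eq hR (hζ 0) (hζ 1) (v := V)
    (fun i hi => by rw [hz, h0 i hi, mul_zero, add_zero])
    (fun i hi => by rw [hq, h0 i hi, mul_zero, add_zero]) ha hb
  rcases hab with ⟨ha, hb⟩ | rfl
  · exact key ha hb
  rcases hlast a with ha | rfl
  · exact key ha ha
  -- The diagonal entry of the extra pair is 2 i times its angular momentum, and the circular
  -- components vanish there.
  · rw [momMat_apply, momMat_apply, hz, hq, (h.support a hLr).1, (h.support a hLr).2]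
    have h3 : conj (qc s κ x a) * zc x a = conj (conj (zc x a) * qc s κ x a) := by simp [mul_comm]
    rw [h3, sub_conj]
    generalize (conj (zc x a) * qc s κ x a).im = l
    have hζ2 : conj (ζ 2) * ζ 2 = 1 := by rw [← normSq_eq_conj_mul_self, hζ, ofReal_one]
    have hU' : (U : ℂ) ≠ 0 := ofReal_ne_zero.2 hU.ne'
    simp only [Pi.single_eq_same, map_mul, map_add, conj_ofReal, conj_I, mul_zero, add_zero,
      zero_add, mul_one]
    push_cast
    field_simp
    linear_combination (2 * I * l) * hζ2

lemma IsBlockSplit.eq_rotor_last (h : IsBlockSplit s κ r x A B) (hL : (L : ℕ) = r)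
    (hlast : ∀ i : Fin (n / 2), (i : ℕ) < r ∨ i = L) (hn : n % 2 = 0) {y : Phase n}
    (hy : ∀ a b : Fin (n / 2), (a : ℕ) < r → (b : ℕ) < r → momMat s κ y a b = momMat s κ x a b)
    (hyL : (conj (zc y L) * qc s κ y L).im = (conj (zc x L) * qc s κ x L).im)
    (hy0 : 0 < normSq (zc y L)) :
    ∃ ζ : Fin 3 → ℂ, (∀ j, normSq (ζ j) = 1) ∧
      rotor s κ ![A, B, Pi.single L 1] ![√(blockSectorial s κ r x),
      -√(blockSectorial s κ r x), (conj (zc x L) * qc s κ x L).im]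
        ![√(blockRadius r y), √(blockRadius r y), √(normSq (zc y L))]
        ![blockVirial s κ r y / √(blockRadius r y), blockVirial s κ r y / √(blockRadius r y),
          (conj (zc y L) * qc s κ y L).re / √(normSq (zc y L))] ζ 0 0 = y := by
  obtain ⟨-, -, -, ζ, η, hζ, hη, hz, hq⟩ := h.phases y hy
  have hLr : ¬ (L : ℕ) < r := by omega
  have hU := Real.sqrt_pos.2 hy0
  have hUU := Real.sq_sqrt hy0.le
  have hUC : ((√(normSq (zc y L)) : ℝ) : ℂ) ≠ 0 := ofReal_ne_zero.2 hU.ne'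
  have h0 : ∀ i : Fin (n / 2), (i : ℕ) < r → (Pi.single L 1 : Fin (n / 2) → ℂ) i = 0 := by
    intro i hi
    rw [Pi.single_apply, if_neg]
    rintro rfl; exact hLr hi
  refine ⟨![ζ, η, zc y L / (√(normSq (zc y L)) : ℝ)], fun j => ?_,
    phase_ext s κ (funext fun i => ?_) (funext fun i => ?_) ?_ ?_⟩
  · fin_cases j
    · exact hζ
    · exact hη
    · change normSq (zc y L / (√(normSq (zc y L)) : ℝ)) = 1
      rw [normSq_div, normSq_ofReal, ← sq, hUU, div_self hy0.ne']
  · rw [zc_rotor]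
    rcases hlast i with hi | rfl
    · rw [← mask_of_lt hi (zc y), hz i]
      simp [Fin.sum_univ_three, blockRadius, h0 i hi]; ring
    · simp [Fin.sum_univ_three, h.support i hLr]
      field_simp
  · rw [qc_rotor, ← hyL]
    rcases hlast i with hi | rfl
    · rw [← mask_of_lt hi (qc s κ y), hq i]
      simp [Fin.sum_univ_three, blockRadius, blockVirial, h0 i hi]; ring
    · have h3 : (normSq (zc y i) : ℂ) = conj (zc y i) * zc y i := normSq_eq_conj_mul_self
      have h4 : ((√(normSq (zc y i)) : ℝ) : ℂ) ^ 2 = normSq (zc y i) := by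
        exact_mod_cast congrArg ofReal hUU
      have h5 : (((conj (zc y i) * qc s κ y i).re : ℝ) : ℂ)
          + I * ((conj (zc y i) * qc s κ y i).im : ℝ) = conj (zc y i) * qc s κ y i := by
        rw [mul_comm I]; exact re_add_im _
      simp only [Fin.sum_univ_three, Finset.sum_apply, Pi.smul_apply,
        Matrix.cons_val_zero, Matrix.cons_val_one, Matrix.cons_val, smul_eq_mul,
        (h.support i hLr).1, (h.support i hLr).2, mul_zero, zero_add, Pi.single_eq_same, mul_one]
      push_cast
      have h6 : (((conj (zc y i) * qc s κ y i).re : ℝ) : ℂ) / (√(normSq (zc y i)) : ℝ)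
          + I * (((conj (zc y i) * qc s κ y i).im : ℝ) / (√(normSq (zc y i)) : ℝ))
          = (conj (zc y i) * qc s κ y i) / (√(normSq (zc y i)) : ℝ) := by
        rw [← h5]; simp; ring
      rw [h6]
      field_simp
      rw [h4, h3]
      ring
  · rw [wc_rotor (Or.inr ⟨rfl, rfl⟩), wc_even hn]
  · rw [wp_rotor (Or.inr ⟨rfl, rfl⟩), wp_even hn]

end Last

section LastTori
variable {m s : ℝ} {κ : Fin (n / 2) → ℝ} {r : ℕ} {κ₀ : ℝ} {x : Phase n} {L : Fin (n / 2)}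
  {A B : Fin (n / 2) → ℂ}

/-- The radial data of motions with given radius square and virial in an extra coordinate pair. -/
def pairData (y η : ℝ → ℝ) (σ : Fin 3 → ℝ → ℝ) : RotorData 3 where
  r j t := (![√(1 - y t), √(1 - y t), √(y t)] : Fin 3 → ℝ) j
  v j t := (![-η t / √(1 - y t), -η t / √(1 - y t), η t / √(y t)] : Fin 3 → ℝ) j
  σ := σ
  w _ := 0
  π _ := 0

lemma pairData_pos {y η : ℝ → ℝ} {σ : Fin 3 → ℝ → ℝ} (hpos : ∀ t, 0 < y t)
    (hlt : ∀ t, 0 < 1 - y t) (j : Fin 3) (t : ℝ) : 0 < (pairData y η σ).r j t := by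
  fin_cases j
  · exact Real.sqrt_pos.2 (hlt t)
  · exact Real.sqrt_pos.2 (hlt t)
  · exact Real.sqrt_pos.2 (hpos t)

lemma pairData_r_smooth {y η : ℝ → ℝ} {σ : Fin 3 → ℝ → ℝ} (hy : ContDiff ℝ ∞ y)
    (hpos : ∀ t, 0 < y t) (hlt : ∀ t, 0 < 1 - y t) (j : Fin 3) :
    ContDiff ℝ ∞ ((pairData y η σ).r j) := by
  have hR : ContDiff ℝ ∞ fun t => √(1 - y t) :=
    (contDiff_const.sub hy).sqrt fun t => (hlt t).ne'
  fin_cases j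
  · exact hR
  · exact hR
  · exact hy.sqrt fun t => (hpos t).ne'

lemma pairData_isPeriodic {y η : ℝ → ℝ} {σ : Fin 3 → ℝ → ℝ}
    (hy : ContDiff ℝ ∞ y) (hη : ContDiff ℝ ∞ η) (hσ : ∀ j, ContDiff ℝ ∞ (σ j))
    (hyp : ∀ t, y (t + 1) = y t) (hηp : ∀ t, η (t + 1) = η t) (hσp : ∀ j t, σ j (t + 1) = σ j t)
    (hpos : ∀ t, 0 < y t) (hlt : ∀ t, 0 < 1 - y t) : (pairData y η σ).IsPeriodic n := by
  have hr := pairData_r_smooth (η := η) (σ := σ) hy hpos hlt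
  have hr0 := fun j t => (pairData_pos (η := η) (σ := σ) hpos hlt j t).ne'
  refine ⟨hr, fun j => ?_, hσ, contDiff_const, contDiff_const, pairData_pos hpos hlt,
    fun j t => ?_, fun j t => ?_, hσp, fun _ => rfl, fun _ => rfl, fun _ => Or.inr ⟨rfl, rfl⟩⟩
  · fin_cases j
    · exact hη.neg.div (hr 0) (hr0 0)
    · exact hη.neg.div (hr 1) (hr0 1)
    · exact hη.div (hr 2) (hr0 2)
  · simp only [pairData, hyp]
  · simp only [pairData, hyp, hηp]

lemma IsBlockSplit.rotorMultiplier_last (h : IsBlockSplit s κ r x A B) {R V U W l : ℝ}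
    (hR : R ≠ 0) (hU : U ≠ 0) :
    rotorMultiplier m s ![A, B, Pi.single L 1] ![κ₀, κ₀, κ L]
        ![√(blockSectorial s κ r x), -√(blockSectorial s κ r x), l] ![R, R, U] ![V, V, W] 0
      = ((-V ^ 2 - (blockSectorial s κ r x / R ^ 2 - s ^ 2 * κ₀ ^ 2 / 4 * R ^ 2))
        + (-W ^ 2 - (l ^ 2 / U ^ 2 - s ^ 2 * κ L ^ 2 / 4 * U ^ 2))) / m := by
  have hr : ∀ j : Fin 3, (![R, R, U] : Fin 3 → ℝ) j ≠ 0 := fun j => by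
    fin_cases j <;> assumption
  have hc := Real.sq_sqrt (Real.sqrt_pos.1 h.split.pos).le
  rw [rotorMultiplier]
  simp only [swirl_mul_swirl (hr _), Fin.sum_univ_three]
  simp [hc, hsq_single]
  congr 1
  linear_combination
    (-V ^ 2 - (blockSectorial s κ r x / R ^ 2 - s ^ 2 * κ₀ ^ 2 / 4 * R ^ 2)) * h.split.hsq_add

lemma pairData_r_deriv {T : ℝ} {y η : ℝ → ℝ} {σ : Fin 3 → ℝ → ℝ} (hm : m ≠ 0)
    (hpos : ∀ t, 0 < y t) (hlt : ∀ t, 0 < 1 - y t)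
    (hy : ∀ t, HasDerivAt y (T * (2 / m * η t)) t) (j : Fin 3) (t : ℝ) :
    HasDerivAt ((pairData y η σ).r j) (T * (m⁻¹ * (pairData y η σ).v j t)) t := by
  have h1 : HasDerivAt (fun t => √(1 - y t)) (T * (m⁻¹ * (-η t / √(1 - y t)))) t := by
    refine (((hy t).const_sub 1).sqrt (hlt t).ne').congr_deriv ?_
    have := (Real.sqrt_pos.2 (hlt t)).ne'
    field_simp
  fin_cases j
  · exact h1
  · exact h1
  · refine ((hy t).sqrt (hpos t).ne').congr_deriv ?_
    have := (Real.sqrt_pos.2 (hpos t)).ne'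
    simp only [pairData]
    change _ = T * (m⁻¹ * (η t / √(y t)))
    field_simp

/-- Quotient rule for a radial velocity N / R with R' = T N / (m R). The hypothesis is the equation
in the squared radius, the conclusion the one for the radius. -/
lemma radial_force {T R N D M F : ℝ} (hR : R ≠ 0) (hm : m ≠ 0)
    (h : D - N ^ 2 / R ^ 2 = M * R ^ 2 + F) :
    (T * (2 / m * (D / 2)) * R - N * (T * (m⁻¹ * (N / R)))) / R ^ 2
      = T * (M / m * R + F / (m * R)) := by
  have h1 : (T * (2 / m * (D / 2)) * R - N * (T * (m⁻¹ * (N / R)))) / R ^ 2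
      = T / (m * R) * (D - N ^ 2 / R ^ 2) := by field_simp
  rw [h1, h]; field_simp

lemma IsBlockSplit.pairData_v_deriv (h : IsBlockSplit s κ r x A B) {T e l : ℝ} (hm : m ≠ 0)
    {y η : ℝ → ℝ} {σ : Fin 3 → ℝ → ℝ} (hpos : ∀ t, 0 < y t) (hlt : ∀ t, 0 < 1 - y t)
    (hy : ∀ t, HasDerivAt y (T * (2 / m * η t)) t)
    (hη : ∀ t, HasDerivAt η (T * (2 / m * ((radialPoly (s ^ 2 * κ₀ ^ 2 / 4) (s ^ 2 * κ L ^ 2 / 4) e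
      (blockSectorial s κ r x) (l ^ 2)).derivative.eval (y t) / 2))) t)
    (hsq_eq : ∀ t, η t ^ 2 = (radialPoly (s ^ 2 * κ₀ ^ 2 / 4) (s ^ 2 * κ L ^ 2 / 4) e
      (blockSectorial s κ r x) (l ^ 2)).eval (y t)) (j : Fin 3) (t : ℝ) :
    HasDerivAt ((pairData y η σ).v j)
      (T * (rotorMultiplier m s ![A, B, Pi.single L 1] ![κ₀, κ₀, κ L]
          ![√(blockSectorial s κ r x), -√(blockSectorial s κ r x), l]
          (fun j => (pairData y η σ).r j t) (fun j => (pairData y η σ).v j t) 0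
            * (pairData y η σ).r j t
        + swirl s ![κ₀, κ₀, κ L] ![√(blockSectorial s κ r x), -√(blockSectorial s κ r x), l]
          (fun j => (pairData y η σ).r j t) j / m
          * ((![√(blockSectorial s κ r x), -√(blockSectorial s κ r x), l] : Fin 3 → ℝ) j
              / (pairData y η σ).r j t ^ 2
            + s * (![κ₀, κ₀, κ L] : Fin 3 → ℝ) j / 2))) t := by
  have hr0 := fun j t => (pairData_pos (η := η) (σ := σ) hpos hlt j t).ne'
  have hR0 : √(1 - y t) ≠ 0 := (Real.sqrt_pos.2 (hlt t)).ne'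
  have hU0 : √(y t) ≠ 0 := (Real.sqrt_pos.2 (hpos t)).ne'
  have hRR : √(1 - y t) ^ 2 = 1 - y t := Real.sq_sqrt (hlt t).le
  have hUU : √(y t) ^ 2 = y t := Real.sq_sqrt (hpos t).le
  have hc := Real.sq_sqrt (Real.sqrt_pos.1 h.split.pos).le
  have hmul := h.rotorMultiplier_last (m := m) (κ₀ := κ₀) (L := L) (V := -η t / √(1 - y t))
    (W := η t / √(y t)) (l := l) hR0 hU0
  rw [div_pow, div_pow, hRR, hUU, neg_sq] at hmul
  have hrd := pairData_r_deriv (σ := σ) hm hpos hlt hy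
  have hb := radialPoly_force_block (hpos t).ne' (hlt t).ne' (hsq_eq t)
  have hl := radialPoly_force_last (hpos t).ne' (hlt t).ne' (hsq_eq t)
  rw [swirl_eq_force (hr0 j t)]
  change HasDerivAt _ (T * (rotorMultiplier m s ![A, B, Pi.single L 1] ![κ₀, κ₀, κ L]
    ![√(blockSectorial s κ r x), -√(blockSectorial s κ r x), l]
    ![√(1 - y t), √(1 - y t), √(y t)] ![-η t / √(1 - y t), -η t / √(1 - y t), η t / √(y t)] 0 * _
      + _)) t
  rw [hmul]
  have hblock : HasDerivAt (fun t => -η t / √(1 - y t))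
      (T * (((-(η t ^ 2 / (1 - y t)) - (blockSectorial s κ r x / (1 - y t)
          - s ^ 2 * κ₀ ^ 2 / 4 * (1 - y t)))
        + (-(η t ^ 2 / y t) - (l ^ 2 / y t - s ^ 2 * κ L ^ 2 / 4 * y t))) / m * √(1 - y t)
        + (blockSectorial s κ r x / √(1 - y t) ^ 2 - s ^ 2 * κ₀ ^ 2 / 4 * √(1 - y t) ^ 2)
          / (m * √(1 - y t)))) t := by
    refine ((hη t).fun_neg.fun_div (hrd 0 t) hR0).congr_deriv ?_
    rw [← radial_force hR0 hm (D := -(radialPoly (s ^ 2 * κ₀ ^ 2 / 4) (s ^ 2 * κ L ^ 2 / 4) e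
      (blockSectorial s κ r x) (l ^ 2)).derivative.eval (y t)) (N := -η t)
      (by rw [hRR, neg_sq]; exact hb)]
    simp only [pairData, Matrix.cons_val_zero]
    ring
  have hlast : HasDerivAt (fun t => η t / √(y t))
      (T * (((-(η t ^ 2 / (1 - y t)) - (blockSectorial s κ r x / (1 - y t)
          - s ^ 2 * κ₀ ^ 2 / 4 * (1 - y t)))
        + (-(η t ^ 2 / y t) - (l ^ 2 / y t - s ^ 2 * κ L ^ 2 / 4 * y t))) / m * √(y t)
        + (l ^ 2 / √(y t) ^ 2 - s ^ 2 * κ L ^ 2 / 4 * √(y t) ^ 2) / (m * √(y t)))) t := by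
    refine ((hη t).fun_div (hrd 2 t) hU0).congr_deriv ?_
    rw [← radial_force hU0 hm (D := (radialPoly (s ^ 2 * κ₀ ^ 2 / 4) (s ^ 2 * κ L ^ 2 / 4) e
      (blockSectorial s κ r x) (l ^ 2)).derivative.eval (y t)) (N := η t) (by rw [hUU]; exact hl)]
    rfl
  fin_cases j
  · simpa only [pairData, Fin.zero_eta, Matrix.cons_val_zero, hc] using hblock
  · simpa only [pairData, Fin.mk_one, Matrix.cons_val_one, Matrix.cons_val_zero, neg_sq, hc]
      using hblock
  · simpa only [pairData, Fin.reduceFinMk, Matrix.cons_val] using hlast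

lemma IsBlockSplit.pairData_isSolution (h : IsBlockSplit s κ r x A B) {T e l : ℝ} (hm : m ≠ 0)
    (hT : T ≠ 0) {y η : ℝ → ℝ} {σ : Fin 3 → ℝ → ℝ} {M : Fin 3 → ℝ} (hpos : ∀ t, 0 < y t)
    (hlt : ∀ t, 0 < 1 - y t)
    (hy : ∀ t, HasDerivAt y (T * (2 / m * η t)) t)
    (hη : ∀ t, HasDerivAt η (T * (2 / m * ((radialPoly (s ^ 2 * κ₀ ^ 2 / 4) (s ^ 2 * κ L ^ 2 / 4) e
      (blockSectorial s κ r x) (l ^ 2)).derivative.eval (y t) / 2))) t)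
    (hsq_eq : ∀ t, η t ^ 2 = (radialPoly (s ^ 2 * κ₀ ^ 2 / 4) (s ^ 2 * κ L ^ 2 / 4) e
      (blockSectorial s κ r x) (l ^ 2)).eval (y t))
    (hσ : ∀ j t, HasDerivAt (σ j) (T * (swirl s ![κ₀, κ₀, κ L]
      ![√(blockSectorial s κ r x), -√(blockSectorial s κ r x), l]
      (fun j => (pairData y η σ).r j t) j / (m * (pairData y η σ).r j t)) - M j) t) :
    (pairData y η σ).IsSolution m s ![A, B, Pi.single L 1] ![κ₀, κ₀, κ L]
      ![√(blockSectorial s κ r x), -√(blockSectorial s κ r x), l]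
      (ContinuousLinearMap.proj 0 : (Fin 4 → ℝ) →L[ℝ] ℝ) Fin.succ
      (Fin.cons T⁻¹ fun j => M j / (2 * Real.pi * T)) := by
  have hr0 := fun j t => (pairData_pos (η := η) (σ := σ) hpos hlt j t).ne'
  have hfreq : (ContinuousLinearMap.proj 0 : (Fin 4 → ℝ) →L[ℝ] ℝ)
      (Fin.cons T⁻¹ fun j => M j / (2 * Real.pi * T)) = T⁻¹ := rfl
  refine ⟨fun t => ?_, fun t => ?_, fun j t => ?_, fun j t => ?_, fun j t => ?_, fun t => ?_,
    fun t => ?_⟩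
  · simp [pairData, Fin.sum_univ_three, Real.sq_sqrt (hlt t).le, Real.sq_sqrt (hpos t).le,
      hsq_single]
    linear_combination (1 - y t) * h.split.hsq_add
  · have h1 : √(1 - y t) * (-η t / √(1 - y t)) = -η t :=
      mul_div_cancel₀ _ (Real.sqrt_pos.2 (hlt t)).ne'
    have h2 : √(y t) * (η t / √(y t)) = η t := mul_div_cancel₀ _ (Real.sqrt_pos.2 (hpos t)).ne'
    simp [pairData, Fin.sum_univ_three, h1, h2, hsq_single]
    linear_combination (-η t) * h.split.hsq_add
  · rw [hfreq, (pairData_r_deriv hm hpos hlt hy j t).deriv, inv_mul_cancel_left₀ hT]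
  · rw [hfreq, (h.pairData_v_deriv hm hpos hlt hy hη hsq_eq j t).deriv, inv_mul_cancel_left₀ hT]
    rfl
  · have h1 : deriv ((pairData y η σ).σ j) t = _ := (hσ j t).deriv
    rw [hfreq, h1, Fin.cons_succ]
    have := hr0 j t
    field_simp
    ring
  · simp [pairData]
  · simp [pairData]

end LastTori

section LastTheorem
variable {m s : ℝ} {κ : Fin (n / 2) → ℝ} {r : ℕ} {κ₀ : ℝ} {x : Phase n} {L : Fin (n / 2)}

/-- If exactly one coordinate pair does not belong to the first `r` pairs, then generic motions are
quasi-periodic on four-dimensional tori. -/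
theorem tori_last (hm : 0 < m) (heq : ∀ i : Fin (n / 2), (i : ℕ) < r → κ i = κ₀)
    (hL : (L : ℕ) = r) (hlast : ∀ i : Fin (n / 2), (i : ℕ) < r ∨ i = L) (hn : n % 2 = 0)
    (hx : x ∈ cotangentSphere n) (hG : hgram (mask r (zc x)) (mask r (qc s κ x)) ≠ 0)
    (hre : (conj (zc x L) * qc s κ x L).re ≠ 0) (him : (conj (zc x L) * qc s κ x L).im ≠ 0) :
    ∃ (Θ : (Fin 4 → ℝ) → Phase n) (freq : Fin 4 → ℝ),
      IsQuasiPeriodicIsotropicTorus m s κ Θ freq ∧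
      Set.range Θ = connectedComponentIn
        {y | y ∈ cotangentSphere n ∧ ∀ f ∈ integrals m s κ r, f y = f x} x := by
  obtain ⟨A, B, h⟩ := exists_block_split hG
  have hE := h.isMagneticFrame_last heq hL
  set C := blockSectorial s κ r x with hC
  have hC0 : 0 < C := Real.sqrt_pos.1 h.split.pos
  set e := gaugeEnergyLast s κ κ₀ r L x with he
  set l := (conj (zc x L) * qc s κ x L).im with hl
  set f := radialPoly (s ^ 2 * κ₀ ^ 2 / 4) (s ^ 2 * κ L ^ 2 / 4) e C (l ^ 2) with hf
  have hlevel : ∀ y ∈ {y | y ∈ cotangentSphere n ∧ ∀ f ∈ integrals m s κ r, f y = f x},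
      (∀ a b : Fin (n / 2), (a : ℕ) < r → (b : ℕ) < r → momMat s κ y a b = momMat s κ x a b) ∧
      (conj (zc y L) * qc s κ y L).im = l ∧
      (conj (zc y L) * qc s κ y L).re ^ 2 = f.eval (normSq (zc y L)) := by
    rintro y ⟨hy, hyf⟩
    have hmom : ∀ a b : Fin (n / 2), (a : ℕ) < r → (b : ℕ) < r →
        momMat s κ y a b = momMat s κ x a b :=
      fun a b ha hb => momMat_eq_of_level heq hyf (Or.inl ⟨ha, hb⟩)
    have hyl : (conj (zc y L) * qc s κ y L).im = l := by
      have h1 := momMat_eq_of_level heq hyf (a := L) (b := L) (Or.inr rfl)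
      have h2 : ∀ z q : ℂ, conj q * z = conj (conj z * q) := fun z q => by simp [mul_comm]
      rw [momMat_apply, momMat_apply, h2 (zc y L), h2 (zc x L), sub_conj, sub_conj] at h1
      have h3 := ofReal_inj.1 (mul_right_cancel₀ I_ne_zero h1)
      rw [hl]; linarith
    refine ⟨hmom, hyl, ?_⟩
    obtain ⟨hsec, -, hbm, -⟩ := h.phases y hmom
    have hH := hyf _ hamiltonian_mem_integrals
    have h3 := hamiltonian_last (s := s) hm.ne' heq hL hlast hn x
    have h4 := hamiltonian_last (s := s) hm.ne' heq hL hlast hn y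
    have h5 : blockMomentum s κ r y = blockMomentum s κ r x := hbm
    rw [hH, h5, h3, hyl] at h4
    rw [virial_sq_eq (s := s) (κ := κ) (κ₀ := κ₀) hL hlast hn hy, hsec, hyl]
    have h6 : gaugeEnergyLast s κ κ₀ r L y = e := by
      rw [he, gaugeEnergyLast, gaugeEnergyLast]; linarith
    rw [h6]
  -- The nonzero angular momentum of the extra pair keeps it away from the origin on the whole level
  -- set, so its phase is always defined.
  have hz0 : ∀ y : Phase n, (conj (zc y L) * qc s κ y L).im = l → 0 < normSq (zc y L) :=
    fun y hy => normSq_pos.2 fun h0 => him (by rw [← hy, h0]; simp)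
  have hradius := blockRadius_last hL hlast hn hx
  have hρ : 0 < blockRadius r x := hsq_pos_of_hgram hG
  have hu0 := hz0 x rfl
  have hu1 : normSq (zc x L) < 1 := by linarith
  -- The value at 0 is minus the square of the angular momentum of the extra pair, the value at 1 is
  -- -C: neither the pair nor the block can collapse.
  have hf0 : f.eval 0 < 0 := by
    rw [hf, radialPoly_eval]; have := sq_pos_of_ne_zero him; linarith
  have hf1 : f.eval 1 < 0 := by rw [hf, radialPoly_eval]; linarith
  have hfx : 0 < f.eval (normSq (zc x L)) := by
    rw [← (hlevel x ⟨hx, fun _ _ => rfl⟩).2.2]; positivity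
  have hsimple : ∀ t, f.eval t = 0 → f.derivative.eval t ≠ 0 :=
    fun t => radialPoly_simple hf0 hf1 ⟨hu0, hu1⟩ hfx
  obtain ⟨a, b, g, hla, hax, hxb, hbh, hfg, hgpos, hfa, hfb⟩ :=
    exists_simple_roots hu0 hu1 hf0 hfx hf1 fun t _ => hsimple t
  obtain ⟨T, y, η, hT, hys, hηs, hyd, hηd, hyp, hηp, hyη, hyI, hinj, hcov⟩ :=
    exists_oval (hax.trans hxb) (div_pos two_pos hm) hgpos hfg
  have hpos : ∀ t, 0 < y t := fun t => hla.trans_le (hyI t).1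
  have hlt : ∀ t, 0 < 1 - y t := fun t => by linarith [(hyI t).2]
  set c : Fin 3 → ℝ := ![√C, -√C, l] with hc
  set k : Fin 3 → ℝ := ![κ₀, κ₀, κ L] with hk
  have hrs := fun σ => pairData_r_smooth (η := η) (σ := σ) hys hpos hlt
  have hr0 := fun σ j t => (pairData_pos (η := η) (σ := σ) hpos hlt j t).ne'
  choose σ M hσs hσp hσd using fun j : Fin 3 => exists_periodic_primitive
    (G := fun t => T * (swirl s k c (fun j => (pairData y η 0).r j t) j
      / (m * (pairData y η 0).r j t)))
    (contDiff_const.mul (((contDiff_const.div (hrs 0 j) (hr0 0 j)).sub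
      (contDiff_const.mul (hrs 0 j))).div
      (contDiff_const.mul (hrs 0 j)) fun t => mul_ne_zero hm.ne' (hr0 0 j t)))
    (fun t => by simp only [pairData, hyp])
  have hD : (pairData y η σ).IsPeriodic n :=
    pairData_isPeriodic hys hηs hσs hyp hηp hσp hpos hlt
  have hS := h.pairData_isSolution (σ := σ) (L := L) hm.ne' hT.ne' hpos hlt hyd hηd hyη hσd
  have hp0 : (ContinuousLinearMap.proj 0 : (Fin 4 → ℝ) →L[ℝ] ℝ)
      (Fin.cons T⁻¹ fun j => M j / (2 * Real.pi * T)) ≠ 0 := (inv_pos.2 hT).ne'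
  have hpne : (ContinuousLinearMap.proj 0 : (Fin 4 → ℝ) →L[ℝ] ℝ) ≠ 0 := fun h0 => by
    rw [h0] at hp0; exact hp0 rfl
  have hU0 : ∀ t, √(y t) ≠ 0 := fun t => (Real.sqrt_pos.2 (hpos t)).ne'
  have hTor := isTorus_torusMap (n := n) _ Fin.succ hm.ne' hE hD hS
    (Or.inr ⟨0, rfl, fun i hi => ⟨i.pred hi, Fin.succ_pred i hi⟩,
      fun t t' hr hv _ _ => by
        have h3 : √(y t) = √(y t') := hr 2
        have h4 : η t / √(y t) = η t' / √(y t') := hv 2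
        refine hinj t t' ((Real.sqrt_inj (hpos t).le (hpos t').le).1 h3) ?_
        rw [h3] at h4
        exact (div_left_inj' (hU0 t')).1 h4,
      -- Stationary radius and radial velocity of the extra pair give η = 0 and f' = 0, a double
      -- root of f.
      fun t hr hv _ _ => by
        have h3 : T * (m⁻¹ * (η t / √(y t))) = 0 :=
          (pairData_r_deriv (σ := σ) hm.ne' hpos hlt hyd 2 t).deriv.symm.trans (hr 2)
        have h4 : η t = 0 := by simpa [hT.ne', hm.ne', hU0 t] using h3
        have h5 : HasDerivAt ((pairData y η σ).v 2) _ t :=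
          (hηd t).fun_div (pairData_r_deriv (σ := σ) hm.ne' hpos hlt hyd 2 t) (hU0 t)
        have h6 := h5.deriv.symm.trans (hv 2)
        rw [h4, zero_mul, sub_zero] at h6
        have h7 : f.derivative.eval (y t) = 0 := by
          simpa [hT.ne', hm.ne', hU0 t] using h6
        exact hsimple (y t) (by rw [← hyη t, h4]; norm_num) h7⟩)
  have hsurj : ∀ z ∈ {y | y ∈ cotangentSphere n ∧ ∀ f ∈ integrals m s κ r, f y = f x},
      normSq (zc z L) ∈ Set.Icc a b →
      z ∈ Set.range (torusMap s κ ![A, B, Pi.single L 1] c (pairData y η σ)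
        (ContinuousLinearMap.proj 0 : (Fin 4 → ℝ) →L[ℝ] ℝ) Fin.succ) := by
    intro z hz hzI
    obtain ⟨hmom, hzl, hre⟩ := hlevel z hz
    obtain ⟨t, ht, ht'⟩ := hcov _ hzI _ hre
    have hR := blockRadius_last hL hlast hn hz.1
    have hV := blockVirial_last (s := s) (κ := κ) hL hlast hn hz.1
    obtain ⟨ζ, hζ, hez⟩ := h.eq_rotor_last hL hlast hn hmom hzl (hz0 z hzl)
    obtain ⟨a, hat, ha⟩ := exists_torusPhase (pairData y η σ) _ (Fin.succ_injective 3)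
      (Or.inr ⟨0, rfl, Fin.succ_ne_zero⟩) t (fun h0 => absurd h0 hpne) hζ
    refine ⟨a, ?_⟩
    rw [torusMap, ha, hat]
    rw [show blockRadius r z = 1 - normSq (zc z L) by linarith,
      show blockVirial s κ r z = -(conj (zc z L) * qc s κ z L).re by linarith, ← ht, ← ht'] at hez
    exact hez
  refine ⟨_, _, hTor, range_torusMap_eq heq hE hD hTor (Or.inr hp0) (fun a i j hij => ?_)
    (hsurj x ⟨hx, fun _ _ => rfl⟩ ⟨hax.le, hxb.le⟩) fun z hz => ?_⟩
  · exact h.rotor_momMat_last hL hlast (Real.sqrt_pos.2 (hlt _)) (Real.sqrt_pos.2 (hpos _))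
      (normSq_torusPhase _ _ _ a) hij
  · exact hsurj z (connectedComponentIn_subset _ _ hz) (mem_Icc_of_mem_component
      (contDiff_normSq (d := 0) (contDiff_zc L)).continuous (f := fun t => f.eval t)
      (fun z hz => by rw [← (hlevel z hz).2.2]; positivity) hfa hfb ⟨hax.le, hxb.le⟩ hz)

end LastTheorem

/-! ### Generic motions -/

section Generic
variable {m s : ℝ} {κ : Fin (n / 2) → ℝ} {r : ℕ} {κ₀ : ℝ}

lemma contDiff_gaugeEnergy {d : WithTop ℕ∞} : ContDiff ℝ d (gaugeEnergy (n := n) s κ κ₀ r) :=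
  ((contDiff_hsq (contDiff_mask (contDiff_qc s κ) r)).add
    (contDiff_const.mul (contDiff_hsq (contDiff_mask contDiff_zc r)))).add (contDiff_wp.pow 2)

lemma contDiff_blockSectorial {d : WithTop ℕ∞} : ContDiff ℝ d (blockSectorial (n := n) s κ r) :=
  ((contDiff_hsq (contDiff_mask contDiff_zc r)).mul
    (contDiff_hsq (contDiff_mask (contDiff_qc s κ) r))).sub
    ((contDiff_re (contDiff_hdot (contDiff_mask contDiff_zc r)
      (contDiff_mask (contDiff_qc s κ) r))).pow 2)

lemma gaugeEnergy_neg (x : Phase n) : gaugeEnergy s κ κ₀ r (-x) = gaugeEnergy s κ κ₀ r x := by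
  simp only [gaugeEnergy, blockEnergy, blockRadius, map_neg, mask_neg, hsq_neg, neg_sq]

lemma blockSectorial_neg (x : Phase n) : blockSectorial s κ r (-x) = blockSectorial s κ r x := by
  simp only [blockSectorial, sectorial, map_neg, mask_neg, hsq_neg, hdot_neg_left, hdot_neg_right,
    neg_neg]

lemma holdsGenerically_height (heq : ∀ i : Fin (n / 2), (i : ℕ) < r → κ i = κ₀) (hr : 0 < r)
    (hn : n % 2 = 1) (h1 : 0 < n / 2) :
    HoldsGenerically fun x : Phase n =>
      gaugeEnergy s κ κ₀ r x - blockSectorial s κ r x - s ^ 2 * κ₀ ^ 2 / 4 ≠ 0 ∧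
      gaugeEnergy s κ κ₀ r x ^ 2 - 4 * (s ^ 2 * κ₀ ^ 2 / 4) * blockSectorial s κ r x ≠ 0 := by
  set i : Fin (n / 2) := ⟨0, h1⟩ with hi
  -- Position in the first pair, kinetic momentum along the axis. With K = s² κ₀² / 4 the energy is
  -- 2 K + 1 and C = K, so the two expressions take the values 1 and 4 K + 1.
  have hmem : twoPoint i i 1 1 0 0 0 1 ∈ cotangentSphere n :=
    onePoint_mem hn (by norm_num) (by norm_num)
  have hir : (i : ℕ) < r := hr
  have hz : mask r (zc (twoPoint i i 1 1 0 0 0 1)) = Pi.single i 1 := by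
    funext j
    by_cases hj : (j : ℕ) < r
    · rw [mask_of_lt hj, zc_twoPoint, Pi.single_apply]; split_ifs <;> rfl
    · rw [mask_of_not_lt hj, Pi.single_apply, if_neg]
      rintro rfl; exact hj hir
  have hq : mask r (qc s κ (twoPoint i i 1 1 0 0 0 1))
      = (I * (s * κ₀ / 2 : ℝ)) • (Pi.single i 1 : Fin (n / 2) → ℂ) := by
    funext j
    by_cases hj : (j : ℕ) < r
    · rw [mask_of_lt hj, qc_twoPoint, Pi.smul_apply, Pi.single_apply, heq j hj]
      split_ifs <;> simp
    · rw [mask_of_not_lt hj, Pi.smul_apply, Pi.single_apply, if_neg, smul_zero]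
      rintro rfl; exact hj hir
  have hw : wp (twoPoint i i 1 1 0 0 0 1) = 1 := wp_ofCoord hn
  have hqq : hsq ((I * (s * κ₀ / 2 : ℝ)) • (Pi.single i 1 : Fin (n / 2) → ℂ))
      = s ^ 2 * κ₀ ^ 2 / 4 := by
    have : ∀ (t : ℂ) (v : Fin (n / 2) → ℂ), hsq (t • v) = normSq t * hsq v := fun t v => by
      simp only [hsq, Pi.smul_apply, smul_eq_mul, normSq_mul, Finset.mul_sum]
    rw [this, hsq_single, normSq_mul, normSq_I, normSq_ofReal]; ring
  have he : gaugeEnergy s κ κ₀ r (twoPoint i i 1 1 0 0 0 1) = 2 * (s ^ 2 * κ₀ ^ 2 / 4) + 1 := by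
    rw [gaugeEnergy, blockEnergy, blockRadius, hz, hq, hqq, hsq_single, hw]; ring
  have hs : blockSectorial s κ r (twoPoint i i 1 1 0 0 0 1) = s ^ 2 * κ₀ ^ 2 / 4 := by
    rw [blockSectorial, sectorial, hz, hq, hqq, hsq_single, hdot_smul_right, hdot_self, hsq_single]
    simp
  refine HoldsGenerically.and ?_ ?_
  · refine holdsGenerically_ne_zero
      ((contDiff_gaugeEnergy.sub contDiff_blockSectorial).sub contDiff_const)
      (fun x => by rw [gaugeEnergy_neg, blockSectorial_neg]) hmem ?_
    rw [he, hs]; ring_nf; norm_num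
  · refine holdsGenerically_ne_zero
      ((contDiff_gaugeEnergy.pow 2).sub (contDiff_const.mul contDiff_blockSectorial))
      (fun x => by rw [gaugeEnergy_neg, blockSectorial_neg]) hmem ?_
    rw [he, hs]
    have : 0 ≤ s ^ 2 * κ₀ ^ 2 / 4 := by positivity
    nlinarith

variable (s κ) in
lemma holdsGenerically_angular {i j : Fin (n / 2)} (hij : i ≠ j) :
    HoldsGenerically fun x : Phase n => (conj (zc x j) * qc s κ x j).im ≠ 0 := by
  refine holdsGenerically_ne_zero
    -- The kinetic momentum of the test point is chosen such that after the gauge shift q_j = i,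
    -- while z_j = 1.
    (contDiff_im ((contDiff_conj (contDiff_zc j)).mul (contDiff_qc s κ j)))
    (fun x => by simp) (twoPoint_mem (i := i) (j := j) (a := 0) (b := 1) (c := 0)
      (d := I * (1 - s * κ j / 2 : ℝ)) hij (by norm_num) (by simp)) ?_
  rw [zc_twoPoint, qc_twoPoint]
  simp [hij.symm]

theorem tori_even_generic (hm : m ≠ 0) (heq : ∀ i : Fin (n / 2), (i : ℕ) < r → κ i = κ₀)
    (hr : 2 ≤ r) (hn : n = 2 * r) : HoldsGenerically fun x =>
      ∃ (Θ : (Fin 2 → ℝ) → Phase n) (freq : Fin 2 → ℝ),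
        IsQuasiPeriodicIsotropicTorus m s κ Θ freq ∧
        Set.range Θ = connectedComponentIn
          {y | y ∈ cotangentSphere n ∧ ∀ f ∈ integrals m s κ r, f y = f x} x :=
  (holdsGenerically_hgram s κ hr (by omega)).mono fun _ hx h =>
    tori_even hm heq (fun i => by omega) (by omega) hx h

theorem tori_odd_generic (hm : 0 < m) (heq : ∀ i : Fin (n / 2), (i : ℕ) < r → κ i = κ₀)
    (hr : 2 ≤ r) (hn : n = 2 * r + 1) : HoldsGenerically fun x =>
      ∃ (Θ : (Fin 3 → ℝ) → Phase n) (freq : Fin 3 → ℝ),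
        IsQuasiPeriodicIsotropicTorus m s κ Θ freq ∧
        Set.range Θ = connectedComponentIn
          {y | y ∈ cotangentSphere n ∧ ∀ f ∈ integrals m s κ r, f y = f x} x :=
  (((holdsGenerically_hgram s κ hr (by omega)).and (holdsGenerically_wp (by omega) (by omega))).and
    (holdsGenerically_height heq (by omega) (by omega) (by omega))).mono fun _ hx h =>
    tori_odd hm heq (fun i => by omega) (by omega) hx h.1.1 h.1.2 h.2.1 h.2.2

theorem tori_last_generic (hm : 0 < m) (heq : ∀ i : Fin (n / 2), (i : ℕ) < r → κ i = κ₀)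
    (hr : 2 ≤ r) (hn : n = 2 * r + 2) : HoldsGenerically fun x =>
      ∃ (Θ : (Fin 4 → ℝ) → Phase n) (freq : Fin 4 → ℝ),
        IsQuasiPeriodicIsotropicTorus m s κ Θ freq ∧
        Set.range Θ = connectedComponentIn
          {y | y ∈ cotangentSphere n ∧ ∀ f ∈ integrals m s κ r, f y = f x} x := by
  have hij : (⟨0, by omega⟩ : Fin (n / 2)) ≠ ⟨r, by omega⟩ := fun h => by
    rw [Fin.mk.injEq] at h; omega
  refine (((holdsGenerically_hgram s κ hr (by omega)).and
    (holdsGenerically_radial s κ hij)).and (holdsGenerically_angular s κ hij)).mono fun x hx h =>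
    tori_last hm heq (L := ⟨r, by omega⟩) rfl (fun i => ?_) (by omega) hx h.1.1 h.1.2 h.2
  by_cases hi : (i : ℕ) < r
  · exact Or.inl hi
  · exact Or.inr (Fin.ext (by simp only; omega))

end Generic

end MagneticSphere

end

theorem theorem5 (n r : ℕ) (hr : 1 ≤ r) (m s : ℝ) (hm : 0 < m) (hs : s ≠ 0)
    (κ : Fin (n / 2) → ℝ) (hκ : ∀ i, 0 ≤ κ i)
    (κ₁₂ : ℝ) (hκ₁₂ : κ₁₂ ≠ 0) (heq : ∀ i : Fin (n / 2), (i : ℕ) < r → κ i = κ₁₂) :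
    (2 ≤ r → n = 2 * r →
      MagneticSphere.IsNoncommutativelyIntegrable m s κ (MagneticSphere.integrals m s κ r) 2) ∧
    (2 ≤ r → n = 2 * r + 1 →
      MagneticSphere.IsNoncommutativelyIntegrable m s κ (MagneticSphere.integrals m s κ r) 3) ∧
    (2 ≤ r → n = 2 * r + 2 → (∀ i : Fin (n / 2), (i : ℕ) = r → κ₁₂ ≠ κ i) →
      MagneticSphere.IsNoncommutativelyIntegrable m s κ (MagneticSphere.integrals m s κ r) 4) ∧
    (n = 2 * r ∨ n = 2 * r + 1 ∨
        (n = 2 * r + 2 ∧ ∀ i : Fin (n / 2), (i : ℕ) = r → κ₁₂ ≠ κ i) →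
      MagneticSphere.IsLiouvilleIntegrable m s κ (MagneticSphere.commutingIntegrals m s κ r)) := by
  refine ⟨fun h hn => ?_, fun h hn => ?_, fun h hn _ => ?_, fun h => ?_⟩
  · exact MagneticSphere.noncommutativelyIntegrable_of heq
      (MagneticSphere.frame_even_generic heq h hn)
      (MagneticSphere.tori_even_generic hm.ne' heq h hn)
  · exact MagneticSphere.noncommutativelyIntegrable_of heq
      (MagneticSphere.frame_odd_generic hm.ne' heq h hn)
      (MagneticSphere.tori_odd_generic hm heq h hn)
  · exact MagneticSphere.noncommutativelyIntegrable_of heq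
      (MagneticSphere.frame_last_generic hm.ne' heq h hn)
      (MagneticSphere.tori_last_generic hm heq h hn)
  · exact MagneticSphere.liouville_integrable hm.ne' hr heq (h.imp id (Or.imp id And.left))
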